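/- Let $(M,g,Q)$ be a quaternionic Kähler manifold, i.e. a Riemannian manifold with a parallel subbundle $Q\subset \mathrm{End}\,TM$ of $g$-skew-symmetric endomorphisms which is locally spanned by $J_1,J_2,J_3=J_1J_2=-J_2J_1$ with $J_\alpha^2=-\mathrm{Id}$; if $\dim M=4$ one requires in addition $Q\cdot R=0$, where $R$ is the curvature tensor and $Q$ acts on it by derivations. Assume that the scalar curvature of $M$ is nonzero. Let $\xi_1,\xi_2$ be Killing vector fields on $M$ with moment maps $P_i:=(\nabla\xi_i)^Q\in\Gamma(Q)$ (the projection of $\nabla\xi_i$ onto $Q$), and let $N\subset M$ be a submanifold such that (i) $\xi_1|_N,\xi_2|_N$ are tangent to $N$, $[\xi_1,\xi_2]|_N=0$ and $|\xi_1|=|\xi_2|\neq 0$ on $N$; (ii) $P_1P_2|_N$ is a section of $Q|_N$ which preserves $TN$ and maps $\xi_1|_N$ to $f\,\xi_2|_N$ for some nowhere vanishing $f\in C^\infty(N)$. Assume that $\xi_1|_N,\xi_2|_N$ generate a smooth proper action on $N$ of a two-dimensional abelian Lie group $A$ (that is, the flows of $\xi_1|_N,\xi_2|_N$ are given by one-parameter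 subgroups of $A$ which together generate $A$). Let $M'=N/A$ with projection $\pi:N\to M'$, and put $I:=\frac1f P_1P_2|_{N}$. A complex structure means a smooth almost complex structure with vanishing Nijenhuis tensor, and a Kähler structure is a pair $(h,J)$ of a Riemannian metric $h$ and an $h$-orthogonal complex structure $J$ such that $h(\cdot,J\cdot)$ is closed. Then $I$ restricts to a complex structure on $N$ (mapping $\xi_1|_N$ to $\xi_2|_N$), and $M'$ is Hausdorff and second countable. Moreover: (a) If the action of $A$ on $N$ is free, then $M'$ carries the structure of a smooth manifold of dimension $\dim N-2$ and a Kähler structure $(h,J)$ such that $\pi$ is a smooth principal fibre bundle with structure group $A$, $\pi:(N,g|_N)\to(M',h)$ is a Riemannian submersion, and $\pi:(N,I)\to(M',J)$ is holomorphic, i.e. $d\pi\circ I=J\circ d\pi$. (b) If the action is only locally free with finite stabilisers, then $M'$ carries the structure of a Kähler orbifold of dimension $\dim N-2$ induced from $N$: it has an atlas of orbifold charts $\varphi: U\to M'$ ($U\subset\mathbb R^{\dim N-2}$ connected and open, with an effective action of a finite group $\Gamma$ such that $\varphi$ induces a homeomorphism of $U/\Gamma$ onto an open subset of $M'$) carrying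 $\Gamma$-invariant Kähler structures, the changes of charts being local holomorphic isometries; and whenever $\varphi(x)=\pi(p)$, there is, on a neighbourhood of $p$ in $N$, a map $s$ to $U$ with $s(p)=x$ and $\varphi\circ s=\pi$ which is a holomorphic Riemannian submersion. -/

import Mathlib

open Bundle Set Topology TopologicalSpace
open scoped Manifold ContDiff

noncomputable section

/-! ### Vector fields, endomorphism fields and metrics on a manifold modelled on `E` -/

/-- The `n`-dimensional model space. -/
abbrev Euc (n : ℕ) : Type := EuclideanSpace ℝ (Fin n)

section Fields

variable {E : Type*} [NormedAddCommGroup E] [NormedSpace ℝ E]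
  {M : Type*} [TopologicalSpace M] [ChartedSpace E M]

variable (E M) in
/-- (Not necessarily smooth) vector fields on `M`. -/
abbrev VField : Type _ := Π x : M, TangentSpace 𝓘(ℝ, E) x

variable (E M) in
/-- (Not necessarily smooth) fields of endomorphisms of the tangent spaces of `M`. -/
abbrev EndField : Type _ :=
  Π x : M, TangentSpace 𝓘(ℝ, E) x →L[ℝ] TangentSpace 𝓘(ℝ, E) x

variable (E M) in
/-- Smooth Riemannian metrics on `M`. -/
abbrev RMetric [IsManifold 𝓘(ℝ, E) ∞ M] : Type _ :=
  ContMDiffRiemannianMetric 𝓘(ℝ, E) ∞ E (fun x : M ↦ TangentSpace 𝓘(ℝ, E) x)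

/-- The vector field `X` is smooth at `p`. -/
def SmoothVFieldAt [IsManifold 𝓘(ℝ, E) ∞ M] (X : VField E M) (p : M) : Prop :=
  ContMDiffAt 𝓘(ℝ, E) (𝓘(ℝ, E).prod 𝓘(ℝ, E)) ∞
    (fun x ↦ TotalSpace.mk' E (E := fun x : M ↦ TangentSpace 𝓘(ℝ, E) x) x (X x)) p

/-- The vector field `X` is differentiable at `p`. -/
def DiffVFieldAt [IsManifold 𝓘(ℝ, E) ∞ M] (X : VField E M) (p : M) : Prop :=
  MDifferentiableAt 𝓘(ℝ, E) (𝓘(ℝ, E).prod 𝓘(ℝ, E))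
    (fun x ↦ TotalSpace.mk' E (E := fun x : M ↦ TangentSpace 𝓘(ℝ, E) x) x (X x)) p

/-- The endomorphism field `J` is smooth at `p`, as a section of the bundle `End TM`. -/
def SmoothEndFieldAt [IsManifold 𝓘(ℝ, E) ∞ M] (J : EndField E M) (p : M) : Prop :=
  ContMDiffAt 𝓘(ℝ, E) (𝓘(ℝ, E).prod 𝓘(ℝ, E →L[ℝ] E)) ∞
    (fun x ↦ TotalSpace.mk' (E →L[ℝ] E)
      (E := fun x : M ↦ TangentSpace 𝓘(ℝ, E) x →L[ℝ] TangentSpace 𝓘(ℝ, E) x) x (J x)) p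

/-! ### The Levi-Civita connection -/

/-- `D` is the Levi-Civita connection of `g`: a metric, torsion-free connection on `TM`.
The covariant derivative `D_u Y` at `p` is written `D Y p u`. -/
structure IsLeviCivita [IsManifold 𝓘(ℝ, E) ∞ M] (g : RMetric E M)
    (D : VField E M → EndField E M) : Prop where
  connection : IsCovariantDerivativeOn E (I := 𝓘(ℝ, E))
    (V := fun x : M ↦ TangentSpace 𝓘(ℝ, E) x) D Set.univ
  metric : ∀ (p : M) (Y Z : VField E M), DiffVFieldAt Y p → DiffVFieldAt Z p →
    ∀ u : TangentSpace 𝓘(ℝ, E) p,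
      mvfderiv 𝓘(ℝ, E) (fun q ↦ g.inner q (Y q) (Z q)) p u
        = g.inner p (D Y p u) (Z p) + g.inner p (Y p) (D Z p u)
  torsion_free : ∀ (p : M) (X Y : VField E M), DiffVFieldAt X p → DiffVFieldAt Y p →
    D Y p (X p) - D X p (Y p) = VectorField.mlieBracket 𝓘(ℝ, E) X Y p

/-- The Levi-Civita connection of `g` (which is unique on differentiable vector fields). -/
def leviCivita [IsManifold 𝓘(ℝ, E) ∞ M] (g : RMetric E M) : VField E M → EndField E M :=
  Classical.epsilon (fun D ↦ IsLeviCivita g D)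

/-- The curvature tensor `R(u,v)w = D_X D_Y Z - D_Y D_X Z - D_[X,Y] Z` at `p`, computed with
extensions `X, Y, Z` of `u, v, w` which are smooth near `p`. -/
def curvature [IsManifold 𝓘(ℝ, E) ∞ M] (g : RMetric E M) (p : M)
    (u v w : TangentSpace 𝓘(ℝ, E) p) : TangentSpace 𝓘(ℝ, E) p :=
  let X : VField E M := FiberBundle.extend E u
  let Y : VField E M := FiberBundle.extend E v
  let Z : VField E M := FiberBundle.extend E w
  leviCivita g (fun q ↦ leviCivita g Z q (Y q)) p u
    - leviCivita g (fun q ↦ leviCivita g Z q (X q)) p v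
    - leviCivita g Z p (VectorField.mlieBracket 𝓘(ℝ, E) X Y p)

/-- `ξ` is a (smooth) Killing vector field: `Dξ` is skew-symmetric, i.e. the Lie derivative of
the metric in direction `ξ` vanishes. -/
def IsKilling [IsManifold 𝓘(ℝ, E) ∞ M] (g : RMetric E M) (ξ : VField E M) : Prop :=
  (∀ p, SmoothVFieldAt ξ p) ∧
  ∀ (p : M) (u v : TangentSpace 𝓘(ℝ, E) p),
    g.inner p (leviCivita g ξ p u) v + g.inner p u (leviCivita g ξ p v) = 0

/-! ### Complex and Kähler structures -/

/-- `J` is a complex structure on `M`: a smooth field of endomorphisms with `J² = -1` whose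
Nijenhuis tensor `[JX,JY] - J[JX,Y] - J[X,JY] - [X,Y]` vanishes, i.e. `[Γ(T^{1,0}), Γ(T^{1,0})]` is
contained in `Γ(T^{1,0})`. -/
structure IsComplexStructure [IsManifold 𝓘(ℝ, E) ∞ M] (J : EndField E M) : Prop where
  smooth : ∀ p, SmoothEndFieldAt J p
  sq : ∀ (p : M) (u : TangentSpace 𝓘(ℝ, E) p), J p (J p u) = -u
  integrable : ∀ (p : M) (X Y : VField E M), SmoothVFieldAt X p → SmoothVFieldAt Y p →
    VectorField.mlieBracket 𝓘(ℝ, E) (fun q ↦ J q (X q)) (fun q ↦ J q (Y q)) p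
      - J p (VectorField.mlieBracket 𝓘(ℝ, E) (fun q ↦ J q (X q)) Y p)
      - J p (VectorField.mlieBracket 𝓘(ℝ, E) X (fun q ↦ J q (Y q)) p)
      - VectorField.mlieBracket 𝓘(ℝ, E) X Y p = 0

/-- The fundamental two-form `φ = h(·, J·)`. -/
def fundamentalForm [IsManifold 𝓘(ℝ, E) ∞ M] (h : RMetric E M) (J : EndField E M)
    (X Y : VField E M) (q : M) : ℝ := h.inner q (X q) (J q (Y q))

/-- `(h, J)` is a Kähler structure on `M`: `J` is a complex structure, `h` is a `J`-invariant
Riemannian metric, and the fundamental two-form is closed. -/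
structure IsKahler [IsManifold 𝓘(ℝ, E) ∞ M] (h : RMetric E M) (J : EndField E M) : Prop where
  complex : IsComplexStructure J
  hermitian : ∀ (p : M) (u v : TangentSpace 𝓘(ℝ, E) p),
    h.inner p (J p u) (J p v) = h.inner p u v
  closed : ∀ (p : M) (X Y Z : VField E M),
    SmoothVFieldAt X p → SmoothVFieldAt Y p → SmoothVFieldAt Z p →
    mvfderiv 𝓘(ℝ, E) (fundamentalForm h J Y Z) p (X p)
      + mvfderiv 𝓘(ℝ, E) (fundamentalForm h J Z X) p (Y p)
      + mvfderiv 𝓘(ℝ, E) (fundamentalForm h J X Y) p (Z p)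
      - fundamentalForm h J (VectorField.mlieBracket 𝓘(ℝ, E) X Y) Z p
      - fundamentalForm h J (VectorField.mlieBracket 𝓘(ℝ, E) Y Z) X p
      - fundamentalForm h J (VectorField.mlieBracket 𝓘(ℝ, E) Z X) Y p = 0

end Fields

/-! ### Quaternionic Kähler manifolds -/

section Quaternionic

variable {m : ℕ} {M : Type*} [TopologicalSpace M] [ChartedSpace (Euc m) M]
  [IsManifold 𝓘(ℝ, Euc m) ∞ M]

/-- The `i`-th standard basis vector of `T_p M` (in the preferred chart at `p`). -/
def stdVec (p : M) (i : Fin m) : TangentSpace 𝓘(ℝ, Euc m) p := EuclideanSpace.single i (1 : ℝ)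

/-- The `i`-th coordinate of a tangent vector with respect to `stdVec p`. -/
def stdCoord (p : M) (u : TangentSpace 𝓘(ℝ, Euc m) p) (i : Fin m) : ℝ :=
  (EuclideanSpace.proj i : Euc m →L[ℝ] ℝ) u

/-- The Ricci curvature `Ric(u,v)`, the trace of `w ↦ R(w,u)v`. -/
def ricci (g : RMetric (Euc m) M) (p : M) (u v : TangentSpace 𝓘(ℝ, Euc m) p) : ℝ :=
  ∑ i, stdCoord p (curvature g p (stdVec p i) u v) i

/-- The scalar curvature, the trace of the Ricci curvature with respect to the metric. -/
def scalarCurvature (g : RMetric (Euc m) M) (p : M) : ℝ :=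
  ∑ i, ∑ j, (Matrix.of fun k l ↦ g.inner p (stdVec p k) (stdVec p l))⁻¹ i j
    * ricci g p (stdVec p i) (stdVec p j)

variable (m M) in
/-- Fields of linear subspaces of the spaces `End T_p M`. -/
abbrev SubspaceField : Type _ :=
  Π p : M, Submodule ℝ (TangentSpace 𝓘(ℝ, Euc m) p →L[ℝ] TangentSpace 𝓘(ℝ, Euc m) p)

/-- `Q` is an (almost) quaternionic structure: a subbundle of `End TM` which is locally spanned by
smooth `J 0, J 1, J 2` satisfying the quaternionic relations. -/
def IsQuaternionicStructure (Q : SubspaceField m M) : Prop :=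
  ∀ p : M, ∃ U : Set M, IsOpen U ∧ p ∈ U ∧ ∃ J : Fin 3 → EndField (Euc m) M,
    ∀ q ∈ U, (∀ i, SmoothEndFieldAt (J i) q) ∧
      (∀ i, J i q ∘L J i q = -ContinuousLinearMap.id ℝ _) ∧
      J 0 q ∘L J 1 q = J 2 q ∧ J 1 q ∘L J 0 q = -J 2 q ∧
      Q q = Submodule.span ℝ (Set.range fun i ↦ J i q)

/-- `Q` consists of endomorphisms which are skew-symmetric with respect to `g`. -/
def IsSkewSubspaceField (g : RMetric (Euc m) M) (Q : SubspaceField m M) : Prop :=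
  ∀ (p : M), ∀ A ∈ Q p, ∀ u v : TangentSpace 𝓘(ℝ, Euc m) p,
    g.inner p (A u) v = -g.inner p u (A v)

/-- `Q` is parallel: for each smooth local section `J` of `Q` the covariant derivative
`D_u J : Y ↦ D_u (J Y) - J (D_u Y)` again belongs to `Q`. -/
def IsParallel (g : RMetric (Euc m) M) (Q : SubspaceField m M) : Prop :=
  ∀ (U : Set M), IsOpen U → ∀ J : EndField (Euc m) M,
    (∀ q ∈ U, SmoothEndFieldAt J q ∧ J q ∈ Q q) →
    ∀ p ∈ U, ∀ u : TangentSpace 𝓘(ℝ, Euc m) p, ∃ B ∈ Q p,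
      ∀ Y : VField (Euc m) M, DiffVFieldAt Y p →
        leviCivita g (fun q ↦ J q (Y q)) p u - J p (leviCivita g Y p u) = B (Y p)

/-- `Q · R = 0`: each element of `Q`, acting as a derivation on tensors, annihilates the
curvature tensor. -/
def AnnihilatesCurvature (g : RMetric (Euc m) M) (Q : SubspaceField m M) : Prop :=
  ∀ (p : M), ∀ A ∈ Q p, ∀ u v w : TangentSpace 𝓘(ℝ, Euc m) p,
    A (curvature g p u v w) - curvature g p (A u) v w - curvature g p u (A v) w
      - curvature g p u v (A w) = 0

/-- `(M, g, Q)` is a quaternionic Kähler manifold. -/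
structure IsQuaternionicKahler (g : RMetric (Euc m) M) (Q : SubspaceField m M) : Prop where
  quaternionic : IsQuaternionicStructure Q
  skew : IsSkewSubspaceField g Q
  parallel : IsParallel g Q
  dim_four : m = 4 → AnnihilatesCurvature g Q

/-- The moment map `P = (Dξ)^Q` of a Killing field `ξ`: the orthogonal projection of the
endomorphism `Dξ` onto `Q`, with respect to the trace form. As `Q` is trace-orthogonal to its
centraliser `Z(Q)` among the skew endomorphisms, on the normaliser `Q ⊕ Z(Q)` this is the
projection onto the first summand. -/
def momentMap (g : RMetric (Euc m) M) (Q : SubspaceField m M) (ξ : VField (Euc m) M) :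
    EndField (Euc m) M := fun p ↦
  Classical.epsilon fun P : TangentSpace 𝓘(ℝ, Euc m) p →L[ℝ] TangentSpace 𝓘(ℝ, Euc m) p ↦
    P ∈ Q p ∧ ∀ B ∈ Q p,
      LinearMap.trace ℝ (TangentSpace 𝓘(ℝ, Euc m) p)
        ((B ∘L (leviCivita g ξ p - P)).toLinearMap) = 0

end Quaternionic

/-! ### Riemannian submersions, holomorphic maps, principal bundles -/

section Maps

variable {E E' EA : Type*} [NormedAddCommGroup E] [NormedSpace ℝ E]
  [NormedAddCommGroup E'] [NormedSpace ℝ E'] [NormedAddCommGroup EA] [NormedSpace ℝ EA]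
  {N : Type*} [TopologicalSpace N] [ChartedSpace E N]
  {B : Type*} [TopologicalSpace B] [ChartedSpace E' B]

/-- On the open set `W`, the map `pr` is a Riemannian submersion from the metric `gN` to `h`: it is a
smooth submersion, and its differential is isometric on the orthogonal complement of its kernel. -/
structure IsRiemannianSubmersionOn [IsManifold 𝓘(ℝ, E') ∞ B]
    (gN : Π p : N, TangentSpace 𝓘(ℝ, E) p → TangentSpace 𝓘(ℝ, E) p → ℝ)
    (h : RMetric E' B) (pr : N → B) (W : Set N) : Prop where
  smooth : ContMDiffOn 𝓘(ℝ, E) 𝓘(ℝ, E') ∞ pr W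
  surjective : ∀ p ∈ W, Function.Surjective (mfderiv 𝓘(ℝ, E) 𝓘(ℝ, E') pr p)
  isometric : ∀ p ∈ W, ∀ u v : TangentSpace 𝓘(ℝ, E) p,
    (∀ k, mfderiv 𝓘(ℝ, E) 𝓘(ℝ, E') pr p k = 0 → gN p u k = 0) →
    (∀ k, mfderiv 𝓘(ℝ, E) 𝓘(ℝ, E') pr p k = 0 → gN p v k = 0) →
    h.inner (pr p) (mfderiv 𝓘(ℝ, E) 𝓘(ℝ, E') pr p u) (mfderiv 𝓘(ℝ, E) 𝓘(ℝ, E') pr p v) = gN p u v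

/-- On the open set `W`, the map `pr` is smooth and holomorphic: `d(pr) ∘ I = J ∘ d(pr)`. -/
def IsHolomorphicOn (I : EndField E N) (J : EndField E' B) (pr : N → B) (W : Set N) : Prop :=
  ContMDiffOn 𝓘(ℝ, E) 𝓘(ℝ, E') ∞ pr W ∧
  ∀ p ∈ W, ∀ u : TangentSpace 𝓘(ℝ, E) p,
    mfderiv 𝓘(ℝ, E) 𝓘(ℝ, E') pr p (I p u) = J (pr p) (mfderiv 𝓘(ℝ, E) 𝓘(ℝ, E') pr p u)

/-- On the open set `W`, the map `pr` is isometric: `h'(d(pr) u, d(pr) v) = h(u, v)`. -/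
def IsIsometricOn [IsManifold 𝓘(ℝ, E) ∞ N] [IsManifold 𝓘(ℝ, E') ∞ B]
    (h : RMetric E N) (h' : RMetric E' B) (pr : N → B) (W : Set N) : Prop :=
  ∀ p ∈ W, ∀ u v : TangentSpace 𝓘(ℝ, E) p,
    h'.inner (pr p) (mfderiv 𝓘(ℝ, E) 𝓘(ℝ, E') pr p u) (mfderiv 𝓘(ℝ, E) 𝓘(ℝ, E') pr p v)
      = h.inner p u v

/-- `pr : N → B` is a smooth principal fibre bundle with structure group `A` (acting on the total
space from the left): `pr` is smooth and onto, and `B` is covered by open sets `U` over which there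
are smooth `A`-equivariant trivialisations `pr⁻¹(U) ≅ U × A`. -/
structure IsPrincipalBundle (A : Type*) [TopologicalSpace A] [ChartedSpace EA A] [Group A]
    [MulAction A N] (pr : N → B) : Prop where
  smooth : ContMDiff 𝓘(ℝ, E) 𝓘(ℝ, E') ∞ pr
  surjective : Function.Surjective pr
  locally_trivial : ∀ b : B, ∃ U : Set B, IsOpen U ∧ b ∈ U ∧
    ∃ Φ : OpenPartialHomeomorph N (B × A),
      Φ.source = pr ⁻¹' U ∧ Φ.target = U ×ˢ Set.univ ∧
      ContMDiffOn 𝓘(ℝ, E) (𝓘(ℝ, E').prod 𝓘(ℝ, EA)) ∞ Φ Φ.source ∧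
      ContMDiffOn (𝓘(ℝ, E').prod 𝓘(ℝ, EA)) 𝓘(ℝ, E) ∞ Φ.symm Φ.target ∧
      ∀ p ∈ Φ.source, (Φ p).1 = pr p ∧ ∀ a : A, Φ (a • p) = (pr p, a * (Φ p).2)

end Maps

/-! ### Kähler orbifolds -/

/-- A `k`-dimensional Kähler orbifold chart on the topological space `X`: a connected open set
`U ⊆ ℝᵏ`, a finite group `Γ` of diffeomorphisms of `U`, a map `φ : U → X` inducing a homeomorphism
of `U/Γ` onto an open subset of `X`, and a `Γ`-invariant Kähler structure `(h, J)` on `U`. -/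
structure KahlerOrbifoldChart (X : Type*) [TopologicalSpace X] (k : ℕ) where
  U : Opens (Euc k)
  connected : IsConnected (U : Set (Euc k))
  Γ : Subgroup (Equiv.Perm U)
  finite : Finite Γ
  smooth : ∀ γ ∈ Γ, ContMDiff 𝓘(ℝ, Euc k) 𝓘(ℝ, Euc k) ∞ (γ : U → U)
  φ : U → X
  continuous : Continuous φ
  isOpenMap : IsOpenMap φ
  fibres : ∀ x y : U, φ x = φ y ↔ ∃ γ ∈ Γ, γ x = y
  h : RMetric (Euc k) U
  J : EndField (Euc k) U
  kahler : IsKahler h J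
  isometric : ∀ γ ∈ Γ, IsIsometricOn h h (γ : U → U) Set.univ
  holomorphic : ∀ γ ∈ Γ, IsHolomorphicOn J J (γ : U → U) Set.univ

/-- A `k`-dimensional Kähler orbifold structure on `X`: an atlas of Kähler orbifold charts covering
`X`, such that points of two charts with the same image in `X` are related by a local holomorphic
isometry between the charts which is compatible with the projections to `X`. -/
structure KahlerOrbifoldStructure (X : Type*) [TopologicalSpace X] (k : ℕ) where
  atlas : Set (KahlerOrbifoldChart X k)
  cover : ∀ x : X, ∃ c ∈ atlas, x ∈ Set.range c.φ
  compatible : ∀ c ∈ atlas, ∀ c' ∈ atlas, ∀ (x : c.U) (y : c'.U), c.φ x = c'.φ y →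
    ∃ e : OpenPartialHomeomorph c.U c'.U, x ∈ e.source ∧ e x = y ∧
      ContMDiffOn 𝓘(ℝ, Euc k) 𝓘(ℝ, Euc k) ∞ e e.source ∧
      ContMDiffOn 𝓘(ℝ, Euc k) 𝓘(ℝ, Euc k) ∞ e.symm e.target ∧
      (∀ z ∈ e.source, c'.φ (e z) = c.φ z) ∧
      IsIsometricOn c.h c'.h e e.source ∧
      IsHolomorphicOn c.J c'.J e e.source

/-! ### The setting of the quotient construction -/

section Setting

variable {m d : ℕ}
  {M : Type*} [TopologicalSpace M] [ChartedSpace (Euc m) M]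
  {N : Type*} [TopologicalSpace N] [ChartedSpace (Euc d) N]

/-- The differential of `ι : N → M` at `p`. -/
abbrev dmap (ι : N → M) (p : N) :
    TangentSpace 𝓘(ℝ, Euc d) p →L[ℝ] TangentSpace 𝓘(ℝ, Euc m) (ι p) :=
  mfderiv 𝓘(ℝ, Euc d) 𝓘(ℝ, Euc m) ι p

/-- The metric induced on the submanifold `ι : N → M`. -/
def inducedMetric [IsManifold 𝓘(ℝ, Euc m) ∞ M] (g : RMetric (Euc m) M) (ι : N → M) (p : N)
    (u v : TangentSpace 𝓘(ℝ, Euc d) p) : ℝ :=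
  g.inner (ι p) (dmap ι p u) (dmap ι p v)

variable (m d) in
/-- `N` is an (injectively immersed) submanifold of `M`, with inclusion `ι`. -/
def IsSubmanifold (ι : N → M) : Prop :=
  Manifold.IsImmersion 𝓘(ℝ, Euc d) 𝓘(ℝ, Euc m) ∞ ι ∧ Function.Injective ι

/-- The vector fields `ξ 0, ξ 1`, restricted to the submanifold `ι : N → M`, generate the action of
`A` on `N`: there are one-parameter subgroups `γ 0, γ 1` of `A` which together generate `A`, such
that `t ↦ γ i t • p` is the integral curve of `ξ i` starting at `p`, for all `p` in `N`. -/
def GenerateAction {EA : Type*} [NormedAddCommGroup EA] [NormedSpace ℝ EA]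
    {A : Type*} [TopologicalSpace A] [ChartedSpace EA A] [Group A] [MulAction A N]
    (ι : N → M) (ξ : Fin 2 → VField (Euc m) M) : Prop :=
  ∃ γ : Fin 2 → ℝ → A,
    (∀ i, ContMDiff 𝓘(ℝ, ℝ) 𝓘(ℝ, EA) ∞ (γ i)) ∧
    (∀ i s t, γ i (s + t) = γ i s * γ i t) ∧
    Subgroup.closure (⋃ i, Set.range (γ i)) = ⊤ ∧
    ∀ i p, IsMIntegralCurve (I := 𝓘(ℝ, Euc m)) (fun t ↦ ι (γ i t • p)) (ξ i)

end Setting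

end

noncomputable section

/-! ### Quaternionic triples in an algebra -/

section QuatAlgebra

variable {𝒜 : Type*} [Ring 𝒜] [Algebra ℝ 𝒜]

/-- A quaternionic triple: `J 0, J 1, J 2` satisfy the relations of `i, j, k`. -/
structure QuatTriple (J : Fin 3 → 𝒜) : Prop where
  sq : ∀ a, J a * J a = -1
  mul01 : J 0 * J 1 = J 2
  mul10 : J 1 * J 0 = -J 2

namespace QuatTriple

variable {J : Fin 3 → 𝒜} (hJ : QuatTriple J)
include hJ

theorem mul12 : J 1 * J 2 = J 0 := by
  rw [show J 2 = -(J 1 * J 0) by rw [hJ.mul10, neg_neg], mul_neg, ← mul_assoc, hJ.sq]; simp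

theorem mul20 : J 2 * J 0 = J 1 := by
  rw [show J 2 = -(J 1 * J 0) by rw [hJ.mul10, neg_neg], neg_mul, mul_assoc, hJ.sq]; simp

theorem mul21 : J 2 * J 1 = -J 0 := by
  rw [← hJ.mul01, mul_assoc, hJ.sq]; simp

theorem mul02 : J 0 * J 2 = -J 1 := by
  rw [← hJ.mul01, ← mul_assoc, hJ.sq]; simp

theorem rotate : QuatTriple (fun a ↦ J (a + 1)) where
  sq a := hJ.sq _
  mul01 := hJ.mul12
  mul10 := hJ.mul21

variable {t : 𝒜 →ₗ[ℝ] ℝ} (ht : ∀ x y, t (x * y) = t (y * x))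
include ht

theorem trace_eq_zero (a : Fin 3) : t (J a) = 0 := by
  have h : ∀ x y z : 𝒜, x * y = z → y * x = -z → t z = 0 := by
    intro x y z h1 h2
    have := ht x y
    rw [h1, h2, map_neg] at this
    linarith
  fin_cases a
  exacts [h _ _ _ hJ.mul12 hJ.mul21, h _ _ _ hJ.mul20 hJ.mul02, h _ _ _ hJ.mul01 hJ.mul10]

theorem trace_mul (a b : Fin 3) : t (J a * J b) = if a = b then -t 1 else 0 := by
  have h := hJ.trace_eq_zero ht
  fin_cases a <;> fin_cases b <;>
    simp [hJ.sq, hJ.mul01, hJ.mul10, hJ.mul12, hJ.mul21, hJ.mul20, hJ.mul02, h]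

theorem trace_mul_commutant {Z : 𝒜} (hZ : ∀ a, Z * J a = J a * Z) (a : Fin 3) :
    t (J a * Z) = 0 := by
  have h : ∀ x y z : 𝒜, x * y = z → y * x = -z → Z * y = y * Z → t (z * Z) = 0 := by
    intro x y z h1 h2 h3
    have := ht (x * Z) y
    rw [mul_assoc, h3, ← mul_assoc, ← mul_assoc, h1, h2, neg_mul, map_neg] at this
    linarith
  fin_cases a
  exacts [h _ _ _ hJ.mul12 hJ.mul21 (hZ _), h _ _ _ hJ.mul20 hJ.mul02 (hZ _),
    h _ _ _ hJ.mul01 hJ.mul10 (hZ _)]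

variable (hm : t 1 ≠ 0)
include hm

/-- The coefficients of an element of the span are given by the trace form. -/
theorem trace_mul_sum (c : Fin 3 → ℝ) (a : Fin 3) :
    t (J a * ∑ b, c b • J b) = -(t 1) * c a := by
  rw [Finset.mul_sum, map_sum]
  simp_rw [mul_smul_comm, map_smul, hJ.trace_mul ht, smul_eq_mul]
  simp [Finset.sum_ite_eq]
  ring

/-- An element which normalises the span of a quaternionic triple is the sum of its trace
projection to the span and of an element of the commutant. -/
theorem commute_sub_of_normalizes {A : 𝒜}
    (hA : ∀ b, A * J b - J b * A ∈ Submodule.span ℝ (Set.range J)) (b : Fin 3) :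
    (A - ∑ a, (-(t (J a * A)) / t 1) • J a) * J b
      = J b * (A - ∑ a, (-(t (J a * A)) / t 1) • J a) := by
  obtain ⟨c, hc⟩ := (Submodule.mem_span_range_iff_exists_fun ℝ).1 (hA 0)
  obtain ⟨c', hc'⟩ := (Submodule.mem_span_range_iff_exists_fun ℝ).1 (hA 1)
  have k1 := hJ.trace_mul_sum ht hm c
  have k2 := hJ.trace_mul_sum ht hm c'
  rw [hc] at k1
  rw [hc'] at k2
  have e1 : c 0 = 0 := by
    have := k1 0
    rw [mul_sub, map_sub, ← mul_assoc (J 0) (J 0), hJ.sq, ht (J 0) (A * J 0), mul_assoc A, hJ.sq]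
      at this
    simpa [hm] using this
  have e2 : c' 1 = 0 := by
    have := k2 1
    rw [mul_sub, map_sub, ← mul_assoc (J 1) (J 1), hJ.sq, ht (J 1) (A * J 1), mul_assoc A, hJ.sq]
      at this
    simpa [hm] using this
  have e3 : c' 0 = - c 1 := by
    have h1 := k1 1
    have h2 := k2 0
    rw [mul_sub, map_sub, ← mul_assoc (J 1) (J 0), hJ.mul10, ht (J 1) (A * J 0), mul_assoc A,
      hJ.mul01, ht A] at h1
    rw [mul_sub, map_sub, ← mul_assoc (J 0) (J 1), hJ.mul01, ht (J 0) (A * J 1), mul_assoc A,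
      hJ.mul10, mul_neg, map_neg, ht A] at h2
    rw [neg_mul, map_neg] at h1
    have : t 1 * (c' 0 + c 1) = 0 := by linarith
    have := (mul_eq_zero.1 this).resolve_left hm
    linarith
  obtain ⟨q, hq⟩ : ∃ q : Fin 3 → ℝ, q = ![c' 2 / 2, - c 2 / 2, c 1 / 2] := ⟨_, rfl⟩
  have q0 : q 0 = c' 2 / 2 := by rw [hq]; rfl
  have q1 : q 1 = -c 2 / 2 := by rw [hq]; rfl
  have q2 : q 2 = c 1 / 2 := by rw [hq]; rfl
  have z0 : (A - ∑ a, q a • J a) * J 0 = J 0 * (A - ∑ a, q a • J a) := by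
    rw [← sub_eq_zero]
    have : A * J 0 - J 0 * A - ∑ a, c a • J a = 0 := by rw [hc, sub_self]
    rw [← this]
    simp only [Fin.sum_univ_three, sub_mul, add_mul, mul_sub, mul_add, smul_mul_assoc,
      mul_smul_comm, hJ.sq, hJ.mul01, hJ.mul10, hJ.mul20, hJ.mul02, e1, q0, q1, q2]
    module
  have z1 : (A - ∑ a, q a • J a) * J 1 = J 1 * (A - ∑ a, q a • J a) := by
    rw [← sub_eq_zero]
    have : A * J 1 - J 1 * A - ∑ a, c' a • J a = 0 := by rw [hc', sub_self]
    rw [← this]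
    simp only [Fin.sum_univ_three, sub_mul, add_mul, mul_sub, mul_add, smul_mul_assoc,
      mul_smul_comm, hJ.sq, hJ.mul01, hJ.mul10, hJ.mul21, hJ.mul12, e2, e3, q0, q1, q2]
    module
  have hz : ∀ b, (A - ∑ a, q a • J a) * J b = J b * (A - ∑ a, q a • J a) := by
    intro b
    fin_cases b
    · exact z0
    · exact z1
    · show _ * J 2 = J 2 * _
      rw [← hJ.mul01, ← mul_assoc, z0, mul_assoc, z1, mul_assoc]
  have hqq : ∀ a, -(t (J a * A)) / t 1 = q a := by
    intro a
    have h1 := hJ.trace_mul_commutant ht hz a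
    rw [mul_sub, map_sub, hJ.trace_mul_sum ht hm] at h1
    field_simp
    linarith
  simp_rw [hqq]
  exact hz b

/-- An element which normalises the span and anticommutes with one of the generators belongs to
the span. -/
theorem mem_span_of_anticommute {A : 𝒜}
    (hA : ∀ b, A * J b - J b * A ∈ Submodule.span ℝ (Set.range J)) (a : Fin 3)
    (ha : A * J a + J a * A = 0) : A ∈ Submodule.span ℝ (Set.range J) := by
  have hz := hJ.commute_sub_of_normalizes ht hm hA
  set q : Fin 3 → ℝ := fun a ↦ -(t (J a * A)) / t 1 with hq
  set Z := A - ∑ a, q a • J a with hZ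
  have hA' : A = Z + ∑ a, q a • J a := by rw [hZ]; abel
  have h1 : Z = -(q a) • J a := by
    have h2 : Z * J a + (∑ b, q b • J b) * J a + (J a * Z + J a * (∑ b, q b • J b)) = 0 := by
      rw [← add_mul, ← mul_add, ← hA', ha]
    rw [← hz a] at h2
    have h3 : (∑ b, q b • J b) * J a + J a * (∑ b, q b • J b) = -(2 * q a) • (1 : 𝒜) := by
      fin_cases a <;>
      simp only [Fin.sum_univ_three, add_mul, mul_add, smul_mul_assoc, Fin.zero_eta, Fin.mk_one,
        Fin.reduceFinMk,
        mul_smul_comm, hJ.sq, hJ.mul01, hJ.mul10, hJ.mul20, hJ.mul02, hJ.mul12, hJ.mul21] <;>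
      module
    have h4 : Z * J a = (q a) • (1 : 𝒜) := by
      have : (2 : ℝ) • (Z * J a - (q a) • (1 : 𝒜)) = 0 := by
        rw [← h2]
        have : Z * J a + (∑ b, q b • J b) * J a + (Z * J a + J a * (∑ b, q b • J b))
          = (2 : ℝ) • (Z * J a) + ((∑ b, q b • J b) * J a + J a * (∑ b, q b • J b)) := by module
        rw [this, h3]; module
      rw [smul_eq_zero] at this
      exact sub_eq_zero.1 (this.resolve_left two_ne_zero)
    have h5 : Z * J a * J a = q a • J a := by rw [h4, smul_mul_assoc, one_mul]
    rw [mul_assoc, hJ.sq, mul_neg, mul_one] at h5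
    rw [neg_smul, ← h5, neg_neg]
  rw [hA', h1]
  refine add_mem (Submodule.smul_mem _ _ (Submodule.subset_span ⟨a, rfl⟩))
    (sum_mem fun b _ ↦ Submodule.smul_mem _ _ (Submodule.subset_span ⟨b, rfl⟩))

end QuatTriple

end QuatAlgebra

/-! ### Algebraic curvature tensors compatible with a quaternionic triple -/

section CurvAlgebra

variable {E : Type*} [NormedAddCommGroup E] [NormedSpace ℝ E]

variable (E) in
/-- The trace, as a linear form on the continuous endomorphisms. -/
def endTrace : (E →L[ℝ] E) →ₗ[ℝ] ℝ := LinearMap.trace ℝ E ∘ₗ ContinuousLinearMap.coeLM ℝ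

theorem endTrace_mul_comm (A B : E →L[ℝ] E) : endTrace E (A * B) = endTrace E (B * A) :=
  LinearMap.trace_mul_comm ℝ A.toLinearMap B.toLinearMap

theorem endTrace_one [FiniteDimensional ℝ E] : endTrace E 1 = Module.finrank ℝ E :=
  LinearMap.trace_one ℝ E

/-- A symmetric positive definite bilinear form. -/
structure IsInnerForm (g : E →L[ℝ] E →L[ℝ] ℝ) : Prop where
  symm : ∀ u v, g u v = g v u
  pos : ∀ u, u ≠ 0 → 0 < g u u

theorem IsInnerForm.eq_of_forall {g : E →L[ℝ] E →L[ℝ] ℝ} (hg : IsInnerForm g) {u v : E}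
    (h : ∀ z, g u z = g v z) : u = v := by
  by_contra hne
  have := hg.pos (u - v) (sub_ne_zero.2 hne)
  have e := h (u - v)
  have : g (u - v) (u - v) = 0 := by
    rw [map_sub g]
    exact sub_eq_zero.2 e
  linarith

/-- `R` has the algebraic symmetries of a curvature tensor. -/
structure IsAlgCurv (g : E →L[ℝ] E →L[ℝ] ℝ) (R : E → E → E →L[ℝ] E) : Prop where
  add_left : ∀ u v w, R (u + v) w = R u w + R v w
  smul_left : ∀ (c : ℝ) u w, R (c • u) w = c • R u w
  swap : ∀ u v, R u v = -R v u
  bianchi : ∀ u v w, R u v w + R v w u + R w u v = 0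
  skew : ∀ u v w z, g (R u v w) z = -g w (R u v z)

theorem IsAlgCurv.pair_symm {g : E →L[ℝ] E →L[ℝ] ℝ} {R : E → E → E →L[ℝ] E}
    (hg : IsInnerForm g) (hR : IsAlgCurv g R) (u v w z : E) :
    g (R u v w) z = g (R w z u) v := by
  have B : ∀ a b c d, g (R a b c) d + g (R b c a) d + g (R c a b) d = 0 := by
    intro a b c d
    simpa using congrArg (fun x ↦ g x d) (hR.bianchi a b c)
  have S : ∀ a b c d, g (R a b c) d = -g (R b a c) d := by
    intro a b c d
    rw [hR.swap a b]; simp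
  have K : ∀ a b c d, g (R a b c) d = -g (R a b d) c := by
    intro a b c d
    rw [hR.skew, hg.symm]
  have h1 := B u v w z
  have h2 := B v w z u
  have h3 := B w z u v
  have h4 := B z u v w
  have := S w u v z
  have := S z v w u
  have := S u w z v
  have := S v z u w
  have := K u v w z
  have := K v w u z
  have := K w u v z
  have := K w z v u
  have := K z u w v
  have := K u w v z
  have := K v z u w
  have := K v w z u
  have := K z v w u
  have := S w z u v
  have := K w z u v
  have := K z u v w
  have := S u z v w
  have := S u v w z
  have := S v z w u
  have := K u w z v
  have := K v z w u
  have := S v w u z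
  linarith

/-- An algebraic curvature tensor with values in the normaliser of a quaternionic triple `J`, with
components `α` in the directions of the `J a`. -/
structure IsQuatCurv (g : E →L[ℝ] E →L[ℝ] ℝ) (R : E → E → E →L[ℝ] E)
    (J : Fin 3 → E →L[ℝ] E) (α : Fin 3 → E → E → ℝ) : Prop where
  inner : IsInnerForm g
  curv : IsAlgCurv g R
  quat : QuatTriple J
  skewJ : ∀ a u v, g (J a u) v = -g u (J a v)
  comp : ∀ a u v, α a u v = -(endTrace E (J a * R u v)) / endTrace E 1
  commute : ∀ u v b, (R u v - ∑ a, α a u v • J a) * J b = J b * (R u v - ∑ a, α a u v • J a)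

namespace IsQuatCurv

variable {g : E →L[ℝ] E →L[ℝ] ℝ} {R : E → E → E →L[ℝ] E} {J : Fin 3 → E →L[ℝ] E}
  {α : Fin 3 → E → E → ℝ}

theorem rotate (h : IsQuatCurv g R J α) :
    IsQuatCurv g R (fun a ↦ J (a + 1)) (fun a ↦ α (a + 1)) where
  inner := h.inner
  curv := h.curv
  quat := h.quat.rotate
  skewJ a := h.skewJ _
  comp a := h.comp _
  commute u v b := by
    have : ∑ a : Fin 3, α (a + 1) u v • J (a + 1) = ∑ a, α a u v • J a := by
      simp only [Fin.sum_univ_three, Fin.isValue, zero_add, Fin.reduceAdd]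
      abel
    simp only [this]
    exact h.commute u v _

theorem add_left (h : IsQuatCurv g R J α) (a : Fin 3) (u v w : E) :
    α a (u + v) w = α a u w + α a v w := by
  simp only [h.comp, h.curv.add_left, map_add, mul_add]; ring

theorem swap (h : IsQuatCurv g R J α) (a : Fin 3) (u v : E) : α a u v = -α a v u := by
  rw [h.comp, h.comp, h.curv.swap u v, mul_neg, map_neg]; ring

theorem smul_left (h : IsQuatCurv g R J α) (a : Fin 3) (c : ℝ) (u w : E) :
    α a (c • u) w = c * α a u w := by
  simp only [h.comp, h.curv.smul_left, map_smul, mul_smul_comm, smul_eq_mul]; ring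

theorem neg_left (h : IsQuatCurv g R J α) (a : Fin 3) (u w : E) :
    α a (-u) w = -α a u w := by
  simpa using h.smul_left a (-1) u w

theorem add_right (h : IsQuatCurv g R J α) (a : Fin 3) (u v w : E) :
    α a w (u + v) = α a w u + α a w v := by
  rw [h.swap, h.add_left, h.swap a u, h.swap a v]; ring

theorem smul_right (h : IsQuatCurv g R J α) (a : Fin 3) (c : ℝ) (u w : E) :
    α a w (c • u) = c * α a w u := by
  rw [h.swap, h.smul_left, h.swap a u]; ring

theorem neg_right (h : IsQuatCurv g R J α) (a : Fin 3) (u w : E) :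
    α a w (-u) = -α a w u := by
  rw [h.swap, h.neg_left, h.swap a u]; ring

theorem self (h : IsQuatCurv g R J α) (a : Fin 3) (u : E) : α a u u = 0 := by
  have := h.swap a u u
  linarith

theorem sq_apply (h : IsQuatCurv g R J α) (a : Fin 3) (u : E) : J a (J a u) = -u := by
  simpa using congrArg (fun T : E →L[ℝ] E ↦ T u) (h.quat.sq a)

theorem apply01 (h : IsQuatCurv g R J α) (u : E) : J 0 (J 1 u) = J 2 u := by
  simpa using congrArg (fun T : E →L[ℝ] E ↦ T u) h.quat.mul01

theorem apply10 (h : IsQuatCurv g R J α) (u : E) : J 1 (J 0 u) = -J 2 u := by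
  simpa using congrArg (fun T : E →L[ℝ] E ↦ T u) h.quat.mul10

theorem apply12 (h : IsQuatCurv g R J α) (u : E) : J 1 (J 2 u) = J 0 u := h.rotate.apply01 u

theorem apply21 (h : IsQuatCurv g R J α) (u : E) : J 2 (J 1 u) = -J 0 u := h.rotate.apply10 u

theorem apply20 (h : IsQuatCurv g R J α) (u : E) : J 2 (J 0 u) = J 1 u := h.rotate.rotate.apply01 u

theorem apply02 (h : IsQuatCurv g R J α) (u : E) : J 0 (J 2 u) = -J 1 u :=
  h.rotate.rotate.apply10 u

theorem inner_self (h : IsQuatCurv g R J α) (a : Fin 3) (u : E) : g (J a u) u = 0 := by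
  have := h.skewJ a u u
  rw [h.inner.symm u] at this
  linarith

theorem inner_map (h : IsQuatCurv g R J α) (a : Fin 3) (u v : E) :
    g (J a u) (J a v) = g u v := by
  rw [h.skewJ, h.sq_apply, map_neg, neg_neg]

theorem curv_map_zero (h : IsQuatCurv g R J α) (u v w z : E) :
    g (R u v (J 0 w)) (J 0 z) = g (R u v w) z - 2 * α 1 u v * g (J 1 w) z
      - 2 * α 2 u v * g (J 2 w) z := by
  have h1 := congrArg (fun T : E →L[ℝ] E ↦ T w) (h.commute u v 0)
  simp only [Fin.sum_univ_three, mul_apply_eq_comp, _root_.sub_apply,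
    _root_.add_apply, _root_.smul_apply, map_sub, map_add, map_smul,
    h.sq_apply, h.apply10, h.apply20, h.apply01, h.apply02] at h1
  have h2 : R u v (J 0 w) = J 0 (R u v w) - (2 * α 1 u v) • J 2 w + (2 * α 2 u v) • J 1 w := by
    rw [sub_eq_iff_eq_add] at h1
    rw [h1]; module
  rw [h2]
  simp only [map_add, map_sub, map_smul, _root_.add_apply,
    _root_.sub_apply, _root_.smul_apply, smul_eq_mul, h.inner_map]
  have e1 : g (J 2 w) (J 0 z) = g (J 1 w) z := by
    have := h.skewJ 0 (J 2 w) z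
    rw [h.apply02, map_neg, _root_.neg_apply] at this
    linarith
  have e2 : g (J 1 w) (J 0 z) = -g (J 2 w) z := by
    have := h.skewJ 0 (J 1 w) z
    rw [h.apply01] at this
    linarith
  rw [e1, e2]; ring

theorem curv_map_one (h : IsQuatCurv g R J α) (u v w z : E) :
    g (R u v (J 1 w)) (J 1 z) = g (R u v w) z - 2 * α 2 u v * g (J 2 w) z
      - 2 * α 0 u v * g (J 0 w) z :=
  h.rotate.curv_map_zero u v w z

theorem curv_map_two (h : IsQuatCurv g R J α) (u v w z : E) :
    g (R u v (J 2 w)) (J 2 z) = g (R u v w) z - 2 * α 0 u v * g (J 0 w) z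
      - 2 * α 1 u v * g (J 1 w) z :=
  h.rotate.rotate.curv_map_zero u v w z

theorem pair (h : IsQuatCurv g R J α) (u v w z : E) : g (R u v w) z = g (R w z u) v :=
  h.curv.pair_symm h.inner u v w z

theorem curv_swap (h : IsQuatCurv g R J α) (u v w z : E) : g (R u v w) z = -g (R v u w) z := by
  rw [h.curv.swap u v]; simp

theorem curv_bianchi (h : IsQuatCurv g R J α) (u v w z : E) :
    g (R u v w) z + g (R v w u) z + g (R w u v) z = 0 := by
  simpa using congrArg (fun x ↦ g x z) (h.curv.bianchi u v w)

/-- `y` is orthogonal to the quaternionic line spanned by `x`. -/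
def _root_.QuatOrtho (g : E →L[ℝ] E →L[ℝ] ℝ) (J : Fin 3 → E →L[ℝ] E) (x y : E) : Prop :=
  g x y = 0 ∧ ∀ a, g (J a x) y = 0

theorem ortho_rotate {x y : E} (hxy : QuatOrtho g J x y) :
    QuatOrtho g (fun a ↦ J (a + 1)) x y := ⟨hxy.1, fun _ ↦ hxy.2 _⟩

theorem ortho_map_one (h : IsQuatCurv g R J α) {x y : E} (hxy : QuatOrtho g J x y) :
    QuatOrtho g J x (J 1 y) := by
  have key : ∀ u, g u (J 1 y) = -g (J 1 u) y := fun u ↦ by rw [h.skewJ]; ring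
  refine ⟨by rw [key, hxy.2, neg_zero], fun a ↦ ?_⟩
  rw [key]
  fin_cases a
  · simp [h.apply10, hxy.2]
  · simp [h.sq_apply, hxy.1]
  · simp [h.apply12, hxy.2]

theorem comp_mul_norm (h : IsQuatCurv g R J α) (u v y : E) :
    2 * α 0 u v * g y y = g (R u v y) (J 0 y) + g (R u v (J 1 y)) (J 2 y) := by
  have h1 := h.curv_map_one u v y (J 0 y)
  rw [h.apply10, map_neg, h.inner_map] at h1
  have : g (J 2 y) (J 0 y) = 0 := by
    have := h.skewJ 0 (J 2 y) y
    rw [h.apply02, map_neg, _root_.neg_apply, h.inner_self] at this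
    linarith
  rw [this] at h1
  linarith

theorem inner_ortho (h : IsQuatCurv g R J α) {x y : E} (hxy : QuatOrtho g J x y) (a b : Fin 3) :
    g (J a x) (J b y) = 0 := by
  have h0 := hxy.2 0
  have h1 := hxy.2 1
  have h2 := hxy.2 2
  have hh := hxy.1
  have key : ∀ u, g u (J b y) = -g (J b u) y := fun u ↦ by rw [h.skewJ]; ring
  rw [key]
  fin_cases a <;> fin_cases b <;>
    simp [h.sq_apply, h.apply01, h.apply10, h.apply12, h.apply21, h.apply20, h.apply02,
      h0, h1, h2, hh]

theorem curv_ortho_zero (h : IsQuatCurv g R J α) {x y : E} (hxy : QuatOrtho g J x y) :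
    g (R x (J 0 x) y) (J 0 y) = g (R x y x) y + g (R x (J 0 y) x) (J 0 y) := by
  have b := h.curv_bianchi x (J 0 x) y (J 0 y)
  have p1 := h.pair (J 0 x) y x (J 0 y)
  have p2 := h.curv_map_zero x (J 0 y) x (J 0 y)
  rw [h.sq_apply, h.inner_ortho hxy, h.inner_ortho hxy, map_neg] at p2
  have p3 := h.curv_map_zero y x x y
  rw [hxy.2, hxy.2] at p3
  have p4 := h.curv_swap y x x y
  linarith

theorem curv_ortho_one (h : IsQuatCurv g R J α) {x y : E} (hxy : QuatOrtho g J x y) :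
    g (R x (J 1 x) y) (J 0 y) = g (R x (J 0 y) x) (J 1 y) + g (R x y x) (J 2 y) := by
  have b := h.curv_bianchi x (J 1 x) y (J 0 y)
  have p1 := h.pair (J 1 x) y x (J 0 y)
  have p2 := h.curv_map_one x (J 0 y) x (J 1 y)
  rw [h.sq_apply, h.inner_ortho hxy, h.inner_ortho hxy, map_neg] at p2
  have p3 := h.curv_map_one y x x (J 2 y)
  rw [h.inner_ortho hxy, h.inner_ortho hxy, h.apply12] at p3
  have p4 := h.curv_swap y x x (J 2 y)
  linarith

theorem curv_ortho_two (h : IsQuatCurv g R J α) {x y : E} (hxy : QuatOrtho g J x y) :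
    g (R x (J 2 x) y) (J 0 y) = g (R x (J 0 y) x) (J 2 y) - g (R x y x) (J 1 y) := by
  have b := h.curv_bianchi x (J 2 x) y (J 0 y)
  have p1 := h.pair (J 2 x) y x (J 0 y)
  have p2 := h.curv_map_two x (J 0 y) x (J 2 y)
  rw [h.sq_apply, h.inner_ortho hxy, h.inner_ortho hxy, map_neg] at p2
  have p3 := h.curv_map_two y x x (J 1 y)
  rw [h.inner_ortho hxy, h.inner_ortho hxy, h.apply21, map_neg] at p3
  have p4 := h.curv_swap y x x (J 1 y)
  linarith

theorem comp_zero_zero (h : IsQuatCurv g R J α) {x y : E} (hxy : QuatOrtho g J x y) :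
    2 * α 0 x (J 0 x) * g y y = g (R x y x) y + g (R x (J 0 y) x) (J 0 y)
      + g (R x (J 1 y) x) (J 1 y) + g (R x (J 2 y) x) (J 2 y) := by
  have h1 := h.comp_mul_norm x (J 0 x) y
  have h2 := h.curv_ortho_zero hxy
  have h3 := h.curv_ortho_zero (h.ortho_map_one hxy)
  rw [h.apply01] at h3
  linarith

theorem comp_zero_one (h : IsQuatCurv g R J α) {x y : E} (hxy : QuatOrtho g J x y)
    (hy : y ≠ 0) : α 0 x (J 1 x) = 0 := by
  have h1 := h.comp_mul_norm x (J 1 x) y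
  have h2 := h.curv_ortho_one hxy
  have h3 := h.curv_ortho_one (h.ortho_map_one hxy)
  rw [h.apply01, h.sq_apply, h.apply21, map_neg, map_neg] at h3
  have h4 := h.pair x (J 0 y) x (J 1 y)
  have h5 := h.pair x y x (J 2 y)
  have h6 := h.inner.pos y hy
  have : α 0 x (J 1 x) * (2 * g y y) = 0 := by linarith
  exact (mul_eq_zero.1 this).resolve_right (by positivity)

theorem comp_zero_two (h : IsQuatCurv g R J α) {x y : E} (hxy : QuatOrtho g J x y)
    (hy : y ≠ 0) : α 0 x (J 2 x) = 0 := by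
  have h1 := h.comp_mul_norm x (J 2 x) y
  have h2 := h.curv_ortho_two hxy
  have h3 := h.curv_ortho_two (h.ortho_map_one hxy)
  rw [h.apply01, h.sq_apply, h.apply21, map_neg, map_neg] at h3
  have h4 := h.pair x (J 0 y) x (J 2 y)
  have h5 := h.pair x y x (J 1 y)
  have h6 := h.inner.pos y hy
  have : α 0 x (J 2 x) * (2 * g y y) = 0 := by linarith
  exact (mul_eq_zero.1 this).resolve_right (by positivity)

theorem comp_zero_ortho (h : IsQuatCurv g R J α)
    (hex : ∀ x, ∃ y, y ≠ 0 ∧ QuatOrtho g J x y) {x y : E} (hxy : QuatOrtho g J x y) :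
    α 0 x y = 0 := by
  have h1 : ∀ x, α 0 x (J 1 x) = 0 := fun x ↦ by
    obtain ⟨y, hy, hxy⟩ := hex x
    exact h.comp_zero_one hxy hy
  have h2 : α 0 (J 1 x) (J 1 y) = -α 0 x y := by
    have := h1 (x + J 1 y)
    rw [map_add, h.sq_apply, h.add_left, h.add_right, h.add_right, h1, h.neg_right, h.neg_right,
      h.swap 0 (J 1 y) y, h1, h.swap 0 (J 1 y)] at this
    linarith
  have h3 : R (J 1 x) (J 1 y) = R x y := by
    ext w
    refine h.inner.eq_of_forall fun z ↦ ?_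
    have := h.curv_map_one w z x y
    rw [hxy.2, hxy.2] at this
    rw [h.pair, this, h.pair]
    ring
  have h4 : α 0 (J 1 x) (J 1 y) = α 0 x y := by rw [h.comp, h.comp, h3]
  linarith

/-- If `α 0 x` is proportional to `g (J 0 x)` for all `x`, the factor does not depend on `x`. -/
theorem exists_const (h : IsQuatCurv g R J α)
    (hk : ∀ x, ∃ k : ℝ, ∀ v, α 0 x v = k * g (J 0 x) v) :
    ∃ c : ℝ, ∀ x v, α 0 x v = c * g (J 0 x) v := by
  choose k hk using hk
  have e1 : ∀ x y, k x * g x y = k (J 0 y) * g x y := by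
    intro x y
    have a1 := hk x (J 0 y)
    have a2 := hk (J 0 y) x
    rw [h.inner_map] at a1
    rw [h.sq_apply, map_neg, _root_.neg_apply, h.inner.symm y x, h.swap, a1] at a2
    linarith
  have e2 : ∀ x y, g x y ≠ 0 → k x = k y := by
    intro x y hxy
    have hy : g y y ≠ 0 := by
      refine (h.inner.pos y ?_).ne'
      rintro rfl
      simp at hxy
    rw [mul_right_cancel₀ hxy (e1 x y), mul_right_cancel₀ hy (e1 y y)]
  have e3 : ∀ x y, x ≠ 0 → y ≠ 0 → k x = k y := by
    intro x y hx hy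
    by_cases hxy : g x y = 0
    · rw [e2 x (x + y), e2 (x + y) y]
      · rw [map_add, _root_.add_apply, hxy, zero_add]
        exact (h.inner.pos y hy).ne'
      · rw [map_add, hxy, add_zero]
        exact (h.inner.pos x hx).ne'
    · exact e2 x y hxy
  by_cases h0 : ∃ x₀ : E, x₀ ≠ 0
  · obtain ⟨x₀, hx₀⟩ := h0
    refine ⟨k x₀, fun x v ↦ ?_⟩
    by_cases hx : x = 0
    · subst hx
      rw [hk]; simp
    · rw [hk, e3 x x₀ hx hx₀]
  · push Not at h0
    exact ⟨0, fun x v ↦ by rw [hk, h0 x]; simp⟩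

/-- The components of `v` along the quaternionic line of `x`, up to the factor `g x x`. -/
def _root_.quatPart (g : E →L[ℝ] E →L[ℝ] ℝ) (J : Fin 3 → E →L[ℝ] E) (x v : E) : E :=
  (g x v / g x x) • x + ∑ a, (g (J a x) v / g x x) • J a x

theorem ortho_sub_quatPart (h : IsQuatCurv g R J α) {x : E} (hx : x ≠ 0) (v : E) :
    QuatOrtho g J x (v - quatPart g J x v) := by
  have hxx := (h.inner.pos x hx).ne'
  have z : ∀ a, g x (J a x) = 0 := fun a ↦ by rw [h.inner.symm, h.inner_self]
  have k : ∀ a b u v, g (J a u) (J b v) = -g (J b (J a u)) v := fun a b u v ↦ by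
    rw [h.skewJ b]; ring
  constructor
  · simp only [quatPart, Fin.sum_univ_three, map_sub, map_add, map_smul, z, smul_eq_mul]
    field_simp
    ring
  · intro b
    simp only [quatPart, Fin.sum_univ_three, map_sub, map_add, map_smul, h.inner_self, smul_eq_mul]
    fin_cases b <;>
    simp [k, h.sq_apply, h.apply01, h.apply10, h.apply12, h.apply21, h.apply20, h.apply02,
      h.inner_self, hxx]

theorem exists_const_of_ortho (h : IsQuatCurv g R J α)
    (h1 : ∀ x, α 0 x (J 1 x) = 0) (h2 : ∀ x, α 0 x (J 2 x) = 0)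
    (h3 : ∀ x y, QuatOrtho g J x y → α 0 x y = 0) :
    ∃ c : ℝ, ∀ x v, α 0 x v = c * g (J 0 x) v := by
  refine h.exists_const fun x ↦ ⟨α 0 x (J 0 x) / g x x, fun v ↦ ?_⟩
  by_cases hx : x = 0
  · subst hx
    have := h.smul_left 0 0 0 v
    simp only [smul_zero, zero_mul] at this
    simp [this]
  have := h3 x _ (h.ortho_sub_quatPart hx v)
  rw [sub_eq_add_neg, h.add_right, h.neg_right, quatPart] at this
  simp only [Fin.sum_univ_three, h.add_right, h.smul_right, h.self, h1, h2] at this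
  have hxx := (h.inner.pos x hx).ne'
  field_simp at this ⊢
  linarith

/-- In the presence of vectors orthogonal to each quaternionic line, the quaternionic part of the
curvature is a multiple of that of the quaternionic projective space. -/
theorem exists_eq_of_exists_ortho (h : IsQuatCurv g R J α)
    (hex : ∀ x, ∃ y, y ≠ 0 ∧ QuatOrtho g J x y) :
    ∃ c : ℝ, ∀ a x v, α a x v = c * g (J a x) v := by
  have main : ∀ {J : Fin 3 → E →L[ℝ] E} {α}, IsQuatCurv g R J α →
      (∀ x, ∃ y, y ≠ 0 ∧ QuatOrtho g J x y) → ∃ c : ℝ, ∀ x v, α 0 x v = c * g (J 0 x) v := by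
    intro J α h hex
    refine h.exists_const_of_ortho (fun x ↦ ?_) (fun x ↦ ?_)
      (fun x y hxy ↦ h.comp_zero_ortho hex hxy)
    · obtain ⟨y, hy, hxy⟩ := hex x
      exact h.comp_zero_one hxy hy
    · obtain ⟨y, hy, hxy⟩ := hex x
      exact h.comp_zero_two hxy hy
  have hex1 : ∀ x, ∃ y, y ≠ 0 ∧ QuatOrtho g (fun a ↦ J (a + 1)) x y := fun x ↦ by
    obtain ⟨y, hy, hxy⟩ := hex x
    exact ⟨y, hy, ortho_rotate hxy⟩
  have hex2 : ∀ x, ∃ y, y ≠ 0 ∧ QuatOrtho g (fun a ↦ J (a + 1 + 1)) x y := fun x ↦ by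
    obtain ⟨y, hy, hxy⟩ := hex1 x
    exact ⟨y, hy, ortho_rotate hxy⟩
  obtain ⟨c0, h0⟩ := main h hex
  obtain ⟨c1, h1⟩ := main h.rotate hex1
  obtain ⟨c2, h2⟩ := main h.rotate.rotate hex2
  change ∀ x v, α 1 x v = c1 * g (J 1 x) v at h1
  change ∀ x v, α 2 x v = c2 * g (J 2 x) v at h2
  by_cases hE : ∃ x : E, x ≠ 0
  · obtain ⟨x, hx⟩ := hE
    obtain ⟨y, hy, hxy⟩ := hex x
    have q0 := h.comp_zero_zero hxy
    have q1 : 2 * α 1 x (J 1 x) * g y y = g (R x y x) y + g (R x (J 1 y) x) (J 1 y)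
      + g (R x (J 2 y) x) (J 2 y) + g (R x (J 0 y) x) (J 0 y) :=
      h.rotate.comp_zero_zero (ortho_rotate hxy)
    have q2 : 2 * α 2 x (J 2 x) * g y y = g (R x y x) y + g (R x (J 2 y) x) (J 2 y)
      + g (R x (J 0 y) x) (J 0 y) + g (R x (J 1 y) x) (J 1 y) :=
      h.rotate.rotate.comp_zero_zero (ortho_rotate (ortho_rotate hxy))
    rw [h0, h.inner_map] at q0
    rw [h1, h.inner_map] at q1
    rw [h2, h.inner_map] at q2
    have hxx := (h.inner.pos x hx).ne'
    have hyy := (h.inner.pos y hy).ne'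
    have hp : g x x * g y y ≠ 0 := mul_ne_zero hxx hyy
    have e1 : c1 = c0 := mul_right_cancel₀ hp (by linarith)
    have e2 : c2 = c0 := mul_right_cancel₀ hp (by linarith)
    refine ⟨c0, fun a ↦ ?_⟩
    fin_cases a
    · exact h0
    · rw [← e1]; exact h1
    · rw [← e2]; exact h2
  · push Not at hE
    refine ⟨0, fun a x v ↦ ?_⟩
    rw [hE x]
    have := h.smul_left a 0 0 v
    simpa using this

/-- The derivation action of the triple on the curvature vanishes. -/
def _root_.AnnihilatesCurv (R : E → E → E →L[ℝ] E) (J : Fin 3 → E →L[ℝ] E) : Prop :=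
  ∀ a u v, J a * R u v - R (J a u) v - R u (J a v) - R u v * J a = 0

theorem deriv_zero (h : IsQuatCurv g R J α) (hA : AnnihilatesCurv R J) (u v : E) :
    α 1 (J 0 u) v + α 1 u (J 0 v) = -2 * α 2 u v ∧
    α 2 (J 0 u) v + α 2 u (J 0 v) = 2 * α 1 u v := by
  have key : ∀ b, endTrace E (J b * R (J 0 u) v) + endTrace E (J b * R u (J 0 v))
      = endTrace E (J b * J 0 * R u v) - endTrace E (J 0 * J b * R u v) := by
    intro b
    have h1 := congrArg (fun T ↦ endTrace E (J b * T)) (hA 0 u v)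
    simp only [mul_sub, map_sub, mul_zero, map_zero] at h1
    rw [← mul_assoc, ← mul_assoc (J b) (R u v), endTrace_mul_comm (J b * R u v) (J 0),
      ← mul_assoc] at h1
    linarith
  have k1 := key 1
  have k2 := key 2
  rw [h.quat.mul10, h.quat.mul01, neg_mul, map_neg] at k1
  rw [h.quat.mul20, h.quat.mul02, neg_mul, map_neg] at k2
  simp only [h.comp]
  constructor
  · rw [← add_div, ← neg_add, k1]; ring
  · rw [← add_div, ← neg_add, k2]; ring

theorem exists_eq_of_annihilates (h : IsQuatCurv g R J α) (hA : AnnihilatesCurv R J)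
    (hdim : ∀ x y, x ≠ 0 → QuatOrtho g J x y → y = 0) :
    ∃ c : ℝ, ∀ a x v, α a x v = c * g (J a x) v := by
  have main : ∀ {J : Fin 3 → E →L[ℝ] E} {α}, IsQuatCurv g R J α → AnnihilatesCurv R J →
      (∀ x y, x ≠ 0 → QuatOrtho g J x y → y = 0) →
      ∃ c : ℝ, ∀ x v, α 0 x v = c * g (J 0 x) v := by
    intro J α h hA hdim
    have hA1 : AnnihilatesCurv R (fun a ↦ J (a + 1)) := fun a ↦ hA _
    have hA2 : AnnihilatesCurv R (fun a ↦ J (a + 1 + 1)) := fun a ↦ hA1 _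
    refine h.exists_const_of_ortho (fun x ↦ ?_) (fun x ↦ ?_) (fun x y hxy ↦ ?_)
    · have : α 2 (J 1 x) (J 1 x) + α 2 x (J 1 (J 1 x)) = -2 * α 0 x (J 1 x) :=
        (h.rotate.deriv_zero hA1 x (J 1 x)).1
      rw [h.self, h.sq_apply, h.neg_right, h.self] at this
      linarith
    · have : α 1 (J 2 x) (J 2 x) + α 1 x (J 2 (J 2 x)) = 2 * α 0 x (J 2 x) :=
        (h.rotate.rotate.deriv_zero hA2 x (J 2 x)).2
      rw [h.self, h.sq_apply, h.neg_right, h.self] at this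
      linarith
    · by_cases hx : x = 0
      · subst hx
        simpa using h.smul_left 0 0 0 y
      · rw [hdim x y hx hxy]
        simpa using h.smul_right 0 0 0 x
  have hA1 : AnnihilatesCurv R (fun a ↦ J (a + 1)) := fun a ↦ hA _
  have hA2 : AnnihilatesCurv R (fun a ↦ J (a + 1 + 1)) := fun a ↦ hA1 _
  have ho : ∀ x y, QuatOrtho g (fun a ↦ J (a + 1)) x y → QuatOrtho g J x y := by
    refine fun x y hxy ↦ ⟨hxy.1, fun a ↦ ?_⟩
    have : g (J (a + 2 + 1) x) y = 0 := hxy.2 (a + 2)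
    rwa [show a + 2 + 1 = a by fin_cases a <;> rfl] at this
  have hd1 : ∀ x y, x ≠ 0 → QuatOrtho g (fun a ↦ J (a + 1)) x y → y = 0 :=
    fun x y hx hxy ↦ hdim x y hx (ho x y hxy)
  have ho2 : ∀ x y, QuatOrtho g (fun a ↦ J (a + 1 + 1)) x y → QuatOrtho g J x y := by
    refine fun x y hxy ↦ ⟨hxy.1, fun a ↦ ?_⟩
    have : g (J (a + 1 + 1 + 1) x) y = 0 := hxy.2 (a + 1)
    rwa [show a + 1 + 1 + 1 = a by fin_cases a <;> rfl] at this
  obtain ⟨c0, h0⟩ := main h hA hdim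
  obtain ⟨c1, h1⟩ := main h.rotate hA1 hd1
  obtain ⟨c2, h2⟩ := main h.rotate.rotate hA2 fun x y hx hxy ↦ hdim x y hx (ho2 x y hxy)
  change ∀ x v, α 1 x v = c1 * g (J 1 x) v at h1
  change ∀ x v, α 2 x v = c2 * g (J 2 x) v at h2
  by_cases hE : ∃ x : E, x ≠ 0
  · obtain ⟨x, hx⟩ := hE
    have hxx := (h.inner.pos x hx).ne'
    have e2 : c2 = c0 := by
      have : α 0 (J 1 x) (J 2 x) + α 0 x (J 1 (J 2 x)) = 2 * α 2 x (J 2 x) :=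
        (h.rotate.deriv_zero hA1 x (J 2 x)).2
      rw [h.apply12, h0, h0, h2, h.apply01, h.inner_map, h.inner_map] at this
      exact mul_right_cancel₀ hxx (by linarith)
    have e1 : c1 = c0 := by
      have : α 1 (J 2 x) (J 0 x) + α 1 x (J 2 (J 0 x)) = 2 * α 0 x (J 0 x) :=
        (h.rotate.rotate.deriv_zero hA2 x (J 0 x)).2
      rw [h.apply20, h1, h1, h0, h.apply12, h.inner_map, h.inner_map] at this
      exact mul_right_cancel₀ hxx (by linarith)
    refine ⟨c0, fun a ↦ ?_⟩
    fin_cases a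
    · exact h0
    · rw [← e1]; exact h1
    · rw [← e2]; exact h2
  · push Not at hE
    refine ⟨0, fun a x v ↦ ?_⟩
    rw [hE x]
    have := h.smul_left a 0 0 v
    simpa using this

end IsQuatCurv

end CurvAlgebra

section CurvAlgebra

variable {E : Type*} [NormedAddCommGroup E] [NormedSpace ℝ E]

namespace IsQuatCurv

variable {g : E →L[ℝ] E →L[ℝ] ℝ} {R : E → E → E →L[ℝ] E} {J : Fin 3 → E →L[ℝ] E}
  {α : Fin 3 → E → E → ℝ}

/-- If the quaternionic part of the curvature vanishes, its Ricci contraction is skew. -/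
theorem ricci_skew (h : IsQuatCurv g R J α) (hα : ∀ a u v, α a u v = 0)
    (K : E → E → E →ₗ[ℝ] E) (hK : ∀ u v w, K u v w = R w u v) (u v : E) :
    LinearMap.trace ℝ E (K u v) = -LinearMap.trace ℝ E (K v u) := by
  have hcomm : ∀ u v w, R u v (J 0 w) = J 0 (R u v w) := by
    intro u v w
    have := congrArg (fun T : E →L[ℝ] E ↦ T w) (h.commute u v 0)
    simpa [hα] using this
  have hJJ : ∀ u v, R (J 0 u) (J 0 v) = R u v := by
    intro u v
    ext w
    refine h.inner.eq_of_forall fun z ↦ ?_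
    have := h.curv_map_zero w z u v
    rw [hα, hα] at this
    rw [h.pair, this, h.pair]
    ring
  have hneg : ∀ u v, R (-u) v = -R u v := fun u v ↦ by simpa using h.curv.smul_left (-1) u v
  have hneg' : ∀ u v, R u (-v) = -R u v := fun u v ↦ by
    rw [h.curv.swap, hneg, h.curv.swap u v]
  have e1 : ∀ u v, (J 0).toLinearMap * K u v = K u (J 0 v) := by
    intro u v
    ext w
    simp [hK, hcomm]
  have e2 : ∀ u v, K u v * (J 0).toLinearMap = -K (J 0 u) v := by
    intro u v
    ext w
    have : R (J 0 w) u = -R w (J 0 u) := by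
      rw [← hneg', ← hJJ w, map_neg, h.sq_apply, neg_neg]
    simp [hK, this]
  have e3 : ∀ u v, K u v - K v u = -(R u v).toLinearMap := by
    intro u v
    ext w
    have b := h.curv.bianchi u v w
    rw [h.curv.swap v w] at b
    simp only [LinearMap.sub_apply, LinearMap.neg_apply, hK, ContinuousLinearMap.coe_coe]
    rw [_root_.neg_apply] at b
    rw [eq_neg_iff_add_eq_zero, ← b]; abel
  have t1 : ∀ u v, LinearMap.trace ℝ E (K u (J 0 v)) = -LinearMap.trace ℝ E (K (J 0 u) v) := by
    intro u v
    rw [← e1, LinearMap.trace_mul_comm, e2, map_neg]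
  have t2 : ∀ u v, LinearMap.trace ℝ E (K u (J 0 v)) = LinearMap.trace ℝ E (K v (J 0 u)) := by
    intro u v
    have hz : endTrace E (J 0 * R u v) = 0 :=
      h.quat.trace_mul_commutant endTrace_mul_comm (fun a ↦ by
        simpa [hα] using h.commute u v a) 0
    have : (J 0).toLinearMap * (K u v - K v u) = -((J 0).toLinearMap * (R u v).toLinearMap) := by
      rw [e3, mul_neg]
    rw [mul_sub, e1, e1] at this
    have := congrArg (LinearMap.trace ℝ E) this
    rw [map_sub, map_neg] at this
    change _ = -endTrace E (J 0 * R u v) at this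
    rw [hz, neg_zero] at this
    linarith
  have hKneg : ∀ u v, K u (-v) = -K u v := by
    intro u v
    ext w
    simp [hK]
  have k1 := t2 u (J 0 v)
  rw [h.sq_apply, hKneg, map_neg] at k1
  have k2 := t1 v (J 0 u)
  rw [h.sq_apply, hKneg, map_neg] at k2
  linarith

/-- In dimension greater than four there are vectors orthogonal to each quaternionic line. -/
theorem exists_ortho [FiniteDimensional ℝ E] (hd : 4 < Module.finrank ℝ E) (x : E) :
    ∃ y, y ≠ 0 ∧ QuatOrtho g J x y := by
  let L : E →ₗ[ℝ] (ℝ × (Fin 3 → ℝ)) :=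
    (g x).toLinearMap.prod (LinearMap.pi fun a ↦ (g (J a x)).toLinearMap)
  have : LinearMap.ker L ≠ ⊥ := by
    apply LinearMap.ker_ne_bot_of_finrank_lt
    simpa using hd
  obtain ⟨y, hy, hy0⟩ := (Submodule.ne_bot_iff _).1 this
  have h1 : (g x y, fun a ↦ g (J a x) y) = (0, 0) := hy
  rw [Prod.mk.injEq] at h1
  exact ⟨y, hy0, h1.1, fun a ↦ congrFun h1.2 a⟩

/-- In dimension four only zero is orthogonal to a quaternionic line. -/
theorem ortho_eq_zero [FiniteDimensional ℝ E] (h : IsQuatCurv g R J α)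
    (hd : Module.finrank ℝ E = 4) (x y : E) (hx : x ≠ 0) (hxy : QuatOrtho g J x y) : y = 0 := by
  let L : E →ₗ[ℝ] (ℝ × (Fin 3 → ℝ)) :=
    (g x).toLinearMap.prod (LinearMap.pi fun a ↦ (g (J a x)).toLinearMap)
  have hxx := (h.inner.pos x hx).ne'
  have z : ∀ a, g x (J a x) = 0 := fun a ↦ by rw [h.inner.symm, h.inner_self]
  have k : ∀ a b u v, g (J a u) (J b v) = -g (J b (J a u)) v := fun a b u v ↦ by
    rw [h.skewJ b]; ring
  have hsurj : Function.Surjective L := by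
    rintro ⟨r, s⟩
    refine ⟨(r / g x x) • x + ∑ a, (s a / g x x) • J a x, ?_⟩
    refine Prod.ext ?_ (funext fun b ↦ ?_)
    · show g x _ = r
      simp only [Fin.sum_univ_three, map_add, map_smul, z, smul_eq_mul]
      field_simp
      ring
    · show g (J b x) _ = s b
      simp only [Fin.sum_univ_three, map_add, map_smul, h.inner_self, smul_eq_mul]
      fin_cases b <;>
      simp [k, h.sq_apply, h.apply01, h.apply10, h.apply12, h.apply21, h.apply20, h.apply02,
        h.inner_self, hxx]
  have hinj : Function.Injective L :=
    (LinearMap.injective_iff_surjective_of_finrank_eq_finrank (by simp [hd])).2 hsurj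
  apply hinj
  rw [map_zero]
  exact Prod.ext hxy.1 (funext fun a ↦ hxy.2 a)

end IsQuatCurv

/-- The components of an algebraic curvature tensor along a quaternionic triple. -/
def quatComp (R : E → E → E →L[ℝ] E) (J : Fin 3 → E →L[ℝ] E) (a : Fin 3) (u v : E) : ℝ :=
  -(endTrace E (J a * R u v)) / endTrace E 1

/-- The structure of the curvature of a quaternionic Kähler manifold at a point: the part in
direction of `Q` is a multiple of that of the quaternionic projective space, and the multiple is
nonzero unless the Ricci contraction is skew. -/
theorem exists_quat_curv [FiniteDimensional ℝ E] {n : ℕ} (hE : Module.finrank ℝ E = 4 * n)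
    (hn : n ≠ 0)
    {g : E →L[ℝ] E →L[ℝ] ℝ} {R : E → E → E →L[ℝ] E} {J : Fin 3 → E →L[ℝ] E}
    (hg : IsInnerForm g) (hR : IsAlgCurv g R) (hJ : QuatTriple J)
    (hskew : ∀ a u v, g (J a u) v = -g u (J a v))
    (hnorm : ∀ u v b, R u v * J b - J b * R u v ∈ Submodule.span ℝ (Set.range J))
    (hfour : Module.finrank ℝ E = 4 → AnnihilatesCurv R J)
    (K : E → E → E →ₗ[ℝ] E) (hK : ∀ u v w, K u v w = R w u v)
    (hric : ¬ ∀ u v, LinearMap.trace ℝ E (K u v) = -LinearMap.trace ℝ E (K v u)) :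
    ∃ c : ℝ, c ≠ 0 ∧ IsQuatCurv g R J (fun a u v ↦ c * g (J a u) v) := by
  have ht : endTrace E 1 ≠ 0 := by
    rw [endTrace_one, hE]
    exact_mod_cast mul_ne_zero four_ne_zero hn
  have hq : IsQuatCurv g R J (quatComp R J) :=
    { inner := hg
      curv := hR
      quat := hJ
      skewJ := hskew
      comp := fun a u v ↦ rfl
      commute := fun u v b ↦
        hJ.commute_sub_of_normalizes endTrace_mul_comm ht (hnorm u v) b }
  obtain ⟨c, hc⟩ : ∃ c : ℝ, ∀ a x v, quatComp R J a x v = c * g (J a x) v := by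
    by_cases h4 : Module.finrank ℝ E = 4
    · exact hq.exists_eq_of_annihilates (hfour h4) (hq.ortho_eq_zero h4)
    · exact hq.exists_eq_of_exists_ortho (IsQuatCurv.exists_ortho (by omega))
  refine ⟨c, ?_, ?_⟩
  · rintro rfl
    exact hric (hq.ricci_skew (fun a u v ↦ by rw [hc, zero_mul]) K hK)
  · rwa [show (fun a u v ↦ c * g (J a u) v) = quatComp R J by
      ext a u v; exact (hc a u v).symm]

end CurvAlgebra

/-! ### Connections on trivial bundles -/

section FlatCalculus

variable {F E : Type*} [NormedAddCommGroup F] [NormedSpace ℝ F]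
  [NormedAddCommGroup E] [NormedSpace ℝ E]

/-- The covariant derivative of `σ` in direction `u`, for the connection form `C`. -/
def covVec (C : F → F → E →L[ℝ] E) (σ : F → E) (x u : F) : E :=
  fderiv ℝ σ x u + C x u (σ x)

/-- The covariant derivative of the endomorphism field `T` in direction `u`. -/
def covEnd (C : F → F → E →L[ℝ] E) (T : F → E →L[ℝ] E) (x u : F) : E →L[ℝ] E :=
  fderiv ℝ T x u + C x u * T x - T x * C x u

variable {C : F → F → E →L[ℝ] E} {S T : F → E →L[ℝ] E} {σ τ : F → E} {x : F}

theorem fderiv_clm_mul_apply (hS : DifferentiableAt ℝ S x) (hT : DifferentiableAt ℝ T x) (u : F) :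
    fderiv ℝ (fun y ↦ S y * T y) x u = fderiv ℝ S x u * T x + S x * fderiv ℝ T x u := by
  have := (hS.hasFDerivAt.clm_comp hT.hasFDerivAt).fderiv
  have h2 := congrArg (fun L ↦ L u) this
  rw [show (fun y ↦ S y * T y) = fun y ↦ (S y).comp (T y) from rfl]
  rw [h2]
  ext w
  simp [add_comm]

theorem fderiv_clm_apply_apply (hT : DifferentiableAt ℝ T x) (hσ : DifferentiableAt ℝ σ x) (u : F) :
    fderiv ℝ (fun y ↦ T y (σ y)) x u = fderiv ℝ T x u (σ x) + T x (fderiv ℝ σ x u) := by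
  rw [(hT.hasFDerivAt.clm_apply hσ.hasFDerivAt).fderiv]
  simp [add_comm]

theorem fderiv_apply_const {W : Type*} [NormedAddCommGroup W] [NormedSpace ℝ W]
    {L : F → E →L[ℝ] W} (hL : DifferentiableAt ℝ L x) (v : E) (u : F) :
    fderiv ℝ (fun y ↦ L y v) x u = fderiv ℝ L x u v := by
  rw [(hL.hasFDerivAt.clm_apply (hasFDerivAt_const v x)).fderiv]
  simp

theorem covEnd_mul (hS : DifferentiableAt ℝ S x) (hT : DifferentiableAt ℝ T x) (u : F) :
    covEnd C (fun y ↦ S y * T y) x u = covEnd C S x u * T x + S x * covEnd C T x u := by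
  simp only [covEnd, fderiv_clm_mul_apply hS hT]
  noncomm_ring

theorem covEnd_sub (hS : DifferentiableAt ℝ S x) (hT : DifferentiableAt ℝ T x) (u : F) :
    covEnd C (fun y ↦ S y - T y) x u = covEnd C S x u - covEnd C T x u := by
  simp only [covEnd, fderiv_fun_sub hS hT, _root_.sub_apply]
  noncomm_ring

theorem covEnd_add (hS : DifferentiableAt ℝ S x) (hT : DifferentiableAt ℝ T x) (u : F) :
    covEnd C (fun y ↦ S y + T y) x u = covEnd C S x u + covEnd C T x u := by
  simp only [covEnd, fderiv_fun_add hS hT, _root_.add_apply]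
  noncomm_ring

theorem covEnd_smul {s : F → ℝ} (hs : DifferentiableAt ℝ s x) (hT : DifferentiableAt ℝ T x)
    (u : F) :
    covEnd C (fun y ↦ s y • T y) x u = fderiv ℝ s x u • T x + s x • covEnd C T x u := by
  simp only [covEnd, fderiv_fun_smul hs hT, _root_.add_apply, _root_.smul_apply, smul_sub,
    smul_add, mul_smul_comm, smul_mul_assoc, ContinuousLinearMap.smulRight_apply]
  abel

theorem covEnd_congr (h : S =ᶠ[𝓝 x] T) (u : F) : covEnd C S x u = covEnd C T x u := by
  simp only [covEnd, h.fderiv_eq, h.eq_of_nhds]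

theorem covVec_congr (h : σ =ᶠ[𝓝 x] τ) (u : F) : covVec C σ x u = covVec C τ x u := by
  simp only [covVec, h.fderiv_eq, h.eq_of_nhds]

theorem covEnd_const {T₀ : E →L[ℝ] E} (h : ∀ u, C x u * T₀ = T₀ * C x u) (u : F) :
    covEnd C (fun _ ↦ T₀) x u = 0 := by
  simp [covEnd, h]

theorem covVec_apply (hT : DifferentiableAt ℝ T x) (hσ : DifferentiableAt ℝ σ x) (u : F) :
    covVec C (fun y ↦ T y (σ y)) x u = covEnd C T x u (σ x) + T x (covVec C σ x u) := by
  simp only [covVec, covEnd, fderiv_clm_apply_apply hT hσ, _root_.add_apply, _root_.sub_apply,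
    mul_apply_eq_comp, map_add]
  abel

theorem covVec_sub (hσ : DifferentiableAt ℝ σ x) (hτ : DifferentiableAt ℝ τ x) (u : F) :
    covVec C (fun y ↦ σ y - τ y) x u = covVec C σ x u - covVec C τ x u := by
  simp only [covVec, fderiv_fun_sub hσ hτ, _root_.sub_apply, map_sub]
  abel

theorem covVec_const (σ₀ : E) (u : F) : covVec C (fun _ ↦ σ₀) x u = C x u σ₀ := by
  simp [covVec]

/-- The pullback of a connection form under a map `θ`. -/
def pullConn (Γ : E → E → E →L[ℝ] E) (θ : F → E) (x u : F) : E →L[ℝ] E :=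
  Γ (θ x) (fderiv ℝ θ x u)

theorem covEnd_pullConn {Γ : E → E → E →L[ℝ] E} {θ : F → E} {T : E → E →L[ℝ] E}
    (hT : DifferentiableAt ℝ T (θ x)) (hθ : DifferentiableAt ℝ θ x) (u : F) :
    covEnd (pullConn Γ θ) (fun y ↦ T (θ y)) x u = covEnd Γ T (θ x) (fderiv ℝ θ x u) := by
  have : fderiv ℝ (fun y ↦ T (θ y)) x u = fderiv ℝ T (θ x) (fderiv ℝ θ x u) := by
    rw [show (fun y ↦ T (θ y)) = T ∘ θ from rfl, fderiv_comp x hT hθ]; rfl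
  simp only [covEnd, pullConn, this]

theorem covVec_pullConn {Γ : E → E → E →L[ℝ] E} {θ : F → E} {σ : E → E}
    (hσ : DifferentiableAt ℝ σ (θ x)) (hθ : DifferentiableAt ℝ θ x) (u : F) :
    covVec (pullConn Γ θ) (fun y ↦ σ (θ y)) x u = covVec Γ σ (θ x) (fderiv ℝ θ x u) := by
  have : fderiv ℝ (fun y ↦ σ (θ y)) x u = fderiv ℝ σ (θ x) (fderiv ℝ θ x u) := by
    rw [show (fun y ↦ σ (θ y)) = σ ∘ θ from rfl, fderiv_comp x hσ hθ]; rfl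
  simp only [covVec, pullConn, this]

/-- The fibre metric `G` is parallel for the connection form `C` at the point `x`. -/
def MetricAt (C : F → F → E →L[ℝ] E) (G : F → E →L[ℝ] E →L[ℝ] ℝ) (x : F) : Prop :=
  ∀ u : F, ∀ v w : E, fderiv ℝ (fun y ↦ G y v w) x u = G x (C x u v) w + G x v (C x u w)

variable {G : F → E →L[ℝ] E →L[ℝ] ℝ}

theorem fderiv_form_apply (hG : DifferentiableAt ℝ G x) (hσ : DifferentiableAt ℝ σ x)
    (hτ : DifferentiableAt ℝ τ x) (u : F) :
    fderiv ℝ (fun y ↦ G y (σ y) (τ y)) x u = fderiv ℝ (fun y ↦ G y (σ x) (τ x)) x u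
      + G x (fderiv ℝ σ x u) (τ x) + G x (σ x) (fderiv ℝ τ x u) := by
  have h1 := ((hG.hasFDerivAt.clm_apply hσ.hasFDerivAt).clm_apply hτ.hasFDerivAt).fderiv
  have h2 := ((hG.hasFDerivAt.clm_apply (hasFDerivAt_const (σ x) x)).clm_apply
    (hasFDerivAt_const (τ x) x)).fderiv
  rw [h1, h2]
  simp only [_root_.add_apply, ContinuousLinearMap.flip_apply, ContinuousLinearMap.comp_apply,
    _root_.zero_apply, map_zero]
  ring

theorem MetricAt.fderiv_inner (hM : MetricAt C G x) (hG : DifferentiableAt ℝ G x)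
    (hσ : DifferentiableAt ℝ σ x) (hτ : DifferentiableAt ℝ τ x) (u : F) :
    fderiv ℝ (fun y ↦ G y (σ y) (τ y)) x u
      = G x (covVec C σ x u) (τ x) + G x (σ x) (covVec C τ x u) := by
  rw [fderiv_form_apply hG hσ hτ, hM, covVec, covVec]
  simp only [map_add, _root_.add_apply]
  ring

/-- The curvature of a connection form. -/
def flatCurv (C : F → F → E →L[ℝ] E) (x u v : F) : E →L[ℝ] E :=
  fderiv ℝ (fun y ↦ C y v) x u - fderiv ℝ (fun y ↦ C y u) x v + C x u * C x v - C x v * C x u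

theorem ricci_identity_end (hC : ∀ u, DifferentiableAt ℝ (fun y ↦ C y u) x)
    (hT : ContDiffAt ℝ 2 T x) (u v : F) :
    covEnd C (fun y ↦ covEnd C T y v) x u - covEnd C (fun y ↦ covEnd C T y u) x v
      = flatCurv C x u v * T x - T x * flatCurv C x u v := by
  have hd : DifferentiableAt ℝ T x := hT.differentiableAt (by norm_num)
  have hdd : DifferentiableAt ℝ (fderiv ℝ T) x :=
    (hT.fderiv_right (m := 1) (by norm_num)).differentiableAt (by norm_num)
  have hsym := hT.isSymmSndFDerivAt (by simp) u v
  have key : ∀ u v, covEnd C (fun y ↦ covEnd C T y v) x u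
      = fderiv ℝ (fderiv ℝ T) x u v + fderiv ℝ (fun y ↦ C y v) x u * T x
        + C x v * fderiv ℝ T x u - (fderiv ℝ T x u * C x v + T x * fderiv ℝ (fun y ↦ C y v) x u)
        + C x u * (fderiv ℝ T x v + C x v * T x - T x * C x v)
        - (fderiv ℝ T x v + C x v * T x - T x * C x v) * C x u := by
    intro u v
    have hdv : DifferentiableAt ℝ (fun y ↦ fderiv ℝ T y v) x :=
      hdd.clm_apply (differentiableAt_const v)
    have e1 : fderiv ℝ (fun y ↦ fderiv ℝ T y v) x u = fderiv ℝ (fderiv ℝ T) x u v := fderiv_apply_const hdd v u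
    have m1 : DifferentiableAt ℝ (fun y ↦ C y v * T y) x := (hC v).mul hd
    have m2 : DifferentiableAt ℝ (fun y ↦ T y * C y v) x := hd.mul (hC v)
    have e2 : fderiv ℝ (fun y ↦ covEnd C T y v) x u
        = fderiv ℝ (fderiv ℝ T) x u v + fderiv ℝ (fun y ↦ C y v * T y) x u
          - fderiv ℝ (fun y ↦ T y * C y v) x u := by
      simp only [covEnd]
      rw [fderiv_fun_sub (hdv.fun_add m1) m2, fderiv_fun_add hdv m1]
      simp only [_root_.sub_apply, _root_.add_apply, e1]
    rw [covEnd, e2, fderiv_clm_mul_apply (hC v) hd, fderiv_clm_mul_apply hd (hC v)]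
    simp only [covEnd]
    abel
  rw [key, key, hsym, flatCurv]
  noncomm_ring

end FlatCalculus

/-! ### Levi-Civita connections in coordinates -/

section FlatLeviCivita

variable {E : Type*} [NormedAddCommGroup E] [NormedSpace ℝ E]

/-- `Γ` is the connection form of the Levi-Civita connection of the metric `G` on the open set
`U`. -/
structure FlatLC (U : Set E) (G : E → E →L[ℝ] E →L[ℝ] ℝ) (Γ : E → E → E →L[ℝ] E) : Prop where
  isOpen : IsOpen U
  smoothG : ContDiffOn ℝ ∞ G U
  smoothΓ : ∀ u, ContDiffOn ℝ ∞ (fun x ↦ Γ x u) U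
  inner : ∀ x ∈ U, IsInnerForm (G x)
  add : ∀ x u v, Γ x (u + v) = Γ x u + Γ x v
  smul : ∀ (c : ℝ) x u, Γ x (c • u) = c • Γ x u
  symm : ∀ x ∈ U, ∀ u v, Γ x u v = Γ x v u
  metric : ∀ x ∈ U, MetricAt Γ G x

namespace FlatLC

variable {U : Set E} {G : E → E →L[ℝ] E →L[ℝ] ℝ} {Γ : E → E → E →L[ℝ] E} (h : FlatLC U G Γ)
  {x : E}
include h

theorem mem_nhds (hx : x ∈ U) : U ∈ 𝓝 x := h.isOpen.mem_nhds hx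

theorem diffG (hx : x ∈ U) : DifferentiableAt ℝ G x :=
  (h.smoothG.contDiffAt (h.mem_nhds hx)).differentiableAt (by simp)

theorem diffΓ (hx : x ∈ U) (u : E) : DifferentiableAt ℝ (fun y ↦ Γ y u) x :=
  ((h.smoothΓ u).contDiffAt (h.mem_nhds hx)).differentiableAt (by simp)

theorem fderiv_symm (hx : x ∈ U) (u v w : E) :
    fderiv ℝ (fun y ↦ Γ y v) x u w = fderiv ℝ (fun y ↦ Γ y w) x u v := by
  have k : ∀ v w, fderiv ℝ (fun y ↦ Γ y v) x u w = fderiv ℝ (fun y ↦ Γ y v w) x u := by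
    intro v w
    rw [fderiv_clm_apply_apply (h.diffΓ hx v) (differentiableAt_const w)]
    simp
  rw [k, k]
  have : (fun y ↦ Γ y v w) =ᶠ[𝓝 x] fun y ↦ Γ y w v := by
    filter_upwards [h.mem_nhds hx] with y hy using h.symm y hy v w
  rw [this.fderiv_eq]

theorem isAlgCurv (hx : x ∈ U) : IsAlgCurv (G x) (flatCurv Γ x) where
  add_left u v w := by
    simp only [flatCurv, fderiv_fun_add (h.diffΓ hx u) (h.diffΓ hx v), h.add, map_add,
      _root_.add_apply]
    noncomm_ring
  smul_left c u w := by
    simp only [flatCurv, fderiv_fun_const_smul (h.diffΓ hx u), h.smul, map_smul,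
      _root_.smul_apply, smul_sub, smul_add, mul_smul_comm, smul_mul_assoc]
  swap u v := by simp only [flatCurv]; abel
  bianchi u v w := by
    simp only [flatCurv, _root_.add_apply, _root_.sub_apply, mul_apply_eq_comp]
    rw [h.fderiv_symm hx u v w, h.fderiv_symm hx v w u, h.fderiv_symm hx w u v, h.symm x hx v w,
      h.symm x hx u w, h.symm x hx u v]
    abel
  skew u v w z := by
    have hsm : ContDiffAt ℝ 2 (fun y ↦ G y w z) x := by
      have := (h.smoothG.contDiffAt (h.mem_nhds hx)).of_le (m := 2) ENat.LEInfty.out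
      exact (this.clm_apply contDiffAt_const).clm_apply contDiffAt_const
    have hsym := hsm.isSymmSndFDerivAt (by simp) u v
    have hdd : DifferentiableAt ℝ (fderiv ℝ (fun y ↦ G y w z)) x :=
      (hsm.fderiv_right (m := 1) (by norm_num)).differentiableAt (by norm_num)
    have key : ∀ u v, fderiv ℝ (fderiv ℝ (fun y ↦ G y w z)) x u v
        = G x (fderiv ℝ (fun y ↦ Γ y v) x u w + Γ x u (Γ x v w)) z + G x (Γ x v w) (Γ x u z)
          + (G x (Γ x u w) (Γ x v z)
          + G x w (fderiv ℝ (fun y ↦ Γ y v) x u z + Γ x u (Γ x v z))) := by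
      intro u v
      have e1 : fderiv ℝ (fun y ↦ fderiv ℝ (fun y ↦ G y w z) y v) x u
          = fderiv ℝ (fderiv ℝ (fun y ↦ G y w z)) x u v := fderiv_apply_const hdd v u
      have hw : ∀ w : E, DifferentiableAt ℝ (fun y ↦ Γ y v w) x := fun w ↦
        (h.diffΓ hx v).clm_apply (differentiableAt_const w)
      have e2 : (fun y ↦ fderiv ℝ (fun y ↦ G y w z) y v) =ᶠ[𝓝 x]
          fun y ↦ G y (Γ y v w) z + G y w (Γ y v z) := by
        filter_upwards [h.mem_nhds hx] with y hy using h.metric y hy v w z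
      have d1 : DifferentiableAt ℝ (fun y ↦ G y (Γ y v w) z) x :=
        ((h.diffG hx).clm_apply (hw w)).clm_apply (differentiableAt_const z)
      have d2 : DifferentiableAt ℝ (fun y ↦ G y w (Γ y v z)) x :=
        ((h.diffG hx).clm_apply (differentiableAt_const w)).clm_apply (hw z)
      have e3 : ∀ w, covVec Γ (fun y ↦ Γ y v w) x u
          = fderiv ℝ (fun y ↦ Γ y v) x u w + Γ x u (Γ x v w) := by
        intro w
        rw [covVec, fderiv_clm_apply_apply (h.diffΓ hx v) (differentiableAt_const w)]
        simp
      rw [← e1, e2.fderiv_eq, fderiv_fun_add d1 d2, _root_.add_apply,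
        (h.metric x hx).fderiv_inner (h.diffG hx) (hw w) (differentiableAt_const z),
        (h.metric x hx).fderiv_inner (h.diffG hx) (differentiableAt_const w) (hw z),
        e3, e3, covVec_const, covVec_const]
    rw [key, key] at hsym
    simp only [flatCurv, _root_.add_apply, _root_.sub_apply, mul_apply_eq_comp, map_add, map_sub]
      at hsym ⊢
    linarith

/-- The covariant derivative of a vector field, as an endomorphism. -/
def _root_.nablaEnd (Γ : E → E → E →L[ℝ] E) (ξ : E → E) (x : E) : E →L[ℝ] E :=
  fderiv ℝ ξ x + Γ x (ξ x)

theorem nablaEnd_apply (hx : x ∈ U) (ξ : E → E) (u : E) :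
    nablaEnd Γ ξ x u = covVec Γ ξ x u := by
  simp [nablaEnd, covVec, h.symm x hx u]

theorem smooth_nablaEnd [FiniteDimensional ℝ E] {ξ : E → E} (hξ : ContDiffOn ℝ ∞ ξ U) :
    ContDiffOn ℝ ∞ (nablaEnd Γ ξ) U := by
  rw [contDiffOn_clm_apply]
  intro v
  have h1 : ContDiffOn ℝ ∞ (fun y ↦ fderiv ℝ ξ y v + Γ y v (ξ y)) U :=
    ((hξ.fderiv_of_isOpen h.isOpen (m := ∞) (by simp)).clm_apply contDiffOn_const).add
      ((h.smoothΓ v).clm_apply hξ)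
  exact h1.congr fun y hy ↦ h.nablaEnd_apply hy ξ v

/-- Killing fields in coordinates. -/
structure _root_.FlatKilling (U : Set E) (G : E → E →L[ℝ] E →L[ℝ] ℝ) (Γ : E → E → E →L[ℝ] E)
    (ξ : E → E) : Prop where
  smooth : ContDiffOn ℝ ∞ ξ U
  skew : ∀ x ∈ U, ∀ u v, G x (nablaEnd Γ ξ x u) v + G x u (nablaEnd Γ ξ x v) = 0

variable [FiniteDimensional ℝ E] {ξ : E → E}

theorem covEnd_nablaEnd_sub (hξ : ContDiffOn ℝ ∞ ξ U) (hx : x ∈ U) (u v : E) :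
    covEnd Γ (nablaEnd Γ ξ) x u v - covEnd Γ (nablaEnd Γ ξ) x v u = flatCurv Γ x u v (ξ x) := by
  have hA : DifferentiableAt ℝ (nablaEnd Γ ξ) x :=
    ((h.smooth_nablaEnd hξ).contDiffAt (h.mem_nhds hx)).differentiableAt (by simp)
  have hξx := hξ.contDiffAt (h.mem_nhds hx)
  have hd : DifferentiableAt ℝ ξ x := hξx.differentiableAt (by simp)
  have hdd : DifferentiableAt ℝ (fderiv ℝ ξ) x :=
    ((hξx.of_le (m := 2) ENat.LEInfty.out).fderiv_right (m := 1)
      (by norm_num)).differentiableAt (by norm_num)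
  have hsym := (hξx.of_le (m := 2) ENat.LEInfty.out).isSymmSndFDerivAt (by simp) u v
  have key : ∀ u v, covEnd Γ (nablaEnd Γ ξ) x u v
      = fderiv ℝ (fderiv ℝ ξ) x u v + fderiv ℝ (fun y ↦ Γ y v) x u (ξ x)
        + Γ x v (fderiv ℝ ξ x u)
        + Γ x u (covVec Γ ξ x v) - nablaEnd Γ ξ x (Γ x u v) := by
    intro u v
    have e1 : fderiv ℝ (nablaEnd Γ ξ) x u v = fderiv ℝ (fun y ↦ nablaEnd Γ ξ y v) x u := by
      rw [fderiv_clm_apply_apply hA (differentiableAt_const v)]; simp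
    have e2 : (fun y ↦ nablaEnd Γ ξ y v) =ᶠ[𝓝 x] fun y ↦ fderiv ℝ ξ y v + Γ y v (ξ y) := by
      filter_upwards [h.mem_nhds hx] with y hy using h.nablaEnd_apply hy ξ v
    have d1 : DifferentiableAt ℝ (fun y ↦ fderiv ℝ ξ y v) x :=
      hdd.clm_apply (differentiableAt_const v)
    have d2 : DifferentiableAt ℝ (fun y ↦ Γ y v (ξ y)) x := (h.diffΓ hx v).clm_apply hd
    have e3 : fderiv ℝ (fun y ↦ fderiv ℝ ξ y v) x u = fderiv ℝ (fderiv ℝ ξ) x u v := fderiv_apply_const hdd v u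
    simp only [covEnd, _root_.add_apply, _root_.sub_apply, mul_apply_eq_comp]
    rw [e1, e2.fderiv_eq, fderiv_fun_add d1 d2, _root_.add_apply, e3,
      fderiv_clm_apply_apply (h.diffΓ hx v) hd, h.nablaEnd_apply hx]
    abel
  rw [key, key, hsym, h.symm x hx u v, flatCurv]
  simp only [_root_.add_apply, _root_.sub_apply, mul_apply_eq_comp, covVec, map_add]
  abel

/-- The second covariant derivative of a Killing field is given by the curvature. -/
theorem covEnd_nablaEnd (hξ : FlatKilling U G Γ ξ) (hx : x ∈ U) (u : E) :
    covEnd Γ (nablaEnd Γ ξ) x u = flatCurv Γ x u (ξ x) := by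
  set A := nablaEnd Γ ξ with hAdef
  have hA : DifferentiableAt ℝ A x :=
    ((h.smooth_nablaEnd hξ.smooth).contDiffAt (h.mem_nhds hx)).differentiableAt (by simp)
  have hg := h.inner x hx
  have hAv : ∀ v : E, DifferentiableAt ℝ (fun y ↦ A y v) x := fun v ↦
    hA.clm_apply (differentiableAt_const v)
  have hskew : ∀ u v w, G x (covEnd Γ A x u v) w = -G x (covEnd Γ A x u w) v := by
    intro u v w
    have e0 : (fun y ↦ G y (A y v) w + G y v (A y w)) =ᶠ[𝓝 x] fun _ ↦ (0 : ℝ) := by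
      filter_upwards [h.mem_nhds hx] with y hy using hξ.skew y hy v w
    have d1 : DifferentiableAt ℝ (fun y ↦ G y (A y v) w) x :=
      ((h.diffG hx).clm_apply (hAv v)).clm_apply (differentiableAt_const w)
    have d2 : DifferentiableAt ℝ (fun y ↦ G y v (A y w)) x :=
      ((h.diffG hx).clm_apply (differentiableAt_const v)).clm_apply (hAv w)
    have e1 := congrArg (fun L : E →L[ℝ] ℝ ↦ L u) e0.fderiv_eq
    simp only [fderiv_fun_add d1 d2, _root_.add_apply] at e1
    rw [(h.metric x hx).fderiv_inner (h.diffG hx) (hAv v) (differentiableAt_const w),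
      (h.metric x hx).fderiv_inner (h.diffG hx) (differentiableAt_const v) (hAv w),
      covVec_const, covVec_const, covVec_apply hA (differentiableAt_const v),
      covVec_apply hA (differentiableAt_const w), covVec_const, covVec_const] at e1
    simp only [fderiv_fun_const, map_add, _root_.add_apply] at e1
    have s1 := hξ.skew x hx (Γ x u v) w
    have s2 := hξ.skew x hx v (Γ x u w)
    rw [hg.symm (covEnd Γ A x u w)]
    simp only [Pi.zero_apply, _root_.zero_apply] at e1
    rw [← hAdef] at s1 s2
    linarith
  have hR := h.isAlgCurv hx
  have hρ : ∀ u v w, G x (covEnd Γ A x u v) w - G x (covEnd Γ A x v u) w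
      = G x (flatCurv Γ x u v (ξ x)) w := by
    intro u v w
    rw [← h.covEnd_nablaEnd_sub hξ.smooth hx u v, map_sub]
    rfl
  ext v
  refine hg.eq_of_forall fun w ↦ ?_
  have p := hR.pair_symm hg
  have b : ∀ a b c d, G x (flatCurv Γ x a b c) d + G x (flatCurv Γ x b c a) d
      + G x (flatCurv Γ x c a b) d = 0 := by
    intro a b c d
    simpa using congrArg (fun y : E ↦ G x y d) (hR.bianchi a b c)
  have sw : ∀ a b c d, G x (flatCurv Γ x a b c) d = -G x (flatCurv Γ x b a c) d := by
    intro a b c d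
    rw [hR.swap a b]; simp
  have sk : ∀ a b c d, G x (flatCurv Γ x a b c) d = -G x (flatCurv Γ x a b d) c := by
    intro a b c d
    rw [hR.skew, hg.symm]
  have r1 := hρ u v w
  have r2 := hρ v w u
  have r3 := hρ w u v
  have k1 := hskew u v w
  have k2 := hskew v w u
  have k3 := hskew w u v
  have b1 := b u v w (ξ x)
  have s1 := sk u v (ξ x) w
  have s2 := sk v w (ξ x) u
  have s3 := sk w u (ξ x) v
  have p1 := p u (ξ x) v w
  have p2 := sk v w u (ξ x)
  linarith

end FlatLC

end FlatLeviCivita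

/-! ### Quaternionic Kähler structures in coordinates -/

section FlatQuaternionic

variable {E : Type*} [NormedAddCommGroup E] [NormedSpace ℝ E]

/-- The quaternionic part `Σ g(J_a u, v) J_a` of the curvature of quaternionic projective space. -/
def quatForm (g : E →L[ℝ] E →L[ℝ] ℝ) (J : Fin 3 → E →L[ℝ] E) (u v : E) : E →L[ℝ] E :=
  ∑ a, g (J a u) v • J a

/-- The trace projection to the span of a quaternionic triple. -/
def quatProj (J : Fin 3 → E →L[ℝ] E) (A : E →L[ℝ] E) : E →L[ℝ] E :=
  ∑ a, (-(endTrace E (J a * A)) / endTrace E 1) • J a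

theorem quatProj_mem (J : Fin 3 → E →L[ℝ] E) (A : E →L[ℝ] E) :
    quatProj J A ∈ Submodule.span ℝ (Set.range J) :=
  sum_mem fun a _ ↦ Submodule.smul_mem _ _ (Submodule.subset_span ⟨a, rfl⟩)

theorem quatForm_mem (g : E →L[ℝ] E →L[ℝ] ℝ) (J : Fin 3 → E →L[ℝ] E) (u v : E) :
    quatForm g J u v ∈ Submodule.span ℝ (Set.range J) :=
  sum_mem fun a _ ↦ Submodule.smul_mem _ _ (Submodule.subset_span ⟨a, rfl⟩)

/-- An element of the span in the commutant vanishes. -/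
theorem QuatTriple.eq_zero_of_mem_span {J : Fin 3 → E →L[ℝ] E} (hJ : QuatTriple J)
    (hm : endTrace E 1 ≠ 0) {A : E →L[ℝ] E} (hA : A ∈ Submodule.span ℝ (Set.range J))
    (hc : ∀ b, A * J b = J b * A) : A = 0 := by
  obtain ⟨c, rfl⟩ := (Submodule.mem_span_range_iff_exists_fun ℝ).1 hA
  have : c = 0 := by
    ext a
    have h1 := hJ.trace_mul_commutant endTrace_mul_comm hc a
    rw [hJ.trace_mul_sum endTrace_mul_comm hm] at h1
    simpa [hm] using h1
  simp [this]

theorem QuatTriple.quatProj_eq_self {J : Fin 3 → E →L[ℝ] E} (hJ : QuatTriple J)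
    (hm : endTrace E 1 ≠ 0) {A : E →L[ℝ] E} (hA : A ∈ Submodule.span ℝ (Set.range J)) :
    quatProj J A = A := by
  obtain ⟨c, rfl⟩ := (Submodule.mem_span_range_iff_exists_fun ℝ).1 hA
  simp only [quatProj, hJ.trace_mul_sum endTrace_mul_comm hm]
  refine Finset.sum_congr rfl fun a _ ↦ ?_
  congr 1
  field_simp

theorem QuatTriple.commutator_mem {J : Fin 3 → E →L[ℝ] E} (hJ : QuatTriple J)
    {A : E →L[ℝ] E} (hA : A ∈ Submodule.span ℝ (Set.range J)) (b : Fin 3) :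
    A * J b - J b * A ∈ Submodule.span ℝ (Set.range J) := by
  obtain ⟨c, rfl⟩ := (Submodule.mem_span_range_iff_exists_fun ℝ).1 hA
  rw [Finset.sum_mul, Finset.mul_sum, ← Finset.sum_sub_distrib]
  refine sum_mem fun a _ ↦ ?_
  rw [smul_mul_assoc, mul_smul_comm, ← smul_sub]
  refine Submodule.smul_mem _ _ ?_
  have m : ∀ a, J a ∈ Submodule.span ℝ (Set.range J) := fun a ↦ Submodule.subset_span ⟨a, rfl⟩
  fin_cases a <;> fin_cases b <;>
    simp only [Fin.zero_eta, Fin.mk_one, Fin.reduceFinMk, sub_self, Submodule.zero_mem,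
      hJ.mul01, hJ.mul10, hJ.mul12, hJ.mul21, hJ.mul20, hJ.mul02]
  all_goals
    first
    | exact sub_mem (m _) (neg_mem (m _))
    | exact sub_mem (neg_mem (m _)) (m _)

theorem QuatTriple.commute_of_mem_span {J : Fin 3 → E →L[ℝ] E}
    {A Z : E →L[ℝ] E} (hA : A ∈ Submodule.span ℝ (Set.range J))
    (hZ : ∀ b, Z * J b = J b * Z) : Z * A = A * Z := by
  obtain ⟨c, rfl⟩ := (Submodule.mem_span_range_iff_exists_fun ℝ).1 hA
  rw [Finset.sum_mul, Finset.mul_sum]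
  exact Finset.sum_congr rfl fun a _ ↦ by rw [mul_smul_comm, smul_mul_assoc, hZ]

theorem QuatTriple.bracket_mem {J : Fin 3 → E →L[ℝ] E} (hJ : QuatTriple J)
    {A B : E →L[ℝ] E} (hA : A ∈ Submodule.span ℝ (Set.range J))
    (hB : B ∈ Submodule.span ℝ (Set.range J)) :
    A * B - B * A ∈ Submodule.span ℝ (Set.range J) := by
  obtain ⟨c, rfl⟩ := (Submodule.mem_span_range_iff_exists_fun ℝ).1 hB
  rw [Finset.sum_mul, Finset.mul_sum, ← Finset.sum_sub_distrib]
  refine sum_mem fun a _ ↦ ?_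
  rw [smul_mul_assoc, mul_smul_comm, ← smul_sub]
  exact Submodule.smul_mem _ _ (hJ.commutator_mem hA a)

/-- The generators are linear combinations of values of the curvature. -/
theorem IsQuatCurv.exists_eq_smul_sub {g : E →L[ℝ] E →L[ℝ] ℝ} {R : E → E → E →L[ℝ] E}
    {J : Fin 3 → E →L[ℝ] E} {c : ℝ} (hc : c ≠ 0)
    (h : IsQuatCurv g R J (fun a u v ↦ c * g (J a u) v)) (b : Fin 3) :
    ∃ (r : ℝ) (u v u' v' : E), J b = r • (R u v - R u' v') := by
  by_cases hE : ∃ u : E, u ≠ 0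
  swap
  · push Not at hE
    refine ⟨0, 0, 0, 0, 0, ?_⟩
    ext w
    rw [hE w]; simp
  obtain ⟨u, hu⟩ := hE
  have main : ∀ {J : Fin 3 → E →L[ℝ] E},
      IsQuatCurv g R J (fun a u v ↦ c * g (J a u) v) →
      ∃ (r : ℝ) (u v u' v' : E), J 1 = r • (R u v - R u' v') := by
    intro J h
    have huu := (h.inner.pos u hu).ne'
    refine ⟨(2 * c * g u u)⁻¹, u, J 1 u, J 0 u, J 0 (J 1 u), ?_⟩
    ext w
    refine h.inner.eq_of_forall fun z ↦ ?_
    have h1 := h.curv_map_zero w z u (J 1 u)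
    rw [h.inner_map] at h1
    have h2 : g (J 2 u) (J 1 u) = 0 := by
      have := h.skewJ 1 (J 2 u) u
      rw [h.apply12, h.inner_self] at this
      linarith
    rw [h2, h.pair, ← h.pair u] at h1
    simp only [_root_.smul_apply, _root_.sub_apply, map_smul, map_sub, smul_eq_mul]
    rw [h1]
    field_simp
    ring
  have r1 : IsQuatCurv g R (fun a ↦ J (a + 1)) (fun a u v ↦ c * g (J (a + 1) u) v) := h.rotate
  have r2 : IsQuatCurv g R (fun a ↦ J (a + 1 + 1)) (fun a u v ↦ c * g (J (a + 1 + 1) u) v) :=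
    r1.rotate
  fin_cases b
  · exact main r2
  · exact main h
  · exact main r1

/-- A parallel quaternionic structure on the open set `U`, with metric `G` and Levi-Civita
connection form `Γ`, spanned by the `J a`. -/
structure FlatQuat (U : Set E) (G : E → E →L[ℝ] E →L[ℝ] ℝ) (Γ : E → E → E →L[ℝ] E)
    (J : Fin 3 → E → E →L[ℝ] E) : Prop extends FlatLC U G Γ where
  trace_ne : endTrace E 1 ≠ 0
  smoothJ : ∀ a, ContDiffOn ℝ ∞ (J a) U
  quat : ∀ x ∈ U, QuatTriple fun a ↦ J a x
  parallel : ∀ x ∈ U, ∀ a u, covEnd Γ (J a) x u ∈ Submodule.span ℝ (Set.range fun a ↦ J a x)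

namespace FlatQuat

variable {U : Set E} {G : E → E →L[ℝ] E →L[ℝ] ℝ} {Γ : E → E → E →L[ℝ] E}
  {J : Fin 3 → E → E →L[ℝ] E} (h : FlatQuat U G Γ J) {x : E}
include h

theorem diffJ (hx : x ∈ U) (a : Fin 3) : DifferentiableAt ℝ (J a) x :=
  ((h.smoothJ a).contDiffAt (h.toFlatLC.mem_nhds hx)).differentiableAt (by simp)

variable [FiniteDimensional ℝ E] {S : E → E →L[ℝ] E}

theorem smooth_quatProj (hS : ContDiffOn ℝ ∞ S U) :
    ContDiffOn ℝ ∞ (fun y ↦ quatProj (fun a ↦ J a y) (S y)) U := by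
  refine ContDiffOn.sum fun a _ ↦ ?_
  suffices hs : ContDiffOn ℝ ∞ (fun y ↦ -(endTrace E (J a y * S y)) / endTrace E 1) U from
    hs.smul (h.smoothJ a)
  refine ContDiffOn.div_const (ContDiffOn.neg ?_) _
  exact (LinearMap.toContinuousLinearMap (endTrace E)).contDiff.comp_contDiffOn
    ((h.smoothJ a).mul hS)

/-- Covariant derivatives of sections of `Q` are sections of `Q`. -/
theorem covEnd_mem (hS : ContDiffOn ℝ ∞ S U)
    (hmem : ∀ y ∈ U, S y ∈ Submodule.span ℝ (Set.range fun a ↦ J a y)) (hx : x ∈ U) (u : E) :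
    covEnd Γ S x u ∈ Submodule.span ℝ (Set.range fun a ↦ J a x) := by
  set s : Fin 3 → E → ℝ := fun a y ↦ -(endTrace E (J a y * S y)) / endTrace E 1 with hs
  have hsd : ∀ a, DifferentiableAt ℝ (s a) x := by
    intro a
    have : ContDiffOn ℝ ∞ (s a) U := by
      refine ContDiffOn.div_const (ContDiffOn.neg ?_) _
      exact (LinearMap.toContinuousLinearMap (endTrace E)).contDiff.comp_contDiffOn
        ((h.smoothJ a).mul hS)
    exact (this.contDiffAt (h.toFlatLC.mem_nhds hx)).differentiableAt (by simp)
  have e : S =ᶠ[𝓝 x] fun y ↦ s 0 y • J 0 y + s 1 y • J 1 y + s 2 y • J 2 y := by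
    filter_upwards [h.toFlatLC.mem_nhds hx] with y hy
    have := (h.quat y hy).quatProj_eq_self h.trace_ne (hmem y hy)
    rw [quatProj, Fin.sum_univ_three] at this
    exact this.symm
  have m : ∀ a, J a x ∈ Submodule.span ℝ (Set.range fun a ↦ J a x) :=
    fun a ↦ Submodule.subset_span ⟨a, rfl⟩
  have d : ∀ a, DifferentiableAt ℝ (fun y ↦ s a y • J a y) x := fun a ↦
    (hsd a).fun_smul (h.diffJ hx a)
  have k : ∀ a, covEnd Γ (fun y ↦ s a y • J a y) x u
      ∈ Submodule.span ℝ (Set.range fun a ↦ J a x) := by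
    intro a
    rw [covEnd_smul (hsd a) (h.diffJ hx a)]
    exact add_mem (Submodule.smul_mem _ _ (m a)) (Submodule.smul_mem _ _ (h.parallel x hx a u))
  rw [covEnd_congr e, covEnd_add ((d 0).fun_add (d 1)) (d 2), covEnd_add (d 0) (d 1)]
  exact add_mem (add_mem (k 0) (k 1)) (k 2)

theorem smooth_covEnd (hS : ContDiffOn ℝ ∞ S U) (v : E) :
    ContDiffOn ℝ ∞ (fun y ↦ covEnd Γ S y v) U := by
  have h1 : ContDiffOn ℝ ∞ (fun y ↦ fderiv ℝ S y v) U :=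
    (hS.fderiv_of_isOpen h.isOpen (m := ∞) (by simp)).clm_apply contDiffOn_const
  exact (h1.add ((h.smoothΓ v).mul hS)).sub (hS.mul (h.smoothΓ v))

/-- Covariant derivatives of fields of endomorphisms normalising `Q` normalise `Q`. -/
theorem covEnd_normalizes (hS : ContDiffOn ℝ ∞ S U)
    (hmem : ∀ y ∈ U, ∀ b, S y * J b y - J b y * S y
      ∈ Submodule.span ℝ (Set.range fun a ↦ J a y)) (hx : x ∈ U) (u : E) (b : Fin 3) :
    covEnd Γ S x u * J b x - J b x * covEnd Γ S x u
      ∈ Submodule.span ℝ (Set.range fun a ↦ J a x) := by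
  have hSd : DifferentiableAt ℝ S x :=
    (hS.contDiffAt (h.toFlatLC.mem_nhds hx)).differentiableAt (by simp)
  have hJd := h.diffJ hx b
  have h1 := h.covEnd_mem ((hS.mul (h.smoothJ b)).sub ((h.smoothJ b).mul hS))
    (fun y hy ↦ hmem y hy b) hx u
  change covEnd Γ (fun y ↦ S y * J b y - J b y * S y) x u ∈ _ at h1
  rw [covEnd_sub (hSd.fun_mul hJd) (hJd.fun_mul hSd), covEnd_mul hSd hJd, covEnd_mul hJd hSd] at h1
  have h2 : S x * covEnd Γ (J b) x u - covEnd Γ (J b) x u * S x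
      ∈ Submodule.span ℝ (Set.range fun a ↦ J a x) := by
    obtain ⟨r, hr⟩ := (Submodule.mem_span_range_iff_exists_fun ℝ).1 (h.parallel x hx b u)
    rw [← hr, Finset.sum_mul, Finset.mul_sum, ← Finset.sum_sub_distrib]
    refine sum_mem fun a _ ↦ ?_
    rw [smul_mul_assoc, mul_smul_comm, ← smul_sub]
    exact Submodule.smul_mem _ _ (hmem x hx a)
  have := sub_mem h1 h2
  convert this using 1
  abel

theorem curv_normalizes (hx : x ∈ U) (u v : E) (b : Fin 3) :
    flatCurv Γ x u v * J b x - J b x * flatCurv Γ x u v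
      ∈ Submodule.span ℝ (Set.range fun a ↦ J a x) := by
  rw [← ricci_identity_end (h.toFlatLC.diffΓ hx) (((h.smoothJ b).contDiffAt
    (h.toFlatLC.mem_nhds hx)).of_le ENat.LEInfty.out)]
  have k : ∀ u v, covEnd Γ (fun y ↦ covEnd Γ (J b) y v) x u
      ∈ Submodule.span ℝ (Set.range fun a ↦ J a x) := fun u v ↦
    h.covEnd_mem (h.smooth_covEnd (h.smoothJ b) v) (fun y hy ↦ h.parallel y hy b v) hx u
  exact sub_mem (k u v) (k v u)

end FlatQuat

/-- A quaternionic Kähler structure of nonzero scalar curvature on the open set `U`, with metric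
`G`, Levi-Civita connection form `Γ`, quaternionic structure spanned by the `J a`, and quaternionic
part of the curvature given by the function `c`. -/
structure FlatQK (U : Set E) (G : E → E →L[ℝ] E →L[ℝ] ℝ) (Γ : E → E → E →L[ℝ] E)
    (J : Fin 3 → E → E →L[ℝ] E) (c : E → ℝ) : Prop extends FlatQuat U G Γ J where
  c_ne : ∀ x ∈ U, c x ≠ 0
  curv : ∀ x ∈ U, IsQuatCurv (G x) (flatCurv Γ x) (fun a ↦ J a x)
    (fun a u v ↦ c x * G x (J a x u) v)

namespace FlatQK

variable {U : Set E} {G : E → E →L[ℝ] E →L[ℝ] ℝ} {Γ : E → E → E →L[ℝ] E}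
  {J : Fin 3 → E → E →L[ℝ] E} {c : E → ℝ} (h : FlatQK U G Γ J c) {x : E}
include h

variable [FiniteDimensional ℝ E] {S : E → E →L[ℝ] E}

variable {ξ : E → E}

/-- The covariant derivative of a Killing field normalises `Q`. -/
theorem nablaEnd_normalizes (hξ : FlatKilling U G Γ ξ) (hx : x ∈ U) (b : Fin 3) :
    nablaEnd Γ ξ x * J b x - J b x * nablaEnd Γ ξ x
      ∈ Submodule.span ℝ (Set.range fun a ↦ J a x) := by
  set A := nablaEnd Γ ξ with hA
  have hAs : ContDiffOn ℝ ∞ A U := h.toFlatLC.smooth_nablaEnd hξ.smooth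
  have hJ := h.quat x hx
  have h1 : ∀ u v b, covEnd Γ (fun y ↦ covEnd Γ A y v) x u * J b x
      - J b x * covEnd Γ (fun y ↦ covEnd Γ A y v) x u
      ∈ Submodule.span ℝ (Set.range fun a ↦ J a x) := by
    intro u v b
    refine h.covEnd_normalizes (h.smooth_covEnd hAs v) (fun y hy b ↦ ?_) hx u b
    rw [h.toFlatLC.covEnd_nablaEnd hξ hy]
    exact h.curv_normalizes hy _ _ b
  have h2 : ∀ u v b, (flatCurv Γ x u v * A x - A x * flatCurv Γ x u v) * J b x
      - J b x * (flatCurv Γ x u v * A x - A x * flatCurv Γ x u v)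
      ∈ Submodule.span ℝ (Set.range fun a ↦ J a x) := by
    intro u v b
    rw [← ricci_identity_end (fun u ↦ h.toFlatLC.diffΓ hx u)
      ((hAs.contDiffAt (h.toFlatLC.mem_nhds hx)).of_le ENat.LEInfty.out)]
    convert sub_mem (h1 u v b) (h1 v u b) using 1
    noncomm_ring
  have h3 : ∀ b', (J b x * A x - A x * J b x) * J b' x - J b' x * (J b x * A x - A x * J b x)
      ∈ Submodule.span ℝ (Set.range fun a ↦ J a x) := by
    intro b'
    obtain ⟨r, u, v, u', v', hr⟩ := (h.curv x hx).exists_eq_smul_sub (h.c_ne x hx) b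
    have := Submodule.smul_mem _ r (sub_mem (h2 u v b') (h2 u' v' b'))
    rw [hr]
    convert this using 1
    simp only [smul_sub, sub_mul, mul_sub, smul_mul_assoc, mul_smul_comm]
    abel
  have h4 := hJ.mem_span_of_anticommute endTrace_mul_comm h.trace_ne h3 b (by
    have hsq := hJ.sq b
    calc (J b x * A x - A x * J b x) * J b x + J b x * (J b x * A x - A x * J b x)
        = (J b x * J b x) * A x - A x * (J b x * J b x) := by noncomm_ring
      _ = 0 := by rw [hsq]; simp)
  have := neg_mem h4
  rwa [neg_sub] at this

/-- The moment map of a vector field, in coordinates. -/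
def _root_.flatMoment (Γ : E → E → E →L[ℝ] E) (J : Fin 3 → E → E →L[ℝ] E) (ξ : E → E) (x : E) :
    E →L[ℝ] E := quatProj (fun a ↦ J a x) (nablaEnd Γ ξ x)

theorem smooth_flatMoment (hξ : ContDiffOn ℝ ∞ ξ U) : ContDiffOn ℝ ∞ (flatMoment Γ J ξ) U :=
  h.smooth_quatProj (h.toFlatLC.smooth_nablaEnd hξ)

omit h [FiniteDimensional ℝ E] in
theorem flatMoment_mem (ξ : E → E) (x : E) :
    flatMoment Γ J ξ x ∈ Submodule.span ℝ (Set.range fun a ↦ J a x) := quatProj_mem _ _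

theorem sub_flatMoment_commute (hξ : FlatKilling U G Γ ξ) (hx : x ∈ U) (b : Fin 3) :
    (nablaEnd Γ ξ x - flatMoment Γ J ξ x) * J b x
      = J b x * (nablaEnd Γ ξ x - flatMoment Γ J ξ x) :=
  (h.quat x hx).commute_sub_of_normalizes endTrace_mul_comm h.trace_ne
    (h.nablaEnd_normalizes hξ hx) b

theorem curv_sub_commute (hx : x ∈ U) (u v : E) (b : Fin 3) :
    (flatCurv Γ x u v - c x • quatForm (G x) (fun a ↦ J a x) u v) * J b x
      = J b x * (flatCurv Γ x u v - c x • quatForm (G x) (fun a ↦ J a x) u v) := by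
  have := (h.curv x hx).commute u v b
  simpa only [quatForm, Finset.smul_sum, smul_smul] using this

/-- The moment map equation. -/
theorem covEnd_flatMoment (hξ : FlatKilling U G Γ ξ) (hx : x ∈ U) (u : E) :
    covEnd Γ (flatMoment Γ J ξ) x u = c x • quatForm (G x) (fun a ↦ J a x) u (ξ x) := by
  have hJ := h.quat x hx
  set A := nablaEnd Γ ξ with hA
  set P := flatMoment Γ J ξ with hP
  have hAs : ContDiffOn ℝ ∞ A U := h.toFlatLC.smooth_nablaEnd hξ.smooth
  have hPs : ContDiffOn ℝ ∞ P U := h.smooth_flatMoment hξ.smooth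
  have hAd := (hAs.contDiffAt (h.toFlatLC.mem_nhds hx)).differentiableAt (by simp)
  have hPd := (hPs.contDiffAt (h.toFlatLC.mem_nhds hx)).differentiableAt (by simp)
  rw [← sub_eq_zero]
  refine hJ.eq_zero_of_mem_span h.trace_ne ?_ fun b ↦ ?_
  · exact sub_mem (h.covEnd_mem hPs (fun y _ ↦ flatMoment_mem ξ y) hx u)
      (Submodule.smul_mem _ _ (quatForm_mem _ _ _ _))
  · have hJd := h.diffJ hx b
    have hZd : DifferentiableAt ℝ (fun y ↦ A y - P y) x := hAd.fun_sub hPd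
    have e0 : (fun y ↦ (A y - P y) * J b y) =ᶠ[𝓝 x] fun y ↦ J b y * (A y - P y) := by
      filter_upwards [h.toFlatLC.mem_nhds hx] with y hy using h.sub_flatMoment_commute hξ hy b
    have e1 := covEnd_congr (C := Γ) e0 u
    rw [covEnd_mul hZd hJd, covEnd_mul hJd hZd, covEnd_sub hAd hPd,
      h.toFlatLC.covEnd_nablaEnd hξ hx] at e1
    have e2 := QuatTriple.commute_of_mem_span (h.parallel x hx b u)
      (h.sub_flatMoment_commute hξ hx)
    have e3 := h.curv_sub_commute hx u (ξ x) b
    rw [← hA, ← hP] at e2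
    rw [e2, add_comm (_ * (A x - P x))] at e1
    have e4 := add_right_cancel e1
    simp only [sub_mul, mul_sub] at e3 e4 ⊢
    rw [sub_eq_sub_iff_add_eq_add] at e3 e4 ⊢
    rw [← sub_eq_zero] at e3 e4 ⊢
    have := congrArg₂ (fun a b ↦ a - b) e3 e4
    simp only [sub_self] at this
    rw [← this]; abel

/-- The bracket of two vector fields, in coordinates. -/
def _root_.flatBracket (ξ η : E → E) (x : E) : E := fderiv ℝ η x (ξ x) - fderiv ℝ ξ x (η x)

variable {η : E → E}

theorem flatBracket_eq (hx : x ∈ U) :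
    flatBracket ξ η x = nablaEnd Γ η x (ξ x) - nablaEnd Γ ξ x (η x) := by
  simp only [flatBracket, nablaEnd, _root_.add_apply, h.symm x hx (η x)]
  abel

theorem nablaEnd_flatBracket (hξ : FlatKilling U G Γ ξ) (hη : FlatKilling U G Γ η) (hx : x ∈ U) :
    nablaEnd Γ (flatBracket ξ η) x = flatCurv Γ x (ξ x) (η x)
      - (nablaEnd Γ ξ x * nablaEnd Γ η x - nablaEnd Γ η x * nablaEnd Γ ξ x) := by
  have hAξ := ((h.toFlatLC.smooth_nablaEnd hξ.smooth).contDiffAt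
    (h.toFlatLC.mem_nhds hx)).differentiableAt (by simp)
  have hAη := ((h.toFlatLC.smooth_nablaEnd hη.smooth).contDiffAt
    (h.toFlatLC.mem_nhds hx)).differentiableAt (by simp)
  have hξd := (hξ.smooth.contDiffAt (h.toFlatLC.mem_nhds hx)).differentiableAt (by simp)
  have hηd := (hη.smooth.contDiffAt (h.toFlatLC.mem_nhds hx)).differentiableAt (by simp)
  ext u
  have e0 : flatBracket ξ η =ᶠ[𝓝 x] fun y ↦ nablaEnd Γ η y (ξ y) - nablaEnd Γ ξ y (η y) := by
    filter_upwards [h.toFlatLC.mem_nhds hx] with y hy using h.flatBracket_eq hy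
  rw [h.toFlatLC.nablaEnd_apply hx, covVec_congr e0,
    covVec_sub (hAη.clm_apply hξd) (hAξ.clm_apply hηd), covVec_apply hAη hξd,
    covVec_apply hAξ hηd, h.toFlatLC.covEnd_nablaEnd hξ hx, h.toFlatLC.covEnd_nablaEnd hη hx,
    ← h.toFlatLC.nablaEnd_apply hx, ← h.toFlatLC.nablaEnd_apply hx]
  have hR := h.toFlatLC.isAlgCurv hx
  have b := hR.bianchi u (η x) (ξ x)
  rw [hR.swap (η x) (ξ x), hR.swap (ξ x) u] at b
  simp only [_root_.sub_apply, mul_apply_eq_comp, _root_.neg_apply] at b ⊢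
  rw [← sub_eq_zero, ← b]
  abel

theorem killing_flatBracket (hξ : FlatKilling U G Γ ξ) (hη : FlatKilling U G Γ η) :
    FlatKilling U G Γ (flatBracket ξ η) where
  smooth := by
    have h1 := h.toFlatLC.smooth_nablaEnd hξ.smooth
    have h2 := h.toFlatLC.smooth_nablaEnd hη.smooth
    exact ((h2.clm_apply hξ.smooth).sub (h1.clm_apply hη.smooth)).congr
      fun y hy ↦ h.flatBracket_eq hy
  skew x hx u v := by
    have hR := h.toFlatLC.isAlgCurv hx
    rw [h.nablaEnd_flatBracket hξ hη hx]
    simp only [_root_.sub_apply, mul_apply_eq_comp, map_sub]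
    have s := hR.skew (ξ x) (η x) u v
    have a1 := hξ.skew x hx (nablaEnd Γ η x u) v
    have a2 := hη.skew x hx u (nablaEnd Γ ξ x v)
    have a3 := hη.skew x hx (nablaEnd Γ ξ x u) v
    have a4 := hξ.skew x hx u (nablaEnd Γ η x v)
    linarith

/-- The moment map of the bracket of two Killing fields. -/
theorem flatMoment_flatBracket (hξ : FlatKilling U G Γ ξ) (hη : FlatKilling U G Γ η)
    (hx : x ∈ U) :
    flatMoment Γ J (flatBracket ξ η) x
      = c x • quatForm (G x) (fun a ↦ J a x) (ξ x) (η x)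
        - (flatMoment Γ J ξ x * flatMoment Γ J η x - flatMoment Γ J η x * flatMoment Γ J ξ x) := by
  have hJ := h.quat x hx
  rw [← sub_eq_zero]
  refine hJ.eq_zero_of_mem_span h.trace_ne ?_ fun b ↦ ?_
  · exact sub_mem (flatMoment_mem _ _) (sub_mem (Submodule.smul_mem _ _ (quatForm_mem _ _ _ _))
      (hJ.bracket_mem (flatMoment_mem _ _) (flatMoment_mem _ _)))
  · have e1 := h.sub_flatMoment_commute (h.killing_flatBracket hξ hη) hx b
    have e2 := h.curv_sub_commute hx (ξ x) (η x) b
    have z1 := h.sub_flatMoment_commute hξ hx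
    have z2 := h.sub_flatMoment_commute hη hx
    rw [h.nablaEnd_flatBracket hξ hη hx] at e1
    obtain ⟨P, hP⟩ : ∃ P, P = flatMoment Γ J ξ x := ⟨_, rfl⟩
    obtain ⟨P', hP'⟩ : ∃ P, P = flatMoment Γ J η x := ⟨_, rfl⟩
    obtain ⟨Z, hZ⟩ : ∃ Z, Z = nablaEnd Γ ξ x - P := ⟨_, rfl⟩
    obtain ⟨Z', hZ'⟩ : ∃ Z, Z = nablaEnd Γ η x - P' := ⟨_, rfl⟩
    have hA : nablaEnd Γ ξ x = Z + P := by rw [hZ]; abel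
    have hA' : nablaEnd Γ η x = Z' + P' := by rw [hZ']; abel
    rw [← hP, ← hZ] at z1
    rw [← hP', ← hZ'] at z2
    have c1 : Z * P' = P' * Z :=
      QuatTriple.commute_of_mem_span (by rw [hP']; exact flatMoment_mem _ _) z1
    have c2 : Z' * P = P * Z' :=
      QuatTriple.commute_of_mem_span (by rw [hP]; exact flatMoment_mem _ _) z2
    have e3 : nablaEnd Γ ξ x * nablaEnd Γ η x - nablaEnd Γ η x * nablaEnd Γ ξ x
        = (Z * Z' - Z' * Z) + (P * P' - P' * P) := by
      rw [hA, hA']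
      simp only [add_mul, mul_add, c1, c2]
      abel
    have e4 : (Z * Z' - Z' * Z) * J b x = J b x * (Z * Z' - Z' * Z) := by
      rw [sub_mul, mul_sub, mul_assoc Z, z2, ← mul_assoc Z, z1, mul_assoc Z', z1, ← mul_assoc Z',
        z2, mul_assoc, mul_assoc]
    rw [e3] at e1
    rw [← hP, ← hP']
    generalize flatMoment Γ J (flatBracket ξ η) x = M at e1 ⊢
    generalize flatCurv Γ x (ξ x) (η x) = R at e1 e2
    generalize c x • quatForm (G x) (fun a ↦ J a x) (ξ x) (η x) = q at e2 ⊢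
    generalize Z * Z' - Z' * Z = z at e1 e4
    generalize P * P' - P' * P = p at e1 ⊢
    simp only [sub_mul, mul_sub, add_mul, mul_add] at e1 e2 ⊢
    have d1 := sub_eq_zero.2 e1
    have d2 := sub_eq_zero.2 e2
    have d4 := sub_eq_zero.2 e4
    rw [← sub_eq_zero]
    have := congrArg₂ (fun a b ↦ a - b) d2 (congrArg₂ (fun a b ↦ a + b) d1 d4)
    simp only [sub_self, add_zero] at this
    rw [← this]
    abel

end FlatQK

end FlatQuaternionic

section FlatSubmanifold

variable {E F : Type*} [NormedAddCommGroup E] [NormedSpace ℝ E]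
  [NormedAddCommGroup F] [NormedSpace ℝ F]

/-! ### Imaginary quaternions -/

namespace QuatTriple

variable {J : Fin 3 → E →L[ℝ] E} (hJ : QuatTriple J)
include hJ

theorem sum_mul_add (x k : Fin 3 → ℝ) :
    (∑ a, x a • J a) * (∑ a, k a • J a) + (∑ a, k a • J a) * (∑ a, x a • J a)
      = (-2 * ∑ a, x a * k a) • (1 : E →L[ℝ] E) := by
  simp only [Fin.sum_univ_three, add_mul, mul_add, smul_mul_assoc, mul_smul_comm, hJ.sq, hJ.mul01,
    hJ.mul10, hJ.mul12, hJ.mul21, hJ.mul20, hJ.mul02]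
  module

theorem exists_mul_self {p : E →L[ℝ] E} (hp : p ∈ Submodule.span ℝ (Set.range J)) :
    ∃ r : ℝ, p * p = -r • 1 := by
  obtain ⟨x, rfl⟩ := (Submodule.mem_span_range_iff_exists_fun ℝ).1 hp
  have h1 := hJ.sum_mul_add x x
  refine ⟨∑ a, x a * x a, ?_⟩
  have h2 : (2 : ℝ) • ((∑ a, x a • J a) * (∑ a, x a • J a) - (-∑ a, x a * x a) • (1 : E →L[ℝ] E))
      = 0 := by
    rw [smul_sub, two_smul, h1]; module
  exact sub_eq_zero.1 ((smul_eq_zero.1 h2).resolve_left two_ne_zero)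

theorem anticommute_of_mul_mem (hm : endTrace E 1 ≠ 0) {p q : E →L[ℝ] E}
    (hp : p ∈ Submodule.span ℝ (Set.range J)) (hq : q ∈ Submodule.span ℝ (Set.range J))
    (hpq : p * q ∈ Submodule.span ℝ (Set.range J)) : q * p = -(p * q) := by
  obtain ⟨x, rfl⟩ := (Submodule.mem_span_range_iff_exists_fun ℝ).1 hp
  obtain ⟨y, rfl⟩ := (Submodule.mem_span_range_iff_exists_fun ℝ).1 hq
  obtain ⟨z, hz⟩ := (Submodule.mem_span_range_iff_exists_fun ℝ).1 hpq
  have t0 : endTrace E (∑ a, z a • J a) = 0 := by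
    simp [hJ.trace_eq_zero endTrace_mul_comm]
  rw [hz] at t0
  have h1 := hJ.sum_mul_add x y
  have h2 := congrArg (endTrace E) h1
  rw [map_add, t0, endTrace_mul_comm, t0, map_smul, smul_eq_mul, add_zero, eq_comm,
    mul_eq_zero] at h2
  rw [h2.resolve_right hm, zero_smul] at h1
  rw [eq_neg_iff_add_eq_zero, add_comm, h1]

variable {g : E →L[ℝ] E →L[ℝ] ℝ} (hg : IsInnerForm g)
  (hskew : ∀ a u v, g (J a u) v = -g u (J a v))
  {K : E →L[ℝ] E} (hK : K ∈ Submodule.span ℝ (Set.range J))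

omit hJ in
include hskew hK in
theorem skew_of_mem (u v : E) : g (K u) v = -g u (K v) := by
  obtain ⟨x, rfl⟩ := (Submodule.mem_span_range_iff_exists_fun ℝ).1 hK
  simp only [_root_.sum_apply, _root_.smul_apply, map_sum, map_smul, hskew, smul_eq_mul,
    Finset.sum_neg_distrib, mul_neg]

include hK in
/-- The component of `quatForm` orthogonal to `K` anticommutes with `K`. -/
theorem quatForm_anticommute (hsq : K * K = -1) (u v : E) :
    (quatForm g J u v - g (K u) v • K) * K + K * (quatForm g J u v - g (K u) v • K) = 0 := by
  obtain ⟨k, rfl⟩ := (Submodule.mem_span_range_iff_exists_fun ℝ).1 hK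
  have h1 := hJ.sum_mul_add (fun a ↦ g (J a u) v) k
  have h2 : g ((∑ a, k a • J a) u) v = ∑ a, g (J a u) v * k a := by
    simp [_root_.sum_apply, mul_comm]
  rw [sub_mul, mul_sub, smul_mul_assoc, mul_smul_comm, hsq, quatForm, h2]
  rw [sub_add_sub_comm, h1]
  module

theorem mul_sum_sub (k : Fin 3 → ℝ) (b : Fin 3) :
    (∑ a, k a • J a) * J b + k b • 1 ∈ Submodule.span ℝ (Set.range J) := by
  have m : ∀ a, J a ∈ Submodule.span ℝ (Set.range J) := fun a ↦ Submodule.subset_span ⟨a, rfl⟩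
  rw [Finset.sum_mul, Fin.sum_univ_three]
  simp only [smul_mul_assoc]
  fin_cases b
  · have : k 0 • (J 0 * J 0) + k 1 • (J 1 * J 0) + k 2 • (J 2 * J 0) + k 0 • (1 : E →L[ℝ] E)
        = (-k 1) • J 2 + k 2 • J 1 := by
      rw [hJ.sq, hJ.mul10, hJ.mul20]; module
    simp only [Fin.zero_eta]
    rw [this]
    exact add_mem (Submodule.smul_mem _ _ (m _)) (Submodule.smul_mem _ _ (m _))
  · have : k 0 • (J 0 * J 1) + k 1 • (J 1 * J 1) + k 2 • (J 2 * J 1) + k 1 • (1 : E →L[ℝ] E)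
        = (-k 2) • J 0 + k 0 • J 2 := by
      rw [hJ.sq, hJ.mul01, hJ.mul21]; module
    simp only [Fin.mk_one]
    rw [this]
    exact add_mem (Submodule.smul_mem _ _ (m _)) (Submodule.smul_mem _ _ (m _))
  · have : k 0 • (J 0 * J 2) + k 1 • (J 1 * J 2) + k 2 • (J 2 * J 2) + k 2 • (1 : E →L[ℝ] E)
        = (-k 0) • J 1 + k 1 • J 0 := by
      rw [hJ.sq, hJ.mul02, hJ.mul12]; module
    simp only [Fin.reduceFinMk]
    rw [this]
    exact add_mem (Submodule.smul_mem _ _ (m _)) (Submodule.smul_mem _ _ (m _))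

include hg hskew hK in
theorem quatForm_self_map (v : E) : quatForm g J v (K v) = g v v • K := by
  obtain ⟨k, hk⟩ := (Submodule.mem_span_range_iff_exists_fun ℝ).1 hK
  have h0 : ∀ {X : E →L[ℝ] E}, X ∈ Submodule.span ℝ (Set.range J) → g (X v) v = 0 := by
    intro X hX
    have := skew_of_mem hskew hX v v
    rw [hg.symm v] at this
    linarith
  rw [quatForm]
  nth_rewrite 2 [← hk]
  rw [Finset.smul_sum]
  refine Finset.sum_congr rfl fun b _ ↦ ?_
  rw [smul_smul]
  congr 1
  have h1 := skew_of_mem hskew hK (J b v) v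
  have h2 := h0 (hJ.mul_sum_sub k b)
  rw [hk] at h2
  simp only [_root_.add_apply, mul_apply_eq_comp, _root_.smul_apply, map_add,
    map_smul, smul_eq_mul] at h2
  rw [h1, show (1 : E →L[ℝ] E) v = v from rfl] at h2
  linarith

end QuatTriple

/-! ### Submanifolds in coordinates -/

/-- The Nijenhuis tensor of `I` on constant vector fields. -/
def flatNijenhuis (I : F → F →L[ℝ] F) (x u w : F) : F :=
  fderiv ℝ I x (I x u) w - fderiv ℝ I x (I x w) u - I x (fderiv ℝ I x u w) + I x (fderiv ℝ I x w u)

/-- A metric `g` and an integrable almost complex structure `I` on the open set `V`, both invariant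
under the vector fields `ζ 0` and `ζ 1 = I (ζ 0)`, such that the fundamental form is closed on the
orthogonal complement of the `ζ i`. -/
structure TransverseKahler (V : Set F) (g : F → F →L[ℝ] F →L[ℝ] ℝ) (I : F → F →L[ℝ] F)
    (ζ : Fin 2 → F → F) : Prop where
  isOpen : IsOpen V
  smooth_g : ContDiffOn ℝ ∞ g V
  smooth_I : ContDiffOn ℝ ∞ I V
  inner : ∀ x ∈ V, IsInnerForm (g x)
  sq : ∀ x ∈ V, ∀ u, I x (I x u) = -u
  herm : ∀ x ∈ V, ∀ u v, g x (I x u) (I x v) = g x u v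
  map_ζ : ∀ x ∈ V, I x (ζ 0 x) = ζ 1 x
  ne : ∀ x ∈ V, ζ 0 x ≠ 0
  nijenhuis : ∀ x ∈ V, ∀ u w, flatNijenhuis I x u w = 0
  lieI : ∀ x ∈ V, ∀ j w, fderiv ℝ I x (ζ j x) w
    = fderiv ℝ (ζ j) x (I x w) - I x (fderiv ℝ (ζ j) x w)
  lieg : ∀ x ∈ V, ∀ j u v, fderiv ℝ (fun y ↦ g y u v) x (ζ j x)
    + g x (fderiv ℝ (ζ j) x u) v + g x u (fderiv ℝ (ζ j) x v) = 0
  closed : ∀ x ∈ V, ∀ u v w, (∀ j, g x u (ζ j x) = 0) → (∀ j, g x v (ζ j x) = 0) →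
    (∀ j, g x w (ζ j x) = 0) →
    fderiv ℝ (fun y ↦ g y v (I y w)) x u + fderiv ℝ (fun y ↦ g y w (I y u)) x v
      + fderiv ℝ (fun y ↦ g y u (I y v)) x w = 0

/-- The submanifold `θ : V → E` of a quaternionic Kähler manifold, with the properties of the
corollary, in coordinates. -/
structure FlatSub (U : Set E) (G : E → E →L[ℝ] E →L[ℝ] ℝ) (Γ : E → E → E →L[ℝ] E)
    (J : Fin 3 → E → E →L[ℝ] E) (c : E → ℝ) (ξ : Fin 2 → E → E)
    (V : Set F) (θ : F → E) (f : F → ℝ) (I : F → F →L[ℝ] F) (ζ : Fin 2 → F → F) : Prop where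
  qk : FlatQK U G Γ J c
  killing : ∀ i, FlatKilling U G Γ (ξ i)
  isOpen : IsOpen V
  smooth : ContDiffOn ℝ ∞ θ V
  maps : ∀ x ∈ V, θ x ∈ U
  inj : ∀ x ∈ V, Function.Injective (fderiv ℝ θ x)
  tangent : ∀ x ∈ V, ∀ i, fderiv ℝ θ x (ζ i x) = ξ i (θ x)
  bracket : ∀ x ∈ V, flatBracket (ξ 0) (ξ 1) (θ x) = 0
  norm : ∀ x ∈ V, G (θ x) (ξ 0 (θ x)) (ξ 0 (θ x)) = G (θ x) (ξ 1 (θ x)) (ξ 1 (θ x))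
  ne : ∀ x ∈ V, ξ 0 (θ x) ≠ 0
  smooth_f : ContDiffOn ℝ ∞ f V
  f_ne : ∀ x ∈ V, f x ≠ 0
  mem : ∀ x ∈ V, flatMoment Γ J (ξ 0) (θ x) * flatMoment Γ J (ξ 1) (θ x)
    ∈ Submodule.span ℝ (Set.range fun a ↦ J a (θ x))
  mapξ : ∀ x ∈ V, flatMoment Γ J (ξ 0) (θ x) (flatMoment Γ J (ξ 1) (θ x) (ξ 0 (θ x)))
    = f x • ξ 1 (θ x)
  map : ∀ x ∈ V, ∀ w, fderiv ℝ θ x (I x w) = (f x)⁻¹ •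
    flatMoment Γ J (ξ 0) (θ x) (flatMoment Γ J (ξ 1) (θ x) (fderiv ℝ θ x w))

namespace FlatSub

variable {U : Set E} {G : E → E →L[ℝ] E →L[ℝ] ℝ} {Γ : E → E → E →L[ℝ] E}
  {J : Fin 3 → E → E →L[ℝ] E} {c : E → ℝ} {ξ : Fin 2 → E → E}
  {V : Set F} {θ : F → E} {f : F → ℝ} {I : F → F →L[ℝ] F} {ζ : Fin 2 → F → F}

/-- The endomorphism `f⁻¹ P₀ P₁`. -/
def _root_.subEnd (Γ : E → E → E →L[ℝ] E) (J : Fin 3 → E → E →L[ℝ] E) (ξ : Fin 2 → E → E)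
    (θ : F → E) (f : F → ℝ) (x : F) : E →L[ℝ] E :=
  (f x)⁻¹ • (flatMoment Γ J (ξ 0) (θ x) * flatMoment Γ J (ξ 1) (θ x))

variable (h : FlatSub U G Γ J c ξ V θ f I ζ) {x : F}
include h

theorem mem_nhds (hx : x ∈ V) : V ∈ 𝓝 x := h.isOpen.mem_nhds hx

theorem map_I (hx : x ∈ V) (w : F) :
    fderiv ℝ θ x (I x w) = subEnd Γ J ξ θ f x (fderiv ℝ θ x w) := h.map x hx w

theorem K_mem (hx : x ∈ V) :
    subEnd Γ J ξ θ f x ∈ Submodule.span ℝ (Set.range fun a ↦ J a (θ x)) :=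
  Submodule.smul_mem _ _ (h.mem x hx)

theorem K_ξ (hx : x ∈ V) : subEnd Γ J ξ θ f x (ξ 0 (θ x)) = ξ 1 (θ x) := by
  rw [subEnd, _root_.smul_apply, mul_apply_eq_comp, h.mapξ x hx, smul_smul,
    inv_mul_cancel₀ (h.f_ne x hx), one_smul]

theorem skewK (hx : x ∈ V) (u v : E) :
    G (θ x) (subEnd Γ J ξ θ f x u) v = -G (θ x) u (subEnd Γ J ξ θ f x v) :=
  QuatTriple.skew_of_mem (h.qk.curv _ (h.maps x hx)).skewJ (h.K_mem hx) u v

theorem p_anti (hx : x ∈ V) :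
    flatMoment Γ J (ξ 1) (θ x) * flatMoment Γ J (ξ 0) (θ x)
      = -(flatMoment Γ J (ξ 0) (θ x) * flatMoment Γ J (ξ 1) (θ x)) :=
  (h.qk.quat _ (h.maps x hx)).anticommute_of_mul_mem h.qk.trace_ne (FlatQK.flatMoment_mem _ _)
    (FlatQK.flatMoment_mem _ _) (h.mem x hx)

theorem norm_pos (hx : x ∈ V) : 0 < G (θ x) (ξ 0 (θ x)) (ξ 0 (θ x)) :=
  (h.qk.inner _ (h.maps x hx)).pos _ (h.ne x hx)

theorem K_sq (hx : x ∈ V) : subEnd Γ J ξ θ f x * subEnd Γ J ξ θ f x = -1 := by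
  have hJ := h.qk.quat _ (h.maps x hx)
  obtain ⟨r, hr⟩ := hJ.exists_mul_self (h.K_mem hx)
  have h1 := h.skewK hx (ξ 0 (θ x)) (subEnd Γ J ξ θ f x (ξ 0 (θ x)))
  rw [← mul_apply_eq_comp (subEnd Γ J ξ θ f x), hr, h.K_ξ hx, ← h.norm x hx] at h1
  simp only [_root_.smul_apply, map_smul, smul_eq_mul] at h1
  rw [show (1 : E →L[ℝ] E) (ξ 0 (θ x)) = ξ 0 (θ x) from rfl] at h1
  have hp := (h.norm_pos hx).ne'
  have : r = 1 := mul_right_cancel₀ hp (by linarith)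
  rw [hr, this]; simp

theorem K_sq_apply (hx : x ∈ V) (u : E) :
    subEnd Γ J ξ θ f x (subEnd Γ J ξ θ f x u) = -u := by
  rw [← mul_apply_eq_comp, h.K_sq hx]; simp

theorem K_ξ_one (hx : x ∈ V) : subEnd Γ J ξ θ f x (ξ 1 (θ x)) = -ξ 0 (θ x) := by
  rw [← h.K_ξ hx, h.K_sq_apply hx]

theorem p_K (hx : x ∈ V) (i : Fin 2) :
    flatMoment Γ J (ξ i) (θ x) * subEnd Γ J ξ θ f x
      = -(subEnd Γ J ξ θ f x * flatMoment Γ J (ξ i) (θ x)) := by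
  have h1 := h.p_anti hx
  rw [subEnd, mul_smul_comm, smul_mul_assoc, ← smul_neg]
  congr 1
  fin_cases i
  · simp only [Fin.zero_eta]
    rw [mul_assoc, h1, mul_neg, neg_neg]
  · simp only [Fin.mk_one]
    rw [← mul_assoc, h1, neg_mul]

theorem f_smul_K (hx : x ∈ V) : f x • subEnd Γ J ξ θ f x
    = flatMoment Γ J (ξ 0) (θ x) * flatMoment Γ J (ξ 1) (θ x) := by
  rw [subEnd, smul_smul, mul_inv_cancel₀ (h.f_ne x hx), one_smul]

theorem inner_ξ (hx : x ∈ V) : G (θ x) (ξ 0 (θ x)) (ξ 1 (θ x)) = 0 := by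
  have h1 := h.skewK hx (ξ 0 (θ x)) (ξ 0 (θ x))
  rw [h.K_ξ hx, (h.qk.inner _ (h.maps x hx)).symm] at h1
  linarith

theorem diffθ (hx : x ∈ V) : DifferentiableAt ℝ θ x :=
  (h.smooth.contDiffAt (h.mem_nhds hx)).differentiableAt (by simp)

variable [FiniteDimensional ℝ E]

theorem smoothP (i : Fin 2) : ContDiffOn ℝ ∞ (fun y ↦ flatMoment Γ J (ξ i) (θ y)) V :=
  (h.qk.smooth_flatMoment (h.killing i).smooth).comp h.smooth fun y hy ↦ h.maps y hy

theorem smoothK : ContDiffOn ℝ ∞ (subEnd Γ J ξ θ f) V :=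
  (h.smooth_f.inv fun y hy ↦ h.f_ne y hy).smul ((h.smoothP 0).mul (h.smoothP 1))

theorem diffP (i : Fin 2) (hx : x ∈ V) :
    DifferentiableAt ℝ (fun y ↦ flatMoment Γ J (ξ i) (θ y)) x :=
  ((h.smoothP i).contDiffAt (h.mem_nhds hx)).differentiableAt (by simp)

theorem diffK (hx : x ∈ V) : DifferentiableAt ℝ (subEnd Γ J ξ θ f) x :=
  (h.smoothK.contDiffAt (h.mem_nhds hx)).differentiableAt (by simp)

theorem covP {η : E → E} (hη : FlatKilling U G Γ η) (hx : x ∈ V) (u : F) :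
    covEnd (pullConn Γ θ) (fun y ↦ flatMoment Γ J η (θ y)) x u
      = c (θ x) • quatForm (G (θ x)) (fun a ↦ J a (θ x)) (fderiv ℝ θ x u) (η (θ x)) := by
  have hd : DifferentiableAt ℝ (flatMoment Γ J η) (θ x) :=
    ((h.qk.smooth_flatMoment hη.smooth).contDiffAt
      (h.qk.toFlatLC.mem_nhds (h.maps x hx))).differentiableAt (by simp)
  rw [covEnd_pullConn hd (h.diffθ hx), h.qk.covEnd_flatMoment hη (h.maps x hx)]

theorem covK_anti (hx : x ∈ V) (u : F) :
    covEnd (pullConn Γ θ) (subEnd Γ J ξ θ f) x u * subEnd Γ J ξ θ f x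
      + subEnd Γ J ξ θ f x * covEnd (pullConn Γ θ) (subEnd Γ J ξ θ f) x u = 0 := by
  rw [← covEnd_mul (h.diffK hx) (h.diffK hx)]
  have e : (fun y ↦ subEnd Γ J ξ θ f y * subEnd Γ J ξ θ f y) =ᶠ[𝓝 x]
      fun _ ↦ (-1 : E →L[ℝ] E) := by
    filter_upwards [h.mem_nhds hx] with y hy
    exact h.K_sq hy
  rw [covEnd_congr e]
  exact covEnd_const (E := E) (C := pullConn Γ θ) (T₀ := -1) (fun u ↦ by simp) u

/-- The covariant derivative of `f⁻¹ P₀ P₁` along the submanifold. -/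
theorem covK (hx : x ∈ V) (u : F) :
    covEnd (pullConn Γ θ) (subEnd Γ J ξ θ f) x u
      = (c (θ x) / f x) • ((G (θ x) (fderiv ℝ θ x u) (ξ 0 (θ x)) • flatMoment Γ J (ξ 0) (θ x)
        + G (θ x) (fderiv ℝ θ x u) (ξ 1 (θ x)) • flatMoment Γ J (ξ 1) (θ x))
          * subEnd Γ J ξ θ f x) := by
  have hJ := h.qk.quat _ (h.maps x hx)
  have hf := h.f_ne x hx
  have hfd : DifferentiableAt ℝ f x :=
    (h.smooth_f.contDiffAt (h.mem_nhds hx)).differentiableAt (by simp)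
  have e0 : (fun y ↦ f y • subEnd Γ J ξ θ f y) =ᶠ[𝓝 x]
      fun y ↦ flatMoment Γ J (ξ 0) (θ y) * flatMoment Γ J (ξ 1) (θ y) := by
    filter_upwards [h.mem_nhds hx] with y hy using h.f_smul_K hy
  have e1 := covEnd_congr (C := pullConn Γ θ) e0 u
  rw [covEnd_smul hfd (h.diffK hx), covEnd_mul (h.diffP 0 hx) (h.diffP 1 hx),
    h.covP (h.killing 0) hx, h.covP (h.killing 1) hx] at e1
  have a0 := hJ.quatForm_anticommute (g := G (θ x)) (h.K_mem hx) (h.K_sq hx)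
    (fderiv ℝ θ x u) (ξ 0 (θ x))
  have a1 := hJ.quatForm_anticommute (g := G (θ x)) (h.K_mem hx) (h.K_sq hx)
    (fderiv ℝ θ x u) (ξ 1 (θ x))
  have aK := h.covK_anti hx u
  have sq := h.K_sq hx
  have p0 := h.p_K hx 0
  have p1 := h.p_K hx 1
  rw [h.skewK hx, h.K_ξ hx] at a0
  rw [h.skewK hx, h.K_ξ_one hx, map_neg, neg_neg] at a1
  generalize covEnd (pullConn Γ θ) (subEnd Γ J ξ θ f) x u = D at *
  generalize subEnd Γ J ξ θ f x = K at *
  generalize flatMoment Γ J (ξ 0) (θ x) = P at *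
  generalize flatMoment Γ J (ξ 1) (θ x) = P' at *
  generalize quatForm (G (θ x)) (fun a ↦ J a (θ x)) (fderiv ℝ θ x u) (ξ 0 (θ x)) = Q0 at *
  generalize quatForm (G (θ x)) (fun a ↦ J a (θ x)) (fderiv ℝ θ x u) (ξ 1 (θ x)) = Q1 at *
  generalize G (θ x) (fderiv ℝ θ x u) (ξ 0 (θ x)) = s0 at *
  generalize G (θ x) (fderiv ℝ θ x u) (ξ 1 (θ x)) = s1 at *
  generalize c (θ x) = c at *
  generalize fderiv ℝ f x u = df at *
  generalize f x = f at *
  obtain ⟨A0, hA0⟩ : ∃ A, A = Q0 - -s1 • K := ⟨_, rfl⟩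
  obtain ⟨A1, hA1⟩ : ∃ A, A = Q1 - s0 • K := ⟨_, rfl⟩
  have q0 : Q0 = A0 + -s1 • K := by rw [hA0]; abel
  have q1 : Q1 = A1 + s0 • K := by rw [hA1]; abel
  rw [← hA0] at a0
  rw [← hA1] at a1
  have b0 : A0 * K = -(K * A0) := eq_neg_of_add_eq_zero_left a0
  have b1 : A1 * K = -(K * A1) := eq_neg_of_add_eq_zero_left a1
  have bK : D * K = -(K * D) := eq_neg_of_add_eq_zero_left aK
  obtain ⟨B, hB⟩ : ∃ B, B = c • (A0 * P') + c • (P * A1) - df • K := ⟨_, rfl⟩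
  have hBD : B = f • D - (c * s1) • (P' * K) - (c * s0) • (P * K) := by
    have : f • D = c • Q0 * P' + P * c • Q1 - df • K := by rw [← e1]; abel
    rw [this, hB, q0, q1, p1]
    simp only [smul_add, add_mul, mul_add, smul_mul_assoc, mul_smul_comm]
    module
  have c1 : B * K = K * B := by
    rw [hB]
    simp only [sub_mul, add_mul, mul_sub, mul_add, smul_mul_assoc, mul_smul_comm]
    rw [mul_assoc A0, p1, mul_assoc P, b1, mul_neg, mul_neg, ← mul_assoc A0, b0, ← mul_assoc P, p0]
    simp only [neg_mul, neg_neg, mul_assoc]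
  have c2 : B * K = -(K * B) := by
    rw [hBD]
    simp only [sub_mul, mul_sub, smul_mul_assoc, mul_smul_comm]
    rw [bK, p0, p1]
    simp only [neg_mul, mul_neg, mul_assoc, p0, p1]
    module
  have c3 : K * B = 0 := by
    have : (2 : ℝ) • (K * B) = 0 := by
      rw [two_smul]
      nth_rewrite 1 [← c1]
      rw [c2]; simp
    exact (smul_eq_zero.1 this).resolve_left two_ne_zero
  have c4 : B = 0 := by
    have : K * (K * B) = 0 := by rw [c3, mul_zero]
    rw [← mul_assoc, sq] at this
    simpa using this
  rw [c4] at hBD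
  have : D = f⁻¹ • (f • D) := by rw [smul_smul, inv_mul_cancel₀ hf, one_smul]
  rw [this, show f • D = (c * s1) • (P' * K) + (c * s0) • (P * K) by
    rw [eq_comm, sub_sub, sub_eq_zero] at hBD; exact hBD]
  rw [add_mul, smul_mul_assoc, smul_mul_assoc, div_eq_inv_mul]
  module

/-- The relation between the norm of the Killing fields and the moment maps. -/
theorem c_mul_norm (hx : x ∈ V) : c (θ x) * G (θ x) (ξ 0 (θ x)) (ξ 0 (θ x)) = 2 * f x := by
  have hη := h.qk.killing_flatBracket (h.killing 0) (h.killing 1)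
  have hM : ∀ y ∈ V, flatMoment Γ J (flatBracket (ξ 0) (ξ 1)) (θ y)
      = (c (θ y) * G (θ y) (ξ 0 (θ y)) (ξ 0 (θ y)) - 2 * f y) • subEnd Γ J ξ θ f y := by
    intro y hy
    have hJ := h.qk.quat _ (h.maps y hy)
    rw [h.qk.flatMoment_flatBracket (h.killing 0) (h.killing 1) (h.maps y hy), h.p_anti hy,
      ← h.f_smul_K hy, ← h.K_ξ hy, hJ.quatForm_self_map (h.qk.inner _ (h.maps y hy))
        (h.qk.curv _ (h.maps y hy)).skewJ (h.K_mem hy)]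
    module
  have hMd : DifferentiableAt ℝ (fun y ↦ flatMoment Γ J (flatBracket (ξ 0) (ξ 1)) (θ y)) x :=
    (((h.qk.smooth_flatMoment hη.smooth).comp h.smooth fun y hy ↦ h.maps y hy).contDiffAt
      (h.mem_nhds hx)).differentiableAt (by simp)
  have e0 : (fun y ↦ flatMoment Γ J (flatBracket (ξ 0) (ξ 1)) (θ y) * subEnd Γ J ξ θ f y) =ᶠ[𝓝 x]
      fun y ↦ subEnd Γ J ξ θ f y * flatMoment Γ J (flatBracket (ξ 0) (ξ 1)) (θ y) := by
    filter_upwards [h.mem_nhds hx] with y hy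
    rw [hM y hy, smul_mul_assoc, mul_smul_comm]
  have e1 := covEnd_congr (C := pullConn Γ θ) e0 (ζ 0 x)
  rw [covEnd_mul hMd (h.diffK hx), covEnd_mul (h.diffK hx) hMd, h.covP hη hx, h.bracket x hx,
    hM x hx] at e1
  simp only [quatForm, map_zero, zero_smul, Finset.sum_const_zero, smul_zero, zero_mul, zero_add,
    mul_zero, add_zero, smul_mul_assoc, mul_smul_comm] at e1
  have aK := h.covK_anti hx (ζ 0 x)
  by_contra hne
  have hm : c (θ x) * G (θ x) (ξ 0 (θ x)) (ξ 0 (θ x)) - 2 * f x ≠ 0 := sub_ne_zero.2 hne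
  have e2 := smul_right_injective _ hm e1
  rw [e2, ← two_smul ℝ] at aK
  have e3 := (smul_eq_zero.1 aK).resolve_left two_ne_zero
  rw [h.covK hx, h.tangent x hx, h.inner_ξ hx, zero_smul, add_zero] at e3
  simp only [smul_mul_assoc, smul_smul, smul_eq_zero] at e3
  have hc := h.qk.c_ne _ (h.maps x hx)
  have hf := h.f_ne x hx
  have hn := (h.norm_pos hx).ne'
  have e4 := e3.resolve_left (mul_ne_zero (div_ne_zero hc hf) hn)
  rw [mul_assoc, h.K_sq hx] at e4
  have e5 : flatMoment Γ J (ξ 0) (θ x) = 0 := by simpa using e4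
  have e6 := h.mapξ x hx
  rw [e5, _root_.zero_apply, eq_comm, smul_eq_zero] at e6
  have e7 := h.norm x hx
  rw [e6.resolve_left hf, map_zero] at e7
  exact hn e7

theorem covK_ζ (hx : x ∈ V) (j : Fin 2) :
    covEnd (pullConn Γ θ) (subEnd Γ J ξ θ f) x (ζ j x)
      = nablaEnd Γ (ξ j) (θ x) * subEnd Γ J ξ θ f x
        - subEnd Γ J ξ θ f x * nablaEnd Γ (ξ j) (θ x) := by
  have hZ := QuatTriple.commute_of_mem_span (h.K_mem hx)
    (h.qk.sub_flatMoment_commute (h.killing j) (h.maps x hx))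
  have hp := h.p_K hx j
  have h1 : nablaEnd Γ (ξ j) (θ x) * subEnd Γ J ξ θ f x
        - subEnd Γ J ξ θ f x * nablaEnd Γ (ξ j) (θ x)
      = (2 : ℝ) • (flatMoment Γ J (ξ j) (θ x) * subEnd Γ J ξ θ f x) := by
    rw [sub_mul, mul_sub, sub_eq_sub_iff_sub_eq_sub] at hZ
    rw [hZ, two_smul]
    nth_rewrite 3 [hp]
    abel
  have hc := h.c_mul_norm hx
  have hf := h.f_ne x hx
  have hdiv : c (θ x) / f x * G (θ x) (ξ 0 (θ x)) (ξ 0 (θ x)) = 2 := by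
    rw [div_mul_eq_mul_div, hc, mul_div_assoc, div_self hf, mul_one]
  rw [h1, h.covK hx, h.tangent x hx]
  fin_cases j
  · simp only [Fin.zero_eta]
    rw [h.inner_ξ hx, zero_smul, add_zero, smul_mul_assoc, smul_smul, hdiv]
  · simp only [Fin.mk_one]
    rw [(h.qk.inner _ (h.maps x hx)).symm (ξ 1 (θ x)) (ξ 0 (θ x)), h.inner_ξ hx, zero_smul,
      zero_add, smul_mul_assoc, smul_smul, ← h.norm x hx, hdiv]

theorem covK_horizontal (hx : x ∈ V) (u : F)
    (hu : ∀ j, G (θ x) (fderiv ℝ θ x u) (ξ j (θ x)) = 0) :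
    covEnd (pullConn Γ θ) (subEnd Γ J ξ θ f) x u = 0 := by
  rw [h.covK hx, hu, hu]; simp

end FlatSub

end FlatSubmanifold

section FlatTransverse

variable {E F : Type*} [NormedAddCommGroup E] [NormedSpace ℝ E] [FiniteDimensional ℝ E]
  [NormedAddCommGroup F] [NormedSpace ℝ F] [FiniteDimensional ℝ F]

/-- A field of vectors is smooth if its image under a smooth field of injective linear maps is
smooth. -/
theorem contDiffAt_of_clm_apply {X W : Type*} [NormedAddCommGroup X] [NormedSpace ℝ X]
    [NormedAddCommGroup W] [NormedSpace ℝ W] [FiniteDimensional ℝ W] {A : X → F →L[ℝ] W} {x : X}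
    (hA : ContDiffAt ℝ ∞ A x) (hinj : Function.Injective (A x)) {σ : X → F} {τ : X → W}
    (hτ : ContDiffAt ℝ ∞ τ x) (h : ∀ᶠ y in 𝓝 x, A y (σ y) = τ y) : ContDiffAt ℝ ∞ σ x := by
  obtain ⟨L, hL⟩ := (A x : F →ₗ[ℝ] W).exists_leftInverse_of_injective
    (LinearMap.ker_eq_bot.2 hinj)
  have hM : ContDiffAt ℝ ∞ (fun y ↦ L.toContinuousLinearMap ∘L A y) x :=
    contDiffAt_const.clm_comp hA
  have h1 : L.toContinuousLinearMap ∘L A x = 1 := by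
    ext v
    exact congrArg (fun f : F →ₗ[ℝ] F ↦ f v) hL
  have hinv : ContDiffAt ℝ ∞ (fun y ↦ Ring.inverse (L.toContinuousLinearMap ∘L A y)) x := by
    have : ContDiffAt ℝ ∞ (Ring.inverse : (F →L[ℝ] F) → F →L[ℝ] F)
        (L.toContinuousLinearMap ∘L A x) := by
      rw [h1]
      exact contDiffAt_ringInverse ℝ (1 : (F →L[ℝ] F)ˣ)
    exact this.comp x hM
  have hu : ∀ᶠ y in 𝓝 x, IsUnit (L.toContinuousLinearMap ∘L A y) := by
    have : {T : F →L[ℝ] F | IsUnit T} ∈ 𝓝 (L.toContinuousLinearMap ∘L A x) :=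
      Units.isOpen.mem_nhds (by rw [h1]; exact isUnit_one)
    exact hM.continuousAt this
  have hs : ContDiffAt ℝ ∞ (fun y ↦ Ring.inverse (L.toContinuousLinearMap ∘L A y)
      (L.toContinuousLinearMap (τ y))) x :=
    hinv.clm_apply (contDiffAt_const.clm_apply hτ)
  refine hs.congr_of_eventuallyEq ?_
  filter_upwards [hu, h] with y hy hyV
  rw [← hyV]
  exact (congrArg (fun T : F →L[ℝ] F ↦ T (σ y)) (Ring.inverse_mul_cancel _ hy)).symm

/-- A field of vectors is smooth if its image under an immersion is smooth. -/
theorem contDiffOn_of_fderiv_apply {θ : F → E} {V : Set F} (hV : IsOpen V)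
    (hθ : ContDiffOn ℝ ∞ θ V) (hinj : ∀ x ∈ V, Function.Injective (fderiv ℝ θ x)) {σ : F → F}
    {τ : F → E} (hτ : ContDiffOn ℝ ∞ τ V) (h : ∀ x ∈ V, fderiv ℝ θ x (σ x) = τ x) :
    ContDiffOn ℝ ∞ σ V := fun x hx ↦
  have hVx : V ∈ 𝓝 x := hV.mem_nhds hx
  (contDiffAt_of_clm_apply ((hθ.contDiffAt hVx).fderiv_right (by simp)) (hinj x hx)
    (hτ.contDiffAt hVx) (Filter.mem_of_superset hVx h)).contDiffWithinAt

namespace FlatSub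

variable {U : Set E} {G : E → E →L[ℝ] E →L[ℝ] ℝ} {Γ : E → E → E →L[ℝ] E}
  {J : Fin 3 → E → E →L[ℝ] E} {c : E → ℝ} {ξ : Fin 2 → E → E}
  {V : Set F} {θ : F → E} {f : F → ℝ} {I : F → F →L[ℝ] F} {ζ : Fin 2 → F → F}
  (h : FlatSub U G Γ J c ξ V θ f I ζ) {x : F}
include h

theorem smooth_fderiv : ContDiffOn ℝ ∞ (fderiv ℝ θ) V :=
  h.smooth.fderiv_of_isOpen h.isOpen (by simp)

theorem smooth_I : ContDiffOn ℝ ∞ I V := by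
  rw [contDiffOn_clm_apply]
  intro w
  refine contDiffOn_of_fderiv_apply h.isOpen h.smooth h.inj
    (h.smoothK.clm_apply (h.smooth_fderiv.clm_apply contDiffOn_const)) fun x hx ↦ h.map_I hx w

theorem smooth_ζ (j : Fin 2) : ContDiffOn ℝ ∞ (ζ j) V :=
  contDiffOn_of_fderiv_apply h.isOpen h.smooth h.inj
    ((h.killing j).smooth.comp h.smooth fun y hy ↦ h.maps y hy) fun x hx ↦ h.tangent x hx j

theorem diffI (hx : x ∈ V) : DifferentiableAt ℝ I x :=
  (h.smooth_I.contDiffAt (h.mem_nhds hx)).differentiableAt (by simp)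

theorem diffζ (hx : x ∈ V) (j : Fin 2) : DifferentiableAt ℝ (ζ j) x :=
  ((h.smooth_ζ j).contDiffAt (h.mem_nhds hx)).differentiableAt (by simp)

theorem diff_fderiv (hx : x ∈ V) : DifferentiableAt ℝ (fderiv ℝ θ) x :=
  (h.smooth_fderiv.contDiffAt (h.mem_nhds hx)).differentiableAt (by simp)

/-- The second fundamental form of the coordinate map, `D_u (dθ w)`. -/
def _root_.subHess (Γ : E → E → E →L[ℝ] E) (θ : F → E) (x u w : F) : E :=
  covVec (pullConn Γ θ) (fun y ↦ fderiv ℝ θ y w) x u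

theorem subHess_comm (hx : x ∈ V) (u w : F) : subHess Γ θ x u w = subHess Γ θ x w u := by
  have hs : IsSymmSndFDerivAt ℝ θ x :=
    (h.smooth.contDiffAt (h.mem_nhds hx)).isSymmSndFDerivAt
      (by simpa using ENat.LEInfty.out)
  rw [subHess, subHess, covVec, covVec, pullConn, pullConn, h.qk.symm _ (h.maps x hx),
    fderiv_apply_const (h.diff_fderiv hx), fderiv_apply_const (h.diff_fderiv hx), hs.eq]

theorem covVec_fderiv {σ : F → F} (hσ : DifferentiableAt ℝ σ x) (hx : x ∈ V) (u : F) :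
    covVec (pullConn Γ θ) (fun y ↦ fderiv ℝ θ y (σ y)) x u
      = fderiv ℝ θ x (fderiv ℝ σ x u) + subHess Γ θ x u (σ x) := by
  have e : fderiv ℝ (fun y ↦ fderiv ℝ θ y (σ y)) x u
      = fderiv ℝ θ x (fderiv ℝ σ x u) + fderiv ℝ (fderiv ℝ θ) x u (σ x) := by
    rw [((h.diff_fderiv hx).hasFDerivAt.clm_apply hσ.hasFDerivAt).fderiv]; rfl
  rw [subHess, covVec, covVec, e, fderiv_apply_const (h.diff_fderiv hx)]
  abel

theorem fderiv_fderiv_I (hx : x ∈ V) (u w : F) :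
    fderiv ℝ θ x (fderiv ℝ I x u w) + subHess Γ θ x u (I x w)
      = covEnd (pullConn Γ θ) (subEnd Γ J ξ θ f) x u (fderiv ℝ θ x w)
        + subEnd Γ J ξ θ f x (subHess Γ θ x u w) := by
  have e : (fun y ↦ fderiv ℝ θ y (I y w)) =ᶠ[𝓝 x]
      fun y ↦ subEnd Γ J ξ θ f y (fderiv ℝ θ y w) := by
    filter_upwards [h.mem_nhds hx] with y hy
    exact h.map_I hy w
  have e1 := covVec_congr (C := pullConn Γ θ) e u
  rw [covVec_fderiv h ((h.diffI hx).clm_apply (differentiableAt_const w)) hx,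
    covVec_apply (h.diffK hx) ((h.diff_fderiv hx).clm_apply (differentiableAt_const w)),
    fderiv_apply_const (h.diffI hx)] at e1
  exact e1

theorem fderiv_fderiv_ζ (hx : x ∈ V) (j : Fin 2) (u : F) :
    fderiv ℝ θ x (fderiv ℝ (ζ j) x u) + subHess Γ θ x u (ζ j x)
      = nablaEnd Γ (ξ j) (θ x) (fderiv ℝ θ x u) := by
  have e : (fun y ↦ fderiv ℝ θ y (ζ j y)) =ᶠ[𝓝 x] fun y ↦ ξ j (θ y) := by
    filter_upwards [h.mem_nhds hx] with y hy
    exact h.tangent y hy j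
  have hd : DifferentiableAt ℝ (ξ j) (θ x) := ((h.killing j).smooth.contDiffAt
    (h.qk.toFlatLC.mem_nhds (h.maps x hx))).differentiableAt (by simp)
  have e1 := covVec_congr (C := pullConn Γ θ) e u
  rwa [covVec_fderiv h (h.diffζ hx j) hx, covVec_pullConn hd (h.diffθ hx),
    ← h.qk.nablaEnd_apply (h.maps x hx)] at e1

theorem map_ζ (hx : x ∈ V) : I x (ζ 0 x) = ζ 1 x := by
  apply h.inj x hx
  rw [h.map_I hx, h.tangent x hx, h.tangent x hx, h.K_ξ hx]

theorem I_sq (hx : x ∈ V) (u : F) : I x (I x u) = -u := by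
  apply h.inj x hx
  rw [h.map_I hx, h.map_I hx, h.K_sq_apply hx, map_neg]

theorem lieI (hx : x ∈ V) (j : Fin 2) (w : F) : fderiv ℝ I x (ζ j x) w
    = fderiv ℝ (ζ j) x (I x w) - I x (fderiv ℝ (ζ j) x w) := by
  apply h.inj x hx
  have e1 := h.fderiv_fderiv_I hx (ζ j x) w
  have e2 := h.fderiv_fderiv_ζ hx j (I x w)
  have e3 := congrArg (subEnd Γ J ξ θ f x) (h.fderiv_fderiv_ζ hx j w)
  rw [h.covK_ζ hx, _root_.sub_apply, mul_apply_eq_comp, mul_apply_eq_comp] at e1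
  rw [h.map_I hx] at e2
  rw [map_add] at e3
  rw [map_sub, h.map_I hx, eq_sub_of_add_eq e1, eq_sub_of_add_eq e2, eq_sub_of_add_eq e3,
    h.subHess_comm hx w, h.subHess_comm hx (I x w)]
  abel

/-- The Nijenhuis tensor in terms of the covariant derivative of `I`. -/
theorem fderiv_nijenhuis (hx : x ∈ V) (u w : F) :
    fderiv ℝ θ x (flatNijenhuis I x u w)
      = covEnd (pullConn Γ θ) (subEnd Γ J ξ θ f) x (I x u) (fderiv ℝ θ x w)
        - covEnd (pullConn Γ θ) (subEnd Γ J ξ θ f) x (I x w) (fderiv ℝ θ x u)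
        - subEnd Γ J ξ θ f x
          (covEnd (pullConn Γ θ) (subEnd Γ J ξ θ f) x u (fderiv ℝ θ x w))
        + subEnd Γ J ξ θ f x
          (covEnd (pullConn Γ θ) (subEnd Γ J ξ θ f) x w (fderiv ℝ θ x u)) := by
  rw [flatNijenhuis, map_add, map_sub, map_sub, h.map_I hx, h.map_I hx,
    eq_sub_of_add_eq (h.fderiv_fderiv_I hx (I x u) w),
    eq_sub_of_add_eq (h.fderiv_fderiv_I hx (I x w) u),
    eq_sub_of_add_eq (h.fderiv_fderiv_I hx u w), eq_sub_of_add_eq (h.fderiv_fderiv_I hx w u)]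
  simp only [map_sub, map_add, h.K_sq_apply hx]
  rw [h.subHess_comm hx w u, h.subHess_comm hx (I x u) w, h.subHess_comm hx u (I x w),
    h.subHess_comm hx (I x u) (I x w)]
  abel

theorem covK_ξ_zero (hx : x ∈ V) (w : F) :
    covEnd (pullConn Γ θ) (subEnd Γ J ξ θ f) x w (ξ 0 (θ x))
        + subEnd Γ J ξ θ f x (nablaEnd Γ (ξ 0) (θ x) (fderiv ℝ θ x w))
      = nablaEnd Γ (ξ 1) (θ x) (fderiv ℝ θ x w) := by
  have hd : ∀ j, DifferentiableAt ℝ (ξ j) (θ x) := fun j ↦ ((h.killing j).smooth.contDiffAt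
    (h.qk.toFlatLC.mem_nhds (h.maps x hx))).differentiableAt (by simp)
  have e : (fun y ↦ subEnd Γ J ξ θ f y (ξ 0 (θ y))) =ᶠ[𝓝 x] fun y ↦ ξ 1 (θ y) := by
    filter_upwards [h.mem_nhds hx] with y hy
    exact h.K_ξ hy
  have e1 := covVec_congr (C := pullConn Γ θ) e w
  rwa [covVec_apply (σ := fun y ↦ ξ 0 (θ y)) (h.diffK hx)
      ((hd 0).comp x (h.diffθ hx)),
    covVec_pullConn (hd 0) (h.diffθ hx), covVec_pullConn (hd 1) (h.diffθ hx),
    ← h.qk.nablaEnd_apply (h.maps x hx), ← h.qk.nablaEnd_apply (h.maps x hx)] at e1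

theorem covK_ξ_one (hx : x ∈ V) (w : F) :
    covEnd (pullConn Γ θ) (subEnd Γ J ξ θ f) x w (ξ 1 (θ x))
        + subEnd Γ J ξ θ f x (nablaEnd Γ (ξ 1) (θ x) (fderiv ℝ θ x w))
      = -nablaEnd Γ (ξ 0) (θ x) (fderiv ℝ θ x w) := by
  have e0 := h.covK_ξ_zero hx w
  have e1 := congrArg (subEnd Γ J ξ θ f x) e0
  have e2 := congrArg (fun T : E →L[ℝ] E ↦ T (ξ 0 (θ x))) (h.covK_anti hx w)
  simp only [_root_.add_apply, mul_apply_eq_comp, h.K_ξ hx, _root_.zero_apply] at e2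
  rw [map_add, h.K_sq_apply hx] at e1
  rw [← e1, eq_neg_of_add_eq_zero_left e2]
  abel

theorem nijenhuis_ζ (hx : x ∈ V) (j : Fin 2) (w : F) : flatNijenhuis I x (ζ j x) w = 0 := by
  apply h.inj x hx
  rw [h.fderiv_nijenhuis hx, map_zero, h.tangent x hx]
  fin_cases j
  · simp only [Fin.zero_eta]
    rw [h.map_ζ hx, h.covK_ζ hx, h.covK_ζ hx, eq_sub_of_add_eq (h.covK_ξ_zero hx (I x w)),
      eq_sub_of_add_eq (h.covK_ξ_zero hx w), h.map_I hx]
    simp only [_root_.sub_apply, mul_apply_eq_comp, map_sub, h.K_sq_apply hx]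
    abel
  · simp only [Fin.mk_one]
    have e : I x (ζ 1 x) = (-1 : ℝ) • ζ 0 x := by rw [← h.map_ζ hx, h.I_sq hx]; simp
    have e' : covEnd (pullConn Γ θ) (subEnd Γ J ξ θ f) x ((-1 : ℝ) • ζ 0 x)
        = (-1 : ℝ) • covEnd (pullConn Γ θ) (subEnd Γ J ξ θ f) x (ζ 0 x) := by
      simp only [covEnd, pullConn, map_smul, h.qk.smul, smul_sub, smul_add, smul_mul_assoc,
        mul_smul_comm]
    rw [e, e', h.covK_ζ hx, h.covK_ζ hx, eq_sub_of_add_eq (h.covK_ξ_one hx (I x w)),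
      eq_sub_of_add_eq (h.covK_ξ_one hx w), h.map_I hx]
    simp only [neg_smul, one_smul, _root_.neg_apply, _root_.sub_apply, mul_apply_eq_comp, map_sub,
      map_neg, h.K_sq_apply hx]
    abel

omit h [FiniteDimensional ℝ E] [FiniteDimensional ℝ F] in
theorem _root_.flatNijenhuis_antisymm (I : F → F →L[ℝ] F) (x u w : F) :
    flatNijenhuis I x u w = -flatNijenhuis I x w u := by
  simp only [flatNijenhuis]; abel

omit h [FiniteDimensional ℝ E] [FiniteDimensional ℝ F] in
theorem _root_.flatNijenhuis_add (I : F → F →L[ℝ] F) (x u v w : F) :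
    flatNijenhuis I x (u + v) w = flatNijenhuis I x u w + flatNijenhuis I x v w := by
  simp only [flatNijenhuis, map_add, _root_.add_apply]; abel

omit h [FiniteDimensional ℝ E] [FiniteDimensional ℝ F] in
theorem _root_.flatNijenhuis_smul (I : F → F →L[ℝ] F) (r : ℝ) (x u w : F) :
    flatNijenhuis I x (r • u) w = r • flatNijenhuis I x u w := by
  simp only [flatNijenhuis, map_smul, _root_.smul_apply]; module

/-- The metric induced by the coordinate map `θ`. -/
def _root_.pullMetric (G : E → E →L[ℝ] E →L[ℝ] ℝ) (θ : F → E) (x : F) : F →L[ℝ] F →L[ℝ] ℝ :=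
  (G (θ x)).bilinearComp (fderiv ℝ θ x) (fderiv ℝ θ x)

omit h [FiniteDimensional ℝ E] [FiniteDimensional ℝ F] in
theorem _root_.pullMetric_apply (u v : F) :
    pullMetric G θ x u v = G (θ x) (fderiv ℝ θ x u) (fderiv ℝ θ x v) := rfl

theorem nijenhuis (hx : x ∈ V) (u w : F) : flatNijenhuis I x u w = 0 := by
  have hg := h.qk.inner _ (h.maps x hx)
  have hn := (h.norm_pos hx).ne'
  have hn' := h.norm x hx
  have h01 := h.inner_ξ hx
  have dec : ∀ u : F, ∃ (v : F) (a b : ℝ), u = v + (a • ζ 0 x + b • ζ 1 x) ∧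
      ∀ j, G (θ x) (fderiv ℝ θ x v) (ξ j (θ x)) = 0 := by
    intro u
    refine ⟨u - ((G (θ x) (fderiv ℝ θ x u) (ξ 0 (θ x)) / G (θ x) (ξ 0 (θ x)) (ξ 0 (θ x))) • ζ 0 x
      + (G (θ x) (fderiv ℝ θ x u) (ξ 1 (θ x)) / G (θ x) (ξ 0 (θ x)) (ξ 0 (θ x))) • ζ 1 x),
      _, _, (sub_add_cancel _ _).symm, ?_⟩
    have h10 : G (θ x) (ξ 1 (θ x)) (ξ 0 (θ x)) = 0 := by rw [hg.symm, h01]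
    intro j
    simp only [map_sub, map_add, map_smul, h.tangent x hx, _root_.sub_apply, _root_.add_apply,
      _root_.smul_apply, smul_eq_mul]
    fin_cases j
    · simp only [Fin.zero_eta]
      rw [h10, div_mul_cancel₀ _ hn]; ring
    · simp only [Fin.mk_one]
      rw [h01, ← hn', div_mul_cancel₀ _ hn]; ring
  have hIh : ∀ v, (∀ j, G (θ x) (fderiv ℝ θ x v) (ξ j (θ x)) = 0) →
      ∀ j, G (θ x) (fderiv ℝ θ x (I x v)) (ξ j (θ x)) = 0 := by
    intro v hv j
    rw [h.map_I hx, h.skewK hx]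
    fin_cases j
    · simp only [Fin.zero_eta]
      rw [h.K_ξ hx, hv, neg_zero]
    · simp only [Fin.mk_one]
      rw [h.K_ξ_one hx, map_neg, hv, neg_zero, neg_zero]
  obtain ⟨u', a, b, rfl, hu⟩ := dec u
  obtain ⟨w', a', b', rfl, hw⟩ := dec w
  have hh : flatNijenhuis I x u' w' = 0 := by
    apply h.inj x hx
    rw [h.fderiv_nijenhuis hx, h.covK_horizontal hx u' hu, h.covK_horizontal hx w' hw,
      h.covK_horizontal hx _ (hIh u' hu), h.covK_horizontal hx _ (hIh w' hw)]
    simp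
  rw [flatNijenhuis_add, flatNijenhuis_add, flatNijenhuis_smul, flatNijenhuis_smul,
    h.nijenhuis_ζ hx, h.nijenhuis_ζ hx, flatNijenhuis_antisymm, flatNijenhuis_add,
    flatNijenhuis_add, flatNijenhuis_smul, flatNijenhuis_smul,
    h.nijenhuis_ζ hx, h.nijenhuis_ζ hx, flatNijenhuis_antisymm, hh]
  simp

theorem metric_pull (hx : x ∈ V) : MetricAt (pullConn Γ θ) (fun y ↦ G (θ y)) x := by
  intro u v w
  have hd : DifferentiableAt ℝ (fun y ↦ G y v w) (θ x) :=
    ((h.qk.diffG (h.maps x hx)).clm_apply (differentiableAt_const v)).clm_apply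
      (differentiableAt_const w)
  rw [show (fun y ↦ G (θ y) v w) = (fun y ↦ G y v w) ∘ θ from rfl,
    fderiv_comp x hd (h.diffθ hx)]
  exact h.qk.metric _ (h.maps x hx) _ v w

set_option synthInstance.maxHeartbeats 200000 in
theorem diff_metric (hx : x ∈ V) : DifferentiableAt ℝ (fun y ↦ G (θ y)) x :=
  ((h.qk.smoothG.comp h.smooth fun y hy ↦ h.maps y hy).contDiffAt (h.mem_nhds hx)).differentiableAt
    (by simp)

set_option synthInstance.maxHeartbeats 200000 in
/-- The structure induced on a submanifold satisfying the assumptions of the corollary. -/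
theorem transverseKahler : TransverseKahler V (pullMetric G θ) I ζ where
  isOpen := h.isOpen
  smooth_g := by
    have hG : ContDiffOn ℝ ∞ (fun y ↦ G (θ y)) V :=
      h.qk.smoothG.comp h.smooth fun y hy ↦ h.maps y hy
    rw [contDiffOn_clm_apply]
    intro u
    rw [contDiffOn_clm_apply]
    intro v
    exact (hG.clm_apply (h.smooth_fderiv.clm_apply contDiffOn_const)).clm_apply
      (h.smooth_fderiv.clm_apply contDiffOn_const)
  smooth_I := h.smooth_I
  inner x hx := by
    have hg := h.qk.inner _ (h.maps x hx)
    refine ⟨fun u v ↦ hg.symm _ _, fun u hu ↦ hg.pos _ fun h0 ↦ hu (h.inj x hx ?_)⟩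
    exact h0.trans (map_zero _).symm
  sq x hx := h.I_sq hx
  herm x hx u v := by
    rw [pullMetric_apply, h.map_I hx, h.map_I hx, h.skewK hx, h.K_sq_apply hx, map_neg, neg_neg]
    rfl
  map_ζ x hx := h.map_ζ hx
  ne x hx h0 := h.ne x hx (by rw [← h.tangent x hx, h0, map_zero])
  nijenhuis x hx := h.nijenhuis hx
  lieI x hx := h.lieI hx
  lieg x hx j u v := by
    have hc := fun w : F ↦ (h.diff_fderiv hx).clm_apply (differentiableAt_const w)
    have e : fderiv ℝ (fun y ↦ pullMetric G θ y u v) x (ζ j x)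
        = G (θ x) (subHess Γ θ x (ζ j x) u) (fderiv ℝ θ x v)
          + G (θ x) (fderiv ℝ θ x u) (subHess Γ θ x (ζ j x) v) :=
      (h.metric_pull hx).fderiv_inner (h.diff_metric hx) (hc u) (hc v) _
    have k := (h.killing j).skew _ (h.maps x hx) (fderiv ℝ θ x u) (fderiv ℝ θ x v)
    rw [← h.fderiv_fderiv_ζ hx, ← h.fderiv_fderiv_ζ hx] at k
    rw [e, pullMetric_apply, pullMetric_apply, h.subHess_comm hx, h.subHess_comm hx (ζ j x) v]
    simp only [map_add, _root_.add_apply] at k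
    linarith
  closed x hx u v w hu hv hw := by
    have hc := fun w : F ↦ (h.diff_fderiv hx).clm_apply (differentiableAt_const w)
    have key : ∀ u v w : F, (∀ j, pullMetric G θ x u (ζ j x) = 0) →
        fderiv ℝ (fun y ↦ pullMetric G θ y v (I y w)) x u
          = G (θ x) (subHess Γ θ x u v) (subEnd Γ J ξ θ f x (fderiv ℝ θ x w))
            - G (θ x) (subEnd Γ J ξ θ f x (fderiv ℝ θ x v)) (subHess Γ θ x u w) := by
      intro u v w hu
      have e : (fun y ↦ pullMetric G θ y v (I y w)) =ᶠ[𝓝 x]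
          fun y ↦ G (θ y) (fderiv ℝ θ y v) (subEnd Γ J ξ θ f y (fderiv ℝ θ y w)) := by
        filter_upwards [h.mem_nhds hx] with y hy
        rw [pullMetric_apply, h.map_I hy]
      have hu' : ∀ j, G (θ x) (fderiv ℝ θ x u) (ξ j (θ x)) = 0 := fun j ↦ by
        rw [← h.tangent x hx]; exact hu j
      rw [e.fderiv_eq, (h.metric_pull hx).fderiv_inner (h.diff_metric hx) (hc v)
        ((h.diffK hx).clm_apply (hc w)), covVec_apply (h.diffK hx) (hc w),
        h.covK_horizontal hx u hu', _root_.zero_apply, zero_add, h.skewK hx]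
      simp only [subHess]
      ring
    have hg := h.qk.inner _ (h.maps x hx)
    rw [key u v w hu, key v w u hv, key w u v hw, h.subHess_comm hx v u, h.subHess_comm hx w v,
      h.subHess_comm hx w u, hg.symm (subEnd Γ J ξ θ f x _), hg.symm (subEnd Γ J ξ θ f x _),
      hg.symm (subEnd Γ J ξ θ f x _)]
    ring

end FlatSub

end FlatTransverse

/-! ### Local parametrisations -/

theorem contDiffAt_clm_of_apply {X W W' : Type*} [NormedAddCommGroup X] [NormedSpace ℝ X]
    [NormedAddCommGroup W] [NormedSpace ℝ W] [FiniteDimensional ℝ W] [NormedAddCommGroup W']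
    [NormedSpace ℝ W'] {f : X → W →L[ℝ] W'} {x : X}
    (h : ∀ w, ContDiffAt ℝ ∞ (fun y ↦ f y w) x) : ContDiffAt ℝ ∞ f x := by
  let e₁ := ContinuousLinearEquiv.ofFinrankEq
    (show Module.finrank ℝ W = Module.finrank ℝ (Fin (Module.finrank ℝ W) → ℝ) by simp)
  let e₂ := (e₁.arrowCongr (1 : W' ≃L[ℝ] W')).trans (ContinuousLinearEquiv.piRing _)
  rw [← Function.id_comp f, ← e₂.symm_comp_self]
  exact e₂.symm.contDiff.contDiffAt.comp x (contDiffAt_pi.mpr fun i ↦ h _)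

section Param

variable {E F : Type*} [NormedAddCommGroup E] [NormedSpace ℝ E]
  [NormedAddCommGroup F] [NormedSpace ℝ F]
  {M : Type*} [TopologicalSpace M] [ChartedSpace E M]

/-- The differential of a parametrisation. -/
def parD (E : Type*) [NormedAddCommGroup E] [NormedSpace ℝ E] {M : Type*} [TopologicalSpace M]
    [ChartedSpace E M] (ψ : F → M) (x : F) : F →L[ℝ] E := mfderiv 𝓘(ℝ, F) 𝓘(ℝ, E) ψ x

/-- The inverse of the differential of a parametrisation. -/
def parInv (E : Type*) [NormedAddCommGroup E] [NormedSpace ℝ E] {M : Type*} [TopologicalSpace M]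
    [ChartedSpace E M] (ψ : F → M) (x : F) : E →L[ℝ] F := (parD E ψ x).inverse

/-- The differential of the chart at `p`. -/
def chartD (E : Type*) [NormedAddCommGroup E] [NormedSpace ℝ E] {M : Type*} [TopologicalSpace M]
    [ChartedSpace E M] [IsManifold 𝓘(ℝ, E) ∞ M] (p q : M) : E →L[ℝ] E :=
  (trivializationAt E (TangentSpace 𝓘(ℝ, E)) p).continuousLinearMapAt ℝ q

/-- A metric as a family of bilinear forms on the model space. -/
def metricForm [IsManifold 𝓘(ℝ, E) ∞ M] (g : RMetric E M) (q : M) : E →L[ℝ] E →L[ℝ] ℝ := g.inner q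

/-- An endomorphism field as a family of endomorphisms of the model space. -/
def endForm (J : EndField E M) (q : M) : E →L[ℝ] E := J q

/-- `ψ` is a local diffeomorphism on the open set `V`. -/
structure IsParam (E : Type*) [NormedAddCommGroup E] [NormedSpace ℝ E] {M : Type*}
    [TopologicalSpace M] [ChartedSpace E M] (V : Set F) (ψ : F → M) : Prop where
  isOpen : IsOpen V
  smooth : ContMDiffOn 𝓘(ℝ, F) 𝓘(ℝ, E) ∞ ψ V
  inv : ∀ x ∈ V, (parD E ψ x).IsInvertible

/-- The coordinate expression of a vector field. -/
def coordVec (ψ : F → M) (Z : VField E M) (x : F) : F := parInv E ψ x (Z (ψ x))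

/-- The coordinate expression of an endomorphism field. -/
def coordEnd (ψ : F → M) (J : EndField E M) (x : F) : F →L[ℝ] F :=
  parInv E ψ x ∘L endForm J (ψ x) ∘L parD E ψ x

/-- The coordinate expression of a metric. -/
def coordForm [IsManifold 𝓘(ℝ, E) ∞ M] (ψ : F → M) (g : RMetric E M) (x : F) :
    F →L[ℝ] F →L[ℝ] ℝ :=
  (metricForm g (ψ x)).bilinearComp (parD E ψ x) (parD E ψ x)

theorem coordForm_apply [IsManifold 𝓘(ℝ, E) ∞ M] (ψ : F → M) (g : RMetric E M) (x u v : F) :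
    coordForm ψ g x u v = metricForm g (ψ x) (parD E ψ x u) (parD E ψ x v) := rfl

theorem coordEnd_apply (ψ : F → M) (J : EndField E M) (x u : F) :
    coordEnd ψ J x u = parInv E ψ x (endForm J (ψ x) (parD E ψ x u)) := rfl

namespace IsParam

variable {V : Set F} {ψ : F → M} (h : IsParam E V ψ) {x : F}
include h

theorem mem_nhds (hx : x ∈ V) : V ∈ 𝓝 x := h.isOpen.mem_nhds hx

theorem contMDiffAt (hx : x ∈ V) : ContMDiffAt 𝓘(ℝ, F) 𝓘(ℝ, E) ∞ ψ x :=
  h.smooth.contMDiffAt (h.mem_nhds hx)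

theorem mdifferentiableAt (hx : x ∈ V) : MDifferentiableAt 𝓘(ℝ, F) 𝓘(ℝ, E) ψ x :=
  (h.contMDiffAt hx).mdifferentiableAt (by simp)

theorem parD_parInv (hx : x ∈ V) (u : E) : parD E ψ x (parInv E ψ x u) = u :=
  (h.inv x hx).self_apply_inverse u

theorem parInv_parD (hx : x ∈ V) (u : F) : parInv E ψ x (parD E ψ x u) = u :=
  (h.inv x hx).inverse_apply_self u

theorem parD_coordVec (hx : x ∈ V) (Z : VField E M) : parD E ψ x (coordVec ψ Z x) = Z (ψ x) :=
  h.parD_parInv hx _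

theorem parD_injective (hx : x ∈ V) : Function.Injective (parD E ψ x) :=
  Function.LeftInverse.injective (h.parInv_parD hx)

theorem parInv_injective (hx : x ∈ V) : Function.Injective (parInv E ψ x) :=
  Function.LeftInverse.injective (h.parD_parInv hx)

end IsParam

variable [IsManifold 𝓘(ℝ, E) ∞ M]

omit [IsManifold 𝓘(ℝ, E) ∞ M] in
theorem fderiv_comp_param [IsManifold 𝓘(ℝ, E) ∞ M] {X : Type*} [NormedAddCommGroup X]
    [NormedSpace ℝ X] {ψ : X → M} {x : X} (hψ : MDifferentiableAt 𝓘(ℝ, X) 𝓘(ℝ, E) ψ x) {p : M}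
    (hp : ψ x ∈ (chartAt E p).source) :
    fderiv ℝ (fun y ↦ extChartAt 𝓘(ℝ, E) p (ψ y)) x = chartD E p (ψ x) ∘L parD E ψ x := by
  rw [← mfderiv_eq_fderiv]
  have := mfderiv_comp x (mdifferentiableAt_extChartAt (I := 𝓘(ℝ, E)) hp) hψ
  rw [← TangentBundle.continuousLinearMapAt_trivializationAt hp] at this
  exact this

theorem chartD_isInvertible {p q : M} (hq : q ∈ (chartAt E p).source) :
    (chartD E p q).IsInvertible := by
  have := isInvertible_mfderiv_extChartAt (I := 𝓘(ℝ, E)) (x := p) (y := q)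
    (by rwa [extChartAt_source])
  rw [← TangentBundle.continuousLinearMapAt_trivializationAt hq] at this
  exact this

omit [IsManifold 𝓘(ℝ, E) ∞ M] in
theorem contMDiffAt_inner [IsManifold 𝓘(ℝ, E) ∞ M] (g : RMetric E M) {X : Type*}
    [TopologicalSpace X] {E' : Type*} [NormedAddCommGroup E'] [NormedSpace ℝ E']
    [ChartedSpace E' X] {ψ : X → M} {x : X} (hψ : ContMDiffAt 𝓘(ℝ, E') 𝓘(ℝ, E) ∞ ψ x)
    {σ τ : Π x : X, TangentSpace 𝓘(ℝ, E) (ψ x)}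
    (hσ : ContMDiffAt 𝓘(ℝ, E') (𝓘(ℝ, E).prod 𝓘(ℝ, E)) ∞
      (fun y ↦ TotalSpace.mk' E (E := fun q : M ↦ TangentSpace 𝓘(ℝ, E) q) (ψ y) (σ y)) x)
    (hτ : ContMDiffAt 𝓘(ℝ, E') (𝓘(ℝ, E).prod 𝓘(ℝ, E)) ∞
      (fun y ↦ TotalSpace.mk' E (E := fun q : M ↦ TangentSpace 𝓘(ℝ, E) q) (ψ y) (τ y)) x) :
    ContMDiffAt 𝓘(ℝ, E') 𝓘(ℝ, ℝ) ∞ (fun y ↦ g.inner (ψ y) (σ y) (τ y)) x := by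
  have h1 := ContMDiffAt.comp x (g.contMDiff (ψ x)) hψ
  have h2 : ContMDiffAt 𝓘(ℝ, E') (𝓘(ℝ, E).prod 𝓘(ℝ, ℝ)) ∞
      (fun y ↦ TotalSpace.mk' ℝ (E := Bundle.Trivial M ℝ) (ψ y) (g.inner (ψ y) (σ y) (τ y))) x :=
    ContMDiffAt.clm_bundle_apply₂ (F₁ := E) (F₂ := E) h1 hσ hτ
  rw [contMDiffAt_totalSpace] at h2
  exact h2.2

/-- A vector field along a map is smooth if its coordinates are. -/
theorem contMDiffAt_along_iff {X : Type*} [NormedAddCommGroup X] [NormedSpace ℝ X]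
    {ψ : X → M} {x : X} {τ : X → E} (hψ : ContMDiffAt 𝓘(ℝ, X) 𝓘(ℝ, E) ∞ ψ x) :
    ContMDiffAt 𝓘(ℝ, X) (𝓘(ℝ, E).prod 𝓘(ℝ, E)) ∞
      (fun y ↦ TotalSpace.mk' E (E := fun q : M ↦ TangentSpace 𝓘(ℝ, E) q) (ψ y) (τ y)) x
    ↔ ContDiffAt ℝ ∞ (fun y ↦ chartD E (ψ x) (ψ y) (τ y)) x := by
  have hs : ∀ᶠ y in 𝓝 x, ψ y ∈ (chartAt E (ψ x)).source :=
    hψ.continuousAt ((chartAt E (ψ x)).open_source.mem_nhds (mem_chart_source E (ψ x)))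
  have e : (fun y ↦ (trivializationAt E (TangentSpace 𝓘(ℝ, E)) (ψ x)
      (TotalSpace.mk' E (E := fun q : M ↦ TangentSpace 𝓘(ℝ, E) q) (ψ y) (τ y))).2)
      =ᶠ[𝓝 x] (fun y ↦ chartD E (ψ x) (ψ y) (τ y)) := by
    filter_upwards [hs] with y hy
    have := (trivializationAt E (TangentSpace 𝓘(ℝ, E)) (ψ x)).continuousLinearMapAt_apply_of_mem
      (R := ℝ) (b := ψ y) (by simpa using hy) (τ y)
    exact this.symm
  rw [contMDiffAt_totalSpace, ← contMDiffAt_iff_contDiffAt]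
  refine (and_iff_right hψ).trans ?_
  exact e.contMDiffAt_iff

namespace IsParam

variable {V : Set F} {ψ : F → M} (h : IsParam E V ψ) {x : F}
include h

theorem eventually_mem (hx : x ∈ V) : ∀ᶠ y in 𝓝 x, ψ y ∈ (chartAt E (ψ x)).source :=
  (h.contMDiffAt hx).continuousAt
    ((chartAt E (ψ x)).open_source.mem_nhds (mem_chart_source E (ψ x)))

theorem contDiffAt_chart (hx : x ∈ V) :
    ContDiffAt ℝ ∞ (fun y ↦ extChartAt 𝓘(ℝ, E) (ψ x) (ψ y)) x := by
  rw [← contMDiffAt_iff_contDiffAt]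
  exact (contMDiffAt_extChartAt (I := 𝓘(ℝ, E)) (x := ψ x)).comp x (h.contMDiffAt hx)

theorem fderiv_chart (hx : x ∈ V) : fderiv ℝ (fun y ↦ extChartAt 𝓘(ℝ, E) (ψ x) (ψ y))
    =ᶠ[𝓝 x] fun y ↦ chartD E (ψ x) (ψ y) ∘L parD E ψ y := by
  filter_upwards [h.eventually_mem hx, h.mem_nhds hx] with y hy hyV
  exact fderiv_comp_param (h.mdifferentiableAt hyV) hy

theorem contMDiffAt_parD (hx : x ∈ V) (w : F) :
    ContMDiffAt 𝓘(ℝ, F) (𝓘(ℝ, E).prod 𝓘(ℝ, E)) ∞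
      (fun y ↦ TotalSpace.mk' E (E := fun q : M ↦ TangentSpace 𝓘(ℝ, E) q) (ψ y)
        (parD E ψ y w)) x := by
  refine (contMDiffAt_along_iff (h.contMDiffAt hx)).2 ?_
  have := ((h.contDiffAt_chart hx).fderiv_right (m := ∞) (by simp)).clm_apply
    (contDiffAt_const (c := w))
  refine this.congr_of_eventuallyEq ?_
  filter_upwards [h.fderiv_chart hx] with y hy
  rw [hy]; rfl

variable [FiniteDimensional ℝ E] [FiniteDimensional ℝ F]

theorem contDiffAt_parInv (hx : x ∈ V) {τ : F → E}
    (hτ : ContMDiffAt 𝓘(ℝ, F) (𝓘(ℝ, E).prod 𝓘(ℝ, E)) ∞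
      (fun y ↦ TotalSpace.mk' E (E := fun q : M ↦ TangentSpace 𝓘(ℝ, E) q) (ψ y) (τ y)) x) :
    ContDiffAt ℝ ∞ (fun y ↦ parInv E ψ y (τ y)) x := by
  have hτ' := (contMDiffAt_along_iff (h.contMDiffAt hx)).1 hτ
  refine contDiffAt_of_clm_apply ((h.contDiffAt_chart hx).fderiv_right (m := ∞) (by simp)) ?_ hτ' ?_
  · rw [(h.fderiv_chart hx).eq_of_nhds]
    exact (chartD_isInvertible (mem_chart_source E (ψ x))).injective.comp (h.parD_injective hx)
  · filter_upwards [h.fderiv_chart hx, h.mem_nhds hx] with y hy hyV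
    rw [hy, ContinuousLinearMap.comp_apply, h.parD_parInv hyV]

theorem contDiffAt_coordVec (hx : x ∈ V) {Z : VField E M} (hZ : SmoothVFieldAt Z (ψ x)) :
    ContDiffAt ℝ ∞ (coordVec ψ Z) x :=
  h.contDiffAt_parInv hx (ContMDiffAt.comp (g := fun q ↦
    TotalSpace.mk' E (E := fun q : M ↦ TangentSpace 𝓘(ℝ, E) q) q (Z q)) x hZ (h.contMDiffAt hx))

theorem contDiffAt_coordEnd (hx : x ∈ V) {J : EndField E M} (hJ : SmoothEndFieldAt J (ψ x)) :
    ContDiffAt ℝ ∞ (coordEnd ψ J) x := by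
  refine contDiffAt_clm_of_apply fun w ↦ ?_
  have h1 := ContMDiffAt.comp (g := fun q ↦ TotalSpace.mk' (E →L[ℝ] E)
      (E := fun x : M ↦ TangentSpace 𝓘(ℝ, E) x →L[ℝ] TangentSpace 𝓘(ℝ, E) x) q (J q)) x hJ
      (h.contMDiffAt hx)
  exact h.contDiffAt_parInv hx (h1.clm_bundle_apply (h.contMDiffAt_parD hx w))

omit [FiniteDimensional ℝ E] in
theorem contDiffAt_coordForm (hx : x ∈ V) (g : RMetric E M) :
    ContDiffAt ℝ ∞ (coordForm ψ g) x := by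
  refine contDiffAt_clm_of_apply fun u ↦ contDiffAt_clm_of_apply fun v ↦ ?_
  exact contMDiffAt_iff_contDiffAt.1
    (contMDiffAt_inner g (h.contMDiffAt hx) (h.contMDiffAt_parD hx u) (h.contMDiffAt_parD hx v))

end IsParam

end Param

section ParamCalculus

variable {E F : Type*} [NormedAddCommGroup E] [NormedSpace ℝ E] [FiniteDimensional ℝ E]
  [NormedAddCommGroup F] [NormedSpace ℝ F] [FiniteDimensional ℝ F]
  {M : Type*} [TopologicalSpace M] [ChartedSpace E M] [IsManifold 𝓘(ℝ, E) ∞ M]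

theorem SmoothVFieldAt.diff {Z : VField E M} {p : M} (hZ : SmoothVFieldAt Z p) :
    DiffVFieldAt Z p := ContMDiffAt.mdifferentiableAt hZ (by simp)

namespace IsParam

variable {V : Set F} {ψ : F → M} (h : IsParam E V ψ) {x : F}
include h

theorem differentiableAt_coordVec (hx : x ∈ V) {Z : VField E M} (hZ : DiffVFieldAt Z (ψ x)) :
    DifferentiableAt ℝ (coordVec ψ Z) x := by
  have : IsManifold 𝓘(ℝ, E) 2 M := IsManifold.of_le (n := ∞) ENat.LEInfty.out
  have := MDifferentiableAt.mpullback_vectorField (I := 𝓘(ℝ, F)) (f := ψ) (n := 2) (V := Z) hZ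
    ((h.contMDiffAt hx).of_le ENat.LEInfty.out) (h.inv x hx) le_rfl
  rw [mdifferentiableAt_totalSpace] at this
  have := this.2
  rw [mdifferentiableAt_iff_differentiableAt] at this
  refine this.congr_of_eventuallyEq (Filter.Eventually.of_forall fun y ↦ ?_)
  simp [VectorField.mpullback_apply, coordVec]
  rfl

theorem coordVec_mlieBracket (hx : x ∈ V) {X Y : VField E M} (hX : DiffVFieldAt X (ψ x))
    (hY : DiffVFieldAt Y (ψ x)) :
    coordVec ψ (VectorField.mlieBracket 𝓘(ℝ, E) X Y) x
      = fderiv ℝ (coordVec ψ Y) x (coordVec ψ X x)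
        - fderiv ℝ (coordVec ψ X) x (coordVec ψ Y x) := by
  have : IsManifold 𝓘(ℝ, E) (minSmoothness ℝ 3) M := by
    simp only [minSmoothness_of_isRCLikeNormedField]
    exact IsManifold.of_le (n := ∞) ENat.LEInfty.out
  have := VectorField.mpullback_mlieBracket (I := 𝓘(ℝ, F)) (I' := 𝓘(ℝ, E)) (f := ψ) (x₀ := x)
    (n := ∞) hX hY (h.contMDiffAt hx)
    (by simp only [minSmoothness_of_isRCLikeNormedField]; exact ENat.LEInfty.out)
  rw [← VectorField.mlieBracketWithin_univ (I := 𝓘(ℝ, F)),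
    VectorField.mlieBracketWithin_eq_lieBracketWithin] at this
  have e : VectorField.lieBracketWithin ℝ (coordVec ψ X) (coordVec ψ Y) univ x
      = fderiv ℝ (coordVec ψ Y) x (coordVec ψ X x)
        - fderiv ℝ (coordVec ψ X) x (coordVec ψ Y x) := by
    rw [VectorField.lieBracketWithin_univ]; rfl
  exact this.trans e

omit [FiniteDimensional ℝ E] [FiniteDimensional ℝ F] in
theorem mvfderiv_parD (hx : x ∈ V) {f : M → ℝ} (hf : MDifferentiableAt 𝓘(ℝ, E) 𝓘(ℝ, ℝ) f (ψ x))
    (u : F) : mvfderiv 𝓘(ℝ, E) f (ψ x) (parD E ψ x u) = fderiv ℝ (fun y ↦ f (ψ y)) x u := by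
  have := mfderiv_comp x hf (h.mdifferentiableAt hx)
  rw [← mfderiv_eq_fderiv]
  exact (congrArg (fun T : F →L[ℝ] ℝ ↦ T u) this).symm

omit [FiniteDimensional ℝ E] [FiniteDimensional ℝ F] in
theorem metric_eq_coordForm (hx : x ∈ V) (g : RMetric E M) (u v : E) :
    metricForm g (ψ x) u v = coordForm ψ g x (parInv E ψ x u) (parInv E ψ x v) := by
  rw [coordForm_apply, h.parD_parInv hx, h.parD_parInv hx]

omit [FiniteDimensional ℝ E] [FiniteDimensional ℝ F] in
theorem isInnerForm_coordForm (hx : x ∈ V) (g : RMetric E M) : IsInnerForm (coordForm ψ g x) where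
  symm _ _ := g.symm _ _ _
  pos _ hu := g.pos _ _ fun h0 ↦ hu <| h.parD_injective hx (h0.trans (map_zero _).symm)

omit [FiniteDimensional ℝ E] [FiniteDimensional ℝ F] in
theorem parInv_endForm (hx : x ∈ V) (J : EndField E M) (u : E) :
    parInv E ψ x (endForm J (ψ x) u) = coordEnd ψ J x (parInv E ψ x u) := by
  rw [coordEnd_apply, h.parD_parInv hx]

end IsParam

variable (E) in
/-- The parametrisation inverse to the chart at `p`. -/
def chartPar (p : M) : E → M := (extChartAt 𝓘(ℝ, E) p).symm

variable (E) in
/-- The domain of `chartPar p`. -/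
def chartDom (p : M) : Set E := (extChartAt 𝓘(ℝ, E) p).target

omit [FiniteDimensional ℝ E] [IsManifold 𝓘(ℝ, E) ∞ M] in
theorem chartPar_self (p : M) : chartPar E p (extChartAt 𝓘(ℝ, E) p p) = p := extChartAt_to_inv p

omit [FiniteDimensional ℝ E] [IsManifold 𝓘(ℝ, E) ∞ M] in
theorem mem_chartDom (p : M) : extChartAt 𝓘(ℝ, E) p p ∈ chartDom E p := mem_extChartAt_target p

omit [FiniteDimensional ℝ E] [IsManifold 𝓘(ℝ, E) ∞ M] in
theorem chartPar_extChartAt {p q : M} (hq : q ∈ (chartAt E p).source) :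
    chartPar E p (extChartAt 𝓘(ℝ, E) p q) = q :=
  (extChartAt 𝓘(ℝ, E) p).left_inv (by rwa [extChartAt_source])

omit [FiniteDimensional ℝ E] [IsManifold 𝓘(ℝ, E) ∞ M] in
theorem extChartAt_mem_chartDom {p q : M} (hq : q ∈ (chartAt E p).source) :
    extChartAt 𝓘(ℝ, E) p q ∈ chartDom E p :=
  (extChartAt 𝓘(ℝ, E) p).map_source (by rwa [extChartAt_source])

omit [FiniteDimensional ℝ E] [IsManifold 𝓘(ℝ, E) ∞ M] in
theorem extChartAt_chartPar {p : M} {x : E} (hx : x ∈ chartDom E p) :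
    extChartAt 𝓘(ℝ, E) p (chartPar E p x) = x := (extChartAt 𝓘(ℝ, E) p).right_inv hx

omit [FiniteDimensional ℝ E] [IsManifold 𝓘(ℝ, E) ∞ M] in
theorem chartPar_mem {p : M} {x : E} (hx : x ∈ chartDom E p) :
    chartPar E p x ∈ (chartAt E p).source := by
  rw [← extChartAt_source (I := 𝓘(ℝ, E))]
  exact (extChartAt 𝓘(ℝ, E) p).map_target hx

variable (E) in
theorem isParam_chart (p : M) :
    IsParam E (chartDom E p) (chartPar E p) where
  isOpen := isOpen_extChartAt_target p
  smooth := contMDiffOn_extChartAt_symm p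
  inv x hx := by
    have := isInvertible_mfderivWithin_extChartAt_symm (I := 𝓘(ℝ, E)) hx
    rw [show range (𝓘(ℝ, E) : E → E) = univ by simp, mfderivWithin_univ] at this
    exact this

theorem parInv_chart {p q : M} (hq : q ∈ (chartAt E p).source) :
    parInv E (chartPar E p) (extChartAt 𝓘(ℝ, E) p q) = chartD E p q := by
  have ht := extChartAt_mem_chartDom hq
  have hP := isParam_chart E p
  have h1 := fderiv_comp_param (hP.mdifferentiableAt ht) (p := p)
    (by rwa [chartPar_extChartAt hq])
  have h2 : (fun y ↦ extChartAt 𝓘(ℝ, E) p (chartPar E p y))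
      =ᶠ[𝓝 (extChartAt 𝓘(ℝ, E) p q)] id := by
    filter_upwards [hP.mem_nhds ht] with y hy using extChartAt_chartPar hy
  rw [h2.fderiv_eq, fderiv_id, chartPar_extChartAt hq] at h1
  ext u
  have h3 := congrArg (fun T : E →L[ℝ] E ↦
    T (parInv E (chartPar E p) (extChartAt 𝓘(ℝ, E) p q) u)) h1
  simp only [ContinuousLinearMap.comp_apply, hP.parD_parInv ht] at h3
  exact h3

/-- The inverse of the chart differential, as the inverse of the trivialisation. -/
theorem symmL_eq_parD {p q : M} (hq : q ∈ (chartAt E p).source) (u : E) :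
    ((trivializationAt E (TangentSpace 𝓘(ℝ, E)) p).symmL ℝ q u : E)
      = parD E (chartPar E p) (extChartAt 𝓘(ℝ, E) p q) u := by
  have hP := isParam_chart E p
  have ht := extChartAt_mem_chartDom hq
  apply hP.parInv_injective ht
  rw [hP.parInv_parD ht, parInv_chart hq]
  exact (trivializationAt E (TangentSpace 𝓘(ℝ, E)) p).continuousLinearMapAt_symmL hq u

theorem smoothEndFieldAt_of_coordEnd {J : EndField E M} {p : M}
    (hJ : ContDiffAt ℝ ∞ (coordEnd (chartPar E p) J) (extChartAt 𝓘(ℝ, E) p p)) :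
    SmoothEndFieldAt J p := by
  rw [SmoothEndFieldAt, contMDiffAt_hom_bundle]
  refine ⟨contMDiffAt_id, ?_⟩
  have h1 := ContMDiffAt.comp p (contMDiffAt_iff_contDiffAt.2 hJ)
    (contMDiffAt_extChartAt (I := 𝓘(ℝ, E)) (n := ∞) (x := p))
  refine h1.congr_of_eventuallyEq ?_
  filter_upwards [(chartAt E p).open_source.mem_nhds (mem_chart_source E p)] with q hq
  ext u
  have e := symmL_eq_parD hq u
  simp only [Function.comp_apply]
  rw [coordEnd_apply, chartPar_extChartAt hq, ← e, parInv_chart hq]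
  rfl

theorem contMDiffAt_metric_of_coord {g : Π q : M, TangentSpace 𝓘(ℝ, E) q →L[ℝ]
    TangentSpace 𝓘(ℝ, E) q →L[ℝ] ℝ} {G : M → E →L[ℝ] E →L[ℝ] ℝ} (hG : ∀ q, G q = g q) {p : M}
    (h : ∀ u v : E, ContDiffAt ℝ ∞ (fun y ↦ G (chartPar E p y)
      (parD E (chartPar E p) y u) (parD E (chartPar E p) y v))
      (extChartAt 𝓘(ℝ, E) p p)) :
    ContMDiffAt 𝓘(ℝ, E) (𝓘(ℝ, E).prod 𝓘(ℝ, E →L[ℝ] E →L[ℝ] ℝ)) ∞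
      (fun b ↦ TotalSpace.mk' (E →L[ℝ] E →L[ℝ] ℝ)
        (E := fun q : M ↦ TangentSpace 𝓘(ℝ, E) q →L[ℝ] TangentSpace 𝓘(ℝ, E) q →L[ℝ] ℝ)
        b (g b)) p := by
  rw [contMDiffAt_hom_bundle]
  refine ⟨contMDiffAt_id, ?_⟩
  have h0 : ContDiffAt ℝ ∞ (fun y ↦ (G (chartPar E p y)).bilinearComp
      (parD E (chartPar E p) y) (parD E (chartPar E p) y))
      (extChartAt 𝓘(ℝ, E) p p) :=
    contDiffAt_clm_of_apply fun u ↦ contDiffAt_clm_of_apply fun v ↦ h u v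
  have h1 := ContMDiffAt.comp p (contMDiffAt_iff_contDiffAt.2 h0)
    (contMDiffAt_extChartAt (I := 𝓘(ℝ, E)) (n := ∞) (x := p))
  refine h1.congr_of_eventuallyEq ?_
  filter_upwards [(chartAt E p).open_source.mem_nhds (mem_chart_source E p)] with q hq
  ext u v
  rw [inCoordinates_apply_eq₂ hq hq (by simp)]
  simp only [Function.comp_apply, ContinuousLinearMap.bilinearComp_apply]
  have e := symmL_eq_parD hq u
  have e' := symmL_eq_parD hq v
  rw [chartPar_extChartAt hq, ← e, ← e', hG]
  simp only [Trivial.fiberBundle_trivializationAt', Trivial.linearMapAt_trivialization,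
    LinearMap.id_coe, id_eq]
  rw [← Trivialization.symmL_apply (R := ℝ) _ hq, ← Trivialization.symmL_apply (R := ℝ) _ hq]
  rfl

end ParamCalculus

section Koszul

variable {E : Type*} [NormedAddCommGroup E] [NormedSpace ℝ E] [FiniteDimensional ℝ E]

set_option synthInstance.maxHeartbeats 400000

/-- The right hand side of the Koszul formula. -/
def koszulForm (G : E → E →L[ℝ] E →L[ℝ] ℝ) (x u v : E) : E →L[ℝ] ℝ :=
  (2⁻¹ : ℝ) • (fderiv ℝ G x u v + fderiv ℝ G x v u - ((fderiv ℝ G x).flip u).flip v)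

theorem koszulForm_apply (G : E → E →L[ℝ] E →L[ℝ] ℝ) (x u v w : E) :
    koszulForm G x u v w
      = 2⁻¹ * (fderiv ℝ G x u v w + fderiv ℝ G x v u w - fderiv ℝ G x w u v) := rfl

theorem koszulForm_add (G : E → E →L[ℝ] E →L[ℝ] ℝ) (x u v w : E) :
    koszulForm G x (u + v) w = koszulForm G x u w + koszulForm G x v w := by
  ext z
  have h := (fderiv ℝ G x).map_add u v
  rw [_root_.add_apply, koszulForm_apply, koszulForm_apply, koszulForm_apply, h, map_add, map_add]
  simp only [_root_.add_apply]
  ring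

theorem koszulForm_smul (G : E → E →L[ℝ] E →L[ℝ] ℝ) (c : ℝ) (x u w : E) :
    koszulForm G x (c • u) w = c • koszulForm G x u w := by
  ext z
  have h := (fderiv ℝ G x).map_smul c u
  rw [_root_.smul_apply, koszulForm_apply, koszulForm_apply, h, map_smul, map_smul]
  simp only [_root_.smul_apply, smul_eq_mul]
  ring

/-- The Christoffel symbols of the metric `G`. -/
def christoffel (G : E → E →L[ℝ] E →L[ℝ] ℝ) (x u : E) : E →L[ℝ] E :=
  LinearMap.toContinuousLinearMap
    { toFun := fun v ↦ (G x).inverse (koszulForm G x u v)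
      map_add' := fun v w ↦ by
        rw [← map_add]
        congr 1
        ext z
        simp only [koszulForm_apply, map_add, _root_.add_apply]
        ring
      map_smul' := fun c v ↦ by
        rw [RingHom.id_apply, ← map_smul]
        congr 1
        ext z
        simp only [koszulForm_apply, map_smul, _root_.smul_apply, smul_eq_mul]
        ring }

theorem christoffel_apply (G : E → E →L[ℝ] E →L[ℝ] ℝ) (x u v : E) :
    christoffel G x u v = (G x).inverse (koszulForm G x u v) := rfl

theorem IsInnerForm.isInvertible {g : E →L[ℝ] E →L[ℝ] ℝ} (hg : IsInnerForm g) :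
    g.IsInvertible := by
  have hinj : Function.Injective (g : E →ₗ[ℝ] E →L[ℝ] ℝ) := by
    rw [injective_iff_map_eq_zero]
    intro u hu
    by_contra hne
    have h1 := hg.pos u hne
    have h2 : g u = 0 := hu
    rw [h2] at h1
    simp at h1
  have hd : Module.finrank ℝ E = Module.finrank ℝ (E →L[ℝ] ℝ) := by
    rw [← LinearMap.toContinuousLinearMap.finrank_eq]
    exact (Subspace.dual_finrank_eq (K := ℝ) (V := E)).symm
  refine ⟨(LinearEquiv.ofInjectiveOfFinrankEq (g : E →ₗ[ℝ] E →L[ℝ] ℝ) hinj hd).toContinuousLinearEquiv, ?_⟩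
  ext u v
  rfl

variable {U : Set E} {G : E → E →L[ℝ] E →L[ℝ] ℝ}

theorem flatLC_christoffel (hU : IsOpen U) (hG : ∀ x ∈ U, ContDiffAt ℝ ∞ G x)
    (hpos : ∀ x ∈ U, IsInnerForm (G x)) : FlatLC U G (christoffel G) := by
  have hd : ∀ x ∈ U, DifferentiableAt ℝ G x := fun x hx ↦ (hG x hx).differentiableAt (by simp)
  have hf : ∀ x ∈ U, ∀ u v w, fderiv ℝ G x u v w = fderiv ℝ (fun y ↦ G y v w) x u := by
    intro x hx u v w
    have := ((hd x hx).hasFDerivAt.clm_apply (hasFDerivAt_const v x)).clm_apply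
      (hasFDerivAt_const w x)
    rw [this.fderiv]
    simp
  have hsymm : ∀ x ∈ U, ∀ u v w, fderiv ℝ G x u v w = fderiv ℝ G x u w v := by
    intro x hx u v w
    rw [hf x hx, hf x hx]
    congr 1
    refine Filter.EventuallyEq.fderiv_eq ?_
    filter_upwards [hU.mem_nhds hx] with y hy using (hpos y hy).symm v w
  have hΓ : ∀ x ∈ U, ∀ u v, G x (christoffel G x u v) = koszulForm G x u v := fun x hx u v ↦
    (hpos x hx).isInvertible.self_apply_inverse _
  refine ⟨hU, fun x hx ↦ (hG x hx).contDiffWithinAt, ?_, hpos, ?_, ?_, ?_, ?_⟩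
  · intro u x hx
    refine (contDiffAt_clm_of_apply fun v ↦ ?_).contDiffWithinAt
    have hk : ContDiffAt ℝ ∞ (fun y ↦ koszulForm G y u v) x := by
      refine contDiffAt_clm_of_apply fun w ↦ ?_
      have h2 : ∀ a b c : E, ContDiffAt ℝ ∞ (fun y ↦ fderiv ℝ G y a b c) x := by
        intro a b c
        have h1 : ContDiffAt ℝ ∞ (fun y ↦ G y b c) x :=
          ((hG x hx).clm_apply contDiffAt_const).clm_apply contDiffAt_const
        have h3 := (h1.fderiv_right (m := ∞) (by simp)).clm_apply (contDiffAt_const (c := a))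
        refine h3.congr_of_eventuallyEq ?_
        filter_upwards [hU.mem_nhds hx] with y hy using hf y hy a b c
      simp only [koszulForm_apply]
      exact contDiffAt_const.mul (((h2 u v w).add (h2 v u w)).sub (h2 w u v))
    refine contDiffAt_of_clm_apply (hG x hx) (hpos x hx).isInvertible.injective hk ?_
    filter_upwards [hU.mem_nhds hx] with y hy using hΓ y hy u v
  · intro x u v
    ext w
    rw [christoffel_apply, _root_.add_apply, christoffel_apply, christoffel_apply, ← map_add,
      koszulForm_add]
  · intro c x u
    ext w
    rw [christoffel_apply, _root_.smul_apply, christoffel_apply, ← map_smul, koszulForm_smul]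
  · intro x hx u v
    rw [christoffel_apply, christoffel_apply]
    congr 1
    ext w
    simp only [koszulForm_apply]
    rw [hsymm x hx w u v]
    ring
  · intro x hx u v w
    rw [hΓ x hx, (hpos x hx).symm v, hΓ x hx, koszulForm_apply, koszulForm_apply, ← hf x hx,
      hsymm x hx u w v, hsymm x hx w u v]
    ring

end Koszul

namespace FlatLC

variable {E : Type*} [NormedAddCommGroup E] [NormedSpace ℝ E]
variable {U : Set E} {G : E → E →L[ℝ] E →L[ℝ] ℝ} {Γ : E → E → E →L[ℝ] E} (h : FlatLC U G Γ) {x : E}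
include h

theorem mono {U' : Set E} (hU' : IsOpen U') (hs : U' ⊆ U) : FlatLC U' G Γ :=
  ⟨hU', h.smoothG.mono hs, fun u ↦ (h.smoothΓ u).mono hs, fun x hx ↦ h.inner x (hs hx), h.add,
    h.smul, fun x hx ↦ h.symm x (hs hx), fun x hx ↦ h.metric x (hs hx)⟩

theorem covVec_sub_covVec (hx : x ∈ U) (X Y : E → E) :
    covVec Γ Y x (X x) - covVec Γ X x (Y x) = fderiv ℝ Y x (X x) - fderiv ℝ X x (Y x) := by
  rw [covVec, covVec, h.symm x hx]
  abel

/-- The curvature in terms of iterated covariant derivatives. -/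
theorem curvature_eq [FiniteDimensional ℝ E] {X Y Z : E → E} (hx : x ∈ U)
    (hX : DifferentiableAt ℝ X x) (hY : DifferentiableAt ℝ Y x) (hZ : ContDiffOn ℝ ∞ Z U) :
    covVec Γ (fun y ↦ covVec Γ Z y (Y y)) x (X x) - covVec Γ (fun y ↦ covVec Γ Z y (X y)) x (Y x)
      - covVec Γ Z x (fderiv ℝ Y x (X x) - fderiv ℝ X x (Y x))
      = flatCurv Γ x (X x) (Y x) (Z x) := by
  have hA : DifferentiableAt ℝ (nablaEnd Γ Z) x :=
    ((h.smooth_nablaEnd hZ).contDiffAt (h.mem_nhds hx)).differentiableAt (by simp)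
  have e : ∀ W : E → E, (fun y ↦ covVec Γ Z y (W y)) =ᶠ[𝓝 x] fun y ↦ nablaEnd Γ Z y (W y) := by
    intro W
    filter_upwards [h.mem_nhds hx] with y hy using (h.nablaEnd_apply hy Z (W y)).symm
  rw [covVec_congr (e Y), covVec_congr (e X), covVec_apply hA hY, covVec_apply hA hX,
    ← h.covEnd_nablaEnd_sub hZ hx, ← h.covVec_sub_covVec hx,
    ← h.nablaEnd_apply hx Z (_ - _), map_sub]
  abel

end FlatLC

section LeviCivita

variable {E : Type*} [NormedAddCommGroup E] [NormedSpace ℝ E] [FiniteDimensional ℝ E]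
  {M : Type*} [TopologicalSpace M] [ChartedSpace E M] [IsManifold 𝓘(ℝ, E) ∞ M]

/-- The Christoffel symbols in the chart at `p`. -/
def chartΓ (g : RMetric E M) (p : M) : E → E → E →L[ℝ] E := christoffel (coordForm (chartPar E p) g)

theorem flatLC_chart (g : RMetric E M) (p : M) :
    FlatLC (chartDom E p) (coordForm (chartPar E p) g) (chartΓ g p) :=
  flatLC_christoffel (isOpen_extChartAt_target p)
    (fun _ hx ↦ (isParam_chart E p).contDiffAt_coordForm hx g)
    (fun _ hx ↦ (isParam_chart E p).isInnerForm_coordForm hx g)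

theorem mdifferentiableAt_metric (g : RMetric E M) {Y Z : VField E M} {p : M}
    (hY : DiffVFieldAt Y p) (hZ : DiffVFieldAt Z p) :
    MDifferentiableAt 𝓘(ℝ, E) 𝓘(ℝ, ℝ) (fun q ↦ g.inner q (Y q) (Z q)) p := by
  have h1 := g.contMDiff.mdifferentiableAt (x := p) (by simp)
  have h2 : MDifferentiableAt 𝓘(ℝ, E) (𝓘(ℝ, E).prod 𝓘(ℝ, ℝ))
      (fun y ↦ TotalSpace.mk' ℝ (E := Bundle.Trivial M ℝ) y (g.inner y (Y y) (Z y))) p :=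
    MDifferentiableAt.clm_bundle_apply₂ (F₁ := E) (F₂ := E) h1 hY hZ
  rw [mdifferentiableAt_totalSpace] at h2
  exact h2.2

/-- The derivative of `g(Y,Z)` in coordinates. -/
theorem mvfderiv_metric (g : RMetric E M) (p : M) {x : E} (hx : x ∈ chartDom E p) {q : M}
    (hq : chartPar E p x = q) {Y Z : VField E M}
    (hY : DiffVFieldAt Y q) (hZ : DiffVFieldAt Z q) (u : E) :
    mvfderiv 𝓘(ℝ, E) (fun q ↦ g.inner q (Y q) (Z q)) q (parD E (chartPar E p) x u)
      = metricForm g q (parD E (chartPar E p) x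
          (covVec (chartΓ g p) (coordVec (chartPar E p) Y) x u)) (Z q)
        + metricForm g q (Y q) (parD E (chartPar E p) x
          (covVec (chartΓ g p) (coordVec (chartPar E p) Z) x u)) := by
  subst hq
  have hP := isParam_chart E p
  have hL := flatLC_chart g p
  have e : (fun y ↦ g.inner (chartPar E p y) (Y (chartPar E p y)) (Z (chartPar E p y))) =ᶠ[𝓝 x]
      fun y ↦ coordForm (chartPar E p) g y (coordVec (chartPar E p) Y y)
        (coordVec (chartPar E p) Z y) := by
    filter_upwards [hP.mem_nhds hx] with y hy
    exact hP.metric_eq_coordForm hy g _ _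
  refine (hP.mvfderiv_parD hx (mdifferentiableAt_metric g hY hZ) u).trans ?_
  rw [e.fderiv_eq, (hL.metric x hx).fderiv_inner (hL.diffG hx) (hP.differentiableAt_coordVec hx hY)
    (hP.differentiableAt_coordVec hx hZ) u, coordForm_apply, coordForm_apply,
    hP.parD_coordVec hx, hP.parD_coordVec hx]

/-- The Levi-Civita connection, defined in charts. -/
def chartLC (g : RMetric E M) : VField E M → EndField E M := fun Y p ↦
  parD E (chartPar E p) (extChartAt 𝓘(ℝ, E) p p)
    ∘L nablaEnd (chartΓ g p) (coordVec (chartPar E p) Y) (extChartAt 𝓘(ℝ, E) p p)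
    ∘L parInv E (chartPar E p) (extChartAt 𝓘(ℝ, E) p p)

theorem chartLC_apply (g : RMetric E M) (Y : VField E M) (p : M) (u : E) :
    chartLC g Y p u = parD E (chartPar E p) (extChartAt 𝓘(ℝ, E) p p)
      (covVec (chartΓ g p) (coordVec (chartPar E p) Y) (extChartAt 𝓘(ℝ, E) p p)
        (parInv E (chartPar E p) (extChartAt 𝓘(ℝ, E) p p) u)) := by
  rw [← (flatLC_chart g p).nablaEnd_apply (mem_chartDom p)]
  rfl

theorem isLeviCivita_chartLC (g : RMetric E M) : IsLeviCivita g (chartLC g) := by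
  have h0 := fun p : M ↦ chartPar_self (E := E) p
  have hP := fun p : M ↦ isParam_chart E p
  have hm := fun p : M ↦ mem_chartDom (E := E) p
  have hd : ∀ (p : M) (σ : VField E M), DiffVFieldAt σ p →
      DifferentiableAt ℝ (coordVec (chartPar E p) σ) (extChartAt 𝓘(ℝ, E) p p) :=
    fun p σ hσ ↦ (hP p).differentiableAt_coordVec (hm p) (by rw [h0]; exact hσ)
  refine ⟨⟨?_, ?_⟩, ?_, ?_⟩
  · intro σ τ p hσ hτ _
    have e : coordVec (chartPar E p) (σ + τ)
        = fun y ↦ coordVec (chartPar E p) σ y + coordVec (chartPar E p) τ y := by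
      funext y
      exact map_add (parInv E (chartPar E p) y) _ _
    ext u
    refine (chartLC_apply g (σ + τ) p u).trans ?_
    refine Eq.trans ?_ (congrArg₂ (· + ·) (chartLC_apply g σ p u) (chartLC_apply g τ p u)).symm
    refine Eq.trans (congrArg _ ?_) (map_add (parD E (chartPar E p) (extChartAt 𝓘(ℝ, E) p p)) _ _)
    rw [covVec, e, fderiv_fun_add (hd p σ hσ) (hd p τ hτ), covVec, covVec, _root_.add_apply, map_add]
    abel
  · intro σ f p hσ hf _
    have hf' : MDifferentiableAt 𝓘(ℝ, E) 𝓘(ℝ, ℝ) f (chartPar E p (extChartAt 𝓘(ℝ, E) p p)) := by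
      rw [h0]; exact hf
    have df : DifferentiableAt ℝ (fun y ↦ f (chartPar E p y)) (extChartAt 𝓘(ℝ, E) p p) := by
      rw [← mdifferentiableAt_iff_differentiableAt]
      exact hf'.comp _ ((hP p).mdifferentiableAt (hm p))
    have e : coordVec (chartPar E p) (f • σ)
        = fun y ↦ f (chartPar E p y) • coordVec (chartPar E p) σ y := by
      funext y
      exact map_smul (parInv E (chartPar E p) y) _ _
    have key : ∀ q, chartPar E p (extChartAt 𝓘(ℝ, E) p p) = q → ∀ u s : E, s = σ q →
        parD E (chartPar E p) (extChartAt 𝓘(ℝ, E) p p)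
          (covVec (chartΓ g p) (coordVec (chartPar E p) (f • σ)) (extChartAt 𝓘(ℝ, E) p p)
            (parInv E (chartPar E p) (extChartAt 𝓘(ℝ, E) p p) u))
        = f q • parD E (chartPar E p) (extChartAt 𝓘(ℝ, E) p p)
          (covVec (chartΓ g p) (coordVec (chartPar E p) σ) (extChartAt 𝓘(ℝ, E) p p)
            (parInv E (chartPar E p) (extChartAt 𝓘(ℝ, E) p p) u))
          + (mvfderiv 𝓘(ℝ, E) f q : E →L[ℝ] ℝ) u • s := by
      rintro q rfl u s hs
      have k2 := (hP p).mvfderiv_parD (hm p) hf'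
        (parInv E (chartPar E p) (extChartAt 𝓘(ℝ, E) p p) u)
      rw [(hP p).parD_parInv (hm p)] at k2
      have k3 := (hP p).parD_coordVec (hm p) σ
      have k4 : covVec (chartΓ g p) (coordVec (chartPar E p) (f • σ)) (extChartAt 𝓘(ℝ, E) p p)
          (parInv E (chartPar E p) (extChartAt 𝓘(ℝ, E) p p) u)
          = f (chartPar E p (extChartAt 𝓘(ℝ, E) p p)) •
            covVec (chartΓ g p) (coordVec (chartPar E p) σ) (extChartAt 𝓘(ℝ, E) p p)
              (parInv E (chartPar E p) (extChartAt 𝓘(ℝ, E) p p) u)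
            + fderiv ℝ (fun y ↦ f (chartPar E p y)) (extChartAt 𝓘(ℝ, E) p p)
              (parInv E (chartPar E p) (extChartAt 𝓘(ℝ, E) p p) u)
                • coordVec (chartPar E p) σ (extChartAt 𝓘(ℝ, E) p p) := by
        rw [covVec, e, fderiv_fun_smul df (hd p σ hσ), covVec]
        simp only [_root_.add_apply, _root_.smul_apply, ContinuousLinearMap.smulRight_apply,
          map_smul, smul_add]
        abel
      rw [k4, map_add, map_smul, map_smul, ← k2, k3, hs]
    have key' : ∀ u s : E, s = σ p → endForm (chartLC g (f • σ)) p u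
        = f p • endForm (chartLC g σ) p u + (mvfderiv 𝓘(ℝ, E) f p : E →L[ℝ] ℝ) u • s := by
      intro u s hs
      have := key p (h0 p) u s hs
      rw [← chartLC_apply, ← chartLC_apply] at this
      exact this
    ext u
    exact key' u _ rfl
  · intro p Y Z hY hZ
    change ∀ u : E, _
    intro u
    have := mvfderiv_metric g p (hm p) (h0 p) hY hZ
      (parInv E (chartPar E p) (extChartAt 𝓘(ℝ, E) p p) u)
    rw [(hP p).parD_parInv (hm p), ← chartLC_apply, ← chartLC_apply] at this
    exact this
  · intro p X Y hX hY
    have key : ∀ q, chartPar E p (extChartAt 𝓘(ℝ, E) p p) = q → DiffVFieldAt X q →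
        DiffVFieldAt Y q → parD E (chartPar E p) (extChartAt 𝓘(ℝ, E) p p)
          (covVec (chartΓ g p) (coordVec (chartPar E p) Y) (extChartAt 𝓘(ℝ, E) p p)
            (parInv E (chartPar E p) (extChartAt 𝓘(ℝ, E) p p) (X q)))
        - parD E (chartPar E p) (extChartAt 𝓘(ℝ, E) p p)
          (covVec (chartΓ g p) (coordVec (chartPar E p) X) (extChartAt 𝓘(ℝ, E) p p)
            (parInv E (chartPar E p) (extChartAt 𝓘(ℝ, E) p p) (Y q)))
        = (VectorField.mlieBracket 𝓘(ℝ, E) X Y q : E) := by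
      rintro q rfl hX hY
      rw [← map_sub]
      refine Eq.trans (congrArg _ ?_) ((hP p).parD_coordVec (hm p) _)
      exact ((flatLC_chart g p).covVec_sub_covVec (hm p) _ _).trans
        ((hP p).coordVec_mlieBracket (hm p) hX hY).symm
    exact (congrArg₂ (· - ·) (chartLC_apply g Y p _) (chartLC_apply g X p _)).trans
      (key p (h0 p) hX hY)

theorem leviCivita_spec (g : RMetric E M) : IsLeviCivita g (leviCivita g) :=
  Classical.epsilon_spec (p := fun D ↦ IsLeviCivita g D) ⟨_, isLeviCivita_chartLC g⟩

end LeviCivita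

section LeviCivitaChart

variable {E : Type*} [NormedAddCommGroup E] [NormedSpace ℝ E] [FiniteDimensional ℝ E]
  {M : Type*} [TopologicalSpace M] [ChartedSpace E M] [IsManifold 𝓘(ℝ, E) ∞ M]

/-- A vector field with values in the model space. -/
def vecForm (Z : VField E M) (q : M) : E := Z q

/-- An extension of a tangent vector which is smooth near its base point. -/
def extVec (q : M) (w : TangentSpace 𝓘(ℝ, E) q) : VField E M := FiberBundle.extend E w

omit [FiniteDimensional ℝ E] in
theorem extVec_self (q : M) (w : E) : vecForm (extVec q w) q = w := by
  apply FiberBundle.extend_apply_self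

omit [FiniteDimensional ℝ E] in
theorem eventually_smooth_extVec (q : M) (w : TangentSpace 𝓘(ℝ, E) q) :
    ∃ S : Set M, IsOpen S ∧ q ∈ S ∧ ∀ y ∈ S, SmoothVFieldAt (extVec q w) y := by
  obtain ⟨S, hS, hZS⟩ := FiberBundle.exists_contMDiffOn_extend (k := ∞) 𝓘(ℝ, E) E w
  obtain ⟨S', hS', hS'o, hxS'⟩ := mem_nhds_iff.1 hS
  exact ⟨S', hS'o, hxS', fun y hy ↦
    (hZS y (hS' hy)).contMDiffAt (Filter.mem_of_superset (hS'o.mem_nhds hy) hS')⟩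

omit [FiniteDimensional ℝ E] in
theorem smoothVFieldAt_extVec (q : M) (w : TangentSpace 𝓘(ℝ, E) q) :
    SmoothVFieldAt (extVec q w) q := by
  obtain ⟨S, -, hq, hS⟩ := eventually_smooth_extVec q w
  exact hS q hq

/-- The covariant derivative of the Levi-Civita connection in coordinates. -/
theorem IsLeviCivita.eq_covVec {g : RMetric E M} {D : VField E M → EndField E M}
    (hD : IsLeviCivita g D) (p : M) {x : E} (hx : x ∈ chartDom E p) {q : M}
    (hq : chartPar E p x = q) {Y : VField E M} (hY : DiffVFieldAt Y q) (u : E) :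
    endForm (D Y) q u = parD E (chartPar E p) x
      (covVec (chartΓ g p) (coordVec (chartPar E p) Y) x (parInv E (chartPar E p) x u)) := by
  have hP := isParam_chart E p
  let B : VField E M → E → E := fun Y u ↦ endForm (D Y) q u - parD E (chartPar E p) x
    (covVec (chartΓ g p) (coordVec (chartPar E p) Y) x (parInv E (chartPar E p) x u))
  have hG : IsInnerForm (metricForm g q) := ⟨g.symm q, g.pos q⟩
  have hm : ∀ Y Z : VField E M, DiffVFieldAt Y q → DiffVFieldAt Z q → ∀ u : E,
      metricForm g q (B Y u) (vecForm Z q)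
        = -metricForm g q (B Z u) (vecForm Y q) := by
    intro Y Z hY hZ u
    have h1 := hD.metric q Y Z hY hZ u
    have h2 := mvfderiv_metric g p hx hq hY hZ (parInv E (chartPar E p) x u)
    rw [hP.parD_parInv hx] at h2
    have h3 : metricForm g q (endForm (D Y) q u) (vecForm Z q) + metricForm g q (vecForm Y q) (endForm (D Z) q u)
      = metricForm g q (parD E (chartPar E p) x (covVec (chartΓ g p) (coordVec (chartPar E p) Y) x
          (parInv E (chartPar E p) x u))) (vecForm Z q)
        + metricForm g q (vecForm Y q) (parD E (chartPar E p) x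
          (covVec (chartΓ g p) (coordVec (chartPar E p) Z) x (parInv E (chartPar E p) x u))) :=
      h1.symm.trans h2
    rw [hG.symm (vecForm Y q), hG.symm (vecForm Y q)] at h3
    simp only [B, map_sub, _root_.sub_apply]
    linarith
  have ht : ∀ X Y : VField E M, DiffVFieldAt X q → DiffVFieldAt Y q → B Y (vecForm X q) = B X (vecForm Y q) := by
    intro X Y hX hY
    have h1 : endForm (D Y) q (X q) - endForm (D X) q (Y q)
      = VectorField.mlieBracket 𝓘(ℝ, E) X Y q := hD.torsion_free q X Y hX hY
    have h2 : parD E (chartPar E p) x (covVec (chartΓ g p) (coordVec (chartPar E p) Y) x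
          (parInv E (chartPar E p) x (X q)))
        - parD E (chartPar E p) x (covVec (chartΓ g p) (coordVec (chartPar E p) X) x
          (parInv E (chartPar E p) x (Y q))) = VectorField.mlieBracket 𝓘(ℝ, E) X Y q := by
      subst hq
      rw [← map_sub]
      refine Eq.trans (congrArg _ ?_) (hP.parD_coordVec hx _)
      exact ((flatLC_chart g p).covVec_sub_covVec hx _ _).trans
        (hP.coordVec_mlieBracket hx hX hY).symm
    have h3 := h1.trans h2.symm
    simp only [B]
    rw [sub_eq_sub_iff_sub_eq_sub]
    exact h3
  have hs : ∀ X Y Z : VField E M, DiffVFieldAt X q → DiffVFieldAt Y q → DiffVFieldAt Z q →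
      metricForm g q (B Y (vecForm X q)) (vecForm Z q) = 0 := by
    intro X Y Z hX hY hZ
    have h1 := hm Y Z hY hZ (vecForm X q)
    have h2 := hm X Y hX hY (vecForm Z q)
    have h3 := hm Z X hZ hX (vecForm Y q)
    rw [ht X Y hX hY, ht X Z hX hZ] at *
    rw [ht Y Z hY hZ] at *
    linarith
  refine sub_eq_zero.1 (hG.eq_of_forall (u := B Y u) fun z ↦ ?_)
  have := hs (extVec q u) Y (extVec q z) (smoothVFieldAt_extVec q u).diff hY
    (smoothVFieldAt_extVec q z).diff
  rw [extVec_self, extVec_self] at this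
  rw [this, map_zero, _root_.zero_apply]

theorem coordVec_leviCivita (g : RMetric E M) (p : M) {x : E} (hx : x ∈ chartDom E p)
    {Y : VField E M} (hY : DiffVFieldAt Y (chartPar E p x)) (X : VField E M) :
    coordVec (chartPar E p) (fun q ↦ leviCivita g Y q (X q)) x
      = covVec (chartΓ g p) (coordVec (chartPar E p) Y) x (coordVec (chartPar E p) X x) := by
  have h1 := (leviCivita_spec g).eq_covVec p hx rfl hY (X (chartPar E p x))
  exact (congrArg (parInv E (chartPar E p) x) h1).trans ((isParam_chart E p).parInv_parD hx _)

theorem diffVFieldAt_of_coordVec (p : M) {x : E} (hx : x ∈ chartDom E p) {Y : VField E M}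
    (hY : DifferentiableAt ℝ (coordVec (chartPar E p) Y) x) : DiffVFieldAt Y (chartPar E p x) := by
  have hs := chartPar_mem hx
  rw [DiffVFieldAt]
  refine ((trivializationAt E (fun q : M ↦ TangentSpace 𝓘(ℝ, E) q)
    p).mdifferentiableAt_section_iff 𝓘(ℝ, E) Y (b₀ := chartPar E p x) hs).2 ?_
  have h1 : MDifferentiableAt 𝓘(ℝ, E) 𝓘(ℝ, E)
      (fun q ↦ coordVec (chartPar E p) Y (extChartAt 𝓘(ℝ, E) p q)) (chartPar E p x) := by
    refine MDifferentiableAt.comp (I' := 𝓘(ℝ, E)) (chartPar E p x)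
      (g := coordVec (chartPar E p) Y) (f := extChartAt 𝓘(ℝ, E) p)
      (mdifferentiableAt_iff_differentiableAt.2 ?_) (mdifferentiableAt_extChartAt hs)
    rwa [extChartAt_chartPar hx]
  refine h1.congr_of_eventuallyEq ?_
  filter_upwards [(chartAt E p).open_source.mem_nhds hs] with q hq
  have h2 := (trivializationAt E (TangentSpace 𝓘(ℝ, E)) p).continuousLinearMapAt_apply_of_mem
    (R := ℝ) (b := q) hq (Y q)
  refine h2.symm.trans ?_
  have h3 := parInv_chart hq
  have h4 := chartPar_extChartAt hq
  rw [coordVec, h4, h3]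
  rfl

/-- The curvature tensor with values in the model space. -/
def curvForm (g : RMetric E M) (q : M) (u v w : E) : E := curvature g q u v w

theorem curvForm_eq (g : RMetric E M) (p : M) {x : E} (hx : x ∈ chartDom E p) (u v w : E) :
    curvForm g (chartPar E p x) (parD E (chartPar E p) x u) (parD E (chartPar E p) x v)
      (parD E (chartPar E p) x w) = parD E (chartPar E p) x (flatCurv (chartΓ g p) x u v w) := by
  have hP := isParam_chart E p
  obtain ⟨X, hX0⟩ : ∃ X : VField E M,
    X = extVec (chartPar E p x) (parD E (chartPar E p) x u) := ⟨_, rfl⟩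
  obtain ⟨Y, hY0⟩ : ∃ X : VField E M,
    X = extVec (chartPar E p x) (parD E (chartPar E p) x v) := ⟨_, rfl⟩
  obtain ⟨Z, hZ0⟩ : ∃ X : VField E M,
    X = extVec (chartPar E p x) (parD E (chartPar E p) x w) := ⟨_, rfl⟩
  have hX : SmoothVFieldAt X (chartPar E p x) := hX0 ▸ smoothVFieldAt_extVec _ _
  have hY : SmoothVFieldAt Y (chartPar E p x) := hY0 ▸ smoothVFieldAt_extVec _ _
  obtain ⟨S', hS'o, hxS', hZ⟩ : ∃ S : Set M, IsOpen S ∧ chartPar E p x ∈ S ∧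
    ∀ y ∈ S, SmoothVFieldAt Z y := hZ0 ▸ eventually_smooth_extVec _ _
  have cE : ∀ w : E,
      coordVec (chartPar E p) (extVec (chartPar E p x) (parD E (chartPar E p) x w)) x = w :=
    fun w ↦ (congrArg (parInv E (chartPar E p) x) (extVec_self (chartPar E p x) _)).trans
      (hP.parInv_parD hx w)
  have cX : coordVec (chartPar E p) X x = u := hX0 ▸ cE u
  have cY : coordVec (chartPar E p) Y x = v := hY0 ▸ cE v
  have cZ : coordVec (chartPar E p) Z x = w := hZ0 ▸ cE w
  obtain ⟨V, hVs, hVo, hxV⟩ := mem_nhds_iff.1 (Filter.inter_mem (hP.mem_nhds hx)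
    ((hP.contMDiffAt hx).continuousAt (hS'o.mem_nhds hxS')))
  have hLC := (flatLC_chart g p).mono hVo fun y hy ↦ (hVs hy).1
  have hZV : ContDiffOn ℝ ∞ (coordVec (chartPar E p) Z) V := fun y hy ↦
    (hP.contDiffAt_coordVec (hVs hy).1 (hZ _ (hVs hy).2)).contDiffWithinAt
  have dX := hP.differentiableAt_coordVec hx hX.diff
  have dY := hP.differentiableAt_coordVec hx hY.diff
  have key : ∀ W : VField E M, DifferentiableAt ℝ (coordVec (chartPar E p) W) x →
      coordVec (chartPar E p) (fun q ↦ leviCivita g Z q (W q)) =ᶠ[𝓝 x]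
        (fun y ↦ covVec (chartΓ g p) (coordVec (chartPar E p) Z) y (coordVec (chartPar E p) W y)) ∧
      DiffVFieldAt (fun q ↦ leviCivita g Z q (W q)) (chartPar E p x) := by
    intro W dW
    have e : coordVec (chartPar E p) (fun q ↦ leviCivita g Z q (W q)) =ᶠ[𝓝 x]
        (fun y ↦ covVec (chartΓ g p) (coordVec (chartPar E p) Z) y
          (coordVec (chartPar E p) W y)) := by
      filter_upwards [hVo.mem_nhds hxV] with y hy
      exact coordVec_leviCivita g p (hVs hy).1 (hZ _ (hVs hy).2).diff W
    refine ⟨e, diffVFieldAt_of_coordVec p hx ?_⟩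
    refine DifferentiableAt.congr_of_eventuallyEq ?_ e
    have hA : DifferentiableAt ℝ (nablaEnd (chartΓ g p) (coordVec (chartPar E p) Z)) x :=
      ((hLC.smooth_nablaEnd hZV).contDiffAt (hVo.mem_nhds hxV)).differentiableAt (by simp)
    refine (hA.clm_apply dW).congr_of_eventuallyEq ?_
    filter_upwards [hVo.mem_nhds hxV] with y hy
    exact (hLC.nablaEnd_apply hy _ _).symm
  have a1 : ∀ A W : VField E M, DifferentiableAt ℝ (coordVec (chartPar E p) W) x →
      coordVec (chartPar E p) (fun q ↦ leviCivita g (fun q ↦ leviCivita g Z q (W q)) q (A q)) x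
      = covVec (chartΓ g p) (fun y ↦ covVec (chartΓ g p) (coordVec (chartPar E p) Z) y
          (coordVec (chartPar E p) W y)) x (coordVec (chartPar E p) A x) := by
    intro A W dW
    rw [coordVec_leviCivita g p hx (key W dW).2]
    exact covVec_congr (key W dW).1 _
  have a2 := coordVec_leviCivita g p hx (hZ _ hxS').diff (VectorField.mlieBracket 𝓘(ℝ, E) X Y)
  rw [hP.coordVec_mlieBracket hx hX.diff hY.diff] at a2
  have a3 := hLC.curvature_eq hxV dX dY hZV
  rw [← a1 X Y dY, ← a1 Y X dX, ← a2, cX, cY, cZ] at a3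
  rw [← a3, map_sub, map_sub, hP.parD_coordVec hx, hP.parD_coordVec hx, hP.parD_coordVec hx]
  have eX : parD E (chartPar E p) x u = vecForm X (chartPar E p x) :=
    hX0 ▸ (extVec_self (chartPar E p x) _).symm
  have eY : parD E (chartPar E p) x v = vecForm Y (chartPar E p x) :=
    hY0 ▸ (extVec_self (chartPar E p x) _).symm
  have eq1 : curvForm g (chartPar E p x) (parD E (chartPar E p) x u) (parD E (chartPar E p) x v)
      (parD E (chartPar E p) x w)
      = endForm (leviCivita g (fun q ↦ leviCivita g Z q (Y q))) (chartPar E p x)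
          (parD E (chartPar E p) x u)
        - endForm (leviCivita g (fun q ↦ leviCivita g Z q (X q))) (chartPar E p x)
          (parD E (chartPar E p) x v)
        - endForm (leviCivita g Z) (chartPar E p x)
          (VectorField.mlieBracket 𝓘(ℝ, E) X Y (chartPar E p x)) := by
    rw [hX0, hY0, hZ0]
    rfl
  rw [eq1, eX, eY]
  rfl

end LeviCivitaChart

section Conjugation

variable {E F : Type*} [NormedAddCommGroup E] [NormedSpace ℝ E] [NormedAddCommGroup F]
  [NormedSpace ℝ F] {M : Type*} [TopologicalSpace M] [ChartedSpace E M]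

/-- Conjugation of endomorphisms by the differential of a parametrisation. -/
def parConj (ψ : F → M) (x : F) : (E →L[ℝ] E) →ₗ[ℝ] (F →L[ℝ] F) where
  toFun A := parInv E ψ x ∘L A ∘L parD E ψ x
  map_add' A B := by ext; simp
  map_smul' c A := by ext; simp

theorem parConj_apply (ψ : F → M) (x : F) (A : E →L[ℝ] E) (u : F) :
    parConj ψ x A u = parInv E ψ x (A (parD E ψ x u)) := rfl

theorem coordEnd_eq_parConj (ψ : F → M) (J : EndField E M) (x : F) :
    coordEnd ψ J x = parConj ψ x (endForm J (ψ x)) := rfl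

namespace IsParam

variable {V : Set F} {ψ : F → M} (h : IsParam E V ψ) {x : F}
include h

theorem parD_parConj (hx : x ∈ V) (A : E →L[ℝ] E) (u : F) :
    parD E ψ x (parConj ψ x A u) = A (parD E ψ x u) := by
  rw [parConj_apply, h.parD_parInv hx]

theorem parConj_mul (hx : x ∈ V) (A B : E →L[ℝ] E) :
    parConj ψ x (A * B) = parConj ψ x A * parConj ψ x B := by
  ext u
  apply h.parD_injective hx
  rw [h.parD_parConj hx, mul_apply_eq_comp, mul_apply_eq_comp, h.parD_parConj hx,
    h.parD_parConj hx]

theorem parConj_one (hx : x ∈ V) : parConj ψ x (1 : E →L[ℝ] E) = 1 := by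
  ext u
  exact h.parInv_parD hx u

theorem parConj_injective (hx : x ∈ V) :
    Function.Injective (parConj ψ x : (E →L[ℝ] E) → F →L[ℝ] F) := by
  intro A B hAB
  ext u
  have := congrArg (fun T : F →L[ℝ] F ↦ parD E ψ x (T (parInv E ψ x u))) hAB
  simp only [h.parD_parConj hx, h.parD_parInv hx] at this
  exact this

theorem parConj_surjective (hx : x ∈ V) (B : F →L[ℝ] F) : ∃ A : E →L[ℝ] E, parConj ψ x A = B := by
  refine ⟨parD E ψ x ∘L B ∘L parInv E ψ x, ?_⟩
  ext u
  simp [parConj_apply, h.parInv_parD hx]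

theorem endTrace_parConj (hx : x ∈ V) (A : E →L[ℝ] E) :
    endTrace F (parConj ψ x A) = endTrace E A := by
  let e : F ≃ₗ[ℝ] E :=
    { (parD E ψ x).toLinearMap with
      invFun := parInv E ψ x
      left_inv := h.parInv_parD hx
      right_inv := h.parD_parInv hx }
  exact LinearMap.trace_conj' A.toLinearMap e.symm

theorem parConj_mem_span_iff (hx : x ∈ V) {ι : Type*} {J : ι → EndField E M} {A : E →L[ℝ] E} :
    parConj ψ x A ∈ Submodule.span ℝ (Set.range fun a ↦ coordEnd ψ (J a) x)
      ↔ A ∈ Submodule.span ℝ (Set.range fun a ↦ endForm (J a) (ψ x)) := by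
  have : (Set.range fun a ↦ coordEnd ψ (J a) x)
      = parConj ψ x '' Set.range fun a ↦ endForm (J a) (ψ x) := by
    rw [← Set.range_comp]; rfl
  rw [this, Submodule.span_image]
  exact ⟨fun ⟨B, hB, e⟩ ↦ h.parConj_injective hx e ▸ hB, fun hA ↦ ⟨A, hA, rfl⟩⟩

end IsParam

end Conjugation

section ChartExtension

variable {E : Type*} [NormedAddCommGroup E] [NormedSpace ℝ E] [FiniteDimensional ℝ E]
  {M : Type*} [TopologicalSpace M] [ChartedSpace E M] [IsManifold 𝓘(ℝ, E) ∞ M]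

theorem coordVec_extVec (p : M) {x : E} (hx : x ∈ chartDom E p) (w : E) :
    coordVec (chartPar E p) (extVec (chartPar E p x) (parD E (chartPar E p) x w)) x = w :=
  (congrArg (parInv E (chartPar E p) x) (extVec_self (chartPar E p x) _)).trans
    ((isParam_chart E p).parInv_parD hx w)

theorem leviCivita_parD (g : RMetric E M) (p : M) {x : E} (hx : x ∈ chartDom E p)
    {Y : VField E M} (hY : DiffVFieldAt Y (chartPar E p x)) (u : E) :
    endForm (leviCivita g Y) (chartPar E p x) (parD E (chartPar E p) x u)
      = parD E (chartPar E p) x (covVec (chartΓ g p) (coordVec (chartPar E p) Y) x u) := by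
  rw [(leviCivita_spec g).eq_covVec p hx rfl hY, (isParam_chart E p).parInv_parD hx]

end ChartExtension

section QuaternionicChart

variable {m : ℕ} {M : Type*} [TopologicalSpace M] [ChartedSpace (Euc m) M]
  [IsManifold 𝓘(ℝ, Euc m) ∞ M]

/-- A field of subspaces of endomorphisms of the model space. -/
def subForm (Q : SubspaceField m M) (q : M) : Submodule ℝ (Euc m →L[ℝ] Euc m) := Q q

/-- The fields `J a` span `Q` on `U`, where `U` is in the domain of the chart at `p`. -/
structure IsQuatFrame (Q : SubspaceField m M) (p : M) (U : Set (Euc m))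
    (J : Fin 3 → EndField (Euc m) M) : Prop where
  isOpen : IsOpen U
  sub : U ⊆ chartDom (Euc m) p
  span : ∀ x ∈ U, subForm Q (chartPar (Euc m) p x)
    = Submodule.span ℝ (Set.range fun a ↦ endForm (J a) (chartPar (Euc m) p x))

variable {g : RMetric (Euc m) M} {Q : SubspaceField m M}

/-- A quaternionic Kähler structure in coordinates. -/
theorem IsQuaternionicKahler.exists_flatQuat (h : IsQuaternionicKahler g Q) (hm : m ≠ 0) (p : M) :
    ∃ (U : Set (Euc m)) (J : Fin 3 → EndField (Euc m) M), extChartAt 𝓘(ℝ, Euc m) p p ∈ U ∧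
      IsQuatFrame Q p U J ∧
      FlatQuat U (coordForm (chartPar (Euc m) p) g) (chartΓ g p)
        (fun a ↦ coordEnd (chartPar (Euc m) p) (J a)) := by
  have hP := isParam_chart (Euc m) p
  obtain ⟨S, hSo, hpS, J, hJ⟩ := h.quaternionic p
  obtain ⟨U, hUs, hUo, hpU⟩ := mem_nhds_iff.1 (Filter.inter_mem
    (hP.mem_nhds (mem_chartDom (E := Euc m) p))
    ((hP.contMDiffAt (mem_chartDom p)).continuousAt
      (hSo.mem_nhds ((chartPar_self (E := Euc m) p).symm ▸ hpS))))
  have hUd : U ⊆ chartDom (Euc m) p := fun x hx ↦ (hUs hx).1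
  have hUS : ∀ x ∈ U, chartPar (Euc m) p x ∈ S := fun x hx ↦ (hUs hx).2
  have hF : IsQuatFrame Q p U J := ⟨hUo, hUd, fun x hx ↦ (hJ _ (hUS x hx)).2.2.2.2⟩
  refine ⟨U, J, hpU, hF, ?_⟩
  have hd : ∀ x ∈ U, ∀ a, ContDiffAt ℝ ∞ (coordEnd (chartPar (Euc m) p) (J a)) x := fun x hx a ↦
    hP.contDiffAt_coordEnd (hUd hx) ((hJ _ (hUS x hx)).1 a)
  exact
    { (flatLC_chart g p).mono hUo hUd with
      trace_ne := by
        rw [endTrace_one]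
        simpa using hm
      smoothJ := fun a x hx ↦ (hd x hx a).contDiffWithinAt
      quat := fun x hx ↦ by
        obtain ⟨-, h1, h2, h3, -⟩ := hJ _ (hUS x hx)
        refine ⟨fun a ↦ ?_, ?_, ?_⟩
        · have h1' : endForm (J a) (chartPar (Euc m) p x) * endForm (J a) (chartPar (Euc m) p x)
            = -1 := h1 a
          have := congrArg (parConj (chartPar (Euc m) p) x) h1'
          rw [map_neg] at this
          exact ((hP.parConj_mul (hUd hx) _ _).symm.trans this).trans
            (congrArg _ (hP.parConj_one (hUd hx)))
        · exact (hP.parConj_mul (hUd hx) _ _).symm.trans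
            (congrArg (parConj (chartPar (Euc m) p) x) h2)
        · exact ((hP.parConj_mul (hUd hx) _ _).symm.trans
            (congrArg (parConj (chartPar (Euc m) p) x) h3)).trans (map_neg _ _)
      parallel := fun x hx a u ↦ by
        obtain ⟨B, hB, hBY⟩ := h.parallel S hSo (J a)
          (fun q hq ↦ ⟨(hJ q hq).1 a, by
            rw [(hJ q hq).2.2.2.2]; exact Submodule.subset_span ⟨a, rfl⟩⟩)
          (chartPar (Euc m) p x) (hUS x hx) (parD (Euc m) (chartPar (Euc m) p) x u)
        obtain ⟨B', hB'⟩ : ∃ B' : Euc m →L[ℝ] Euc m, B' = B := ⟨B, rfl⟩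
        have e : covEnd (chartΓ g p) (coordEnd (chartPar (Euc m) p) (J a)) x u
            = parConj (chartPar (Euc m) p) x B' := by
          ext1 w
          obtain ⟨W, hW, hWw⟩ : ∃ W : VField (Euc m) M, SmoothVFieldAt W (chartPar (Euc m) p x) ∧
              coordVec (chartPar (Euc m) p) W x = w :=
            ⟨_, smoothVFieldAt_extVec _ (parD (Euc m) (chartPar (Euc m) p) x w),
              coordVec_extVec p (hUd hx) w⟩
          have dW := hP.differentiableAt_coordVec (hUd hx) hW.diff
          have dJ := (hd x hx a).differentiableAt (by simp)
          have hJW : coordVec (chartPar (Euc m) p) (fun q ↦ J a q (W q))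
              =ᶠ[𝓝 x] fun y ↦ coordEnd (chartPar (Euc m) p) (J a) y
                (coordVec (chartPar (Euc m) p) W y) := by
            filter_upwards [hP.mem_nhds (hUd hx)] with y hy
            exact hP.parInv_endForm hy (J a) _
          have hJWd : DiffVFieldAt (fun q ↦ J a q (W q)) (chartPar (Euc m) p x) :=
            diffVFieldAt_of_coordVec p (hUd hx)
              ((dJ.clm_apply dW).congr_of_eventuallyEq hJW)
          have h1 := covVec_apply (C := chartΓ g p) dJ dW u
          rw [← covVec_congr hJW, hWw] at h1
          have h2 := hBY W hW.diff
          have h3 : parD (Euc m) (chartPar (Euc m) p) x (covVec (chartΓ g p)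
              (coordVec (chartPar (Euc m) p) (fun q ↦ J a q (W q))) x u)
              - endForm (J a) (chartPar (Euc m) p x) (parD (Euc m) (chartPar (Euc m) p) x
                (covVec (chartΓ g p) (coordVec (chartPar (Euc m) p) W) x u))
              = B' (parD (Euc m) (chartPar (Euc m) p) x w) := by
            rw [← leviCivita_parD g p (hUd hx) hJWd, ← leviCivita_parD g p (hUd hx) hW.diff, ← hWw,
              hP.parD_coordVec (hUd hx), hB']
            exact h2
          rw [h1, map_add, coordEnd_eq_parConj, hP.parD_parConj (hUd hx), add_sub_cancel_right] at h3
          apply hP.parD_injective (hUd hx)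
          rw [hP.parD_parConj (hUd hx), ← h3]
        rw [e, hP.parConj_mem_span_iff (hUd hx), ← hF.span x hx, hB']
        exact hB }

end QuaternionicChart

theorem quatProj_trace {E : Type*} [NormedAddCommGroup E] [NormedSpace ℝ E]
    {J : Fin 3 → E →L[ℝ] E} (hJ : QuatTriple J) (hm : endTrace E 1 ≠ 0)
    (A : E →L[ℝ] E) (a : Fin 3) : endTrace E (J a * quatProj J A) = endTrace E (J a * A) := by
  rw [quatProj, hJ.trace_mul_sum endTrace_mul_comm hm]
  field_simp

/-- The trace projection to the span is characterised by trace-orthogonality. -/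
theorem quatProj_unique {E : Type*} [NormedAddCommGroup E] [NormedSpace ℝ E]
    {J : Fin 3 → E →L[ℝ] E} (hJ : QuatTriple J) (hm : endTrace E 1 ≠ 0)
    {A P : E →L[ℝ] E} (hP : P ∈ Submodule.span ℝ (Set.range J))
    (h : ∀ a, endTrace E (J a * (A - P)) = 0) : P = quatProj J A := by
  rw [← hJ.quatProj_eq_self hm hP, quatProj, quatProj]
  refine Finset.sum_congr rfl fun a _ ↦ ?_
  have := h a
  rw [mul_sub, map_sub, sub_eq_zero] at this
  rw [this]

section QuaternionicChart

variable {m : ℕ} {M : Type*} [TopologicalSpace M] [ChartedSpace (Euc m) M]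
  [IsManifold 𝓘(ℝ, Euc m) ∞ M] {g : RMetric (Euc m) M} {Q : SubspaceField m M}

theorem sum_repr_eq_trace (L : Euc m →ₗ[ℝ] Euc m) :
    ∑ i, (EuclideanSpace.proj i : Euc m →L[ℝ] ℝ) (L (EuclideanSpace.single i (1 : ℝ)))
      = LinearMap.trace ℝ (Euc m) L := by
  rw [LinearMap.trace_eq_matrix_trace ℝ (EuclideanSpace.basisFun (Fin m) ℝ).toBasis, Matrix.trace]
  refine Finset.sum_congr rfl fun i _ ↦ ?_
  simp [LinearMap.toMatrix_apply]

/-- The Ricci curvature in coordinates. -/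
theorem ricci_eq (g : RMetric (Euc m) M) (p : M) {x : Euc m} (hx : x ∈ chartDom (Euc m) p)
    (K : Euc m → Euc m → Euc m →ₗ[ℝ] Euc m)
    (hK : ∀ u v w, K u v w = flatCurv (chartΓ g p) x w u v) (u v : Euc m) :
    ricci g (chartPar (Euc m) p x) u v = LinearMap.trace ℝ (Euc m)
      (K (parInv (Euc m) (chartPar (Euc m) p) x u) (parInv (Euc m) (chartPar (Euc m) p) x v)) := by
  have hP := isParam_chart (Euc m) p
  let e : Euc m ≃ₗ[ℝ] Euc m :=
    { (parD (Euc m) (chartPar (Euc m) p) x).toLinearMap with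
      invFun := parInv (Euc m) (chartPar (Euc m) p) x
      left_inv := hP.parInv_parD hx
      right_inv := hP.parD_parInv hx }
  rw [← LinearMap.trace_conj' _ e, ← sum_repr_eq_trace]
  refine Finset.sum_congr rfl fun i _ ↦ ?_
  have h1 := curvForm_eq g p hx (parInv (Euc m) (chartPar (Euc m) p) x (EuclideanSpace.single i 1))
    (parInv (Euc m) (chartPar (Euc m) p) x u) (parInv (Euc m) (chartPar (Euc m) p) x v)
  rw [hP.parD_parInv hx, hP.parD_parInv hx, hP.parD_parInv hx, ← hK] at h1
  exact congrArg (EuclideanSpace.proj i : Euc m →L[ℝ] ℝ) h1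

theorem scalarCurvature_eq_zero (g : RMetric (Euc m) M) (p : M)
    (h : ∀ u v, ricci g p u v = -ricci g p v u) : scalarCurvature g p = 0 := by
  have hs : ∀ i j, (Matrix.of fun k l ↦ g.inner p (stdVec p k) (stdVec p l))⁻¹ i j
      = (Matrix.of fun k l ↦ g.inner p (stdVec p k) (stdVec p l))⁻¹ j i := by
    intro i j
    have : (Matrix.of fun k l ↦ g.inner p (stdVec p k) (stdVec p l)).IsSymm := by
      ext k l
      exact g.symm p _ _
    have h2 := this.inv
    exact h2.apply j i
  have h1 : scalarCurvature g p = -scalarCurvature g p := by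
    conv_lhs => rw [scalarCurvature, Finset.sum_comm]
    rw [scalarCurvature, ← Finset.sum_neg_distrib]
    refine Finset.sum_congr rfl fun i _ ↦ ?_
    rw [← Finset.sum_neg_distrib]
    refine Finset.sum_congr rfl fun j _ ↦ ?_
    rw [hs, h]
    ring
  linarith

end QuaternionicChart

section QuaternionicKahlerChart

variable {n : ℕ} {M : Type*} [TopologicalSpace M] [ChartedSpace (Euc (4 * n)) M]
  [IsManifold 𝓘(ℝ, Euc (4 * n)) ∞ M] {g : RMetric (Euc (4 * n)) M} {Q : SubspaceField (4 * n) M}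

theorem IsQuaternionicKahler.exists_flatQK (h : IsQuaternionicKahler g Q)
    (hs : ∀ x, scalarCurvature g x ≠ 0) (p : M) :
    ∃ (U : Set (Euc (4 * n))) (J : Fin 3 → EndField (Euc (4 * n)) M) (c : (Euc (4 * n)) → ℝ), extChartAt 𝓘(ℝ, (Euc (4 * n))) p p ∈ U ∧
      IsQuatFrame Q p U J ∧
      FlatQK U (coordForm (chartPar (Euc (4 * n)) p) g) (chartΓ g p)
        (fun a ↦ coordEnd (chartPar (Euc (4 * n)) p) (J a)) c := by
  have hn : n ≠ 0 := by
    rintro rfl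
    exact hs p (Finset.sum_eq_zero fun i _ ↦ i.elim0)
  obtain ⟨U, J, hpU, hF, hQ⟩ := h.exists_flatQuat (by simpa using hn) p
  have hP := isParam_chart (Euc (4 * n)) p
  have hJQ : ∀ x ∈ U, ∀ a, endForm (J a) (chartPar (Euc (4 * n)) p x) ∈ subForm Q (chartPar (Euc (4 * n)) p x) := by
    intro x hx a
    rw [hF.span x hx]
    exact Submodule.subset_span ⟨a, rfl⟩
  have key : ∀ x : (Euc (4 * n)), ∃ c : ℝ, x ∈ U → c ≠ 0 ∧ IsQuatCurv (coordForm (chartPar (Euc (4 * n)) p) g x)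
      (flatCurv (chartΓ g p) x) (fun a ↦ coordEnd (chartPar (Euc (4 * n)) p) (J a) x)
      (fun a u v ↦ c * coordForm (chartPar (Euc (4 * n)) p) g x (coordEnd (chartPar (Euc (4 * n)) p) (J a) x u) v) := by
    intro x
    by_cases hx : x ∈ U
    swap
    · exact ⟨0, fun h ↦ absurd h hx⟩
    have hxd := hF.sub hx
    have hR := hQ.toFlatLC.isAlgCurv hx
    let K : (Euc (4 * n)) → (Euc (4 * n)) → (Euc (4 * n)) →ₗ[ℝ] (Euc (4 * n)) := fun u v ↦
      { toFun := fun w ↦ flatCurv (chartΓ g p) x w u v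
        map_add' := fun w z ↦ by rw [hR.add_left]; rfl
        map_smul' := fun c w ↦ by rw [hR.smul_left]; rfl }
    obtain ⟨c, hc⟩ := exists_quat_curv (n := n) (by simp) hn (hQ.inner x hx) hR (hQ.quat x hx)
      (fun a u v ↦ by
        rw [coordForm_apply, coordForm_apply, coordEnd_eq_parConj, hP.parD_parConj hxd,
          hP.parD_parConj hxd]
        exact h.skew _ _ (hJQ x hx a) _ _)
      (fun u v b ↦ hQ.curv_normalizes hx u v b)
      (fun h4 a u v ↦ by
        have h4' : 4 * n = 4 := by simpa using h4
        ext1 w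
        have := h.dim_four h4' _ _ (hJQ x hx a) (parD (Euc (4 * n)) (chartPar (Euc (4 * n)) p) x u)
          (parD (Euc (4 * n)) (chartPar (Euc (4 * n)) p) x v) (parD (Euc (4 * n)) (chartPar (Euc (4 * n)) p) x w)
        have h5 : endForm (J a) (chartPar (Euc (4 * n)) p x) (curvForm g (chartPar (Euc (4 * n)) p x)
              (parD (Euc (4 * n)) (chartPar (Euc (4 * n)) p) x u) (parD (Euc (4 * n)) (chartPar (Euc (4 * n)) p) x v)
              (parD (Euc (4 * n)) (chartPar (Euc (4 * n)) p) x w))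
            - curvForm g (chartPar (Euc (4 * n)) p x)
              (endForm (J a) (chartPar (Euc (4 * n)) p x) (parD (Euc (4 * n)) (chartPar (Euc (4 * n)) p) x u))
              (parD (Euc (4 * n)) (chartPar (Euc (4 * n)) p) x v) (parD (Euc (4 * n)) (chartPar (Euc (4 * n)) p) x w)
            - curvForm g (chartPar (Euc (4 * n)) p x) (parD (Euc (4 * n)) (chartPar (Euc (4 * n)) p) x u)
              (endForm (J a) (chartPar (Euc (4 * n)) p x) (parD (Euc (4 * n)) (chartPar (Euc (4 * n)) p) x v))
              (parD (Euc (4 * n)) (chartPar (Euc (4 * n)) p) x w)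
            - curvForm g (chartPar (Euc (4 * n)) p x) (parD (Euc (4 * n)) (chartPar (Euc (4 * n)) p) x u)
              (parD (Euc (4 * n)) (chartPar (Euc (4 * n)) p) x v)
              (endForm (J a) (chartPar (Euc (4 * n)) p x) (parD (Euc (4 * n)) (chartPar (Euc (4 * n)) p) x w)) = 0 := this
        rw [← hP.parD_parConj hxd, ← hP.parD_parConj hxd, ← hP.parD_parConj hxd,
          curvForm_eq g p hxd, curvForm_eq g p hxd, curvForm_eq g p hxd, curvForm_eq g p hxd,
          ← hP.parD_parConj hxd, ← map_sub, ← map_sub, ← map_sub] at h5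
        have h6 := hP.parD_injective hxd (h5.trans (map_zero _).symm)
        exact h6) K (fun u v w ↦ rfl)
      (fun hK ↦ hs (chartPar (Euc (4 * n)) p x) (scalarCurvature_eq_zero g _ <| by
        change ∀ u v : (Euc (4 * n)), _
        intro u v
        rw [ricci_eq g p hxd K (fun u v w ↦ rfl), ricci_eq g p hxd K (fun u v w ↦ rfl)]
        exact hK _ _))
    exact ⟨c, fun _ ↦ hc⟩
  choose c hc using key
  exact ⟨U, J, c, hpU, hF, { hQ with c_ne := fun x hx ↦ (hc x hx).1, curv := fun x hx ↦ (hc x hx).2 }⟩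

variable {p : M} {U : Set (Euc (4 * n))} {J : Fin 3 → EndField (Euc (4 * n)) M} {c : (Euc (4 * n)) → ℝ}

theorem IsKilling.flatKilling {ξ : VField (Euc (4 * n)) M} (hξ : IsKilling g ξ)
    (hs : U ⊆ chartDom (Euc (4 * n)) p) :
    FlatKilling U (coordForm (chartPar (Euc (4 * n)) p) g) (chartΓ g p) (coordVec (chartPar (Euc (4 * n)) p) ξ) where
  smooth x hx := ((isParam_chart (Euc (4 * n)) p).contDiffAt_coordVec (hs hx) (hξ.1 _)).contDiffWithinAt
  skew x hx u v := by
    rw [(flatLC_chart g p).nablaEnd_apply (hs hx), (flatLC_chart g p).nablaEnd_apply (hs hx),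
      coordForm_apply, coordForm_apply, ← leviCivita_parD g p (hs hx) (hξ.1 _).diff,
      ← leviCivita_parD g p (hs hx) (hξ.1 _).diff]
    exact hξ.2 _ _ _

/-- The moment map in coordinates. -/
theorem coordEnd_momentMap (hF : IsQuatFrame Q p U J)
    (hQ : FlatQuat U (coordForm (chartPar (Euc (4 * n)) p) g) (chartΓ g p)
        (fun a ↦ coordEnd (chartPar (Euc (4 * n)) p) (J a))) {ξ : VField (Euc (4 * n)) M} (hξ : IsKilling g ξ)
    {x : (Euc (4 * n))} (hx : x ∈ U) :
    coordEnd (chartPar (Euc (4 * n)) p) (momentMap g Q ξ) x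
      = flatMoment (chartΓ g p) (fun a ↦ coordEnd (chartPar (Euc (4 * n)) p) (J a))
        (coordVec (chartPar (Euc (4 * n)) p) ξ) x := by
  have hP := isParam_chart (Euc (4 * n)) p
  have hxd := hF.sub hx
  have hD : parConj (chartPar (Euc (4 * n)) p) x (endForm (leviCivita g ξ) (chartPar (Euc (4 * n)) p x))
      = nablaEnd (chartΓ g p) (coordVec (chartPar (Euc (4 * n)) p) ξ) x := by
    ext1 u
    apply hP.parD_injective hxd
    rw [hP.parD_parConj hxd, (flatLC_chart g p).nablaEnd_apply hxd,
      leviCivita_parD g p hxd (hξ.1 _).diff]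
  have ht : ∀ P B : (Euc (4 * n)) →L[ℝ] (Euc (4 * n)), LinearMap.trace ℝ (Euc (4 * n))
      ((B ∘L (endForm (leviCivita g ξ) (chartPar (Euc (4 * n)) p x) - P)).toLinearMap)
      = endTrace (Euc (4 * n)) (parConj (chartPar (Euc (4 * n)) p) x B
        * (nablaEnd (chartΓ g p) (coordVec (chartPar (Euc (4 * n)) p) ξ) x
          - parConj (chartPar (Euc (4 * n)) p) x P)) := by
    intro P B
    rw [← hD, ← map_sub, ← hP.parConj_mul hxd, hP.endTrace_parConj hxd]
    rfl
  have hex : ∃ P : (Euc (4 * n)) →L[ℝ] (Euc (4 * n)), P ∈ subForm Q (chartPar (Euc (4 * n)) p x) ∧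
      ∀ B ∈ subForm Q (chartPar (Euc (4 * n)) p x), LinearMap.trace ℝ (Euc (4 * n))
        ((B ∘L (endForm (leviCivita g ξ) (chartPar (Euc (4 * n)) p x) - P)).toLinearMap) = 0 := by
    obtain ⟨P, hPe⟩ := hP.parConj_surjective hxd (flatMoment (chartΓ g p)
      (fun a ↦ coordEnd (chartPar (Euc (4 * n)) p) (J a)) (coordVec (chartPar (Euc (4 * n)) p) ξ) x)
    refine ⟨P, ?_, fun B hB ↦ ?_⟩
    · rw [hF.span x hx, ← hP.parConj_mem_span_iff hxd, hPe]
      exact quatProj_mem _ _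
    · rw [hF.span x hx, ← hP.parConj_mem_span_iff hxd] at hB
      rw [ht, hPe]
      obtain ⟨k, hk⟩ := (Submodule.mem_span_range_iff_exists_fun ℝ).1 hB
      rw [← hk, Finset.sum_mul, map_sum]
      refine Finset.sum_eq_zero fun a _ ↦ ?_
      rw [smul_mul_assoc, map_smul, mul_sub, map_sub, flatMoment,
        quatProj_trace (hQ.quat x hx) hQ.trace_ne, sub_self, smul_zero]
  have hsp := Classical.epsilon_spec hex
  obtain ⟨P, hPe⟩ : ∃ P : (Euc (4 * n)) →L[ℝ] (Euc (4 * n)), P = endForm (momentMap g Q ξ) (chartPar (Euc (4 * n)) p x) := ⟨_, rfl⟩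
  have h1 : P ∈ subForm Q (chartPar (Euc (4 * n)) p x) := hPe ▸ hsp.1
  have h2 : ∀ B ∈ subForm Q (chartPar (Euc (4 * n)) p x), LinearMap.trace ℝ (Euc (4 * n))
        ((B ∘L (endForm (leviCivita g ξ) (chartPar (Euc (4 * n)) p x) - P)).toLinearMap) = 0 := hPe ▸ hsp.2
  rw [coordEnd_eq_parConj, ← hPe]
  refine quatProj_unique (hQ.quat x hx) hQ.trace_ne ?_ fun a ↦ ?_
  · rwa [hP.parConj_mem_span_iff hxd, ← hF.span x hx]
  · rw [coordEnd_eq_parConj, ← ht]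
    refine h2 _ ?_
    rw [hF.span x hx]
    exact Submodule.subset_span ⟨a, rfl⟩

end QuaternionicKahlerChart

/-- The differential of an immersion is injective. -/
theorem IsImmersionAt.mfderiv_injective {E E' : Type*} [NormedAddCommGroup E] [NormedSpace ℝ E]
    [NormedAddCommGroup E'] [NormedSpace ℝ E'] {N : Type*} [TopologicalSpace N] [ChartedSpace E N]
    {M : Type*} [TopologicalSpace M] [ChartedSpace E' M] {ι : N → M} {p : N}
    (h : Manifold.IsImmersionAt 𝓘(ℝ, E) 𝓘(ℝ, E') ∞ ι p) :
    Function.Injective (mfderiv 𝓘(ℝ, E) 𝓘(ℝ, E') ι p) := by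
  have h1 : ContMDiffAt 𝓘(ℝ, E') 𝓘(ℝ, E') ∞ h.codChart (ι p) :=
    contMDiffAt_of_mem_maximalAtlas h.codChart_mem_maximalAtlas h.mem_codChart_source
  have h2 : ContMDiffAt 𝓘(ℝ, E) 𝓘(ℝ, E) ∞ h.domChart.symm (h.domChart p) :=
    contMDiffAt_symm_of_mem_maximalAtlas h.domChart_mem_maximalAtlas
      (h.domChart.map_source h.mem_domChart_source)
  have hw : ∀ q ∈ h.domChart.source, (h.equiv.symm (h.codChart (ι q))).1 = h.domChart q := by
    intro q hq
    have hq' : h.domChart q ∈ (h.domChart.extend 𝓘(ℝ, E)).target := by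
      simpa using h.domChart.map_source hq
    have := h.writtenInCharts hq'
    simp only [Function.comp_apply, OpenPartialHomeomorph.extend_coe, OpenPartialHomeomorph.extend_coe_symm, modelWithCornersSelf_coe, modelWithCornersSelf_coe_symm, id_eq, h.domChart.left_inv hq] at this
    rw [this]
    simp
  have hL : ContMDiffAt 𝓘(ℝ, E') 𝓘(ℝ, E) ∞ (fun z ↦ (h.equiv.symm z).1) (h.codChart (ι p)) :=
    ((ContinuousLinearMap.fst ℝ E h.complement) ∘L (h.equiv.symm : E' →L[ℝ] E × h.complement)).contDiff.contDiffAt.contMDiffAt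
  have h3 : ContMDiffAt 𝓘(ℝ, E') 𝓘(ℝ, E) ∞
      (fun z ↦ h.domChart.symm ((h.equiv.symm (h.codChart z)).1)) (ι p) := by
    refine ContMDiffAt.comp (ι p) ?_ (hL.comp (ι p) h1)
    rw [hw p h.mem_domChart_source]
    exact h2
  have hr : (fun z ↦ h.domChart.symm ((h.equiv.symm (h.codChart z)).1)) ∘ ι =ᶠ[𝓝 p] id := by
    filter_upwards [h.domChart.open_source.mem_nhds h.mem_domChart_source] with q hq
    simp only [Function.comp_apply, hw q hq, h.domChart.left_inv hq, id_eq]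
  have h4 := mfderiv_comp p (h3.mdifferentiableAt (by simp)) (h.contMDiffAt.mdifferentiableAt (by simp))
  rw [hr.mfderiv_eq, mfderiv_id] at h4
  intro u v huv
  have h5 : ∀ w : TangentSpace 𝓘(ℝ, E) p, w = mfderiv 𝓘(ℝ, E') 𝓘(ℝ, E)
      (fun z ↦ h.domChart.symm ((h.equiv.symm (h.codChart z)).1)) (ι p)
      (mfderiv 𝓘(ℝ, E) 𝓘(ℝ, E') ι p w) := fun w ↦ congrArg (fun T : E →L[ℝ] E ↦ T w) h4
  rw [h5 u, h5 v, huv]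

namespace TransverseKahler

variable {F : Type*} [NormedAddCommGroup F] [NormedSpace ℝ F] {V : Set F}
  {g g' : F → F →L[ℝ] F →L[ℝ] ℝ} {I : F → F →L[ℝ] F} {ζ : Fin 2 → F → F}

theorem congr (h : TransverseKahler V g' I ζ) (hg : ∀ x ∈ V, g' x = g x) :
    TransverseKahler V g I ζ := by
  have e : ∀ x ∈ V, g' =ᶠ[𝓝 x] g := fun x hx ↦ Filter.mem_of_superset (h.isOpen.mem_nhds hx) hg
  have e1 : ∀ x ∈ V, ∀ u v, (fun y ↦ g' y u v) =ᶠ[𝓝 x] (fun y ↦ g y u v) := fun x hx u v ↦ by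
    filter_upwards [e x hx] with y hy; rw [hy]
  have e2 : ∀ x ∈ V, ∀ u v, (fun y ↦ g' y u (I y v)) =ᶠ[𝓝 x] (fun y ↦ g y u (I y v)) :=
    fun x hx u v ↦ by filter_upwards [e x hx] with y hy; rw [hy]
  exact
    { h with
      smooth_g := h.smooth_g.congr fun x hx ↦ (hg x hx).symm
      inner := fun x hx ↦ hg x hx ▸ h.inner x hx
      herm := fun x hx ↦ hg x hx ▸ h.herm x hx
      lieg := fun x hx j u v ↦ by
        rw [← (e1 x hx u v).fderiv_eq, ← hg x hx]
        exact h.lieg x hx j u v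
      closed := fun x hx u v w hu hv hw ↦ by
        rw [← (e2 x hx v w).fderiv_eq, ← (e2 x hx w u).fderiv_eq, ← (e2 x hx u v).fderiv_eq]
        rw [← hg x hx] at hu hv hw
        exact h.closed x hx u v w hu hv hw }

theorem of_local (hV : IsOpen V) (h : ∀ x ∈ V, ∃ W, x ∈ W ∧ TransverseKahler W g I ζ) :
    TransverseKahler V g I ζ where
  isOpen := hV
  smooth_g x hx := by
    obtain ⟨W, hW, k⟩ := h x hx
    exact (k.smooth_g.contDiffAt (k.isOpen.mem_nhds hW)).contDiffWithinAt
  smooth_I x hx := by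
    obtain ⟨W, hW, k⟩ := h x hx
    exact (k.smooth_I.contDiffAt (k.isOpen.mem_nhds hW)).contDiffWithinAt
  inner x hx := by obtain ⟨W, hW, k⟩ := h x hx; exact k.inner x hW
  sq x hx := by obtain ⟨W, hW, k⟩ := h x hx; exact k.sq x hW
  herm x hx := by obtain ⟨W, hW, k⟩ := h x hx; exact k.herm x hW
  map_ζ x hx := by obtain ⟨W, hW, k⟩ := h x hx; exact k.map_ζ x hW
  ne x hx := by obtain ⟨W, hW, k⟩ := h x hx; exact k.ne x hW
  nijenhuis x hx := by obtain ⟨W, hW, k⟩ := h x hx; exact k.nijenhuis x hW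
  lieI x hx := by obtain ⟨W, hW, k⟩ := h x hx; exact k.lieI x hW
  lieg x hx := by obtain ⟨W, hW, k⟩ := h x hx; exact k.lieg x hW
  closed x hx := by obtain ⟨W, hW, k⟩ := h x hx; exact k.closed x hW

end TransverseKahler

section MomentSubmanifold

variable {n d : ℕ} {M : Type*} [TopologicalSpace M] [ChartedSpace (Euc (4 * n)) M]
  [IsManifold 𝓘(ℝ, Euc (4 * n)) ∞ M]
  {N : Type*} [TopologicalSpace N] [ChartedSpace (Euc d) N] [IsManifold 𝓘(ℝ, Euc d) ∞ N]

/-- The submanifold `ι : N → M` is tangent to the commuting Killing fields `ξ 0`, `ξ 1` of equal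
nonzero length, and preserved by the product of their moment maps, which maps `ξ 0` to `f ξ 1`. The
resulting endomorphisms of the tangent spaces of `N` and lifts of the `ξ i` are `I` and `ζ i`. -/
structure IsMomentSubmanifold (g : RMetric (Euc (4 * n)) M) (Q : SubspaceField (4 * n) M)
    (ξ : Fin 2 → VField (Euc (4 * n)) M) (ι : N → M) (f : N → ℝ)
    (I : EndField (Euc d) N) (ζ : Fin 2 → VField (Euc d) N) : Prop where
  qk : IsQuaternionicKahler g Q
  scal : ∀ x, scalarCurvature g x ≠ 0
  killing : ∀ i, IsKilling g (ξ i)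
  sub : IsSubmanifold (4 * n) d ι
  tangent : ∀ i p, dmap ι p (ζ i p) = ξ i (ι p)
  comm : ∀ p, VectorField.mlieBracket 𝓘(ℝ, Euc (4 * n)) (ξ 0) (ξ 1) (ι p) = 0
  norm : ∀ p, g.inner (ι p) (ξ 0 (ι p)) (ξ 0 (ι p)) = g.inner (ι p) (ξ 1 (ι p)) (ξ 1 (ι p))
  ne : ∀ i p, ξ i (ι p) ≠ 0
  mem : ∀ p, momentMap g Q (ξ 0) (ι p) ∘L momentMap g Q (ξ 1) (ι p) ∈ Q (ι p)
  smooth_f : ContMDiff 𝓘(ℝ, Euc d) 𝓘(ℝ, ℝ) ∞ f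
  f_ne : ∀ p, f p ≠ 0
  mapξ : ∀ p, momentMap g Q (ξ 0) (ι p) (momentMap g Q (ξ 1) (ι p) (ξ 0 (ι p)))
    = f p • ξ 1 (ι p)
  map : ∀ p (w : TangentSpace 𝓘(ℝ, Euc d) p), dmap ι p (I p w)
    = (f p)⁻¹ • momentMap g Q (ξ 0) (ι p) (momentMap g Q (ξ 1) (ι p) (dmap ι p w))

variable (d) in
/-- The differential of `ι`, as a linear map between the model spaces. -/
def dForm (ι : N → M) (p : N) : Euc d →L[ℝ] Euc (4 * n) := dmap ι p

variable (d) in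
/-- The induced metric, as a bilinear form on the model space. -/
def indForm (g : RMetric (Euc (4 * n)) M) (ι : N → M) (p : N) : Euc d →L[ℝ] Euc d →L[ℝ] ℝ :=
  (metricForm g (ι p)).bilinearComp (dForm d ι p) (dForm d ι p)

variable (d) in
/-- The induced metric in coordinates. -/
def coordInd {F : Type*} [NormedAddCommGroup F] [NormedSpace ℝ F] (ψ : F → N)
    (g : RMetric (Euc (4 * n)) M) (ι : N → M) (x : F) : F →L[ℝ] F →L[ℝ] ℝ :=
  (indForm d g ι (ψ x)).bilinearComp (parD (Euc d) ψ x) (parD (Euc d) ψ x)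

theorem coordInd_apply {F : Type*} [NormedAddCommGroup F] [NormedSpace ℝ F] (ψ : F → N)
    (g : RMetric (Euc (4 * n)) M) (ι : N → M) (x u v : F) :
    coordInd d ψ g ι x u v = metricForm g (ι (ψ x)) (dForm d ι (ψ x) (parD (Euc d) ψ x u))
      (dForm d ι (ψ x) (parD (Euc d) ψ x v)) := rfl

variable {g : RMetric (Euc (4 * n)) M} {Q : SubspaceField (4 * n) M}
    {ξ : Fin 2 → VField (Euc (4 * n)) M} {ι : N → M} {f : N → ℝ}
    {I : EndField (Euc d) N} {ζ : Fin 2 → VField (Euc d) N}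
    {F : Type*} [NormedAddCommGroup F] [NormedSpace ℝ F] [FiniteDimensional ℝ F] {V : Set F}
    {ψ : F → N}

namespace IsMomentSubmanifold

theorem transverseKahler (h : IsMomentSubmanifold g Q ξ ι f I ζ) (hψ : IsParam (Euc d) V ψ) :
    TransverseKahler V (coordInd d ψ g ι) (coordEnd ψ I) (fun j ↦ coordVec ψ (ζ j)) := by
  refine TransverseKahler.of_local hψ.isOpen fun x hx ↦ ?_
  obtain ⟨U, J, c, hpU, hF, hQ⟩ := h.qk.exists_flatQK h.scal (ι (ψ x))
  have hP := isParam_chart (Euc (4 * n)) (ι (ψ x))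
  have hιs := h.sub.1.contMDiff
  have hc : ∀ y ∈ V, ContMDiffAt 𝓘(ℝ, F) 𝓘(ℝ, Euc (4 * n)) ∞ (fun y ↦ ι (ψ y)) y := fun y hy ↦
    (hιs (ψ y)).comp y (hψ.contMDiffAt hy)
  set X : F → Euc (4 * n) := fun y ↦ extChartAt 𝓘(ℝ, Euc (4 * n)) (ι (ψ x)) (ι (ψ y)) with hX
  have hXc : ContinuousAt X x :=
    ContinuousAt.comp (f := fun y ↦ ι (ψ y)) (continuousAt_extChartAt (ι (ψ x)))
      (hc x hx).continuousAt
  obtain ⟨W, hWs, hWo, hxW⟩ := mem_nhds_iff.1 (Filter.inter_mem (hψ.mem_nhds hx)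
    (Filter.inter_mem ((hc x hx).continuousAt
      ((chartAt (Euc (4 * n)) (ι (ψ x))).open_source.mem_nhds (mem_chart_source _ (ι (ψ x)))))
      (hXc (hF.isOpen.mem_nhds hpU))))
  have hWV : ∀ y ∈ W, y ∈ V := fun y hy ↦ (hWs hy).1
  have hWc : ∀ y ∈ W, ι (ψ y) ∈ (chartAt (Euc (4 * n)) (ι (ψ x))).source := fun y hy ↦ (hWs hy).2.1
  have hWU : ∀ y ∈ W, X y ∈ U := fun y hy ↦ (hWs hy).2.2
  have hq : ∀ y ∈ W, chartPar (Euc (4 * n)) (ι (ψ x)) (X y) = ι (ψ y) := fun y hy ↦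
    chartPar_extChartAt (hWc y hy)
  have hUd : ∀ y ∈ W, X y ∈ chartDom (Euc (4 * n)) (ι (ψ x)) := fun y hy ↦ hF.sub (hWU y hy)
  have hXs : ContDiffOn ℝ ∞ X W := fun y hy ↦ by
    refine ContDiffAt.contDiffWithinAt ?_
    rw [← contMDiffAt_iff_contDiffAt]
    exact (contMDiffAt_extChartAt' (I := 𝓘(ℝ, Euc (4 * n))) (hWc y hy)).comp y (hc y (hWV y hy))
  have hX' : ∀ y ∈ W, ∀ u, fderiv ℝ X y u = parInv (Euc (4 * n))
      (chartPar (Euc (4 * n)) (ι (ψ x))) (X y) (dForm d ι (ψ y) (parD (Euc d) ψ y u)) := by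
    intro y hy u
    rw [fderiv_comp_param ((hc y (hWV y hy)).mdifferentiableAt (by simp)) (hWc y hy),
      parInv_chart (hWc y hy)]
    have := mfderiv_comp y ((hιs (ψ y)).mdifferentiableAt (by simp))
      (hψ.mdifferentiableAt (hWV y hy))
    exact congrArg (fun T : F →L[ℝ] Euc (4 * n) ↦ chartD (Euc (4 * n)) (ι (ψ x)) (ι (ψ y)) (T u)) this
  have hξ : ∀ y ∈ W, ∀ i, coordVec (chartPar (Euc (4 * n)) (ι (ψ x))) (ξ i) (X y)
      = parInv (Euc (4 * n)) (chartPar (Euc (4 * n)) (ι (ψ x))) (X y) (vecForm (ξ i) (ι (ψ y))) := by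
    intro y hy i
    rw [← hq y hy]; rfl
  have hM : ∀ y ∈ W, ∀ i u, flatMoment (chartΓ g (ι (ψ x)))
      (fun a ↦ coordEnd (chartPar (Euc (4 * n)) (ι (ψ x))) (J a))
      (coordVec (chartPar (Euc (4 * n)) (ι (ψ x))) (ξ i)) (X y)
      (parInv (Euc (4 * n)) (chartPar (Euc (4 * n)) (ι (ψ x))) (X y) u)
      = parInv (Euc (4 * n)) (chartPar (Euc (4 * n)) (ι (ψ x))) (X y)
        (endForm (momentMap g Q (ξ i)) (ι (ψ y)) u) := by
    intro y hy i u
    rw [← coordEnd_momentMap hF hQ.toFlatQuat (h.killing i) (hWU y hy), coordEnd_apply,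
      hP.parD_parInv (hUd y hy), hq y hy]
  have hG : ∀ y ∈ W, ∀ u v, coordForm (chartPar (Euc (4 * n)) (ι (ψ x))) g (X y)
      (parInv (Euc (4 * n)) (chartPar (Euc (4 * n)) (ι (ψ x))) (X y) u)
      (parInv (Euc (4 * n)) (chartPar (Euc (4 * n)) (ι (ψ x))) (X y) v)
      = metricForm g (ι (ψ y)) u v := by
    intro y hy u v
    rw [← hP.metric_eq_coordForm (hUd y hy), hq y hy]
  have hζ : ∀ y ∈ W, ∀ i, dForm d ι (ψ y) (parD (Euc d) ψ y (coordVec ψ (ζ i) y))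
      = vecForm (ξ i) (ι (ψ y)) := by
    intro y hy i
    rw [hψ.parD_coordVec (hWV y hy)]
    exact h.tangent i (ψ y)
  have hI : ∀ y ∈ W, ∀ w, dForm d ι (ψ y) (parD (Euc d) ψ y (coordEnd ψ I y w))
      = (f (ψ y))⁻¹ • endForm (momentMap g Q (ξ 0)) (ι (ψ y))
        (endForm (momentMap g Q (ξ 1)) (ι (ψ y)) (dForm d ι (ψ y) (parD (Euc d) ψ y w))) := by
    intro y hy w
    rw [coordEnd_apply, hψ.parD_parInv (hWV y hy)]
    exact h.map (ψ y) _
  have hS : FlatSub U (coordForm (chartPar (Euc (4 * n)) (ι (ψ x))) g) (chartΓ g (ι (ψ x)))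
      (fun a ↦ coordEnd (chartPar (Euc (4 * n)) (ι (ψ x))) (J a)) c
      (fun i ↦ coordVec (chartPar (Euc (4 * n)) (ι (ψ x))) (ξ i)) W X (fun y ↦ f (ψ y))
      (coordEnd ψ I) (fun j ↦ coordVec ψ (ζ j)) :=
    { qk := hQ
      killing := fun i ↦ (h.killing i).flatKilling hF.sub
      isOpen := hWo
      smooth := hXs
      maps := hWU
      inj := fun y hy u v huv ↦ by
        rw [hX' y hy, hX' y hy] at huv
        exact hψ.parD_injective (hWV y hy) (IsImmersionAt.mfderiv_injective (h.sub.1.isImmersionAt _)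
          (hP.parInv_injective (hUd y hy) huv))
      tangent := fun y hy i ↦ by rw [hX' y hy, hζ y hy, hξ y hy]
      bracket := fun y hy ↦ by
        rw [flatBracket, ← hP.coordVec_mlieBracket (hUd y hy) ((h.killing 0).1 _).diff
          ((h.killing 1).1 _).diff, coordVec, hq y hy]
        exact (congrArg _ (h.comm (ψ y))).trans (map_zero _)
      norm := fun y hy ↦ by
        rw [hξ y hy, hξ y hy, hG y hy, hG y hy]
        exact h.norm (ψ y)
      ne := fun y hy h0 ↦ by
        rw [hξ y hy] at h0
        exact h.ne 0 (ψ y) (hP.parInv_injective (hUd y hy) (h0.trans (map_zero _).symm))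
      smooth_f := fun y hy ↦ by
        refine ContDiffAt.contDiffWithinAt ?_
        rw [← contMDiffAt_iff_contDiffAt]
        exact (h.smooth_f (ψ y)).comp y (hψ.contMDiffAt (hWV y hy))
      f_ne := fun y hy ↦ h.f_ne _
      mem := fun y hy ↦ by
        rw [← coordEnd_momentMap hF hQ.toFlatQuat (h.killing 0) (hWU y hy),
          ← coordEnd_momentMap hF hQ.toFlatQuat (h.killing 1) (hWU y hy), coordEnd_eq_parConj,
          coordEnd_eq_parConj, ← hP.parConj_mul (hUd y hy), hP.parConj_mem_span_iff (hUd y hy),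
          ← hF.span _ (hWU y hy), hq y hy]
        exact h.mem (ψ y)
      mapξ := fun y hy ↦ by
        rw [hξ y hy, hξ y hy, hM y hy, hM y hy, ← map_smul]
        exact congrArg _ (h.mapξ (ψ y))
      map := fun y hy w ↦ by
        rw [hX' y hy, hX' y hy, hM y hy, hM y hy, hI y hy, map_smul] }
  refine ⟨W, hxW, hS.transverseKahler.congr fun y hy ↦ ?_⟩
  ext u v
  rw [pullMetric_apply, hX' y hy, hX' y hy, hG y hy, coordInd_apply]

end IsMomentSubmanifold

end MomentSubmanifold

theorem IsInnerForm.isVonNBounded {E : Type*} [NormedAddCommGroup E] [NormedSpace ℝ E]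
    [FiniteDimensional ℝ E] {G : E →L[ℝ] E →L[ℝ] ℝ} (hG : IsInnerForm G) :
    Bornology.IsVonNBounded ℝ {v : E | G v v < 1} := by
  rw [NormedSpace.isVonNBounded_iff]
  have hc : Continuous fun v : E ↦ G v v := G.continuous.clm_apply continuous_id
  rcases subsingleton_or_nontrivial E with hE | hE
  · exact (Set.toFinite _).isBounded
  obtain ⟨w, hw, hmin⟩ := (isCompact_sphere (0 : E) 1).exists_isMinOn
    (NormedSpace.sphere_nonempty.2 zero_le_one) hc.continuousOn
  have hw0 : w ≠ 0 := by
    rintro rfl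
    simp at hw
  have hpos := hG.pos w hw0
  rw [isBounded_iff_forall_norm_le]
  refine ⟨(G w w)⁻¹ + 1, fun v hv ↦ ?_⟩
  by_contra! hlt
  have hinv := inv_pos.2 hpos
  have hv0 : 0 < ‖v‖ := by linarith
  have h1 : G w w ≤ G (‖v‖⁻¹ • v) (‖v‖⁻¹ • v) := hmin (by
    rw [mem_sphere_zero_iff_norm, norm_smul, norm_inv, norm_norm, inv_mul_cancel₀ hv0.ne'])
  rw [map_smul, map_smul, _root_.smul_apply, smul_eq_mul, smul_eq_mul] at h1
  have h2 : G w w * ‖v‖ * ‖v‖ ≤ G v v := by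
    calc G w w * ‖v‖ * ‖v‖ ≤ ‖v‖⁻¹ * (‖v‖⁻¹ * G v v) * ‖v‖ * ‖v‖ := by gcongr
      _ = G v v := by field_simp
  have h3 : G v v < 1 := hv
  have h4 : 1 < G w w * ‖v‖ := by
    have : G w w * ((G w w)⁻¹ + 1) < G w w * ‖v‖ := by gcongr
    rw [mul_add, mul_inv_cancel₀ hpos.ne'] at this
    linarith
  have h5 : 1 ≤ ‖v‖ := by linarith
  nlinarith

/-- A Kähler structure on the open set `V` of a vector space. -/
structure FlatKahler {F : Type*} [NormedAddCommGroup F] [NormedSpace ℝ F] (V : Set F)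
    (g : F → F →L[ℝ] F →L[ℝ] ℝ) (I : F → F →L[ℝ] F) : Prop where
  isOpen : IsOpen V
  smooth_g : ContDiffOn ℝ ∞ g V
  smooth_I : ContDiffOn ℝ ∞ I V
  inner : ∀ x ∈ V, IsInnerForm (g x)
  sq : ∀ x ∈ V, ∀ u, I x (I x u) = -u
  herm : ∀ x ∈ V, ∀ u v, g x (I x u) (I x v) = g x u v
  nijenhuis : ∀ x ∈ V, ∀ u w, flatNijenhuis I x u w = 0
  closed : ∀ x ∈ V, ∀ u v w, fderiv ℝ (fun y ↦ g y v (I y w)) x u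
    + fderiv ℝ (fun y ↦ g y w (I y u)) x v + fderiv ℝ (fun y ↦ g y u (I y v)) x w = 0

theorem FlatKahler.mono {F : Type*} [NormedAddCommGroup F] [NormedSpace ℝ F] {V W : Set F}
    {g : F → F →L[ℝ] F →L[ℝ] ℝ} {I : F → F →L[ℝ] F} (h : FlatKahler V g I) (hW : IsOpen W)
    (hs : W ⊆ V) : FlatKahler W g I where
  isOpen := hW
  smooth_g := h.smooth_g.mono hs
  smooth_I := h.smooth_I.mono hs
  inner x hx := h.inner x (hs hx)
  sq x hx := h.sq x (hs hx)
  herm x hx := h.herm x (hs hx)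
  nijenhuis x hx := h.nijenhuis x (hs hx)
  closed x hx := h.closed x (hs hx)

section FlatFields

variable {F : Type*} [NormedAddCommGroup F] [NormedSpace ℝ F] {x : F}
  {g : F → F →L[ℝ] F →L[ℝ] ℝ} {I : F → F →L[ℝ] F} {X Y Z : F → F}

/-- The Nijenhuis tensor on arbitrary vector fields. -/
theorem flatNijenhuis_fields (hI : DifferentiableAt ℝ I x) (hsq : ∀ u, I x (I x u) = -u)
    (hX : DifferentiableAt ℝ X x) (hY : DifferentiableAt ℝ Y x) :
    flatBracket (fun y ↦ I y (X y)) (fun y ↦ I y (Y y)) x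
      - I x (flatBracket (fun y ↦ I y (X y)) Y x) - I x (flatBracket X (fun y ↦ I y (Y y)) x)
      - flatBracket X Y x = flatNijenhuis I x (X x) (Y x) := by
  simp only [flatBracket, fderiv_clm_apply_apply hI hX, fderiv_clm_apply_apply hI hY, flatNijenhuis,
    map_sub, map_add, hsq]
  abel

theorem fderiv_fundamental (hg : DifferentiableAt ℝ g x) (hI : DifferentiableAt ℝ I x)
    (hX : DifferentiableAt ℝ X x) (hY : DifferentiableAt ℝ Y x) (u : F) :
    fderiv ℝ (fun y ↦ g y (X y) (I y (Y y))) x u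
      = fderiv ℝ (fun y ↦ g y (X x) (I y (Y x))) x u
        + g x (fderiv ℝ X x u) (I x (Y x)) + g x (X x) (I x (fderiv ℝ Y x u)) := by
  have h1 : ∀ (X Y : F → F), DifferentiableAt ℝ X x → DifferentiableAt ℝ Y x →
      fderiv ℝ (fun y ↦ g y (X y) (I y (Y y))) x u
      = fderiv ℝ (fun y ↦ g y (X x) (I x (Y x))) x u
        + g x (fderiv ℝ X x u) (I x (Y x)) + g x (X x) (fderiv ℝ I x u (Y x))
        + g x (X x) (I x (fderiv ℝ Y x u)) := by
    intro X Y hX hY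
    rw [fderiv_form_apply hg hX (hI.clm_apply hY), fderiv_clm_apply_apply hI hY, map_add]
    ring
  rw [h1 X Y hX hY, h1 (fun _ ↦ X x) (fun _ ↦ Y x) (differentiableAt_const _)
    (differentiableAt_const _)]
  simp only [fderiv_fun_const, Pi.zero_apply, _root_.zero_apply, map_zero]
  ring

end FlatFields

section Structures

variable {E : Type*} [NormedAddCommGroup E] [NormedSpace ℝ E] [FiniteDimensional ℝ E]
  {M : Type*} [TopologicalSpace M] [ChartedSpace E M] [IsManifold 𝓘(ℝ, E) ∞ M]

theorem coordVec_bracket_self {X Y : VField E M} {p : M} (hX : DiffVFieldAt X p)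
    (hY : DiffVFieldAt Y p) :
    coordVec (chartPar E p) (VectorField.mlieBracket 𝓘(ℝ, E) X Y) (extChartAt 𝓘(ℝ, E) p p)
      = flatBracket (coordVec (chartPar E p) X) (coordVec (chartPar E p) Y)
        (extChartAt 𝓘(ℝ, E) p p) :=
  (isParam_chart E p).coordVec_mlieBracket (mem_chartDom p) (by rwa [chartPar_self])
    (by rwa [chartPar_self])

theorem coordVec_endForm (J : EndField E M) (X : VField E M) (p : M) {x : E}
    (hx : x ∈ chartDom E p) : coordVec (chartPar E p) (fun q ↦ J q (X q)) x
      = coordEnd (chartPar E p) J x (coordVec (chartPar E p) X x) :=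
  (isParam_chart E p).parInv_endForm hx J _

theorem diffVFieldAt_endForm {J : EndField E M} {X : VField E M} {p : M}
    (hJ : DifferentiableAt ℝ (coordEnd (chartPar E p) J) (extChartAt 𝓘(ℝ, E) p p))
    (hX : DiffVFieldAt X p) : DiffVFieldAt (fun q ↦ J q (X q)) p := by
  have hP := isParam_chart E p
  have dX := hP.differentiableAt_coordVec (mem_chartDom p) (Z := X) (by rwa [chartPar_self])
  have := diffVFieldAt_of_coordVec p (mem_chartDom p) (Y := fun q ↦ J q (X q))
    ((hJ.clm_apply dX).congr_of_eventuallyEq (by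
      filter_upwards [hP.mem_nhds (mem_chartDom p)] with y hy
      exact coordVec_endForm J X p hy))
  rwa [chartPar_self] at this

/-- A complex structure in terms of its coordinate expressions. -/
theorem isComplexStructure_of_coord {J : EndField E M}
    (hJ : ∀ p, ContDiffAt ℝ ∞ (coordEnd (chartPar E p) J) (extChartAt 𝓘(ℝ, E) p p))
    (hsq : ∀ p u, endForm J p (endForm J p u) = -u)
    (hN : ∀ p u w, flatNijenhuis (coordEnd (chartPar E p) J) (extChartAt 𝓘(ℝ, E) p p) u w = 0) :
    IsComplexStructure J where
  smooth p := smoothEndFieldAt_of_coordEnd (hJ p)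
  sq := hsq
  integrable p X Y hX hY := by
    have hP := isParam_chart E p
    have hm := mem_chartDom (E := E) p
    have dJ := (hJ p).differentiableAt (by simp)
    have dX := hP.differentiableAt_coordVec hm (Z := X) (by rw [chartPar_self]; exact hX.diff)
    have dY := hP.differentiableAt_coordVec hm (Z := Y) (by rw [chartPar_self]; exact hY.diff)
    have dJX := diffVFieldAt_endForm dJ hX.diff
    have dJY := diffVFieldAt_endForm dJ hY.diff
    have sq : ∀ u, coordEnd (chartPar E p) J (extChartAt 𝓘(ℝ, E) p p)
        (coordEnd (chartPar E p) J (extChartAt 𝓘(ℝ, E) p p) u) = -u := by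
      intro u
      rw [coordEnd_apply, coordEnd_apply, hP.parD_parInv hm, hsq, map_neg, hP.parInv_parD hm]
    have key := flatNijenhuis_fields dJ sq dX dY
    rw [hN] at key
    have eX : coordVec (chartPar E p) (fun q ↦ J q (X q)) =ᶠ[𝓝 (extChartAt 𝓘(ℝ, E) p p)]
        fun y ↦ coordEnd (chartPar E p) J y (coordVec (chartPar E p) X y) := by
      filter_upwards [hP.mem_nhds hm] with y hy
      exact coordVec_endForm J X p hy
    have eY : coordVec (chartPar E p) (fun q ↦ J q (Y q)) =ᶠ[𝓝 (extChartAt 𝓘(ℝ, E) p p)]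
        fun y ↦ coordEnd (chartPar E p) J y (coordVec (chartPar E p) Y y) := by
      filter_upwards [hP.mem_nhds hm] with y hy
      exact coordVec_endForm J Y p hy
    have hb : ∀ {A B A' B' : E → E}, A =ᶠ[𝓝 (extChartAt 𝓘(ℝ, E) p p)] A' →
        B =ᶠ[𝓝 (extChartAt 𝓘(ℝ, E) p p)] B' → flatBracket A B (extChartAt 𝓘(ℝ, E) p p)
          = flatBracket A' B' (extChartAt 𝓘(ℝ, E) p p) := by
      intro A B A' B' h1 h2
      rw [flatBracket, flatBracket, h1.fderiv_eq, h2.fderiv_eq, h1.eq_of_nhds, h2.eq_of_nhds]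
    rw [← hb eX eY, ← hb eX (Filter.EventuallyEq.refl _ (coordVec (chartPar E p) Y)),
      ← hb (Filter.EventuallyEq.refl _ (coordVec (chartPar E p) X)) eY,
      ← coordVec_bracket_self dJX dJY, ← coordVec_bracket_self dJX hY.diff,
      ← coordVec_bracket_self hX.diff dJY, ← coordVec_bracket_self hX.diff hY.diff,
      ← coordVec_endForm J _ p hm, ← coordVec_endForm J _ p hm] at key
    have h2 : ∀ q, q = p → ∀ (a b c d : E), parInv E (chartPar E p) (extChartAt 𝓘(ℝ, E) p p) a
        - parInv E (chartPar E p) (extChartAt 𝓘(ℝ, E) p p) b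
        - parInv E (chartPar E p) (extChartAt 𝓘(ℝ, E) p p) c
        - parInv E (chartPar E p) (extChartAt 𝓘(ℝ, E) p p) d = 0 → a - b - c - d = 0 := by
      rintro q - a b c d h
      rw [← map_sub, ← map_sub, ← map_sub] at h
      exact hP.parInv_injective hm (h.trans (map_zero _).symm)
    have h3 := h2 p rfl _ _ _ _ key
    rw [chartPar_self] at h3
    exact h3

/-- Kähler structures in terms of their coordinate expressions. -/
theorem isKahler_of_coord {h : RMetric E M} {J : EndField E M} (hJ : IsComplexStructure J)
    (hh : ∀ p u v, metricForm h p (endForm J p u) (endForm J p v) = metricForm h p u v)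
    (hc : ∀ p u v w,
      fderiv ℝ (fun y ↦ coordForm (chartPar E p) h y v (coordEnd (chartPar E p) J y w))
        (extChartAt 𝓘(ℝ, E) p p) u
      + fderiv ℝ (fun y ↦ coordForm (chartPar E p) h y w (coordEnd (chartPar E p) J y u))
        (extChartAt 𝓘(ℝ, E) p p) v
      + fderiv ℝ (fun y ↦ coordForm (chartPar E p) h y u (coordEnd (chartPar E p) J y v))
        (extChartAt 𝓘(ℝ, E) p p) w = 0) : IsKahler h J where
  complex := hJ
  hermitian := hh
  closed p X Y Z hX hY hZ := by
    have hP := isParam_chart E p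
    have hm := mem_chartDom (E := E) p
    set x := extChartAt 𝓘(ℝ, E) p p with hx
    have h0 : chartPar E p x = p := chartPar_self p
    set Ĝ := coordForm (chartPar E p) h
    set Ĵ := coordEnd (chartPar E p) J
    have dG : DifferentiableAt ℝ Ĝ x := (hP.contDiffAt_coordForm hm h).differentiableAt (by simp)
    have dJ : DifferentiableAt ℝ Ĵ x :=
      (hP.contDiffAt_coordEnd hm (hJ.smooth _)).differentiableAt (by simp)
    have anti : ∀ u v, Ĝ x u (Ĵ x v) = -Ĝ x v (Ĵ x u) := by
      intro u v
      have h1 : ∀ u v, Ĝ x (Ĵ x u) (Ĵ x v) = Ĝ x u v := by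
        intro u v
        simp only [Ĝ, Ĵ]
        rw [coordForm_apply, coordEnd_apply, coordEnd_apply, hP.parD_parInv hm, hP.parD_parInv hm,
          hh, coordForm_apply]
      have h2 : Ĵ x (Ĵ x v) = -v := by
        simp only [Ĵ]
        rw [coordEnd_apply, coordEnd_apply, hP.parD_parInv hm]
        refine (congrArg _ (hJ.sq _ _)).trans ?_
        refine (map_neg (parInv E (chartPar E p) x) _).trans (congrArg _ (hP.parInv_parD hm _))
      rw [← h1, h2, map_neg, (hP.isInnerForm_coordForm hm h).symm]
    have hf : ∀ A B : VField E M, (fun y ↦ fundamentalForm h J A B (chartPar E p y)) =ᶠ[𝓝 x]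
        fun y ↦ Ĝ y (coordVec (chartPar E p) A y) (Ĵ y (coordVec (chartPar E p) B y)) := by
      intro A B
      filter_upwards [hP.mem_nhds hm] with y hy
      simp only [Ĝ, Ĵ]
      rw [← coordVec_endForm J B p hy]
      exact hP.metric_eq_coordForm hy h _ _
    have hd : ∀ A : VField E M, SmoothVFieldAt A p →
        DifferentiableAt ℝ (coordVec (chartPar E p) A) x := fun A hA ↦
      hP.differentiableAt_coordVec hm (by rw [h0]; exact hA.diff)
    have key : ∀ A B C : VField E M, SmoothVFieldAt A p → SmoothVFieldAt B p → SmoothVFieldAt C p →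
        mvfderiv 𝓘(ℝ, E) (fundamentalForm h J A B) p (C p)
          = fderiv ℝ (fun y ↦ Ĝ y (coordVec (chartPar E p) A x) (Ĵ y (coordVec (chartPar E p) B x))) x
              (coordVec (chartPar E p) C x)
            + Ĝ x (fderiv ℝ (coordVec (chartPar E p) A) x (coordVec (chartPar E p) C x))
              (Ĵ x (coordVec (chartPar E p) B x))
            + Ĝ x (coordVec (chartPar E p) A x)
              (Ĵ x (fderiv ℝ (coordVec (chartPar E p) B) x (coordVec (chartPar E p) C x))) := by
      intro A B C hA hB hC
      have h1 : DiffVFieldAt (fun q ↦ J q (B q)) p := diffVFieldAt_endForm dJ hB.diff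
      have h2 : ∀ q, q = p → mvfderiv 𝓘(ℝ, E) (fundamentalForm h J A B) q (C q)
          = mvfderiv 𝓘(ℝ, E) (fundamentalForm h J A B) p (C p) := by rintro q rfl; rfl
      rw [← h2 _ h0, ← fderiv_fundamental dG dJ (hd A hA) (hd B hB), ← (hf A B).fderiv_eq,
        ← hP.mvfderiv_parD hm]
      · exact congrArg _ (hP.parD_coordVec hm C).symm
      · rw [h0]
        exact mdifferentiableAt_metric h hA.diff h1
    have br : ∀ A B C : VField E M, SmoothVFieldAt A p → SmoothVFieldAt B p →
        fundamentalForm h J (VectorField.mlieBracket 𝓘(ℝ, E) A B) C p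
          = Ĝ x (fderiv ℝ (coordVec (chartPar E p) B) x (coordVec (chartPar E p) A x)
            - fderiv ℝ (coordVec (chartPar E p) A) x (coordVec (chartPar E p) B x))
            (Ĵ x (coordVec (chartPar E p) C x)) := by
      intro A B C hA hB
      have h1 := (hf (VectorField.mlieBracket 𝓘(ℝ, E) A B) C).eq_of_nhds
      rw [h0, coordVec_bracket_self hA.diff hB.diff] at h1
      exact h1
    rw [key Y Z X hY hZ hX, key Z X Y hZ hX hY, key X Y Z hX hY hZ, br X Y Z hX hY, br Y Z X hY hZ,
      br Z X Y hZ hX]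
    have h3 := hc p (coordVec (chartPar E p) X x) (coordVec (chartPar E p) Y x)
      (coordVec (chartPar E p) Z x)
    simp only [map_sub, _root_.sub_apply]
    rw [anti (coordVec (chartPar E p) Y x), anti (coordVec (chartPar E p) Z x),
      anti (coordVec (chartPar E p) X x)]
    linarith

/-- A Kähler structure given by bilinear forms and endomorphisms of the model space whose coordinate
expressions are Kähler. -/
theorem exists_kahler (G : M → E →L[ℝ] E →L[ℝ] ℝ) (J : M → E →L[ℝ] E)
    (g : M → E → E →L[ℝ] E →L[ℝ] ℝ) (I : M → E → E →L[ℝ] E)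
    (hf : ∀ p, FlatKahler (chartDom E p) (g p) (I p))
    (hG : ∀ p, ∀ x ∈ chartDom E p, ∀ u v, G (chartPar E p x) (parD E (chartPar E p) x u)
      (parD E (chartPar E p) x v) = g p x u v)
    (hJ : ∀ p, ∀ x ∈ chartDom E p, ∀ u, J (chartPar E p x) (parD E (chartPar E p) x u)
      = parD E (chartPar E p) x (I p x u)) :
    ∃ (h : RMetric E M) (K : EndField E M), IsKahler h K ∧ (∀ p, metricForm h p = G p) ∧
      ∀ p, endForm K p = J p := by
  have hP := fun p : M ↦ isParam_chart E p
  have hm := fun p : M ↦ mem_chartDom (E := E) p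
  have h0 := fun p : M ↦ chartPar_self (E := E) p
  have hGi : ∀ p, IsInnerForm (G p) := by
    intro p
    have h1 : ∀ u v, G p (parD E (chartPar E p) (extChartAt 𝓘(ℝ, E) p p) u)
        (parD E (chartPar E p) (extChartAt 𝓘(ℝ, E) p p) v) = g p (extChartAt 𝓘(ℝ, E) p p) u v := by
      intro u v
      rw [← hG p _ (hm p), h0]
    have h2 := (hf p).inner _ (hm p)
    refine ⟨fun u v ↦ ?_, fun u hu ↦ ?_⟩
    · have := h2.symm (parInv E (chartPar E p) (extChartAt 𝓘(ℝ, E) p p) u)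
        (parInv E (chartPar E p) (extChartAt 𝓘(ℝ, E) p p) v)
      rwa [← h1, ← h1, (hP p).parD_parInv (hm p), (hP p).parD_parInv (hm p)] at this
    · have := h2.pos (parInv E (chartPar E p) (extChartAt 𝓘(ℝ, E) p p) u) fun h ↦ hu
        ((hP p).parInv_injective (hm p) (h.trans (map_zero _).symm))
      rwa [← h1, (hP p).parD_parInv (hm p)] at this
  have hnh : ∀ p, chartDom E p ∈ 𝓝 (extChartAt 𝓘(ℝ, E) p p) := fun p ↦ (hP p).mem_nhds (hm p)
  let h : RMetric E M :=
    { inner := G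
      symm := fun p u v ↦ (hGi p).symm u v
      pos := fun p u hu ↦ (hGi p).pos u hu
      isVonNBounded := fun p ↦ (hGi p).isVonNBounded
      contMDiff := fun p ↦ contMDiffAt_metric_of_coord (G := G) (fun q ↦ rfl) fun u v ↦
        ((((hf p).smooth_g.contDiffAt (hnh p)).clm_apply (contDiffAt_const (c := u))).clm_apply
          (contDiffAt_const (c := v))).congr_of_eventuallyEq (by
            filter_upwards [hnh p] with y hy
            exact hG p y hy u v) }
  let K : EndField E M := J
  have eG : ∀ p, ∀ x ∈ chartDom E p, coordForm (chartPar E p) h x = g p x := by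
    intro p x hx
    ext u v
    exact hG p x hx u v
  have eJ : ∀ p, ∀ x ∈ chartDom E p, coordEnd (chartPar E p) K x = I p x := by
    intro p x hx
    ext1 u
    rw [coordEnd_apply]
    exact (congrArg _ (hJ p x hx u)).trans ((hP p).parInv_parD hx _)
  have eGn : ∀ p, coordForm (chartPar E p) h =ᶠ[𝓝 (extChartAt 𝓘(ℝ, E) p p)] g p := fun p ↦
    Filter.mem_of_superset (hnh p) (eG p)
  have eJn : ∀ p, coordEnd (chartPar E p) K =ᶠ[𝓝 (extChartAt 𝓘(ℝ, E) p p)] I p := fun p ↦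
    Filter.mem_of_superset (hnh p) (eJ p)
  have eJ' : ∀ p u, endForm K p u = parD E (chartPar E p) (extChartAt 𝓘(ℝ, E) p p)
      (I p (extChartAt 𝓘(ℝ, E) p p) (parInv E (chartPar E p) (extChartAt 𝓘(ℝ, E) p p) u)) := by
    intro p u
    rw [← hJ p _ (hm p), (hP p).parD_parInv (hm p), h0]
    rfl
  refine ⟨h, K, isKahler_of_coord (isComplexStructure_of_coord (fun p ↦ ?_) (fun p u ↦ ?_)
    fun p u w ↦ ?_) (fun p u v ↦ ?_) fun p u v w ↦ ?_, fun p ↦ rfl, fun p ↦ rfl⟩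
  · exact ((hf p).smooth_I.contDiffAt (hnh p)).congr_of_eventuallyEq (eJn p)
  · rw [eJ', eJ', (hP p).parInv_parD (hm p), (hf p).sq _ (hm p), map_neg, (hP p).parD_parInv (hm p)]
  · rw [flatNijenhuis, (eJn p).fderiv_eq, (eJn p).eq_of_nhds]
    exact (hf p).nijenhuis _ (hm p) u w
  · have h1 : ∀ q, q = p → ∀ u v, metricForm h q u v = metricForm h p u v := by
      rintro q rfl u v; rfl
    rw [eJ', eJ', ← h1 _ (h0 p), ← coordForm_apply, eG p _ (hm p), (hf p).herm _ (hm p), ← eG p _ (hm p),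
      coordForm_apply, (hP p).parD_parInv (hm p), (hP p).parD_parInv (hm p), h1 _ (h0 p)]
  · have e1 : ∀ v w, (fun y ↦ coordForm (chartPar E p) h y v (coordEnd (chartPar E p) K y w))
        =ᶠ[𝓝 (extChartAt 𝓘(ℝ, E) p p)] fun y ↦ g p y v (I p y w) := by
      intro v w
      filter_upwards [hnh p] with y hy
      rw [eG p y hy, eJ p y hy]
    rw [(e1 v w).fderiv_eq, (e1 w u).fderiv_eq, (e1 u v).fderiv_eq]
    exact (hf p).closed _ (hm p) u v w

end Structures

section TransversalForm

variable {F : Type*} [NormedAddCommGroup F] [NormedSpace ℝ F]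

/-- The part of a bilinear form transversal to the vectors `e j`. -/
def transForm (g : F →L[ℝ] F →L[ℝ] ℝ) (e : Fin 2 → F) : F →L[ℝ] F →L[ℝ] ℝ :=
  g - ∑ j, (g (e j) (e j))⁻¹ • (g (e j)).smulRight (g (e j))

theorem transForm_apply (g : F →L[ℝ] F →L[ℝ] ℝ) (e : Fin 2 → F) (u v : F) :
    transForm g e u v = g u v - (g (e 0) (e 0))⁻¹ * (g (e 0) u * g (e 0) v)
      - (g (e 1) (e 1))⁻¹ * (g (e 1) u * g (e 1) v) := by
  rw [transForm, Fin.sum_univ_two]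
  simp only [_root_.sub_apply, _root_.add_apply, _root_.smul_apply,
    ContinuousLinearMap.smulRight_apply, smul_eq_mul]
  ring

theorem transForm_of_ortho {g : F →L[ℝ] F →L[ℝ] ℝ} {e : Fin 2 → F} {u : F}
    (hu : ∀ j, g (e j) u = 0) (v : F) : transForm g e u v = g u v := by
  rw [transForm_apply, hu, hu]
  ring

/-- The linear algebra of an inner product with a complex structure and a complex line. -/
structure IsHermitianLine (g : F →L[ℝ] F →L[ℝ] ℝ) (I : F →L[ℝ] F) (e : Fin 2 → F) : Prop where
  inner : IsInnerForm g
  sq : ∀ u, I (I u) = -u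
  herm : ∀ u v, g (I u) (I v) = g u v
  map : I (e 0) = e 1
  ne : e 0 ≠ 0

namespace IsHermitianLine

variable {g : F →L[ℝ] F →L[ℝ] ℝ} {I : F →L[ℝ] F} {e : Fin 2 → F} (h : IsHermitianLine g I e)
include h

theorem map_one : I (e 1) = -e 0 := by rw [← h.map, h.sq]

theorem skew (u v : F) : g (I u) v = -g u (I v) := by
  rw [← h.herm u (I v), h.sq, map_neg, neg_neg]

theorem e01 : g (e 0) (e 1) = 0 := by
  have h1 := h.skew (e 0) (e 0)
  rw [h.map, h.inner.symm] at h1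
  linarith

theorem e11 : g (e 1) (e 1) = g (e 0) (e 0) := by rw [← h.map, h.herm]

theorem pos : 0 < g (e 0) (e 0) := h.inner.pos _ h.ne

theorem transForm_eq (u v : F) : transForm g e u v
    = g u v - (g (e 0) (e 0))⁻¹ * (g (e 0) u * g (e 0) v + g (e 1) u * g (e 1) v) := by
  rw [transForm_apply, h.e11]
  ring

theorem transForm_symm (u v : F) : transForm g e u v = transForm g e v u := by
  rw [h.transForm_eq, h.transForm_eq, h.inner.symm]
  ring

theorem transForm_map (u v : F) : transForm g e (I u) (I v) = transForm g e u v := by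
  have h0 : ∀ w, g (e 0) (I w) = -g (e 1) w := fun w ↦ by
    have := h.skew (e 0) w
    rw [h.map] at this
    linarith
  have h1 : ∀ w, g (e 1) (I w) = g (e 0) w := fun w ↦ by rw [← h.map, h.herm]
  rw [h.transForm_eq, h.transForm_eq, h.herm, h0, h0, h1, h1]
  ring

theorem transForm_left (j : Fin 2) (v : F) : transForm g e (e j) v = 0 := by
  have hp := h.pos.ne'
  rw [h.transForm_eq]
  fin_cases j
  · simp only [Fin.zero_eta]
    rw [h.inner.symm (e 1), h.e01]
    field_simp
    ring
  · simp only [Fin.mk_one]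
    rw [h.e01, h.e11]
    field_simp
    ring

theorem transForm_right (j : Fin 2) (v : F) : transForm g e v (e j) = 0 := by
  rw [h.transForm_symm, h.transForm_left]

/-- The horizontal part of a vector. -/
theorem exists_horizontal (u : F) : ∃ a b : ℝ, ∀ j, g (e j) (u - a • e 0 - b • e 1) = 0 := by
  have hp := h.pos.ne'
  refine ⟨(g (e 0) (e 0))⁻¹ * g (e 0) u, (g (e 0) (e 0))⁻¹ * g (e 1) u, fun j ↦ ?_⟩
  simp only [map_sub, map_smul, smul_eq_mul]
  fin_cases j
  · simp only [Fin.zero_eta]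
    rw [h.e01]
    field_simp
    ring
  · simp only [Fin.mk_one]
    rw [h.inner.symm (e 1) (e 0), h.e01, h.e11]
    field_simp
    ring

theorem transForm_pos {u : F} (hu : ∀ a b : ℝ, u ≠ a • e 0 + b • e 1) : 0 < transForm g e u u := by
  obtain ⟨a, b, hab⟩ := h.exists_horizontal u
  have h1 : transForm g e u u
      = transForm g e (u - a • e 0 - b • e 1) (u - a • e 0 - b • e 1) := by
    simp only [map_sub, map_smul, _root_.sub_apply, _root_.smul_apply, h.transForm_left,
      h.transForm_right]
    simp
  rw [h1, transForm_of_ortho hab]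
  refine h.inner.pos _ fun h0 ↦ hu a b ?_
  rw [sub_sub, sub_eq_zero] at h0
  exact h0

end IsHermitianLine

theorem TransverseKahler.hermitianLine {V : Set F} {g : F → F →L[ℝ] F →L[ℝ] ℝ} {I : F → F →L[ℝ] F}
    {ζ : Fin 2 → F → F} (h : TransverseKahler V g I ζ) {x : F} (hx : x ∈ V) :
    IsHermitianLine (g x) (I x) fun j ↦ ζ j x :=
  ⟨h.inner x hx, h.sq x hx, h.herm x hx, h.map_ζ x hx, h.ne x hx⟩

end TransversalForm

section SliceQuotient

variable {E : Type*} [NormedAddCommGroup E] [NormedSpace ℝ E]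

variable (E) in
/-- The coordinate vectors in direction of the orbits. -/
def orbVec (j : Fin 2) : (ℝ × ℝ) × E := (if j = 0 then (1, 0) else (0, 1), 0)

theorem eq_orbVec_add (a : (ℝ × ℝ) × E) :
    a = a.1.1 • orbVec E 0 + a.1.2 • orbVec E 1 + (0, a.2) := by
  ext <;> simp [orbVec]

/-- A function on a product whose derivatives in direction of the first factor vanish. -/
theorem eq_of_fderiv_orbVec {W : Type*} [NormedAddCommGroup W] [NormedSpace ℝ W]
    {S : Set (ℝ × ℝ)} {B : Set E} (hS : IsOpen S) (hc : IsPreconnected S) (h0 : (0 : ℝ × ℝ) ∈ S)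
    {f : (ℝ × ℝ) × E → W} (hf : ∀ x ∈ S ×ˢ B, DifferentiableAt ℝ f x)
    (hd : ∀ x ∈ S ×ˢ B, ∀ j, fderiv ℝ f x (orbVec E j) = 0) :
    ∀ x ∈ S ×ˢ B, f x = f (0, x.2) := by
  rintro ⟨s, y⟩ ⟨hs, hy⟩
  have hi : ∀ t : ℝ × ℝ, HasFDerivAt (fun t : ℝ × ℝ ↦ (t, y)) (.inl ℝ (ℝ × ℝ) E) t := fun t ↦
    hasFDerivAt_prodMk_left t y
  have hdf : ∀ t ∈ S, HasFDerivAt (fun t ↦ f (t, y)) (fderiv ℝ f (t, y) ∘L .inl ℝ (ℝ × ℝ) E) t :=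
    fun t ht ↦ (hf (t, y) ⟨ht, hy⟩).hasFDerivAt.comp t (hi t)
  refine hS.is_const_of_fderiv_eq_zero (𝕜 := ℝ) hc
    (fun t ht ↦ (hdf t ht).differentiableAt.differentiableWithinAt) (fun t ht ↦ ?_) hs h0
  rw [(hdf t ht).fderiv]
  refine ContinuousLinearMap.ext fun ⟨a, b⟩ ↦ ?_
  have : ((a, b), (0 : E)) = a • orbVec E 0 + b • orbVec E 1 := by ext <;> simp [orbVec]
  simp only [ContinuousLinearMap.comp_apply, ContinuousLinearMap.inl_apply, Pi.zero_apply,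
    _root_.zero_apply]
  rw [this, map_add, map_smul, map_smul, hd (t, y) ⟨ht, hy⟩, hd (t, y) ⟨ht, hy⟩, smul_zero, smul_zero,
    add_zero]

/-- The metric of the local quotient. -/
def sliceForm (g : (ℝ × ℝ) × E → ((ℝ × ℝ) × E) →L[ℝ] ((ℝ × ℝ) × E) →L[ℝ] ℝ) (y : E) :
    E →L[ℝ] E →L[ℝ] ℝ :=
  (transForm (g (0, y)) (orbVec E)).bilinearComp (.inr ℝ (ℝ × ℝ) E) (.inr ℝ (ℝ × ℝ) E)

/-- The complex structure of the local quotient. -/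
def sliceEnd (I : (ℝ × ℝ) × E → ((ℝ × ℝ) × E) →L[ℝ] ((ℝ × ℝ) × E)) (y : E) : E →L[ℝ] E :=
  .snd ℝ (ℝ × ℝ) E ∘L I (0, y) ∘L .inr ℝ (ℝ × ℝ) E

variable {S : Set (ℝ × ℝ)} {B : Set E}
  {g : (ℝ × ℝ) × E → ((ℝ × ℝ) × E) →L[ℝ] ((ℝ × ℝ) × E) →L[ℝ] ℝ}
  {I : (ℝ × ℝ) × E → ((ℝ × ℝ) × E) →L[ℝ] ((ℝ × ℝ) × E)}

namespace TransverseKahler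

variable (h : TransverseKahler (S ×ˢ B) g I fun j _ ↦ orbVec E j) (hS : IsOpen S)
  (hc : IsPreconnected S) (h0 : (0 : ℝ × ℝ) ∈ S) {x : (ℝ × ℝ) × E} (hx : x ∈ S ×ˢ B)
include h

include hx in
theorem diff_slice_g : DifferentiableAt ℝ g x :=
  (h.smooth_g.contDiffAt (h.isOpen.mem_nhds hx)).differentiableAt (by simp)

include hx in
theorem diff_slice_I : DifferentiableAt ℝ I x :=
  (h.smooth_I.contDiffAt (h.isOpen.mem_nhds hx)).differentiableAt (by simp)

include hS hc h0 hx

theorem slice_I_eq : I x = I (0, x.2) := by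
  refine eq_of_fderiv_orbVec hS hc h0 (f := I) (B := B) (fun x hx ↦ h.diff_slice_I hx)
    (fun x hx j ↦ ?_) x hx
  refine ContinuousLinearMap.ext fun w ↦ ?_
  have := h.lieI x hx j w
  simpa using this

set_option synthInstance.maxHeartbeats 400000 in
theorem slice_g_eq : g x = g (0, x.2) := by
  refine eq_of_fderiv_orbVec hS hc h0 (f := g) (B := B) (fun x hx ↦ h.diff_slice_g hx)
    (fun x hx j ↦ ?_) x hx
  refine ContinuousLinearMap.ext fun u ↦ ContinuousLinearMap.ext fun v ↦ ?_
  have h1 := h.lieg x hx j u v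
  have h2 := fderiv_form_apply (h.diff_slice_g hx) (differentiableAt_const u)
    (differentiableAt_const v) (orbVec E j)
  simp only [fderiv_fun_const, Pi.zero_apply, _root_.zero_apply, map_zero, add_zero] at h1
  have h3 := ((h.diff_slice_g hx).hasFDerivAt.clm_apply (hasFDerivAt_const u x)).clm_apply
    (hasFDerivAt_const v x)
  rw [h3.fderiv] at h1
  simpa using h1

omit hS hc h0 hx in
theorem slice_mem (hx : x ∈ S ×ˢ B) (h0 : (0 : ℝ × ℝ) ∈ S) : ((0, x.2) : (ℝ × ℝ) × E) ∈ S ×ˢ B :=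
  ⟨h0, hx.2⟩

theorem sliceForm_snd (a b : (ℝ × ℝ) × E) :
    sliceForm g x.2 a.2 b.2 = transForm (g x) (orbVec E) a b := by
  have hl := h.hermitianLine (h.slice_mem hx h0)
  rw [h.slice_g_eq hS hc h0 hx]
  conv_rhs => rw [eq_orbVec_add a, eq_orbVec_add b]
  simp only [map_add, map_smul, _root_.add_apply, _root_.smul_apply, hl.transForm_left,
    hl.transForm_right]
  simp [sliceForm]

theorem sliceEnd_snd (a : (ℝ × ℝ) × E) : sliceEnd I x.2 a.2 = (I x a).2 := by
  have hl := h.hermitianLine (h.slice_mem hx h0)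
  rw [h.slice_I_eq hS hc h0 hx]
  conv_rhs => rw [eq_orbVec_add a]
  rw [map_add, map_add, map_smul, map_smul, hl.map, hl.map_one]
  simp [sliceEnd, orbVec]

omit hS hc h0 in
theorem diff_transForm (b c : (ℝ × ℝ) × E) (hb : ∀ j, g x (orbVec E j) b = 0)
    (hcc : ∀ j, g x (orbVec E j) (I x c) = 0) :
    fderiv ℝ (fun y ↦ transForm (g y) (orbVec E) b (I y c)) x
      = fderiv ℝ (fun y ↦ g y b (I y c)) x := by
  have hg := h.diff_slice_g hx
  have hI := (h.diff_slice_I hx).clm_apply (differentiableAt_const c)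
  have hα : ∀ u v : (ℝ × ℝ) × E, DifferentiableAt ℝ (fun y ↦ g y u v) x := fun u v ↦
    (hg.clm_apply (differentiableAt_const u)).clm_apply (differentiableAt_const v)
  have hβ : ∀ u : (ℝ × ℝ) × E, DifferentiableAt ℝ (fun y ↦ g y u (I y c)) x := fun u ↦
    (hg.clm_apply (differentiableAt_const u)).clm_apply hI
  have hl := h.hermitianLine hx
  have hne : ∀ j, g x (orbVec E j) (orbVec E j) ≠ 0 := by
    intro j
    fin_cases j
    · exact hl.pos.ne'
    · exact (hl.e11.trans_gt hl.pos).ne'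
  have hz : ∀ j, HasFDerivAt (fun y ↦ (g y (orbVec E j) (orbVec E j))⁻¹
      * (g y (orbVec E j) b * g y (orbVec E j) (I y c))) (0 : (ℝ × ℝ) × E →L[ℝ] ℝ) x := by
    intro j
    have h1 := ((hα (orbVec E j) (orbVec E j)).inv (hne j)).hasFDerivAt.mul
      ((hα (orbVec E j) b).hasFDerivAt.mul (hβ (orbVec E j)).hasFDerivAt)
    refine h1.congr_fderiv ?_
    simp [hb, hcc]
  have h2 := ((hβ b).hasFDerivAt.sub (hz 0)).sub (hz 1)
  rw [sub_zero, sub_zero] at h2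
  exact (h2.congr_of_eventuallyEq (.of_forall fun y ↦ transForm_apply _ _ _ _)).fderiv

end TransverseKahler

variable [FiniteDimensional ℝ E]

/-- The Kähler structure of the local quotient. -/
theorem TransverseKahler.sliceKahler
    (h : TransverseKahler (S ×ˢ B) g I fun j _ ↦ orbVec E j) (hS : IsOpen S) (hB : IsOpen B)
    (hc : IsPreconnected S) (h0 : (0 : ℝ × ℝ) ∈ S) : FlatKahler B (sliceForm g) (sliceEnd I) := by
  have hmem : ∀ y ∈ B, ((0, y) : (ℝ × ℝ) × E) ∈ S ×ˢ B := fun y hy ↦ ⟨h0, hy⟩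
  have hline := fun y hy ↦ h.hermitianLine (hmem y hy)
  have hform : ∀ y ∈ B, ∀ a b : (ℝ × ℝ) × E,
      sliceForm g y a.2 b.2 = transForm (g (0, y)) (orbVec E) a b := fun y hy a b ↦
    h.sliceForm_snd hS hc h0 (hmem y hy) a b
  have hend : ∀ y ∈ B, ∀ a : (ℝ × ℝ) × E, sliceEnd I y a.2 = (I (0, y) a).2 := fun y hy a ↦
    h.sliceEnd_snd hS hc h0 (hmem y hy) a
  have hgs : ∀ y ∈ B, ContDiffAt ℝ ∞ (fun y ↦ g (0, y)) y := fun y hy ↦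
    (h.smooth_g.contDiffAt (h.isOpen.mem_nhds (hmem y hy))).comp y (by fun_prop)
  have hIs : ∀ y ∈ B, ContDiffAt ℝ ∞ (fun y ↦ I (0, y)) y := fun y hy ↦
    (h.smooth_I.contDiffAt (h.isOpen.mem_nhds (hmem y hy))).comp y (by fun_prop)
  have hIs' : ∀ y ∈ B, ContDiffAt ℝ ∞ (sliceEnd I) y := fun y hy ↦
    contDiffAt_clm_of_apply fun u ↦
      contDiff_snd.contDiffAt.comp y ((hIs y hy).clm_apply contDiffAt_const)
  have hgs' : ∀ y ∈ B, ContDiffAt ℝ ∞ (sliceForm g) y := fun y hy ↦ by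
    have hα : ∀ u v : (ℝ × ℝ) × E, ContDiffAt ℝ ∞ (fun y ↦ g (0, y) u v) y := fun u v ↦
      ((hgs y hy).clm_apply contDiffAt_const).clm_apply contDiffAt_const
    have hne : ∀ j, g (0, y) (orbVec E j) (orbVec E j) ≠ 0 := by
      intro j
      fin_cases j
      · exact (hline y hy).pos.ne'
      · exact ((hline y hy).e11.trans_gt (hline y hy).pos).ne'
    refine contDiffAt_clm_of_apply fun u ↦ contDiffAt_clm_of_apply fun v ↦ ?_
    refine ContDiffAt.congr_of_eventuallyEq ?_ (.of_forall fun y ↦ transForm_apply (g (0, y)) _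
      (ContinuousLinearMap.inr ℝ (ℝ × ℝ) E u) (ContinuousLinearMap.inr ℝ (ℝ × ℝ) E v))
    exact ((hα _ _).sub (((hα _ _).inv (hne 0)).mul ((hα _ _).mul (hα _ _)))).sub
      (((hα _ _).inv (hne 1)).mul ((hα _ _).mul (hα _ _)))
  refine ⟨hB, fun y hy ↦ (hgs' y hy).contDiffWithinAt, fun y hy ↦ (hIs' y hy).contDiffWithinAt,
    fun y hy ↦ ⟨fun u v ↦ ?_, fun u hu ↦ ?_⟩, fun y hy u ↦ ?_, fun y hy u v ↦ ?_,
    fun y hy u w ↦ ?_, fun y hy u v w ↦ ?_⟩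
  · exact (hline y hy).transForm_symm _ _
  · refine (hline y hy).transForm_pos (u := (0, u)) fun a b hab ↦ hu ?_
    have := congrArg Prod.snd hab
    simpa [orbVec] using this
  · have h1 := hend y hy (0, u)
    have h2 := hend y hy (I (0, y) (0, u))
    dsimp only at h1
    rw [h1, h2, h.sq _ (hmem y hy)]
    rfl
  · have h1 := hend y hy (0, u)
    have h2 := hend y hy (0, v)
    dsimp only at h1 h2
    rw [h1, h2, hform y hy, (hline y hy).transForm_map, ← hform y hy]
  · have hD : ∀ a b : (ℝ × ℝ) × E,
        fderiv ℝ (sliceEnd I) y a.2 b.2 = (fderiv ℝ I (0, y) a b).2 := by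
      intro a b
      have h1' : HasFDerivAt (fun y ↦ sliceEnd I y b.2) _ ((0, y) : (ℝ × ℝ) × E).2 :=
        ((hIs' y hy).differentiableAt (by simp)).hasFDerivAt.clm_apply (hasFDerivAt_const b.2 y)
      have h1 : HasFDerivAt (fun x : (ℝ × ℝ) × E ↦ sliceEnd I x.2 b.2) _ (0, y) :=
        h1'.comp ((0, y) : (ℝ × ℝ) × E) hasFDerivAt_snd
      have h2 : HasFDerivAt (fun x : (ℝ × ℝ) × E ↦ (I x b).2) _ (0, y) :=
        hasFDerivAt_snd.comp ((0, y) : (ℝ × ℝ) × E) ((h.diff_slice_I (hmem y hy)).hasFDerivAt.clm_apply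
          (hasFDerivAt_const b (0, y)))
      have h3 := (h2.congr_of_eventuallyEq (by
        filter_upwards [h.isOpen.mem_nhds (hmem y hy)] with x hx
        exact h.sliceEnd_snd hS hc h0 hx b)).unique h1
      have h4 := DFunLike.congr_fun h3 a
      simpa using h4.symm
    have hl := congrArg Prod.snd (h.nijenhuis _ (hmem y hy) (0, u) (0, w))
    have e1 := hend y hy
    have hu := hend y hy (0, u)
    have hw := hend y hy (0, w)
    have hDuw := hD (0, u) (0, w)
    have hDwu := hD (0, w) (0, u)
    dsimp only at hu hw hDuw hDwu
    have k1 := hD (I (0, y) (0, u)) (0, w)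
    have k2 := hD (I (0, y) (0, w)) (0, u)
    dsimp only at k1 k2
    rw [flatNijenhuis, hu, hw, hDuw, hDwu, hend y hy, hend y hy, k1, k2]
    exact hl
  · have hx := hmem y hy
    have hlift : ∀ u : E, ∃ a : (ℝ × ℝ) × E, a.2 = u ∧ ∀ j, g (0, y) (orbVec E j) a = 0 := by
      intro u
      obtain ⟨a, b, hab⟩ := (hline y hy).exists_horizontal ((0, u) : (ℝ × ℝ) × E)
      exact ⟨_, by simp [orbVec], hab⟩
    have hIj : ∀ a : (ℝ × ℝ) × E, (∀ j, g (0, y) (orbVec E j) a = 0) →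
        ∀ j, g (0, y) (orbVec E j) (I (0, y) a) = 0 := by
      intro a ha j
      have hl := hline y hy
      have k := hl.skew
      fin_cases j
      · have := k (orbVec E 0) a
        rw [hl.map, ha] at this
        simp only [Fin.zero_eta]
        linarith
      · have := k (orbVec E 1) a
        rw [hl.map_one, map_neg, _root_.neg_apply, ha] at this
        simp only [Fin.mk_one]
        linarith
    have hD : ∀ a b c : (ℝ × ℝ) × E, (∀ j, g (0, y) (orbVec E j) b = 0) →
        (∀ j, g (0, y) (orbVec E j) c = 0) →
        fderiv ℝ (fun y ↦ sliceForm g y b.2 (sliceEnd I y c.2)) y a.2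
          = fderiv ℝ (fun x ↦ g x b (I x c)) (0, y) a := by
      intro a b c hb hc'
      rw [← h.diff_transForm hx b c hb (hIj c hc')]
      have h1 : DifferentiableAt ℝ (fun y ↦ sliceForm g y b.2 (sliceEnd I y c.2)) y :=
        (((hgs' y hy).differentiableAt (by simp)).clm_apply (differentiableAt_const _)).clm_apply
          (((hIs' y hy).differentiableAt (by simp)).clm_apply (differentiableAt_const _))
      have h1' : HasFDerivAt (fun y ↦ sliceForm g y b.2 (sliceEnd I y c.2)) _
        ((0, y) : (ℝ × ℝ) × E).2 := h1.hasFDerivAt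
      have h2 : HasFDerivAt (fun x : (ℝ × ℝ) × E ↦ sliceForm g x.2 b.2 (sliceEnd I x.2 c.2)) _
        (0, y) := h1'.comp ((0, y) : (ℝ × ℝ) × E) hasFDerivAt_snd
      have h3 := h2.congr_of_eventuallyEq
        (f₁ := fun x ↦ transForm (g x) (orbVec E) b (I x c)) (by
        filter_upwards [h.isOpen.mem_nhds hx] with x hx
        rw [h.sliceEnd_snd hS hc h0 hx, h.sliceForm_snd hS hc h0 hx])
      rw [h3.fderiv]
      rfl
    obtain ⟨a, rfl, ha⟩ := hlift u
    obtain ⟨b, rfl, hb⟩ := hlift v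
    obtain ⟨c, rfl, hc'⟩ := hlift w
    rw [hD a b c hb hc', hD b c a hc' ha, hD c a b ha hb]
    have hs := (hline y hy).inner.symm
    exact h.closed _ hx a b c (fun j ↦ (hs _ _).trans (ha j)) (fun j ↦ (hs _ _).trans (hb j))
      (fun j ↦ (hs _ _).trans (hc' j))

end SliceQuotient

section Differential

variable {E E' E'' : Type*} [NormedAddCommGroup E] [NormedSpace ℝ E] [NormedAddCommGroup E']
  [NormedSpace ℝ E'] [NormedAddCommGroup E''] [NormedSpace ℝ E'']
  {N : Type*} [TopologicalSpace N] [ChartedSpace E N]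
  {N' : Type*} [TopologicalSpace N'] [ChartedSpace E' N']
  {N'' : Type*} [TopologicalSpace N''] [ChartedSpace E'' N'']

variable (E E') in
/-- The differential of a map between manifolds, as a linear map between the model spaces. -/
def mD (f : N → N') (q : N) : E →L[ℝ] E' := mfderiv 𝓘(ℝ, E) 𝓘(ℝ, E') f q

theorem mD_comp {f : N → N'} {g : N' → N''} {q : N}
    (hg : MDifferentiableAt 𝓘(ℝ, E') 𝓘(ℝ, E'') g (f q))
    (hf : MDifferentiableAt 𝓘(ℝ, E) 𝓘(ℝ, E') f q) :
    mD E E'' (fun q ↦ g (f q)) q = mD E' E'' g (f q) ∘L mD E E' f q := mfderiv_comp q hg hf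

theorem mD_congr {f f' : N → N'} {q : N} (h : f =ᶠ[𝓝 q] f') : mD E E' f q = mD E E' f' q :=
  h.mfderiv_eq

theorem mD_id (q : N) : mD E E (fun q : N ↦ q) q = .id ℝ E := mfderiv_id

theorem mD_fderiv {f : E → E'} {x : E} : mD E E' f x = fderiv ℝ f x := mfderiv_eq_fderiv

/-- A bilinear form in coordinates. -/
def coordBil (ψ : E' → N) (G : N → E →L[ℝ] E →L[ℝ] ℝ) (x : E') : E' →L[ℝ] E' →L[ℝ] ℝ :=
  (G (ψ x)).bilinearComp (parD E ψ x) (parD E ψ x)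

end Differential

section Action

variable {E : Type} [NormedAddCommGroup E] [NormedSpace ℝ E]
  {EA : Type*} [NormedAddCommGroup EA] [NormedSpace ℝ EA]
  {N : Type*} [TopologicalSpace N] [ChartedSpace E N] [IsManifold 𝓘(ℝ, E) ∞ N]
  {A : Type*} [TopologicalSpace A] [ChartedSpace EA A] [CommGroup A] [MulAction A N]

variable (EA) in
/-- An action of `A`, generated by the vector fields `ζ j` by means of the homomorphism `γ` onto
`A`, together with a transversal Kähler structure. -/
structure TransverseAction (G : N → E →L[ℝ] E →L[ℝ] ℝ) (I : EndField E N)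
    (ζ : Fin 2 → VField E N) (γ : ℝ × ℝ → A) : Prop where
  smooth : ContMDiff 𝓘(ℝ, ℝ × ℝ) 𝓘(ℝ, EA) ∞ γ
  map_add : ∀ s t, γ (s + t) = γ s * γ t
  surjective : Function.Surjective γ
  orbit : ∀ q s u, mD (ℝ × ℝ) E (fun s ↦ γ s • q) s u
    = u.1 • vecForm (ζ 0) (γ s • q) + u.2 • vecForm (ζ 1) (γ s • q)
  transverse : ∀ {F : Type} [NormedAddCommGroup F] [NormedSpace ℝ F] [FiniteDimensional ℝ F]
    {V : Set F} {ψ : F → N}, IsParam E V ψ →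
    TransverseKahler V (coordBil ψ G) (coordEnd ψ I) (fun j ↦ coordVec ψ (ζ j))

/-- A slice of the action, with the corresponding coordinates. -/
structure ActionSlice (E : Type*) [NormedAddCommGroup E] [NormedSpace ℝ E]
    (N : Type*) [TopologicalSpace N] [ChartedSpace E N] {A : Type*} [SMul A N]
    (γ : ℝ × ℝ → A) (E' : Type*) [NormedAddCommGroup E'] [NormedSpace ℝ E'] where
  e : OpenPartialHomeomorph N ((ℝ × ℝ) × E')
  r : ℝ
  pos : 0 < r
  σ : E' → N
  target : e.target = Metric.ball 0 r ×ˢ Metric.ball 0 r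
  symm_apply : ∀ x ∈ e.target, e.symm x = γ x.1 • σ x.2
  smooth : ContMDiffOn 𝓘(ℝ, E) 𝓘(ℝ, (ℝ × ℝ) × E') ∞ e e.source
  smooth_symm : ContMDiffOn 𝓘(ℝ, (ℝ × ℝ) × E') 𝓘(ℝ, E) ∞ e.symm e.target

namespace TransverseAction

variable {G : N → E →L[ℝ] E →L[ℝ] ℝ} {I : EndField E N} {ζ : Fin 2 → VField E N} {γ : ℝ × ℝ → A}
  (h : TransverseAction EA G I ζ γ)
include h

theorem map_zero : γ 0 = 1 := by
  have := h.map_add 0 0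
  rw [add_zero] at this
  exact left_eq_mul.1 this

theorem map_neg (s : ℝ × ℝ) : γ (-s) = (γ s)⁻¹ := by
  rw [eq_inv_iff_mul_eq_one, ← h.map_add, neg_add_cancel, h.map_zero]

theorem isOpenMap [FiniteDimensional ℝ EA] [LieGroup 𝓘(ℝ, EA) ∞ A] : IsOpenMap γ := by
  have : IsTopologicalGroup A := topologicalGroup_of_lieGroup 𝓘(ℝ, EA) ∞
  have : T1Space A := ChartedSpace.t1Space EA A
  have : ProperSpace EA := FiniteDimensional.proper_real EA
  have : LocallyCompactSpace A := ChartedSpace.locallyCompactSpace EA A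
  let f : Multiplicative (ℝ × ℝ) →* A :=
    { toFun := fun s ↦ γ s.toAdd, map_one' := h.map_zero, map_mul' := fun s t ↦ h.map_add _ _ }
  exact f.isOpenMap_of_sigmaCompact (fun a ↦ h.surjective a) h.smooth.continuous

variable [FiniteDimensional ℝ E] {E' : Type} [NormedAddCommGroup E'] [NormedSpace ℝ E']
  [FiniteDimensional ℝ E'] [ContMDiffSMul 𝓘(ℝ, EA) 𝓘(ℝ, E) ∞ A N]

omit [FiniteDimensional ℝ E] in
theorem contMDiff_orbit (q : N) : ContMDiff 𝓘(ℝ, ℝ × ℝ) 𝓘(ℝ, E) ∞ fun s ↦ γ s • q :=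
  h.smooth.smul contMDiff_const

end TransverseAction

theorem IsHermitianLine.linearIndependent {F : Type*} [NormedAddCommGroup F] [NormedSpace ℝ F]
    {g : F →L[ℝ] F →L[ℝ] ℝ} {I : F →L[ℝ] F} {e : Fin 2 → F} (h : IsHermitianLine g I e) :
    LinearIndependent ℝ e := by
  have he : e = ![e 0, e 1] := by ext i; fin_cases i <;> rfl
  rw [he, LinearIndependent.pair_iff' h.ne]
  intro a ha
  have h1 := h.e01
  have h2 := h.e11
  have h3 := h.pos
  rw [← ha] at h1 h2
  simp only [_root_.map_smul, _root_.smul_apply, smul_eq_mul, mul_eq_zero, h3.ne', or_false] at h1 h2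
  rw [h1, zero_mul] at h2
  exact h3.ne h2

/-- Adapted coordinates of a vector space with two independent vectors. -/
theorem exists_adapted_equiv {E : Type*} [NormedAddCommGroup E] [NormedSpace ℝ E]
    [FiniteDimensional ℝ E] {E' : Type*} [NormedAddCommGroup E'] [NormedSpace ℝ E']
    [FiniteDimensional ℝ E'] {e : Fin 2 → E} (he : LinearIndependent ℝ e)
    (hd : Module.finrank ℝ E = Module.finrank ℝ E' + 2) :
    ∃ Λ : ((ℝ × ℝ) × E') ≃L[ℝ] E, ∀ s : ℝ × ℝ, Λ (s, 0) = s.1 • e 0 + s.2 • e 1 := by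
  obtain ⟨W, hW⟩ := (Submodule.span ℝ (range e)).exists_isCompl
  have h1 := Submodule.finrank_add_eq_of_isCompl hW
  rw [finrank_span_eq_card he, Fintype.card_fin] at h1
  have h2 : Module.finrank ℝ E' = Module.finrank ℝ W := by omega
  let L : E' ≃ₗ[ℝ] W := LinearEquiv.ofFinrankEq _ _ h2
  let T : ((ℝ × ℝ) × E') →ₗ[ℝ] E :=
    (((LinearMap.fst ℝ ℝ ℝ).smulRight (e 0) + (LinearMap.snd ℝ ℝ ℝ).smulRight (e 1)).coprod
      (W.subtype ∘ₗ L.toLinearMap))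
  have hT : ∀ s y, T (s, y) = s.1 • e 0 + s.2 • e 1 + L y := fun s y ↦ rfl
  have hinj : Function.Injective T := by
    rw [← LinearMap.ker_eq_bot, LinearMap.ker_eq_bot']
    rintro ⟨s, y⟩ hsy
    rw [hT] at hsy
    have hmem : s.1 • e 0 + s.2 • e 1 ∈ Submodule.span ℝ (range e) :=
      Submodule.add_mem _ (Submodule.smul_mem _ _ (Submodule.subset_span ⟨0, rfl⟩))
        (Submodule.smul_mem _ _ (Submodule.subset_span ⟨1, rfl⟩))
    have hy : (L y : E) ∈ Submodule.span ℝ (range e) := by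
      rw [eq_neg_of_add_eq_zero_right hsy]
      exact Submodule.neg_mem _ hmem
    have h0 : (L y : E) = 0 := Submodule.disjoint_def.1 hW.disjoint _ hy (L y).2
    rw [h0, add_zero] at hsy
    have he' := LinearIndependent.pair_iff.1
      (show LinearIndependent ℝ ![e 0, e 1] by convert he; ext i; fin_cases i <;> rfl) _ _ hsy
    have hy0 : y = 0 := L.map_eq_zero_iff.1 (Subtype.ext h0)
    rw [hy0, Prod.mk_eq_zero]
    exact ⟨Prod.ext he'.1 he'.2, rfl⟩
  have hfin : Module.finrank ℝ ((ℝ × ℝ) × E') = Module.finrank ℝ E := by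
    rw [Module.finrank_prod, Module.finrank_prod, Module.finrank_self, hd]
    omega
  refine ⟨(LinearEquiv.ofInjectiveOfFinrankEq T hinj hfin).toContinuousLinearEquiv, fun s ↦ ?_⟩
  change T (s, 0) = _
  rw [hT, LinearEquiv.map_zero, ZeroMemClass.coe_zero, add_zero]

namespace TransverseAction

variable [FiniteDimensional ℝ E] {E' : Type} [NormedAddCommGroup E'] [NormedSpace ℝ E']
  [FiniteDimensional ℝ E'] [ContMDiffSMul 𝓘(ℝ, EA) 𝓘(ℝ, E) ∞ A N]
  {G : N → E →L[ℝ] E →L[ℝ] ℝ} {I : EndField E N} {ζ : Fin 2 → VField E N} {γ : ℝ × ℝ → A}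

/-- The coordinates by a slice, provided their differential is invertible. -/
theorem exists_slice_of_param {V : Set ((ℝ × ℝ) × E')} (hV : IsOpen V) (h0 : 0 ∈ V) {σ : E' → N}
    {p : N} (hc : ∀ x ∈ V, γ x.1 • σ x.2 ∈ (chartAt E p).source)
    (hs : ∀ x ∈ V, ContMDiffAt 𝓘(ℝ, (ℝ × ℝ) × E') 𝓘(ℝ, E) ∞
      (fun x : (ℝ × ℝ) × E' ↦ γ x.1 • σ x.2) x)
    {Λ : ((ℝ × ℝ) × E') ≃L[ℝ] E} (hΛ : fderiv ℝ (fun x : (ℝ × ℝ) × E' ↦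
      extChartAt 𝓘(ℝ, E) p (γ x.1 • σ x.2)) 0 = Λ) :
    ∃ c : ActionSlice E N γ E', c.σ = σ := by
  set Ψ : (ℝ × ℝ) × E' → N := fun x ↦ γ x.1 • σ x.2
  set Φ : (ℝ × ℝ) × E' → E := fun x ↦ extChartAt 𝓘(ℝ, E) p (Ψ x)
  have hΦ : ∀ x ∈ V, ContDiffAt ℝ ∞ Φ x := fun x hx ↦
    contMDiffAt_iff_contDiffAt.1
      ((contMDiffAt_extChartAt' (I := 𝓘(ℝ, E)) (hc x hx)).comp x (hs x hx))
  have hΛ' : HasFDerivAt Φ (Λ : ((ℝ × ℝ) × E') →L[ℝ] E) 0 := by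
    rw [← hΛ]
    exact ((hΦ 0 h0).differentiableAt (by simp)).hasFDerivAt
  set φ := (hΦ 0 h0).toOpenPartialHomeomorph Φ hΛ' (by simp)
  have hφ : ∀ x, φ x = Φ x := fun x ↦ rfl
  have hmem : ∀ᶠ x in 𝓝 (0 : (ℝ × ℝ) × E'), x ∈ V ∧ x ∈ φ.source ∧
      fderiv ℝ Φ x ∈ range ContinuousLinearEquiv.toContinuousLinearMap := by
    refine Filter.Eventually.and (hV.mem_nhds h0) (Filter.Eventually.and (φ.open_source.mem_nhds
      ((hΦ 0 h0).mem_toOpenPartialHomeomorph_source hΛ' (by simp))) ?_)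
    have h1 : ContinuousAt (fderiv ℝ Φ) 0 :=
      ((hΦ 0 h0).fderiv_right (m := ∞) (by simp)).continuousAt
    refine h1 ?_
    rw [hΛ'.fderiv]
    exact ContinuousLinearEquiv.nhds Λ
  obtain ⟨r, hr, hball⟩ := Metric.eventually_nhds_iff_ball.1 hmem
  set e₁ := (chartAt E p).trans φ.symm
  have htarget : ∀ x ∈ Metric.ball (0 : (ℝ × ℝ) × E') r, x ∈ e₁.target := fun x hx ↦ by
    refine ⟨(hball x hx).2.1, ?_⟩
    exact (chartAt E p).map_source (hc x (hball x hx).1)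
  set e := (e₁.symm.restrOpen (Metric.ball 0 r) Metric.isOpen_ball).symm
  have het : e.target = Metric.ball 0 r := by
    change e₁.target ∩ Metric.ball 0 r = _
    exact inter_eq_right.2 htarget
  have hes : ∀ x ∈ e.target, e.symm x = Ψ x := fun x hx ↦ by
    rw [het] at hx
    exact (chartAt E p).left_inv (hc x (hball x hx).1)
  refine ⟨⟨e, r, hr, σ, ?_, hes, fun q hq ↦ ?_, fun x hx ↦ ?_⟩, rfl⟩
  · rw [het, ← ball_prod_same]
    rfl
  · refine ContMDiffAt.contMDiffWithinAt ?_
    have hx : e q ∈ Metric.ball 0 r := het ▸ e.map_source hq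
    have hqc : q ∈ (chartAt E p).source := by
      rw [← e.left_inv hq, hes _ (e.map_source hq)]
      exact hc _ (hball _ hx).1
    have hqΦ : extChartAt 𝓘(ℝ, E) p q = φ (e q) := by
      rw [hφ, ← e.left_inv hq, hes _ (e.map_source hq), ← hes _ (e.map_source hq), e.left_inv hq]
      change _ = extChartAt 𝓘(ℝ, E) p (Ψ (e q))
      rw [← hes _ (e.map_source hq), e.left_inv hq]
    obtain ⟨T, hT⟩ := (hball _ hx).2.2
    have hT' : φ.symm (extChartAt 𝓘(ℝ, E) p q) = e q := by
      rw [hqΦ, φ.left_inv (hball _ hx).2.1]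
    have h1 : ContDiffAt ℝ ∞ φ.symm (extChartAt 𝓘(ℝ, E) p q) := by
      refine φ.contDiffAt_symm (f₀' := T) ?_ ?_ ?_
      · rw [hqΦ]
        exact φ.map_source (hball _ hx).2.1
      · rw [hT', hT]
        exact ((hΦ _ (hball _ hx).1).differentiableAt (by simp)).hasFDerivAt
      · rw [hT']
        exact hΦ _ (hball _ hx).1
    exact (contMDiffAt_iff_contDiffAt.2 h1).comp q (contMDiffAt_extChartAt' (I := 𝓘(ℝ, E)) hqc)
  · refine ((hs x (hball x (het ▸ hx)).1).contMDiffWithinAt).congr hes (hes x hx)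

variable (h : TransverseAction EA G I ζ γ)
include h

theorem hermitianLine (p : N) : IsHermitianLine
    (coordBil (chartPar E p) G (extChartAt 𝓘(ℝ, E) p p))
    (coordEnd (chartPar E p) I (extChartAt 𝓘(ℝ, E) p p))
    fun j ↦ coordVec (chartPar E p) (ζ j) (extChartAt 𝓘(ℝ, E) p p) :=
  (h.transverse (isParam_chart E p)).hermitianLine (mem_chartDom p)

/-- Existence of slices. -/
theorem exists_slice (hd : Module.finrank ℝ E = Module.finrank ℝ E' + 2) (p : N) :
    ∃ c : ActionSlice E N γ E', c.σ 0 = p := by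
  have hP := isParam_chart E p
  set x₀ := extChartAt 𝓘(ℝ, E) p p with hx₀
  obtain ⟨Λ, hΛ⟩ := exists_adapted_equiv (h.hermitianLine p).linearIndependent hd
  set σ : E' → N := fun y ↦ chartPar E p (x₀ + Λ (0, y)) with hσ
  have hσ0 : σ 0 = p := by
    simp only [hσ, Prod.mk_zero_zero, _root_.map_zero, add_zero]
    exact chartPar_self p
  set Ψ : (ℝ × ℝ) × E' → N := fun x ↦ γ x.1 • σ x.2
  set V₁ : Set ((ℝ × ℝ) × E') := (fun x ↦ x₀ + Λ (0, x.2)) ⁻¹' chartDom E p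
  have hV₁ : IsOpen V₁ := hP.isOpen.preimage (by fun_prop)
  have hs : ∀ x ∈ V₁, ContMDiffAt 𝓘(ℝ, (ℝ × ℝ) × E') 𝓘(ℝ, E) ∞ Ψ x := fun x hx ↦ by
    have h1 : ContMDiffAt 𝓘(ℝ, (ℝ × ℝ) × E') 𝓘(ℝ, EA) ∞ (fun x : (ℝ × ℝ) × E' ↦ γ x.1) x :=
      (h.smooth x.1).comp x contDiff_fst.contMDiff.contMDiffAt
    have h2 : ContMDiffAt 𝓘(ℝ, (ℝ × ℝ) × E') 𝓘(ℝ, E) ∞ (fun x : (ℝ × ℝ) × E' ↦ σ x.2) x :=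
      ContMDiffAt.comp (g := chartPar E p) x (hP.contMDiffAt hx)
        (contMDiffAt_iff_contDiffAt.2 (by fun_prop))
    exact h1.smul h2
  set V := V₁ ∩ Ψ ⁻¹' (chartAt E p).source
  have hV : IsOpen V := ContinuousOn.isOpen_inter_preimage
    (fun x hx ↦ (hs x hx).continuousAt.continuousWithinAt) hV₁ (chartAt E p).open_source
  have hΨ0 : Ψ 0 = p := by
    change γ 0 • σ 0 = p
    rw [h.map_zero, hσ0, one_smul]
  have h0 : (0 : (ℝ × ℝ) × E') ∈ V := by
    refine ⟨?_, ?_⟩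
    · change x₀ + Λ (0, 0) ∈ chartDom E p
      rw [Prod.mk_zero_zero, _root_.map_zero, add_zero]
      exact mem_chartDom p
    · rw [mem_preimage, hΨ0]
      exact mem_chart_source E p
  have hdiff : DifferentiableAt ℝ (fun x : (ℝ × ℝ) × E' ↦ extChartAt 𝓘(ℝ, E) p (Ψ x)) 0 :=
    (contMDiffAt_iff_contDiffAt.1 ((contMDiffAt_extChartAt' (I := 𝓘(ℝ, E)) h0.2).comp 0
      (hs 0 h0.1))).differentiableAt (by simp)
  have hγ : ∀ s : ℝ × ℝ, fderiv ℝ (fun x : (ℝ × ℝ) × E' ↦ extChartAt 𝓘(ℝ, E) p (Ψ x)) 0 (s, 0)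
      = Λ (s, 0) := by
    intro s
    have h1 := HasFDerivAt.comp (f := fun s : ℝ × ℝ ↦ (s, (0 : E'))) (0 : ℝ × ℝ) hdiff.hasFDerivAt
      (hasFDerivAt_prodMk_left (0 : ℝ × ℝ) (0 : E'))
    have h2 := fderiv_comp_param (E := E) (p := p) (ψ := fun s ↦ γ s • p) (x := (0 : ℝ × ℝ))
      ((h.contMDiff_orbit p 0).mdifferentiableAt (by simp))
      (by rw [h.map_zero, one_smul]; exact mem_chart_source E p)
    have h3 : (fun x : (ℝ × ℝ) × E' ↦ extChartAt 𝓘(ℝ, E) p (Ψ x)) ∘ (fun s ↦ (s, 0))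
        = fun s ↦ extChartAt 𝓘(ℝ, E) p (γ s • p) := by
      funext s
      change extChartAt 𝓘(ℝ, E) p (γ s • σ 0) = _
      rw [hσ0]
    rw [h3] at h1
    have h4 := DFunLike.congr_fun (h1.fderiv.symm.trans h2) s
    have h5 := h.orbit p 0 s
    have h6 : ∀ j, coordVec (chartPar E p) (ζ j) x₀ = chartD E p p (vecForm (ζ j) p) := by
      intro j
      rw [coordVec, parInv_chart (mem_chart_source E p), hx₀, chartPar_self]
      rfl
    rw [h.map_zero, one_smul] at h4 h5
    rw [hΛ, h6, h6]
    refine h4.trans ?_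
    rw [ContinuousLinearMap.comp_apply]
    refine (congrArg (chartD E p p) h5).trans ?_
    rw [_root_.map_add, _root_.map_smul, _root_.map_smul]
  have hy : ∀ y : E', fderiv ℝ (fun x : (ℝ × ℝ) × E' ↦ extChartAt 𝓘(ℝ, E) p (Ψ x)) 0 (0, y)
      = Λ (0, y) := by
    intro y
    have h1 := HasFDerivAt.comp (f := fun y : E' ↦ ((0 : ℝ × ℝ), y)) (0 : E') hdiff.hasFDerivAt
      (hasFDerivAt_prodMk_right (0 : ℝ × ℝ) (0 : E'))
    have h3 : (fun x : (ℝ × ℝ) × E' ↦ extChartAt 𝓘(ℝ, E) p (Ψ x)) ∘ (fun y ↦ (0, y))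
        =ᶠ[𝓝 0] fun y ↦ x₀ + (Λ : ((ℝ × ℝ) × E') →L[ℝ] E) (0, y) := by
      have h4 : ∀ᶠ y in 𝓝 (0 : E'), ((0, y) : (ℝ × ℝ) × E') ∈ V₁ :=
        (Continuous.prodMk_right (0 : ℝ × ℝ)).continuousAt (hV₁.mem_nhds h0.1)
      filter_upwards [h4] with y hy
      change extChartAt 𝓘(ℝ, E) p (γ 0 • σ y) = _
      rw [h.map_zero, one_smul]
      exact extChartAt_chartPar hy
    have h4 : HasFDerivAt (fun y ↦ x₀ + (Λ : ((ℝ × ℝ) × E') →L[ℝ] E) (0, y))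
        ((Λ : ((ℝ × ℝ) × E') →L[ℝ] E) ∘L .inr ℝ (ℝ × ℝ) E') 0 :=
      ((Λ : ((ℝ × ℝ) × E') →L[ℝ] E).hasFDerivAt.comp (0 : E')
        (hasFDerivAt_prodMk_right (0 : ℝ × ℝ) (0 : E'))).const_add x₀
    exact DFunLike.congr_fun (h1.unique (h4.congr_of_eventuallyEq h3)) y
  have hfd : fderiv ℝ (fun x : (ℝ × ℝ) × E' ↦ extChartAt 𝓘(ℝ, E) p (Ψ x)) 0 = Λ := by
    refine ContinuousLinearMap.ext fun ⟨s, y⟩ ↦ ?_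
    have h1 : ((s, y) : (ℝ × ℝ) × E') = (s, 0) + (0, y) := by simp
    rw [h1, _root_.map_add, hγ, hy, _root_.map_add]
    rfl
  obtain ⟨c, hc⟩ := exists_slice_of_param (γ := γ) hV h0 (fun x hx ↦ hx.2) (fun x hx ↦ hs x hx.1) hfd
  exact ⟨c, hc ▸ hσ0⟩

end TransverseAction

end Action

theorem TransverseKahler.congr_field {F : Type*} [NormedAddCommGroup F] [NormedSpace ℝ F] {V : Set F}
    {g : F → F →L[ℝ] F →L[ℝ] ℝ} {I : F → F →L[ℝ] F} {ζ ζ' : Fin 2 → F → F}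
    (h : TransverseKahler V g I ζ) (hζ : ∀ x ∈ V, ∀ j, ζ' j x = ζ j x) :
    TransverseKahler V g I ζ' := by
  have hd : ∀ x ∈ V, ∀ j, fderiv ℝ (ζ' j) x = fderiv ℝ (ζ j) x := fun x hx j ↦
    Filter.EventuallyEq.fderiv_eq (by
      filter_upwards [h.isOpen.mem_nhds hx] with y hy using hζ y hy j)
  refine ⟨h.isOpen, h.smooth_g, h.smooth_I, h.inner, h.sq, h.herm, fun x hx ↦ ?_, fun x hx ↦ ?_,
    h.nijenhuis, fun x hx j w ↦ ?_, fun x hx j u v ↦ ?_, fun x hx u v w hu hv hw ↦ ?_⟩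
  · rw [hζ x hx, hζ x hx, h.map_ζ x hx]
  · rw [hζ x hx]
    exact h.ne x hx
  · rw [hζ x hx, hd x hx, h.lieI x hx]
  · rw [hζ x hx, hd x hx, h.lieg x hx]
  · simp only [hζ x hx] at hu hv hw
    exact h.closed x hx u v w hu hv hw

section Lift

variable {E : Type} [NormedAddCommGroup E] [NormedSpace ℝ E]
  {E' : Type} [NormedAddCommGroup E'] [NormedSpace ℝ E']

/-- The linear map `D` is the quotient of a Hermitian vector space by a complex line. -/
structure IsTransverseQuotient (g : E →L[ℝ] E →L[ℝ] ℝ) (I : E →L[ℝ] E) (z : Fin 2 → E)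
    (D : E →L[ℝ] E') (g' : E' →L[ℝ] E' →L[ℝ] ℝ) (I' : E' →L[ℝ] E') : Prop where
  surjective : Function.Surjective D
  ker : ∀ k, D k = 0 ↔ ∃ a b : ℝ, k = a • z 0 + b • z 1
  form : ∀ u v, g' (D u) (D v) = transForm g z u v
  map : ∀ u, D (I u) = I' (D u)

namespace IsTransverseQuotient

variable {g : E →L[ℝ] E →L[ℝ] ℝ} {I : E →L[ℝ] E} {z : Fin 2 → E} {E'' : Type}
  [NormedAddCommGroup E''] [NormedSpace ℝ E''] {D : E →L[ℝ] E'} {D' : E →L[ℝ] E''}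
  {g' : E' →L[ℝ] E' →L[ℝ] ℝ} {I' : E' →L[ℝ] E'} {g'' : E'' →L[ℝ] E'' →L[ℝ] ℝ} {I'' : E'' →L[ℝ] E''}
  {T : E' →L[ℝ] E''}

theorem isometric (h : IsTransverseQuotient g I z D g' I')
    (h' : IsTransverseQuotient g I z D' g'' I'') (hT : ∀ u, T (D u) = D' u) (u v : E') :
    g'' (T u) (T v) = g' u v := by
  obtain ⟨u, rfl⟩ := h.surjective u
  obtain ⟨v, rfl⟩ := h.surjective v
  rw [hT, hT, h'.form, h.form]

theorem holomorphic (h : IsTransverseQuotient g I z D g' I')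
    (h' : IsTransverseQuotient g I z D' g'' I'') (hT : ∀ u, T (D u) = D' u) (u : E') :
    T (I' u) = I'' (T u) := by
  obtain ⟨u, rfl⟩ := h.surjective u
  rw [← h.map, hT, hT, h'.map]

theorem form_of_ortho (h : IsTransverseQuotient g I z D g' I') (hs : ∀ u v, g u v = g v u) {u : E}
    (hu : ∀ k, D k = 0 → g u k = 0) (v : E) : g' (D u) (D v) = g u v := by
  rw [h.form, transForm_of_ortho]
  intro j
  rw [hs]
  refine hu _ ((h.ker _).2 ?_)
  fin_cases j
  · exact ⟨1, 0, by simp⟩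
  · exact ⟨0, 1, by simp⟩

end IsTransverseQuotient

end Lift

section Action

variable {E : Type} [NormedAddCommGroup E] [NormedSpace ℝ E]
  {EA : Type*} [NormedAddCommGroup EA] [NormedSpace ℝ EA]
  {N : Type*} [TopologicalSpace N] [ChartedSpace E N]
  {A : Type*} [TopologicalSpace A] [ChartedSpace EA A] [CommGroup A] [MulAction A N]
  {E' : Type} [NormedAddCommGroup E'] [NormedSpace ℝ E'] {γ : ℝ × ℝ → A}

namespace ActionSlice

variable (c : ActionSlice E N γ E')

theorem mem_target {x : (ℝ × ℝ) × E'} :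
    x ∈ c.e.target ↔ x.1 ∈ Metric.ball 0 c.r ∧ x.2 ∈ Metric.ball 0 c.r := by
  rw [c.target]
  rfl

theorem zero_mem_ball : (0 : ℝ × ℝ) ∈ Metric.ball 0 c.r := Metric.mem_ball_self c.pos

theorem zero_mem_ball' : (0 : E') ∈ Metric.ball 0 c.r := Metric.mem_ball_self c.pos

theorem mk_mem_target {s : ℝ × ℝ} {y : E'} (hs : s ∈ Metric.ball 0 c.r)
    (hy : y ∈ Metric.ball 0 c.r) : (s, y) ∈ c.e.target := c.mem_target.2 ⟨hs, hy⟩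

theorem e_fst_mem {q : N} (hq : q ∈ c.e.source) : (c.e q).1 ∈ Metric.ball 0 c.r :=
  (c.mem_target.1 (c.e.map_source hq)).1

theorem e_snd_mem {q : N} (hq : q ∈ c.e.source) : (c.e q).2 ∈ Metric.ball 0 c.r :=
  (c.mem_target.1 (c.e.map_source hq)).2

/-- A point in terms of its slice coordinates. -/
theorem eq_smul {q : N} (hq : q ∈ c.e.source) : γ (c.e q).1 • c.σ (c.e q).2 = q := by
  rw [← c.symm_apply _ (c.e.map_source hq), c.e.left_inv hq]

theorem mem_source_of_eq {q : N} {s : ℝ × ℝ} {y : E'} (hs : s ∈ Metric.ball 0 c.r)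
    (hy : y ∈ Metric.ball 0 c.r) (h : q = γ s • c.σ y) : q ∈ c.e.source := by
  rw [h, ← c.symm_apply (s, y) (c.mk_mem_target hs hy)]
  exact c.e.map_target (c.mk_mem_target hs hy)

theorem e_eq {q : N} {s : ℝ × ℝ} {y : E'} (hs : s ∈ Metric.ball 0 c.r)
    (hy : y ∈ Metric.ball 0 c.r) (h : q = γ s • c.σ y) : c.e q = (s, y) := by
  rw [h, ← c.symm_apply (s, y) (c.mk_mem_target hs hy)]
  exact c.e.right_inv (c.mk_mem_target hs hy)

theorem contMDiffAt_e {q : N} (hq : q ∈ c.e.source) :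
    ContMDiffAt 𝓘(ℝ, E) 𝓘(ℝ, (ℝ × ℝ) × E') ∞ c.e q :=
  c.smooth.contMDiffAt (c.e.open_source.mem_nhds hq)

theorem contMDiffAt_symm {x : (ℝ × ℝ) × E'} (hx : x ∈ c.e.target) :
    ContMDiffAt 𝓘(ℝ, (ℝ × ℝ) × E') 𝓘(ℝ, E) ∞ c.e.symm x :=
  c.smooth_symm.contMDiffAt (c.e.open_target.mem_nhds hx)

theorem mD_e_parD {x : (ℝ × ℝ) × E'} (hx : x ∈ c.e.target) :
    mD E ((ℝ × ℝ) × E') c.e (c.e.symm x) ∘L parD E c.e.symm x = .id ℝ _ := by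
  have h1 := mD_comp ((c.contMDiffAt_e (c.e.map_target hx)).mdifferentiableAt (by simp))
    ((c.contMDiffAt_symm hx).mdifferentiableAt (by simp))
  refine h1.symm.trans ((mD_congr ?_).trans (mD_id x))
  filter_upwards [c.e.open_target.mem_nhds hx] with y hy using c.e.right_inv hy

theorem parD_mD_e {x : (ℝ × ℝ) × E'} (hx : x ∈ c.e.target) :
    parD E c.e.symm x ∘L mD E ((ℝ × ℝ) × E') c.e (c.e.symm x) = .id ℝ _ := by
  have hs := c.e.map_target hx
  have h0 : MDifferentiableAt 𝓘(ℝ, (ℝ × ℝ) × E') 𝓘(ℝ, E) c.e.symm (c.e (c.e.symm x)) := by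
    rw [c.e.right_inv hx]
    exact (c.contMDiffAt_symm hx).mdifferentiableAt (by simp)
  have h1 := mD_comp h0 ((c.contMDiffAt_e hs).mdifferentiableAt (by simp))
  rw [c.e.right_inv hx] at h1
  refine h1.symm.trans ((mD_congr ?_).trans (mD_id _))
  filter_upwards [c.e.open_source.mem_nhds hs] with y hy using c.e.left_inv hy

theorem isParam : IsParam E c.e.target c.e.symm where
  isOpen := c.e.open_target
  smooth := c.smooth_symm
  inv x hx := .of_inverse (c.parD_mD_e hx) (c.mD_e_parD hx)

theorem parInv_eq {q : N} (hq : q ∈ c.e.source) :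
    parInv E c.e.symm (c.e q) = mD E ((ℝ × ℝ) × E') c.e q := by
  have hx := c.e.map_source hq
  have h1 := ContinuousLinearMap.inverse_eq (c.parD_mD_e hx) (c.mD_e_parD hx)
  rw [c.e.left_inv hq] at h1
  exact h1

end ActionSlice

namespace TransverseAction

variable [IsManifold 𝓘(ℝ, E) ∞ N] [FiniteDimensional ℝ E] [FiniteDimensional ℝ E']
  [ContMDiffSMul 𝓘(ℝ, EA) 𝓘(ℝ, E) ∞ A N]
  {G : N → E →L[ℝ] E →L[ℝ] ℝ} {I : EndField E N} {ζ : Fin 2 → VField E N}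
  (h : TransverseAction EA G I ζ γ) (c : ActionSlice E N γ E')
include h

theorem symm_zero {y : E'} (hy : y ∈ Metric.ball 0 c.r) : c.e.symm (0, y) = c.σ y := by
  rw [c.symm_apply _ (c.mk_mem_target c.zero_mem_ball hy), h.map_zero, one_smul]

theorem σ_mem {y : E'} (hy : y ∈ Metric.ball 0 c.r) : c.σ y ∈ c.e.source :=
  c.mem_source_of_eq c.zero_mem_ball hy (by rw [h.map_zero, one_smul])

theorem e_σ {y : E'} (hy : y ∈ Metric.ball 0 c.r) : c.e (c.σ y) = (0, y) :=
  c.e_eq c.zero_mem_ball hy (by rw [h.map_zero, one_smul])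

theorem contMDiffAt_σ {y : E'} (hy : y ∈ Metric.ball 0 c.r) :
    ContMDiffAt 𝓘(ℝ, E') 𝓘(ℝ, E) ∞ c.σ y := by
  have h1 : ContMDiffAt 𝓘(ℝ, E') 𝓘(ℝ, E) ∞ (fun y ↦ c.e.symm (0, y)) y :=
    ContMDiffAt.comp y (c.contMDiffAt_symm (c.mk_mem_target c.zero_mem_ball hy))
      (contMDiffAt_iff_contDiffAt.2 (by fun_prop))
  refine h1.congr_of_eventuallyEq ?_
  filter_upwards [Metric.isOpen_ball.mem_nhds hy] with z hz using (h.symm_zero c hz).symm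

/-- The vector fields `ζ j` are constant in slice coordinates. -/
theorem coordVec_slice {x : (ℝ × ℝ) × E'} (hx : x ∈ c.e.target) (j : Fin 2) :
    coordVec c.e.symm (ζ j) x = orbVec E' j := by
  have hP := c.isParam
  have h1 : ∀ u : ℝ × ℝ, parD E c.e.symm x (u, 0)
      = u.1 • vecForm (ζ 0) (c.e.symm x) + u.2 • vecForm (ζ 1) (c.e.symm x) := by
    intro u
    have h2 : mD (ℝ × ℝ) E (fun s ↦ c.e.symm (s, x.2)) x.1
        = parD E c.e.symm x ∘L mD (ℝ × ℝ) ((ℝ × ℝ) × E') (fun s : ℝ × ℝ ↦ (s, x.2)) x.1 :=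
      mD_comp (g := c.e.symm) (hP.mdifferentiableAt hx)
        (hasFDerivAt_prodMk_left x.1 x.2).differentiableAt.mdifferentiableAt
    rw [mD_fderiv, (hasFDerivAt_prodMk_left x.1 x.2).fderiv] at h2
    have h3 : (fun s ↦ c.e.symm (s, x.2)) =ᶠ[𝓝 x.1] fun s ↦ γ s • c.σ x.2 := by
      filter_upwards [Metric.isOpen_ball.mem_nhds (c.mem_target.1 hx).1] with s hs
      exact c.symm_apply (s, x.2) (c.mk_mem_target hs (c.mem_target.1 hx).2)
    rw [mD_congr h3] at h2
    have h4 := DFunLike.congr_fun h2 u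
    rw [h.orbit, ← c.symm_apply x hx] at h4
    exact h4.symm
  apply hP.parD_injective hx
  rw [hP.parD_coordVec hx, orbVec, h1]
  fin_cases j
  · change vecForm (ζ 0) _ = (1 : ℝ) • vecForm (ζ 0) _ + (0 : ℝ) • vecForm (ζ 1) _
    rw [one_smul, zero_smul, add_zero]
  · change vecForm (ζ 1) _ = (0 : ℝ) • vecForm (ζ 0) _ + (1 : ℝ) • vecForm (ζ 1) _
    rw [one_smul, zero_smul, zero_add]

theorem transverseKahler_slice : TransverseKahler (Metric.ball 0 c.r ×ˢ Metric.ball 0 c.r)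
    (coordBil c.e.symm G) (coordEnd c.e.symm I) fun j _ ↦ orbVec E' j := by
  rw [← c.target]
  exact (h.transverse c.isParam).congr_field fun x hx j ↦ (h.coordVec_slice c hx j).symm

omit h in
theorem isPreconnected_ball {F : Type*} [NormedAddCommGroup F] [NormedSpace ℝ F] (r : ℝ) :
    IsPreconnected (Metric.ball (0 : F) r) := (convex_ball 0 r).isPreconnected

end TransverseAction

namespace ActionSlice

/-- The metric on the slice. -/
def form (c : ActionSlice E N γ E') (G : N → E →L[ℝ] E →L[ℝ] ℝ) : E' → E' →L[ℝ] E' →L[ℝ] ℝ :=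
  sliceForm (coordBil c.e.symm G)

/-- The complex structure on the slice. -/
def cpx (c : ActionSlice E N γ E') (I : EndField E N) : E' → E' →L[ℝ] E' :=
  sliceEnd (coordEnd c.e.symm I)

/-- The projection to the slice, after the action of `a`. -/
def lift (c : ActionSlice E N γ E') (a : A) (q : N) : E' := (c.e (a • q)).2

end ActionSlice

namespace TransverseAction

variable [IsManifold 𝓘(ℝ, E) ∞ N] [FiniteDimensional ℝ E] [FiniteDimensional ℝ E']
  [ContMDiffSMul 𝓘(ℝ, EA) 𝓘(ℝ, E) ∞ A N]
  {G : N → E →L[ℝ] E →L[ℝ] ℝ} {I : EndField E N} {ζ : Fin 2 → VField E N}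
  (h : TransverseAction EA G I ζ γ) (c : ActionSlice E N γ E')
include h

theorem kahler_slice : FlatKahler (Metric.ball 0 c.r) (c.form G) (c.cpx I) :=
  (h.transverseKahler_slice c).sliceKahler Metric.isOpen_ball Metric.isOpen_ball
    (isPreconnected_ball _) c.zero_mem_ball

end TransverseAction

end Action

section Invariance

variable {E : Type} [NormedAddCommGroup E] [NormedSpace ℝ E]
  {EA : Type*} [NormedAddCommGroup EA] [NormedSpace ℝ EA]
  {N : Type*} [TopologicalSpace N] [ChartedSpace E N] [IsManifold 𝓘(ℝ, E) ∞ N]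
  {A : Type*} [TopologicalSpace A] [ChartedSpace EA A] [CommGroup A] [MulAction A N]
  {E' : Type} [NormedAddCommGroup E'] [NormedSpace ℝ E'] {γ : ℝ × ℝ → A}

variable (E) in
/-- The differential of the action of `a`. -/
def actD (a : A) (q : N) : E →L[ℝ] E := mD E E (a • · : N → N) q

/-- The action of `a` is isometric and holomorphic at `q`. -/
def InvariantAt (G : N → E →L[ℝ] E →L[ℝ] ℝ) (I : EndField E N) (a : A) (q : N) : Prop :=
  (∀ u v, G (a • q) (actD E a q u) (actD E a q v) = G q u v) ∧
    ∀ u, endForm I (a • q) (actD E a q u) = actD E a q (endForm I q u)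

variable (E EA) in
theorem mdifferentiableAt_act [ContMDiffSMul 𝓘(ℝ, EA) 𝓘(ℝ, E) ∞ A N] (a : A) (q : N) :
    MDifferentiableAt 𝓘(ℝ, E) 𝓘(ℝ, E) (a • · : N → N) q :=
  (ContMDiffSMul.contMDiff_const_smul (I := 𝓘(ℝ, EA)) (I' := 𝓘(ℝ, E)) (n := ∞) a q).mdifferentiableAt
    (by simp)

variable (EA) in
theorem actD_mul [ContMDiffSMul 𝓘(ℝ, EA) 𝓘(ℝ, E) ∞ A N] (a b : A) (q : N) :
    actD E (a * b) q = actD E a (b • q) ∘L actD E b q := by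
  have h1 := mD_comp (mdifferentiableAt_act E EA a (b • q)) (mdifferentiableAt_act E EA b q)
  rw [actD, ← show (fun q : N ↦ a • b • q) = fun q ↦ (a * b) • q from funext fun q ↦ smul_smul a b q]
  exact h1

theorem actD_one (q : N) : actD E (1 : A) q = .id ℝ E := by
  rw [actD, show (fun q : N ↦ (1 : A) • q) = fun q ↦ q from funext fun q ↦ one_smul A q]
  exact mD_id q

variable (EA) in
theorem actD_inv_actD [ContMDiffSMul 𝓘(ℝ, EA) 𝓘(ℝ, E) ∞ A N] (a : A) (q : N) (u : E) :
    actD E a⁻¹ (a • q) (actD E a q u) = u := by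
  rw [← ContinuousLinearMap.comp_apply, ← actD_mul EA, inv_mul_cancel, actD_one]
  rfl

variable (EA) in
theorem actD_actD_inv [ContMDiffSMul 𝓘(ℝ, EA) 𝓘(ℝ, E) ∞ A N] (a : A) (q : N) (u : E) :
    actD E a q (actD E a⁻¹ (a • q) u) = u := by
  have := actD_inv_actD EA a⁻¹ (a • q) u
  rwa [inv_inv, inv_smul_smul] at this

namespace InvariantAt

variable [ContMDiffSMul 𝓘(ℝ, EA) 𝓘(ℝ, E) ∞ A N]
  {G : N → E →L[ℝ] E →L[ℝ] ℝ} {I : EndField E N} {a b : A} {q : N}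

variable (EA) in
include EA in
theorem mul (hb : InvariantAt G I b q) (ha : InvariantAt G I a (b • q)) :
    InvariantAt G I (a * b) q := by
  refine ⟨fun u v ↦ ?_, fun u ↦ ?_⟩
  · rw [actD_mul EA, ContinuousLinearMap.comp_apply, ContinuousLinearMap.comp_apply, mul_smul,
      ha.1, hb.1]
  · rw [actD_mul EA, ContinuousLinearMap.comp_apply, ContinuousLinearMap.comp_apply, mul_smul,
      ha.2, hb.2]

variable (EA) in
include EA in
theorem inv (ha : InvariantAt G I a q) : InvariantAt G I a⁻¹ (a • q) := by
  refine ⟨fun u v ↦ ?_, fun u ↦ ?_⟩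
  · rw [inv_smul_smul, ← ha.1, actD_actD_inv EA, actD_actD_inv EA]
  · have h1 := ha.2 (actD E a⁻¹ (a • q) u)
    rw [actD_actD_inv EA] at h1
    rw [h1, actD_inv_actD EA, inv_smul_smul]

end InvariantAt

namespace TransverseAction

variable [FiniteDimensional ℝ E] [FiniteDimensional ℝ E']
  [ContMDiffSMul 𝓘(ℝ, EA) 𝓘(ℝ, E) ∞ A N]
  {G : N → E →L[ℝ] E →L[ℝ] ℝ} {I : EndField E N} {ζ : Fin 2 → VField E N}
  (h : TransverseAction EA G I ζ γ) (c : ActionSlice E N γ E')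
include h

theorem actD_vecForm (a : A) (q : N) (j : Fin 2) :
    actD E a q (vecForm (ζ j) q) = vecForm (ζ j) (a • q) := by
  have key : ∀ u : ℝ × ℝ, actD E a q (u.1 • vecForm (ζ 0) q + u.2 • vecForm (ζ 1) q)
      = u.1 • vecForm (ζ 0) (a • q) + u.2 • vecForm (ζ 1) (a • q) := by
    intro u
    have h0 : γ 0 • q = q := by rw [h.map_zero, one_smul]
    have h0' : γ 0 • a • q = a • q := by rw [h.map_zero, one_smul]
    have h1 : mD (ℝ × ℝ) E (fun s ↦ a • γ s • q) 0
        = actD E a (γ 0 • q) ∘L mD (ℝ × ℝ) E (fun s ↦ γ s • q) 0 :=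
      mD_comp (g := (a • · : N → N)) (mdifferentiableAt_act E EA a _)
        ((h.contMDiff_orbit q 0).mdifferentiableAt (by simp))
    have h2 : (fun s ↦ a • γ s • q) = fun s ↦ γ s • a • q := by
      funext s
      rw [smul_comm]
    rw [h2] at h1
    have h3 := DFunLike.congr_fun h1 u
    rw [h.orbit, ContinuousLinearMap.comp_apply, h.orbit, h0, h0'] at h3
    exact h3.symm
  fin_cases j
  · simpa using key (1, 0)
  · simpa using key (0, 1)

/-- The action is isometric and holomorphic in slice coordinates. -/
theorem invariantAt_slice {t : ℝ × ℝ} (ht : t ∈ Metric.ball 0 c.r) :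
    InvariantAt G I (γ t) (c.σ 0) := by
  have hP := c.isParam
  have h0 : ((0, 0) : (ℝ × ℝ) × E') ∈ c.e.target := c.mk_mem_target c.zero_mem_ball c.zero_mem_ball'
  have ht' : ((t, 0) : (ℝ × ℝ) × E') ∈ c.e.target := c.mk_mem_target ht c.zero_mem_ball'
  have e0 : c.e.symm (0, 0) = c.σ 0 := h.symm_zero c c.zero_mem_ball'
  have et : c.e.symm (t, 0) = γ t • c.σ 0 := c.symm_apply _ ht'
  have hD : actD E (γ t) (c.σ 0) ∘L parD E c.e.symm (0, 0) = parD E c.e.symm (t, 0) := by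
    have h1 : mD ((ℝ × ℝ) × E') E (fun x ↦ γ t • c.e.symm x) (0, 0)
        = actD E (γ t) (c.e.symm (0, 0)) ∘L parD E c.e.symm (0, 0) :=
      mD_comp (g := (γ t • · : N → N)) (mdifferentiableAt_act E EA _ _) (hP.mdifferentiableAt h0)
    have h2 : mD ((ℝ × ℝ) × E') E (fun x : (ℝ × ℝ) × E' ↦ c.e.symm (x + (t, 0))) (0, 0)
        = parD E c.e.symm ((0, 0) + (t, 0))
          ∘L mD ((ℝ × ℝ) × E') ((ℝ × ℝ) × E') (fun x : (ℝ × ℝ) × E' ↦ x + (t, 0)) (0, 0) :=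
      mD_comp (g := c.e.symm) (by
        rw [Prod.mk_add_mk, zero_add, zero_add]
        exact hP.mdifferentiableAt ht')
        (differentiableAt_id.add_const _).mdifferentiableAt
    rw [mD_fderiv, fderiv_add_const, Prod.mk_add_mk, zero_add, zero_add] at h2
    have h3 : (fun x ↦ γ t • c.e.symm x) =ᶠ[𝓝 (0, 0)] fun x ↦ c.e.symm (x + (t, 0)) := by
      have h4 : ContinuousAt (fun x : (ℝ × ℝ) × E' ↦ x + (t, 0)) (0, 0) := by fun_prop
      filter_upwards [hP.mem_nhds h0, h4 (hP.mem_nhds (by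
        change ((0, 0) : (ℝ × ℝ) × E') + (t, 0) ∈ c.e.target
        rw [Prod.mk_add_mk, zero_add, zero_add]
        exact ht'))] with x hx hx'
      rw [c.symm_apply x hx, c.symm_apply _ hx', smul_smul, ← h.map_add]
      simp [add_comm]
    rw [mD_congr h3, h2, e0] at h1
    rw [← h1]
    refine ContinuousLinearMap.ext fun u ↦ ?_
    simp
  have hD' : ∀ u, actD E (γ t) (c.σ 0) (parD E c.e.symm (0, 0) u) = parD E c.e.symm (t, 0) u :=
    fun u ↦ DFunLike.congr_fun hD u
  have hK := h.transverseKahler_slice c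
  have hg := hK.slice_g_eq Metric.isOpen_ball (isPreconnected_ball _) c.zero_mem_ball
    (x := (t, 0)) ⟨ht, c.zero_mem_ball'⟩
  have hI := hK.slice_I_eq Metric.isOpen_ball (isPreconnected_ball _) c.zero_mem_ball
    (x := (t, 0)) ⟨ht, c.zero_mem_ball'⟩
  have hsurj : ∀ u : E, ∃ w, parD E c.e.symm (0, 0) w = u := fun u ↦ ⟨_, hP.parD_parInv h0 u⟩
  refine ⟨fun u v ↦ ?_, fun u ↦ ?_⟩
  · obtain ⟨u, rfl⟩ := hsurj u
    obtain ⟨v, rfl⟩ := hsurj v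
    have := DFunLike.congr_fun (DFunLike.congr_fun hg u) v
    rw [hD', hD', ← et, ← e0]
    exact this
  · obtain ⟨u, rfl⟩ := hsurj u
    have h1 := congrArg (parD E c.e.symm (t, 0)) (DFunLike.congr_fun hI u)
    rw [coordEnd_apply, hP.parD_parInv ht', coordEnd_apply, et] at h1
    dsimp only at h1
    rw [← hD', ← hD', hP.parD_parInv h0, e0] at h1
    exact h1

/-- The action is isometric and holomorphic. -/
theorem invariantAt (hs : ∀ p : N, ∃ c : ActionSlice E N γ E', c.σ 0 = p) (a : A) (q : N) :
    InvariantAt G I a q := by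
  obtain ⟨s, rfl⟩ := h.surjective a
  have hloc : ∀ q : N, ∃ r : ℝ, 0 < r ∧ ∀ t : ℝ × ℝ, ‖t‖ < r → InvariantAt G I (γ t) q := by
    intro q
    obtain ⟨c, rfl⟩ := hs q
    exact ⟨c.r, c.pos, fun t ht ↦ h.invariantAt_slice c (by simpa using ht)⟩
  set T : Set ℝ := {t | InvariantAt G I (γ (t • s)) q}
  have hstep : ∀ t : ℝ, ∃ δ : ℝ, 0 < δ ∧ ∀ t', |t' - t| < δ → (t' ∈ T ↔ t ∈ T) := by
    intro t
    obtain ⟨r, hr, hr'⟩ := hloc (γ (t • s) • q)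
    refine ⟨r / (‖s‖ + 1), by positivity, fun t' ht' ↦ ?_⟩
    have hn : ‖(t' - t) • s‖ < r := by
      rw [norm_smul, Real.norm_eq_abs]
      rw [lt_div_iff₀ (by positivity)] at ht'
      nlinarith [abs_nonneg (t' - t)]
    have h1 := hr' _ hn
    have h2 : γ ((t' - t) • s) * γ (t • s) = γ (t' • s) := by
      rw [← h.map_add, ← add_smul, sub_add_cancel]
    refine ⟨fun ht ↦ ?_, fun ht ↦ ?_⟩
    · have h3 := InvariantAt.mul EA (a := (γ ((t' - t) • s))⁻¹) (b := γ (t' • s)) (q := q) ht (by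
        rw [← h2, mul_smul]
        exact h1.inv EA)
      rwa [← h2, inv_mul_cancel_left] at h3
    · have h3 := InvariantAt.mul EA ht h1
      rwa [h2] at h3
  have hT : IsClopen T := by
    refine ⟨⟨?_⟩, ?_⟩
    · rw [Metric.isOpen_iff]
      intro t ht
      obtain ⟨δ, hδ, hδ'⟩ := hstep t
      exact ⟨δ, hδ, fun t' ht' ht'' ↦ ht ((hδ' t' (by simpa [Real.dist_eq] using ht')).1 ht'')⟩
    · rw [Metric.isOpen_iff]
      intro t ht
      obtain ⟨δ, hδ, hδ'⟩ := hstep t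
      exact ⟨δ, hδ, fun t' ht' ↦ (hδ' t' (by simpa [Real.dist_eq] using ht')).2 ht⟩
  have h0 : (0 : ℝ) ∈ T := by
    obtain ⟨r, hr, hr'⟩ := hloc q
    have := hr' 0 (by simpa using hr)
    change InvariantAt G I (γ ((0 : ℝ) • s)) q
    rwa [zero_smul]
  have h1 : (1 : ℝ) ∈ T := by rw [hT.eq_univ ⟨0, h0⟩]; trivial
  have h2 : InvariantAt G I (γ ((1 : ℝ) • s)) q := h1
  rwa [one_smul] at h2

end TransverseAction

end Invariance

theorem transForm_map_of_isometric {F F' : Type*} [NormedAddCommGroup F] [NormedSpace ℝ F]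
    [NormedAddCommGroup F'] [NormedSpace ℝ F'] {g : F →L[ℝ] F →L[ℝ] ℝ} {g' : F' →L[ℝ] F' →L[ℝ] ℝ}
    {T : F' →L[ℝ] F} (hT : ∀ u v, g (T u) (T v) = g' u v) {e : Fin 2 → F} {e' : Fin 2 → F'}
    (he : ∀ j, T (e' j) = e j) (u v : F') : transForm g e (T u) (T v) = transForm g' e' u v := by
  simp only [transForm_apply, ← he, hT]

section Lifts

variable {E : Type} [NormedAddCommGroup E] [NormedSpace ℝ E]
  {EA : Type*} [NormedAddCommGroup EA] [NormedSpace ℝ EA]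
  {N : Type*} [TopologicalSpace N] [ChartedSpace E N] [IsManifold 𝓘(ℝ, E) ∞ N]
  {A : Type*} [TopologicalSpace A] [ChartedSpace EA A] [CommGroup A] [MulAction A N]
  {E' : Type} [NormedAddCommGroup E'] [NormedSpace ℝ E'] {γ : ℝ × ℝ → A}
  [FiniteDimensional ℝ E] [FiniteDimensional ℝ E']
  [ContMDiffSMul 𝓘(ℝ, EA) 𝓘(ℝ, E) ∞ A N]
  {G : N → E →L[ℝ] E →L[ℝ] ℝ} {I : EndField E N} {ζ : Fin 2 → VField E N}

namespace TransverseAction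

variable (h : TransverseAction EA G I ζ γ)
include h

theorem contMDiffAt_lift (c : ActionSlice E N γ E') {a : A} {q : N} (hq : a • q ∈ c.e.source) :
    ContMDiffAt 𝓘(ℝ, E) 𝓘(ℝ, E') ∞ (c.lift a) q := by
  have h1 : ContMDiffAt 𝓘(ℝ, E) 𝓘(ℝ, (ℝ × ℝ) × E') ∞ (fun q ↦ c.e (a • q)) q :=
    ContMDiffAt.comp q (c.contMDiffAt_e hq)
      (ContMDiffSMul.contMDiff_const_smul (I := 𝓘(ℝ, EA)) (I' := 𝓘(ℝ, E)) (n := ∞) a q)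
  exact ContMDiffAt.comp q contDiff_snd.contMDiff.contMDiffAt h1

theorem mD_lift (c : ActionSlice E N γ E') {a : A} {q : N} (hq : a • q ∈ c.e.source) (u : E) :
    mD E E' (c.lift a) q u = (parInv E c.e.symm (c.e (a • q)) (actD E a q u)).2 := by
  have h1 : mD E ((ℝ × ℝ) × E') (fun q ↦ c.e (a • q)) q
      = mD E ((ℝ × ℝ) × E') c.e (a • q) ∘L actD E a q :=
    mD_comp (f := (a • · : N → N)) ((c.contMDiffAt_e hq).mdifferentiableAt (by simp))
      (mdifferentiableAt_act E EA a q)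
  have h2 : MDifferentiableAt 𝓘(ℝ, E) 𝓘(ℝ, (ℝ × ℝ) × E') (fun q ↦ c.e (a • q)) q :=
    MDifferentiableAt.comp q ((c.contMDiffAt_e hq).mdifferentiableAt (by simp))
      (mdifferentiableAt_act E EA a q)
  have h3 : mD E E' (c.lift a) q
      = mD ((ℝ × ℝ) × E') E' (Prod.snd : (ℝ × ℝ) × E' → E') (c.e (a • q))
        ∘L mD E ((ℝ × ℝ) × E') (fun q ↦ c.e (a • q)) q :=
    mD_comp (g := (Prod.snd : (ℝ × ℝ) × E' → E')) differentiableAt_snd.mdifferentiableAt h2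
  rw [h3, h1, mD_fderiv, fderiv_snd, c.parInv_eq hq]
  rfl

variable (hs : ∀ p : N, ∃ c : ActionSlice E N γ E', c.σ 0 = p)
include hs

/-- The projections to a slice are the quotients of the transversal Kähler structure. -/
theorem isTransverseQuotient_lift (c : ActionSlice E N γ E') {a : A} {q : N}
    (hq : a • q ∈ c.e.source) :
    IsTransverseQuotient (G q) (endForm I q) (fun j ↦ vecForm (ζ j) q) (mD E E' (c.lift a) q)
      (c.form G (c.lift a q)) (c.cpx I (c.lift a q)) := by
  have hP := c.isParam
  have hx := c.e.map_source hq
  have hxm := c.mem_target.1 hx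
  have hK := h.transverseKahler_slice c
  have ez : c.e.symm (c.e (a • q)) = a • q := c.e.left_inv hq
  have hInv := h.invariantAt hs a q
  set z := c.e (a • q)
  have hζ : ∀ j, parD E c.e.symm z (orbVec E' j) = vecForm (ζ j) (a • q) := by
    intro j
    rw [← h.coordVec_slice c hx j, hP.parD_coordVec hx, ez]
    rfl
  have hw : ∀ u, parD E c.e.symm z (parInv E c.e.symm z (actD E a q u)) = actD E a q u :=
    fun u ↦ hP.parD_parInv hx _
  have hbij : ∀ w, ∃ u, parInv E c.e.symm z (actD E a q u) = w := fun w ↦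
    ⟨actD E a⁻¹ (a • q) (parD E c.e.symm z w), by rw [actD_actD_inv EA, hP.parInv_parD hx]⟩
  refine ⟨fun y ↦ ?_, fun k ↦ ?_, fun u v ↦ ?_, fun u ↦ ?_⟩
  · obtain ⟨u, hu⟩ := hbij (0, y)
    exact ⟨u, by rw [h.mD_lift c hq, hu]⟩
  · rw [h.mD_lift c hq]
    refine ⟨fun h0 ↦ ?_, fun ⟨α, β, hk⟩ ↦ ?_⟩
    · have h1 := eq_orbVec_add (parInv E c.e.symm z (actD E a q k))
      rw [h0, Prod.mk_zero_zero, add_zero] at h1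
      have h2 := congrArg (parD E c.e.symm z) h1
      rw [hw, _root_.map_add, _root_.map_smul, _root_.map_smul, hζ, hζ, ← h.actD_vecForm,
        ← h.actD_vecForm, ← _root_.map_smul, ← _root_.map_smul, ← _root_.map_add] at h2
      have h3 := congrArg (actD E a⁻¹ (a • q)) h2
      rw [actD_inv_actD EA, actD_inv_actD EA] at h3
      exact ⟨_, _, h3⟩
    · rw [hk, _root_.map_add, _root_.map_smul, _root_.map_smul, h.actD_vecForm, h.actD_vecForm,
        ← hζ, ← hζ, ← _root_.map_smul, ← _root_.map_smul, ← _root_.map_add, hP.parInv_parD hx]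
      simp [orbVec]
  · rw [h.mD_lift c hq, h.mD_lift c hq]
    have h1 := hK.sliceForm_snd Metric.isOpen_ball (isPreconnected_ball _) c.zero_mem_ball (x := z)
      hxm (parInv E c.e.symm z (actD E a q u)) (parInv E c.e.symm z (actD E a q v))
    refine h1.trans ?_
    have h2 : transForm (G (a • q)) (fun j ↦ vecForm (ζ j) (a • q)) (actD E a q u) (actD E a q v)
        = transForm (G q) (fun j ↦ vecForm (ζ j) q) u v :=
      transForm_map_of_isometric hInv.1 (fun j ↦ h.actD_vecForm a q j) u v
    have hcb : ∀ u v, G (a • q) (parD E c.e.symm z u) (parD E c.e.symm z v)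
        = coordBil c.e.symm G z u v := by
      intro u v
      rw [← ez]
      rfl
    have h3 := transForm_map_of_isometric hcb hζ (parInv E c.e.symm z (actD E a q u))
      (parInv E c.e.symm z (actD E a q v))
    rw [hw, hw] at h3
    exact h3.symm.trans h2
  · rw [h.mD_lift c hq, h.mD_lift c hq]
    have h1 := hK.sliceEnd_snd Metric.isOpen_ball (isPreconnected_ball _) c.zero_mem_ball (x := z)
      hxm (parInv E c.e.symm z (actD E a q u))
    refine Eq.trans ?_ h1.symm
    rw [coordEnd_apply, hw, ez, hInv.2]

end TransverseAction

namespace ActionSlice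

variable (c c' : ActionSlice E N γ E')

/-- The domain of the transition between two slices by means of `a`. -/
def transDom (a : A) : Set E' := {y ∈ Metric.ball 0 c.r | a • c.σ y ∈ c'.e.source ∧
  -(c'.e (a • c.σ y)).1 ∈ Metric.ball 0 c.r}

end ActionSlice

namespace TransverseAction

variable (h : TransverseAction EA G I ζ γ) (c c' : ActionSlice E N γ E')
include h

theorem transition_eq {a : A} {y : E'} (hy : y ∈ c.transDom c' a) :
    a⁻¹ • c'.σ (c'.lift a (c.σ y)) = γ (-(c'.e (a • c.σ y)).1) • c.σ y := by
  have h1 := c'.eq_smul hy.2.1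
  rw [h.map_neg, eq_inv_smul_iff, smul_comm, ActionSlice.lift, h1, inv_smul_smul]

theorem transition_mem {a : A} {y : E'} (hy : y ∈ c.transDom c' a) :
    c'.lift a (c.σ y) ∈ c'.transDom c a⁻¹ ∧ c.lift a⁻¹ (c'.σ (c'.lift a (c.σ y))) = y := by
  have h1 := h.transition_eq c c' hy
  have h2 := c.mem_source_of_eq hy.2.2 hy.1 h1
  have h3 := c.e_eq hy.2.2 hy.1 h1
  refine ⟨⟨c'.e_snd_mem hy.2.1, h2, ?_⟩, ?_⟩
  · rw [h3, neg_neg]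
    exact c'.e_fst_mem hy.2.1
  · rw [ActionSlice.lift, h3]

theorem isOpen_transDom (a : A) : IsOpen (c.transDom c' a) := by
  have hσ : ContinuousOn (fun y ↦ a • c.σ y) (Metric.ball 0 c.r) := fun y hy ↦
    ((ContMDiffSMul.contMDiff_const_smul (I := 𝓘(ℝ, EA)) (I' := 𝓘(ℝ, E)) (n := ∞) a
      (c.σ y)).continuousAt.comp (h.contMDiffAt_σ c hy).continuousAt).continuousWithinAt
  have hV : IsOpen (c'.e.source ∩ c'.e ⁻¹' {x | -x.1 ∈ Metric.ball 0 c.r}) :=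
    c'.e.isOpen_inter_preimage (Metric.isOpen_ball.preimage (by fun_prop))
  exact hσ.isOpen_inter_preimage Metric.isOpen_ball hV

theorem contMDiffAt_transition {a : A} {y : E'} (hy : y ∈ Metric.ball 0 c.r)
    (hy' : a • c.σ y ∈ c'.e.source) :
    ContMDiffAt 𝓘(ℝ, E') 𝓘(ℝ, E') ∞ (fun y ↦ c'.lift a (c.σ y)) y :=
  ContMDiffAt.comp (g := c'.lift a) (f := c.σ) y (h.contMDiffAt_lift c' hy') (h.contMDiffAt_σ c hy)

/-- The transition between two slices by means of the action of `a`. -/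
def transition (a : A) : OpenPartialHomeomorph E' E' where
  toFun y := c'.lift a (c.σ y)
  invFun y := c.lift a⁻¹ (c'.σ y)
  source := c.transDom c' a
  target := c'.transDom c a⁻¹
  map_source' _ hy := (h.transition_mem c c' hy).1
  map_target' y hy := by
    have := (h.transition_mem c' c hy).1
    rwa [inv_inv] at this
  left_inv' _ hy := (h.transition_mem c c' hy).2
  right_inv' y hy := by
    have := (h.transition_mem c' c hy).2
    rwa [inv_inv] at this
  open_source := h.isOpen_transDom c c' a
  open_target := h.isOpen_transDom c' c a⁻¹
  continuousOn_toFun _ hy :=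
    (h.contMDiffAt_transition c c' hy.1 hy.2.1).continuousAt.continuousWithinAt
  continuousOn_invFun _ hy :=
    (h.contMDiffAt_transition c' c hy.1 hy.2.1).continuousAt.continuousWithinAt

theorem mem_transDom {a : A} {x y : E'} (hx : x ∈ Metric.ball 0 c.r) (hy : y ∈ Metric.ball 0 c'.r)
    (hxy : a • c.σ x = c'.σ y) : x ∈ c.transDom c' a ∧ c'.lift a (c.σ x) = y := by
  have h1 : a • c.σ x = γ 0 • c'.σ y := by rw [h.map_zero, one_smul, hxy]
  have h2 := c'.e_eq c'.zero_mem_ball hy h1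
  refine ⟨⟨hx, c'.mem_source_of_eq c'.zero_mem_ball hy h1, ?_⟩, ?_⟩
  · rw [h2, neg_zero]
    exact c.zero_mem_ball
  · rw [ActionSlice.lift, h2]

/-- Projections to slices are compatible with the transitions. -/
theorem lift_transition {a b : A} {q : N} (hq : b • q ∈ c.e.source)
    (hy : a • c.σ (c.lift b q) ∈ c'.e.source) :
    ∃ b' : A, b' • q ∈ c'.e.source ∧ c'.lift b' q = c'.lift a (c.σ (c.lift b q)) ∧
      (fun q ↦ c'.lift a (c.σ (c.lift b q))) =ᶠ[𝓝 q] c'.lift b' := by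
  set s := (c.e (b • q)).1
  have hcont : ContinuousAt (fun q : N ↦ b • q) q :=
    (ContMDiffSMul.contMDiff_const_smul (I := 𝓘(ℝ, EA)) (I' := 𝓘(ℝ, E)) (n := ∞) b q).continuousAt
  have hce : ContinuousAt (fun q : N ↦ c.e (b • q)) q :=
    ContinuousAt.comp (f := fun q : N ↦ b • q) (c.contMDiffAt_e hq).continuousAt hcont
  have hkey : ∀ q' : N, b • q' ∈ c.e.source →
      a • c.σ (c.lift b q') = (γ (c.e (b • q')).1)⁻¹ • (a * b) • q' := fun q' hq' ↦ by
    rw [eq_inv_smul_iff, mul_smul, smul_comm]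
    exact congrArg (a • ·) (c.eq_smul hq')
  have hnear : ∀ᶠ q' in 𝓝 q, b • q' ∈ c.e.source ∧ a • c.σ (c.lift b q') ∈ c'.e.source ∧
      (c'.e (a • c.σ (c.lift b q'))).1 + ((c.e (b • q')).1 - s) ∈ Metric.ball 0 c'.r := by
    have h1 : ContinuousAt (fun q : N ↦ a • c.σ (c.lift b q)) q :=
      ContinuousAt.comp (g := fun q : N ↦ a • q) (ContMDiffSMul.contMDiff_const_smul
        (I := 𝓘(ℝ, EA)) (I' := 𝓘(ℝ, E)) (n := ∞) a _).continuousAt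
        (ContinuousAt.comp (f := c.lift b) (h.contMDiffAt_σ c (c.e_snd_mem hq)).continuousAt
          (h.contMDiffAt_lift c hq).continuousAt)
    have h2 : ContinuousAt (fun q ↦ (c'.e (a • c.σ (c.lift b q))).1 + ((c.e (b • q)).1 - s)) q :=
      (ContinuousAt.fst (ContinuousAt.comp (f := fun q : N ↦ a • c.σ (c.lift b q))
        (c'.contMDiffAt_e hy).continuousAt h1)).add (hce.fst.sub continuousAt_const)
    refine Filter.Eventually.and (hcont (c.e.open_source.mem_nhds hq)) (Filter.Eventually.and
      (h1 (c'.e.open_source.mem_nhds hy)) (h2 (Metric.isOpen_ball.mem_nhds ?_)))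
    change _ + (s - s) ∈ _
    rw [sub_self, add_zero]
    exact c'.e_fst_mem hy
  have hmain : ∀ q', b • q' ∈ c.e.source ∧ a • c.σ (c.lift b q') ∈ c'.e.source ∧
      (c'.e (a • c.σ (c.lift b q'))).1 + ((c.e (b • q')).1 - s) ∈ Metric.ball 0 c'.r →
      (γ (-s) * (a * b)) • q' ∈ c'.e.source ∧
        c'.lift (γ (-s) * (a * b)) q' = c'.lift a (c.σ (c.lift b q')) := by
    rintro q' ⟨h1, h2, h3⟩
    have h4 : (γ (-s) * (a * b)) • q' = γ ((c'.e (a • c.σ (c.lift b q'))).1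
        + ((c.e (b • q')).1 - s)) • c'.σ (c'.lift a (c.σ (c.lift b q'))) := by
      have h5 := hkey q' h1
      rw [eq_inv_smul_iff, ← c'.eq_smul h2] at h5
      rw [mul_smul, ← h5, smul_smul, smul_smul, ← h.map_add, ← h.map_add, ActionSlice.lift]
      congr 2
      abel
    refine ⟨c'.mem_source_of_eq h3 (c'.e_snd_mem h2) h4, ?_⟩
    have h5 := c'.e_eq h3 (c'.e_snd_mem h2) h4
    exact (congrArg (fun x : (ℝ × ℝ) × E' ↦ x.2) h5 :)
  have hq0 := hmain q hnear.self_of_nhds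
  refine ⟨γ (-s) * (a * b), hq0.1, hq0.2, ?_⟩
  filter_upwards [hnear] with q' hq' using (hmain q' hq').2.symm

variable (hs : ∀ p : N, ∃ c : ActionSlice E N γ E', c.σ 0 = p)
include hs

/-- The transitions are holomorphic isometries. -/
theorem transition_isometric {a : A} {y : E'} (hy : y ∈ Metric.ball 0 c.r)
    (hy' : a • c.σ y ∈ c'.e.source) :
    (∀ u v, c'.form G (c'.lift a (c.σ y)) (fderiv ℝ (fun y ↦ c'.lift a (c.σ y)) y u)
        (fderiv ℝ (fun y ↦ c'.lift a (c.σ y)) y v) = c.form G y u v) ∧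
      ∀ u, fderiv ℝ (fun y ↦ c'.lift a (c.σ y)) y (c.cpx I y u)
        = c'.cpx I (c'.lift a (c.σ y)) (fderiv ℝ (fun y ↦ c'.lift a (c.σ y)) y u) := by
  have hq : (1 : A) • c.σ y ∈ c.e.source := by
    rw [one_smul]
    exact h.σ_mem c hy
  have hl : c.lift (1 : A) (c.σ y) = y := by
    rw [ActionSlice.lift, one_smul, h.e_σ c hy]
  obtain ⟨b, hb, hb', hbe⟩ := h.lift_transition c c' (a := a) hq (by rwa [hl])
  have h1 := h.isTransverseQuotient_lift hs c hq
  have h2 := h.isTransverseQuotient_lift hs c' hb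
  rw [hb', hl] at h2
  rw [hl] at h1
  have hT : mD E E' (fun q ↦ c'.lift a (c.σ (c.lift (1 : A) q))) (c.σ y)
      = mD E' E' (fun y ↦ c'.lift a (c.σ y)) (c.lift (1 : A) (c.σ y))
        ∘L mD E E' (c.lift (1 : A)) (c.σ y) :=
    mD_comp (g := fun y ↦ c'.lift a (c.σ y)) (by
      rw [hl]
      exact (h.contMDiffAt_transition c c' hy hy').mdifferentiableAt (by simp))
      ((h.contMDiffAt_lift c hq).mdifferentiableAt (by simp))
  rw [mD_congr hbe, hl, mD_fderiv] at hT
  have hT' := fun u ↦ (DFunLike.congr_fun hT u).symm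
  exact ⟨h1.isometric h2 hT', h1.holomorphic h2 hT'⟩

end TransverseAction

end Lifts

section OpenSubset

variable {E E' : Type*} [NormedAddCommGroup E] [NormedSpace ℝ E] [NormedAddCommGroup E']
  [NormedSpace ℝ E'] {N : Type*} [TopologicalSpace N] [ChartedSpace E N] {U : Opens E'}

theorem mD_val (p : U) : mD E' E' (Subtype.val : U → E') p = .id ℝ E' := by
  exact mfderiv_extChartAt_self

theorem mD_val_comp {f : N → U} {q : N} (hf : MDifferentiableAt 𝓘(ℝ, E) 𝓘(ℝ, E') f q) :
    mD E E' (fun q ↦ (f q : E')) q = mD E E' f q := by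
  have h1 := mD_comp (g := (Subtype.val : U → E'))
    ((contMDiff_subtype_val (n := ∞) (f q)).mdifferentiableAt (by simp)) hf
  rw [mD_val] at h1
  exact h1

theorem contMDiffAt_opens_iff {f : N → U} {q : N} :
    ContMDiffAt 𝓘(ℝ, E) 𝓘(ℝ, E') ∞ f q ↔ ContMDiffAt 𝓘(ℝ, E) 𝓘(ℝ, E') ∞ (fun q ↦ (f q : E')) q :=
  (ContMDiffAt.subtypeVal_comp_iff U f q).symm

theorem val_chartPar {p : U} {x : E'} (hx : x ∈ chartDom E' p) :
    ((chartPar E' p x : U) : E') = x := extChartAt_chartPar hx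

theorem parD_chartPar_opens [FiniteDimensional ℝ E'] {p : U} {x : E'} (hx : x ∈ chartDom E' p) :
    parD E' (chartPar E' p) x = .id ℝ E' := by
  have hP := isParam_chart E' p
  have h1 := mD_val_comp (hP.mdifferentiableAt hx)
  refine h1.symm.trans ((mD_congr ?_).trans (mD_id x))
  filter_upwards [hP.mem_nhds hx] with y hy using val_chartPar hy

/-- The Kähler structure on an open subset. -/
theorem FlatKahler.exists_opens [FiniteDimensional ℝ E'] {V : Set E'}
    {g : E' → E' →L[ℝ] E' →L[ℝ] ℝ} {I : E' → E' →L[ℝ] E'} (h : FlatKahler V g I)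
    (hU : (U : Set E') ⊆ V) : ∃ (k : RMetric E' U) (J : EndField E' U), IsKahler k J ∧
      (∀ p : U, metricForm k p = g p) ∧ ∀ p : U, endForm J p = I p := by
  refine exists_kahler (fun p : U ↦ g p) (fun p : U ↦ I p) (fun _ ↦ g) (fun _ ↦ I)
    (fun p ↦ h.mono (isParam_chart E' p).isOpen fun x hx ↦ hU ?_) (fun p x hx u v ↦ ?_)
    (fun p x hx u ↦ ?_)
  · rw [← val_chartPar hx]
    exact (chartPar E' p x : U).2
  · rw [parD_chartPar_opens hx, val_chartPar hx]
    rfl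
  · rw [parD_chartPar_opens hx, val_chartPar hx]
    rfl

end OpenSubset

/-- A map between open subsets of vector spaces, in terms of a map between the vector spaces. -/
theorem contMDiffAt_opens_of_eq {F F' : Type*} [NormedAddCommGroup F] [NormedSpace ℝ F]
    [NormedAddCommGroup F'] [NormedSpace ℝ F'] {U : Opens F} {U' : Opens F'} {f : U → U'}
    {K : F → F'} {x : U} (hK : ContDiffAt ℝ ∞ K x) (hf : ∀ᶠ z in 𝓝 x, (f z : F') = K z) :
    ContMDiffAt 𝓘(ℝ, F) 𝓘(ℝ, F') ∞ f x ∧ mD F F' f x = fderiv ℝ K x := by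
  have h1 : ContMDiffAt 𝓘(ℝ, F) 𝓘(ℝ, F') ∞ (fun z : U ↦ K z) x :=
    ContMDiffAt.comp (g := K) (f := (Subtype.val : U → F)) x (contMDiffAt_iff_contDiffAt.2 hK)
      (contMDiff_subtype_val x)
  have h2 : ContMDiffAt 𝓘(ℝ, F) 𝓘(ℝ, F') ∞ f x :=
    contMDiffAt_opens_iff.2 (h1.congr_of_eventuallyEq hf)
  refine ⟨h2, ?_⟩
  rw [← mD_val_comp (h2.mdifferentiableAt (by simp)), mD_congr hf]
  have h3 := mD_comp (g := K) (f := (Subtype.val : U → F)) (q := x)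
    (hK.differentiableAt (by simp)).mdifferentiableAt
    ((contMDiff_subtype_val (n := ∞) x).mdifferentiableAt (by simp))
  rw [h3, mD_val, mD_fderiv]
  rfl

section Radius

variable {E : Type} [NormedAddCommGroup E] [NormedSpace ℝ E]
  {EA : Type*} [NormedAddCommGroup EA] [NormedSpace ℝ EA]
  {N : Type*} [TopologicalSpace N] [ChartedSpace E N] [IsManifold 𝓘(ℝ, E) ∞ N]
  {A : Type*} [TopologicalSpace A] [ChartedSpace EA A] [CommGroup A] [MulAction A N]
  {E' : Type} [NormedAddCommGroup E'] [NormedSpace ℝ E'] {γ : ℝ × ℝ → A}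
  [FiniteDimensional ℝ E] [FiniteDimensional ℝ E']
  {G : N → E →L[ℝ] E →L[ℝ] ℝ} {I : EndField E N} {ζ : Fin 2 → VField E N}

/-- On the ball of radius `ρ` in the slice, the action of `A` is described by the stabiliser. -/
structure ActionSlice.IsOrbifoldRadius (c : ActionSlice E N γ E') (ρ : ℝ) : Prop where
  pos : 0 < ρ
  le : ρ ≤ c.r
  mem : ∀ k ∈ MulAction.stabilizer A (c.σ 0), ∀ y ∈ Metric.ball (0 : E') ρ,
    k • c.σ y ∈ c.e.source ∧ (c.e (k • c.σ y)).1 ∈ Metric.ball 0 (c.r / 2)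
  rep : ∀ a : A, ∀ x ∈ Metric.ball (0 : E') ρ, ∀ y ∈ Metric.ball (0 : E') ρ, a • c.σ x = c.σ y →
    ∃ k ∈ MulAction.stabilizer A (c.σ 0), y = c.lift k (c.σ x)

namespace TransverseAction

theorem add_mem_ball {F : Type*} [SeminormedAddCommGroup F] {s t : F} {r : ℝ}
    (hs : s ∈ Metric.ball 0 (r / 2)) (ht : t ∈ Metric.ball 0 (r / 2)) :
    s + t ∈ Metric.ball 0 r := by
  rw [mem_ball_zero_iff] at *
  linarith [norm_add_le s t]

variable [ContMDiffSMul 𝓘(ℝ, EA) 𝓘(ℝ, E) ∞ A N] (h : TransverseAction EA G I ζ γ)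
  (c : ActionSlice E N γ E')
include h

/-- By properness, elements of `A` which move a point near `p` to a point near `p` are close to the
stabiliser of `p`. -/
theorem exists_nhds_of_proper [FiniteDimensional ℝ EA] [LieGroup 𝓘(ℝ, EA) ∞ A] [ProperSMul A N]
    (p : N) {r : ℝ} (hr : 0 < r) : ∃ W ∈ 𝓝 p, ∀ a : A, ∀ q ∈ W, a • q ∈ W →
      ∃ s ∈ Metric.ball (0 : ℝ × ℝ) r, ∃ k ∈ MulAction.stabilizer A p, a = γ s * k := by
  have : IsTopologicalGroup A := topologicalGroup_of_lieGroup 𝓘(ℝ, EA) ∞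
  set O : Set A := ⋃ k ∈ MulAction.stabilizer A p, (· * k) '' (γ '' Metric.ball 0 r)
  have hO : IsOpen O := isOpen_biUnion fun k _ ↦
    isOpenMap_mul_right k _ (h.isOpenMap _ Metric.isOpen_ball)
  have hmap := (ProperSMul.isProperMap_smul_pair (G := A) (X := N)).isClosedMap
  have hcl : IsClosed ((fun gx : A × N ↦ (gx.1 • gx.2, gx.2)) '' (Oᶜ ×ˢ univ)) :=
    hmap _ (hO.isClosed_compl.prod isClosed_univ)
  have hp : (p, p) ∉ (fun gx : A × N ↦ (gx.1 • gx.2, gx.2)) '' (Oᶜ ×ˢ univ) := by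
    rintro ⟨⟨a, q⟩, ⟨ha, -⟩, haq⟩
    simp only [Prod.mk.injEq] at haq
    obtain ⟨h1, rfl⟩ := haq
    refine ha (mem_biUnion (show a ∈ MulAction.stabilizer A q from h1) ⟨1, ⟨0, ?_, h.map_zero⟩, ?_⟩)
    · exact Metric.mem_ball_self hr
    · exact one_mul a
  obtain ⟨W₁, hW₁, W₂, hW₂, hW⟩ := mem_nhds_prod_iff.1 (hcl.isOpen_compl.mem_nhds hp)
  refine ⟨W₁ ∩ W₂, Filter.inter_mem hW₁ hW₂, fun a q hq haq ↦ ?_⟩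
  have h1 : a ∈ O := by
    by_contra ha
    exact hW (show (a • q, q) ∈ W₁ ×ˢ W₂ from ⟨haq.1, hq.2⟩) ⟨(a, q), ⟨ha, trivial⟩, rfl⟩
  simp only [O, mem_iUnion] at h1
  obtain ⟨k, hk, _, ⟨s, hs, rfl⟩, hak⟩ := h1
  exact ⟨s, hs, k, hk, hak.symm⟩

theorem exists_isOrbifoldRadius [FiniteDimensional ℝ EA] [LieGroup 𝓘(ℝ, EA) ∞ A] [ProperSMul A N]
    (hfin : Finite (MulAction.stabilizer A (c.σ 0))) : ∃ ρ, c.IsOrbifoldRadius ρ := by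
  obtain ⟨W, hW, hWa⟩ := h.exists_nhds_of_proper (c.σ 0) (half_pos c.pos)
  have h0 : (0 : E') ∈ Metric.ball 0 c.r := c.zero_mem_ball'
  have hσ := h.contMDiffAt_σ c h0
  have key : ∀ k : MulAction.stabilizer A (c.σ 0), ∀ᶠ y in 𝓝 (0 : E'), k.1 • c.σ y ∈ W ∧
      k.1 • c.σ y ∈ c.e.source ∧ (c.e (k.1 • c.σ y)).1 ∈ Metric.ball 0 (c.r / 2) := by
    intro k
    have hk : k.1 • c.σ 0 = c.σ 0 := k.2
    have h1 : ContinuousAt (fun y ↦ k.1 • c.σ y) 0 :=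
      ContinuousAt.comp (g := fun q : N ↦ k.1 • q) (ContMDiffSMul.contMDiff_const_smul
        (I := 𝓘(ℝ, EA)) (I' := 𝓘(ℝ, E)) (n := ∞) k.1 _).continuousAt hσ.continuousAt
    have hs : c.σ 0 ∈ c.e.source := h.σ_mem c h0
    have h2 : ContinuousAt (fun q ↦ (c.e q).1) (c.σ 0) := (c.contMDiffAt_e hs).continuousAt.fst
    have h3 : ∀ᶠ q in 𝓝 (k.1 • c.σ 0), q ∈ W ∧ q ∈ c.e.source ∧
        (c.e q).1 ∈ Metric.ball 0 (c.r / 2) := by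
      rw [hk]
      refine Filter.Eventually.and hW (Filter.Eventually.and (c.e.open_source.mem_nhds hs)
        (h2 (Metric.isOpen_ball.mem_nhds ?_)))
      change (c.e (c.σ 0)).1 ∈ _
      rw [h.e_σ c h0]
      exact Metric.mem_ball_self (half_pos c.pos)
    exact h1.eventually h3
  have hall := (Filter.eventually_all.2 key).and (Metric.isOpen_ball.mem_nhds h0)
  obtain ⟨ρ, hρ, hball⟩ := Metric.eventually_nhds_iff_ball.1 hall
  have hball' : ∀ y ∈ Metric.ball (0 : E') (min ρ c.r), y ∈ Metric.ball (0 : E') ρ := fun y hy ↦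
    Metric.ball_subset_ball (min_le_left _ _) hy
  refine ⟨min ρ c.r, lt_min hρ c.pos, min_le_right _ _, fun k hk y hy ↦ ?_, fun a x hx y hy hxy ↦ ?_⟩
  · exact ((hball y (hball' y hy)).1 ⟨k, hk⟩).2
  · have hx1 := (hball x (hball' x hx)).1 1
    have hy1 := (hball y (hball' y hy)).1 1
    rw [OneMemClass.coe_one, one_smul] at hx1 hy1
    obtain ⟨s, hs, k, hk, rfl⟩ := hWa a _ hx1.1 (by rw [hxy]; exact hy1.1)
    refine ⟨k, hk, ?_⟩
    have h1 := (hball x (hball' x hx)).1 ⟨k, hk⟩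
    have h2 : c.σ y = γ (s + (c.e (k • c.σ x)).1) • c.σ (c.lift k (c.σ x)) := by
      rw [← hxy, mul_smul, h.map_add, mul_smul, ActionSlice.lift, c.eq_smul h1.2.1]
    have h3 := c.e_eq (add_mem_ball hs h1.2.2) (c.e_snd_mem h1.2.1) h2
    rw [h.e_σ c (hball y (hball' y hy)).2] at h3
    exact (congrArg (fun x : (ℝ × ℝ) × E' ↦ x.2) h3 :)

variable {c}

theorem lift_lift {ρ : ℝ} (hρ : c.IsOrbifoldRadius ρ) {k l : A}
    (hk : k ∈ MulAction.stabilizer A (c.σ 0)) (hl : l ∈ MulAction.stabilizer A (c.σ 0)) {y : E'}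
    (hy : y ∈ Metric.ball 0 ρ) :
    c.lift k (c.σ (c.lift l (c.σ y))) = c.lift (k * l) (c.σ y) := by
  have h1 := hρ.mem l hl y hy
  have h2 := hρ.mem (k * l) (mul_mem hk hl) y hy
  have h3 : k • c.σ (c.lift l (c.σ y))
      = γ (-(c.e (l • c.σ y)).1 + (c.e ((k * l) • c.σ y)).1) • c.σ (c.lift (k * l) (c.σ y)) := by
    rw [h.map_add, mul_smul, ActionSlice.lift, ActionSlice.lift, c.eq_smul h2.1, h.map_neg,
      eq_inv_smul_iff, smul_comm, c.eq_smul h1.1, mul_smul]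
  have h4 := c.e_eq (add_mem_ball (by simpa using h1.2) h2.2) (c.e_snd_mem h2.1) h3
  exact (congrArg (fun x : (ℝ × ℝ) × E' ↦ x.2) h4 :)

theorem lift_one_σ {y : E'} (hy : y ∈ Metric.ball 0 c.r) : c.lift 1 (c.σ y) = y := by
  rw [ActionSlice.lift, one_smul, h.e_σ c hy]

theorem lift_zero {k : A} (hk : k ∈ MulAction.stabilizer A (c.σ 0)) : c.lift k (c.σ 0) = 0 := by
  have : k • c.σ 0 = c.σ 0 := hk
  rw [ActionSlice.lift, this, h.e_σ c c.zero_mem_ball']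

theorem mk_lift {a : A} {q : N} (hq : a • q ∈ c.e.source) :
    (Quotient.mk (MulAction.orbitRel A N) (c.σ (c.lift a q))) = Quotient.mk _ q := by
  refine Quotient.sound ⟨(γ (c.e (a • q)).1)⁻¹ * a, ?_⟩
  change ((γ (c.e (a • q)).1)⁻¹ * a) • q = _
  rw [mul_smul, inv_smul_eq_iff, ActionSlice.lift, c.eq_smul hq]

end TransverseAction

end Radius

section OrbifoldChart

variable {E : Type} [NormedAddCommGroup E] [NormedSpace ℝ E]
  {EA : Type*} [NormedAddCommGroup EA] [NormedSpace ℝ EA]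
  {N : Type*} [TopologicalSpace N] [ChartedSpace E N] [IsManifold 𝓘(ℝ, E) ∞ N]
  {A : Type*} [TopologicalSpace A] [ChartedSpace EA A] [CommGroup A] [MulAction A N]
  {k : ℕ} {γ : ℝ × ℝ → A} [FiniteDimensional ℝ E]
  {G : N → E →L[ℝ] E →L[ℝ] ℝ} {I : EndField E N} {ζ : Fin 2 → VField E N}

/-- `C` is an orbifold chart of the quotient on an open subset of the slice `c`. -/
structure IsSliceChart (G : N → E →L[ℝ] E →L[ℝ] ℝ) (I : EndField E N)
    (c : ActionSlice E N γ (Euc k)) (C : KahlerOrbifoldChart (MulAction.orbitRel.Quotient A N) k) :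
    Prop where
  sub : ∀ x : C.U, (x : Euc k) ∈ Metric.ball 0 c.r
  zero_mem : 0 ∈ C.U
  φ_apply : ∀ x : C.U, C.φ x = Quotient.mk (MulAction.orbitRel A N) (c.σ x)
  group : ∀ f ∈ C.Γ, ∃ a ∈ MulAction.stabilizer A (c.σ 0), ∀ x : C.U, (f x : Euc k) = c.lift a (c.σ x)
  form : ∀ x : C.U, metricForm C.h x = c.form G x
  cpx : ∀ x : C.U, endForm C.J x = c.cpx I x

namespace ActionSlice

variable (c : ActionSlice E N γ (Euc k)) (ρ : ℝ)

/-- The part of the slice which is preserved by the stabiliser. -/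
def invDom : Set (Euc k) := {y ∈ Metric.ball 0 ρ |
  ∀ a ∈ MulAction.stabilizer A (c.σ 0), c.lift a (c.σ y) ∈ Metric.ball 0 ρ}

/-- A connected part of the slice which is preserved by the stabiliser. -/
def chartSet : Set (Euc k) := connectedComponentIn (c.invDom ρ) 0

end ActionSlice

namespace TransverseAction

variable [ContMDiffSMul 𝓘(ℝ, EA) 𝓘(ℝ, E) ∞ A N] (h : TransverseAction EA G I ζ γ)
  {c : ActionSlice E N γ (Euc k)} {ρ : ℝ} (hρ : c.IsOrbifoldRadius ρ)

include h hρ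

theorem contMDiffAt_lift_σ {a : A} (ha : a ∈ MulAction.stabilizer A (c.σ 0)) {y : Euc k}
    (hy : y ∈ Metric.ball 0 ρ) :
    ContMDiffAt 𝓘(ℝ, Euc k) 𝓘(ℝ, Euc k) ∞ (fun y ↦ c.lift a (c.σ y)) y :=
  h.contMDiffAt_transition c c (Metric.ball_subset_ball hρ.le hy) (hρ.mem a ha y hy).1

theorem zero_mem_invDom : (0 : Euc k) ∈ c.invDom ρ :=
  ⟨Metric.mem_ball_self hρ.pos, fun a ha ↦ by
    rw [h.lift_zero ha]
    exact Metric.mem_ball_self hρ.pos⟩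

theorem isOpen_invDom (hfin : Finite (MulAction.stabilizer A (c.σ 0))) : IsOpen (c.invDom ρ) := by
  have h1 : c.invDom ρ = ⋂ a : MulAction.stabilizer A (c.σ 0),
      (Metric.ball 0 ρ ∩ (fun y ↦ c.lift a.1 (c.σ y)) ⁻¹' Metric.ball 0 ρ) := by
    ext y
    simp only [ActionSlice.invDom, mem_ofPred_eq, mem_iInter, mem_inter_iff, mem_preimage]
    exact ⟨fun hy a ↦ ⟨hy.1, hy.2 a.1 a.2⟩, fun hy ↦ ⟨(hy 1).1, fun a ha ↦ (hy ⟨a, ha⟩).2⟩⟩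
  rw [h1]
  exact isOpen_iInter_of_finite fun a ↦ ContinuousOn.isOpen_inter_preimage (fun y hy ↦
    (h.contMDiffAt_lift_σ hρ a.2 hy).continuousAt.continuousWithinAt) Metric.isOpen_ball
    Metric.isOpen_ball

theorem isOpen_chartSet (hfin : Finite (MulAction.stabilizer A (c.σ 0))) :
    IsOpen (c.chartSet ρ) := (h.isOpen_invDom hρ hfin).connectedComponentIn

omit hρ h [FiniteDimensional ℝ E] [IsManifold 𝓘(ℝ, E) ∞ N] [ContMDiffSMul 𝓘(ℝ, EA) 𝓘(ℝ, E) ∞ A N] [ChartedSpace EA A] [NormedSpace ℝ EA] [NormedAddCommGroup EA] [TopologicalSpace A] in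
theorem chartSet_subset : c.chartSet ρ ⊆ Metric.ball 0 ρ := fun _ hy ↦
  (connectedComponentIn_subset _ _ hy).1

theorem zero_mem_chartSet : (0 : Euc k) ∈ c.chartSet ρ :=
  mem_connectedComponentIn (h.zero_mem_invDom hρ)

theorem lift_mem_chartSet {a : A} (ha : a ∈ MulAction.stabilizer A (c.σ 0)) {y : Euc k}
    (hy : y ∈ c.chartSet ρ) : c.lift a (c.σ y) ∈ c.chartSet ρ := by
  have hcont : ContinuousOn (fun y ↦ c.lift a (c.σ y)) (c.chartSet ρ) := fun z hz ↦
    (h.contMDiffAt_lift_σ hρ ha (chartSet_subset hz)).continuousAt.continuousWithinAt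
  have h1 : (fun y ↦ c.lift a (c.σ y)) '' c.chartSet ρ ⊆ c.chartSet ρ := by
    refine (isPreconnected_connectedComponentIn.image _ hcont).subset_connectedComponentIn
      ⟨0, h.zero_mem_chartSet hρ, h.lift_zero ha⟩ ?_
    rintro _ ⟨z, hz, rfl⟩
    have hz' := connectedComponentIn_subset _ _ hz
    refine ⟨hz'.2 a ha, fun b hb ↦ ?_⟩
    rw [h.lift_lift hρ hb ha hz'.1]
    exact hz'.2 _ (mul_mem hb ha)
  exact h1 ⟨y, hy, rfl⟩

/-- The connected part of the slice, as an open set. -/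
def chartOpens (hfin : Finite (MulAction.stabilizer A (c.σ 0))) : Opens (Euc k) :=
  ⟨c.chartSet ρ, h.isOpen_chartSet hρ hfin⟩

variable (hfin : Finite (MulAction.stabilizer A (c.σ 0)))

/-- The action of the stabiliser on the slice. -/
def slicePerm : MulAction.stabilizer A (c.σ 0) →* Equiv.Perm (h.chartOpens hρ hfin) where
  toFun a :=
    { toFun := fun y ↦ ⟨c.lift a.1 (c.σ y), h.lift_mem_chartSet hρ a.2 y.2⟩
      invFun := fun y ↦ ⟨c.lift a.1⁻¹ (c.σ y), h.lift_mem_chartSet hρ (inv_mem a.2) y.2⟩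
      left_inv := fun y ↦ Subtype.ext <| by
        have hy := chartSet_subset y.2
        change c.lift a.1⁻¹ (c.σ (c.lift a.1 (c.σ y))) = y
        rw [h.lift_lift hρ (inv_mem a.2) a.2 hy, inv_mul_cancel,
          h.lift_one_σ (Metric.ball_subset_ball hρ.le hy)]
      right_inv := fun y ↦ Subtype.ext <| by
        have hy := chartSet_subset y.2
        change c.lift a.1 (c.σ (c.lift a.1⁻¹ (c.σ y))) = y
        rw [h.lift_lift hρ a.2 (inv_mem a.2) hy, mul_inv_cancel,
          h.lift_one_σ (Metric.ball_subset_ball hρ.le hy)] }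
  map_one' := Equiv.ext fun y ↦ Subtype.ext <|
    h.lift_one_σ (Metric.ball_subset_ball hρ.le (chartSet_subset y.2))
  map_mul' a b := Equiv.ext fun y ↦ Subtype.ext
    (h.lift_lift hρ a.2 b.2 (chartSet_subset y.2)).symm

variable (hs : ∀ p : N, ∃ c : ActionSlice E N γ (Euc k), c.σ 0 = p)

include hs hfin in
theorem exists_sliceChart_of_radius :
    ∃ C : KahlerOrbifoldChart (MulAction.orbitRel.Quotient A N) k, IsSliceChart G I c C := by
  have hsub : ∀ x ∈ c.chartSet ρ, x ∈ Metric.ball (0 : Euc k) c.r := fun x hx ↦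
    Metric.ball_subset_ball hρ.le (chartSet_subset hx)
  have : ContinuousConstSMul A N := ⟨fun a ↦ (ContMDiffSMul.contMDiff_const_smul
        (I := 𝓘(ℝ, EA)) (I' := 𝓘(ℝ, E)) (n := ∞) a).continuous⟩
  let U : Opens (Euc k) := h.chartOpens hρ hfin
  obtain ⟨K, J, hK, hKG, hJI⟩ := (h.kahler_slice c).exists_opens (U := U) hsub
  have hmap : ∀ a : MulAction.stabilizer A (c.σ 0), ∀ x : U,
      ContMDiffAt 𝓘(ℝ, Euc k) 𝓘(ℝ, Euc k) ∞ (h.slicePerm hρ hfin a : U → U) x ∧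
      mD (Euc k) (Euc k) (h.slicePerm hρ hfin a : U → U) x = fderiv ℝ (fun y ↦ c.lift a.1 (c.σ y)) x :=
    fun a x ↦ contMDiffAt_opens_of_eq (contMDiffAt_iff_contDiffAt.1
      (h.contMDiffAt_lift_σ hρ a.2 (chartSet_subset x.2))) (.of_forall fun z ↦ rfl)
  have htr := fun (a : MulAction.stabilizer A (c.σ 0)) (x : U) ↦
    h.transition_isometric c c hs (a := a.1) (hsub x x.2) (hρ.mem a.1 a.2 x (chartSet_subset x.2)).1
  have hσc : ContinuousOn c.σ (c.chartSet ρ) := fun x hx ↦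
    (h.contMDiffAt_σ c (hsub x hx)).continuousAt.continuousWithinAt
  have hmk := isOpenMap_quotient_mk'_mul (Γ := A) (T := N)
  refine ⟨⟨U, ⟨⟨0, h.zero_mem_chartSet hρ⟩, isPreconnected_connectedComponentIn⟩,
    (h.slicePerm hρ hfin).range, .of_surjective _ (h.slicePerm hρ hfin).rangeRestrict_surjective, ?_, fun x ↦ Quotient.mk (MulAction.orbitRel A N) (c.σ x),
    ?_, ?_, ?_, K, J, hK, ?_, ?_⟩, ⟨fun x ↦ hsub x x.2, h.zero_mem_chartSet hρ, fun x ↦ rfl, ?_,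
    hKG, hJI⟩⟩
  · rintro _ ⟨a, rfl⟩ x
    exact (hmap a x).1
  · exact continuous_quotient_mk'.comp (hσc.comp_continuous continuous_subtype_val fun x ↦ x.2)
  · intro O hO
    have hO' : IsOpen (Subtype.val '' O : Set (Euc k)) := U.isOpen.isOpenMap_subtype_val _ hO
    have hV : IsOpen (c.e.source ∩ c.e ⁻¹' (Prod.snd ⁻¹' (Subtype.val '' O))) :=
      c.e.isOpen_inter_preimage (hO'.preimage continuous_snd)
    convert hmk _ hV using 1
    ext z
    constructor
    · rintro ⟨x, hx, rfl⟩
      refine ⟨c.σ x, ⟨h.σ_mem c (hsub x x.2), ?_⟩, rfl⟩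
      rw [mem_preimage, h.e_σ c (hsub x x.2)]
      exact ⟨x, hx, rfl⟩
    · rintro ⟨q, ⟨hq, x, hx, hxq⟩, rfl⟩
      refine ⟨x, hx, ?_⟩
      have h1 := mk_lift h (c := c) (a := (1 : A)) (q := q) (by rwa [one_smul])
      rw [ActionSlice.lift, one_smul, ← hxq] at h1
      exact h1
  · intro x y
    refine ⟨fun hxy ↦ ?_, ?_⟩
    · obtain ⟨a, ha⟩ := Quotient.exact hxy.symm
      obtain ⟨b, hb, hby⟩ := hρ.rep a x (chartSet_subset x.2) y (chartSet_subset y.2) ha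
      exact ⟨_, ⟨⟨b, hb⟩, rfl⟩, Subtype.ext hby.symm⟩
    · rintro ⟨_, ⟨a, rfl⟩, rfl⟩
      have := mk_lift h (c := c) (hρ.mem a.1 a.2 x (chartSet_subset x.2)).1
      exact this.symm
  · rintro _ ⟨a, rfl⟩ x -
    have key : ∀ u v, metricForm K (h.slicePerm hρ hfin a x : U)
        (mD (Euc k) (Euc k) (h.slicePerm hρ hfin a : U → U) x u)
        (mD (Euc k) (Euc k) (h.slicePerm hρ hfin a : U → U) x v) = metricForm K x u v := by
      intro u v
      rw [hKG, hKG, (hmap a x).2]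
      exact (htr a x).1 u v
    exact key
  · rintro _ ⟨a, rfl⟩
    refine ⟨fun x _ ↦ (hmap a x).1.contMDiffWithinAt, fun x _ ↦ ?_⟩
    have key : ∀ u, mD (Euc k) (Euc k) (h.slicePerm hρ hfin a : U → U) x (endForm J x u)
        = endForm J (h.slicePerm hρ hfin a x : U) (mD (Euc k) (Euc k) (h.slicePerm hρ hfin a : U → U) x u) := by
      intro u
      rw [hJI, hJI, (hmap a x).2]
      exact (htr a x).2 u
    exact key
  · rintro _ ⟨a, rfl⟩
    exact ⟨a.1, a.2, fun x ↦ rfl⟩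

end TransverseAction

end OrbifoldChart

section OrbifoldStructure

variable {E : Type} [NormedAddCommGroup E] [NormedSpace ℝ E]
  {EA : Type*} [NormedAddCommGroup EA] [NormedSpace ℝ EA]
  {N : Type*} [TopologicalSpace N] [ChartedSpace E N] [IsManifold 𝓘(ℝ, E) ∞ N]
  {A : Type*} [TopologicalSpace A] [ChartedSpace EA A] [CommGroup A] [MulAction A N]
  {k : ℕ} {γ : ℝ × ℝ → A} [FiniteDimensional ℝ E]
  {G : N → E →L[ℝ] E →L[ℝ] ℝ} {I : EndField E N} {ζ : Fin 2 → VField E N}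
  [ContMDiffSMul 𝓘(ℝ, EA) 𝓘(ℝ, E) ∞ A N]

namespace TransverseAction

variable (h : TransverseAction EA G I ζ γ)
  {c c' : ActionSlice E N γ (Euc k)} {C C' : KahlerOrbifoldChart (MulAction.orbitRel.Quotient A N) k}
include h

theorem symm_form (q : N) (u v : E) : G q u v = G q v u := by
  have hP := isParam_chart E q
  have hm := mem_chartDom (E := E) q
  have h1 := (h.hermitianLine q).inner.symm (parInv E (chartPar E q) (extChartAt 𝓘(ℝ, E) q q) u)
    (parInv E (chartPar E q) (extChartAt 𝓘(ℝ, E) q q) v)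
  simp only [coordBil, ContinuousLinearMap.bilinearComp_apply, hP.parD_parInv hm] at h1
  rwa [chartPar_self] at h1

variable (hs : ∀ p : N, ∃ c : ActionSlice E N γ (Euc k), c.σ 0 = p)
include hs

/-- The compatibility of orbifold charts. -/
theorem sliceChart_compatible (hC : IsSliceChart G I c C) (hC' : IsSliceChart G I c' C')
    (x : C.U) (y : C'.U) (hxy : C.φ x = C'.φ y) :
    ∃ e : OpenPartialHomeomorph C.U C'.U, x ∈ e.source ∧ e x = y ∧
      ContMDiffOn 𝓘(ℝ, Euc k) 𝓘(ℝ, Euc k) ∞ e e.source ∧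
      ContMDiffOn 𝓘(ℝ, Euc k) 𝓘(ℝ, Euc k) ∞ e.symm e.target ∧
      (∀ z ∈ e.source, C'.φ (e z) = C.φ z) ∧
      IsIsometricOn C.h C'.h e e.source ∧
      IsHolomorphicOn C.J C'.J e e.source := by
  rw [hC.φ_apply, hC'.φ_apply] at hxy
  obtain ⟨a, ha⟩ := Quotient.exact hxy.symm
  obtain ⟨hxd, hxy'⟩ := h.mem_transDom c c' (a := a) (hC.sub x) (hC'.sub y) ha
  have hne : Nonempty C.U := ⟨x⟩
  have hne' : Nonempty C'.U := ⟨y⟩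
  set κ := h.transition c c' a
  set j := C.U.openPartialHomeomorphSubtypeCoe hne
  set j' := C'.U.openPartialHomeomorphSubtypeCoe hne'
  set e := (j.trans κ).trans j'.symm
  have hj' : ∀ z ∈ C'.U, (j'.symm z : Euc k) = z := fun z hz ↦ j'.right_inv (by simpa [j'] using hz)
  have hj : ∀ z ∈ C.U, (j.symm z : Euc k) = z := fun z hz ↦ j.right_inv (by simpa [j] using hz)
  have hmem : ∀ z, z ∈ e.source ↔ (z : Euc k) ∈ c.transDom c' a ∧ c'.lift a (c.σ z) ∈ C'.U := by
    intro z
    simp [e, j, j', κ, transition]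
  have hmem' : ∀ z, z ∈ e.target ↔ (z : Euc k) ∈ c'.transDom c a⁻¹ ∧ c.lift a⁻¹ (c'.σ z) ∈ C.U := by
    intro z
    simp [e, j, j', κ, transition]
  have he : ∀ z ∈ e.source, (e z : Euc k) = c'.lift a (c.σ z) := fun z hz ↦ hj' _ ((hmem z).1 hz).2
  have he' : ∀ z ∈ e.target, (e.symm z : Euc k) = c.lift a⁻¹ (c'.σ z) := fun z hz ↦
    hj _ ((hmem' z).1 hz).2
  have hxe : x ∈ e.source := (hmem x).2 ⟨hxd, by rw [hxy']; exact y.2⟩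
  have hsm := fun z hz ↦ contMDiffAt_opens_of_eq (x := z) (contMDiffAt_iff_contDiffAt.1
    (h.contMDiffAt_transition c c' ((hmem z).1 hz).1.1 ((hmem z).1 hz).1.2.1)) (by
      filter_upwards [e.open_source.mem_nhds hz] with w hw using he w hw)
  have hsm' := fun z hz ↦ contMDiffAt_opens_of_eq (x := z) (contMDiffAt_iff_contDiffAt.1
    (h.contMDiffAt_transition c' c ((hmem' z).1 hz).1.1 ((hmem' z).1 hz).1.2.1)) (by
      filter_upwards [e.open_target.mem_nhds hz] with w hw using he' w hw)
  have htr := fun z hz ↦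
    h.transition_isometric c c' hs (a := a) ((hmem z).1 hz).1.1 ((hmem z).1 hz).1.2.1
  refine ⟨e, hxe, Subtype.ext ((he x hxe).trans hxy'), fun z hz ↦ (hsm z hz).1.contMDiffWithinAt,
    fun z hz ↦ (hsm' z hz).1.contMDiffWithinAt, fun z hz ↦ ?_, fun z hz ↦ ?_,
    fun z hz ↦ (hsm z hz).1.contMDiffWithinAt, fun z hz ↦ ?_⟩
  · rw [hC.φ_apply, hC'.φ_apply, he z hz, mk_lift h ((hmem z).1 hz).1.2.1]
  · have key : ∀ u v, metricForm C'.h (e z) (mD (Euc k) (Euc k) e z u) (mD (Euc k) (Euc k) e z v)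
        = metricForm C.h z u v := by
      intro u v
      rw [hC.form, hC'.form, (hsm z hz).2, he z hz]
      exact (htr z hz).1 u v
    exact key
  · have key : ∀ u, mD (Euc k) (Euc k) e z (endForm C.J z u)
        = endForm C'.J (e z) (mD (Euc k) (Euc k) e z u) := by
      intro u
      rw [hC.cpx, hC'.cpx, (hsm z hz).2, he z hz]
      exact (htr z hz).2 u
    exact key

/-- The projection to the quotient lifts to orbifold charts. -/
theorem sliceChart_lift (hC : IsSliceChart G I c C)
    {gN : Π p : N, TangentSpace 𝓘(ℝ, E) p → TangentSpace 𝓘(ℝ, E) p → ℝ}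
    (hgN : ∀ (p : N) (u v : E), gN p u v = G p u v) (x : C.U) (p : N)
    (hx : C.φ x = Quotient.mk (MulAction.orbitRel A N) p) :
    ∃ (W : Set N) (s : N → C.U), IsOpen W ∧ p ∈ W ∧ s p = x ∧
      (∀ q ∈ W, C.φ (s q) = Quotient.mk (MulAction.orbitRel A N) q) ∧
      IsRiemannianSubmersionOn gN C.h s W ∧ IsHolomorphicOn I C.J s W := by
  classical
  rw [hC.φ_apply] at hx
  obtain ⟨a, ha⟩ := Quotient.exact hx
  replace ha : a • p = c.σ x := ha
  have hl : ∀ q, a • q ∈ c.e.source → ContMDiffAt 𝓘(ℝ, E) 𝓘(ℝ, Euc k) ∞ (c.lift a) q :=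
    fun q hq ↦ h.contMDiffAt_lift c hq
  set W := ((a • · : N → N) ⁻¹' c.e.source) ∩ c.lift a ⁻¹' C.U
  have hW : IsOpen W := ContinuousOn.isOpen_inter_preimage
    (fun q hq ↦ (hl q hq).continuousAt.continuousWithinAt)
    (c.e.open_source.preimage (ContMDiffSMul.contMDiff_const_smul
        (I := 𝓘(ℝ, EA)) (I' := 𝓘(ℝ, E)) (n := ∞) a).continuous) C.U.isOpen
  let s : N → C.U := fun q ↦ if hq : c.lift a q ∈ C.U then ⟨c.lift a q, hq⟩ else x
  have hsv : ∀ q ∈ W, (s q : Euc k) = c.lift a q := fun q hq ↦ by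
    have h2 : c.lift a q ∈ C.U := hq.2
    simp only [s]
    rw [dif_pos h2]
  have hlp : c.lift a p = x := by rw [ActionSlice.lift, ha, h.e_σ c (hC.sub x)]
  have hpW : p ∈ W := by
    refine ⟨?_, ?_⟩
    · rw [mem_preimage, ha]
      exact h.σ_mem c (hC.sub x)
    · rw [mem_preimage, hlp]
      exact x.2
  have hev : ∀ q ∈ W, (fun q ↦ (s q : Euc k)) =ᶠ[𝓝 q] c.lift a := fun q hq ↦ by
    filter_upwards [hW.mem_nhds hq] with w hw using hsv w hw
  have hsm : ∀ q ∈ W, ContMDiffAt 𝓘(ℝ, E) 𝓘(ℝ, Euc k) ∞ s q := fun q hq ↦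
    contMDiffAt_opens_iff.2 ((hl q hq.1).congr_of_eventuallyEq (hev q hq))
  have hD : ∀ q ∈ W, mD E (Euc k) s q = mD E (Euc k) (c.lift a) q := fun q hq ↦ by
    rw [← mD_val_comp ((hsm q hq).mdifferentiableAt (by simp)), mD_congr (hev q hq)]
  have hT := fun q (hq : q ∈ W) ↦ h.isTransverseQuotient_lift hs c hq.1
  refine ⟨W, s, hW, hpW, Subtype.ext ((hsv p hpW).trans hlp), fun q hq ↦ ?_,
    ⟨fun q hq ↦ (hsm q hq).contMDiffWithinAt, fun q hq ↦ ?_, fun q hq ↦ ?_⟩,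
    fun q hq ↦ (hsm q hq).contMDiffWithinAt, fun q hq ↦ ?_⟩
  · rw [hC.φ_apply, hsv q hq, mk_lift h hq.1]
  · have key : Function.Surjective (mD E (Euc k) s q) := by
      rw [hD q hq]
      exact (hT q hq).surjective
    exact key
  · have key : ∀ u v : E, (∀ l : E, mD E (Euc k) s q l = 0 → G q u l = 0) →
        metricForm C.h (s q) (mD E (Euc k) s q u) (mD E (Euc k) s q v) = G q u v := by
      intro u v hu
      rw [hD q hq] at hu ⊢
      rw [hC.form, hsv q hq]
      exact (hT q hq).form_of_ortho (h.symm_form q) hu v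
    intro u v hu _
    exact (key u v fun l hl ↦ (hgN q u l).symm.trans (hu l hl)).trans (hgN q u v).symm
  · have key : ∀ u : E, mD E (Euc k) s q (endForm I q u)
        = endForm C.J (s q) (mD E (Euc k) s q u) := by
      intro u
      rw [hC.cpx, hsv q hq, hD q hq]
      exact (hT q hq).map u
    exact key

/-- The orbifold structure of the quotient. -/
theorem exists_orbifold [FiniteDimensional ℝ EA] [LieGroup 𝓘(ℝ, EA) ∞ A] [ProperSMul A N]
    {gN : Π p : N, TangentSpace 𝓘(ℝ, E) p → TangentSpace 𝓘(ℝ, E) p → ℝ}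
    (hgN : ∀ (p : N) (u v : E), gN p u v = G p u v)
    (hfin : ∀ p : N, Finite (MulAction.stabilizer A p)) :
    ∃ O : KahlerOrbifoldStructure (MulAction.orbitRel.Quotient A N) k,
      ∀ c ∈ O.atlas, ∀ (x : c.U) (p : N), c.φ x = Quotient.mk (MulAction.orbitRel A N) p →
        ∃ (W : Set N) (s : N → c.U), IsOpen W ∧ p ∈ W ∧ s p = x ∧
          (∀ q ∈ W, c.φ (s q) = Quotient.mk (MulAction.orbitRel A N) q) ∧
          IsRiemannianSubmersionOn gN c.h s W ∧ IsHolomorphicOn I c.J s W := by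
  refine ⟨⟨{C | ∃ c : ActionSlice E N γ (Euc k), IsSliceChart G I c C}, fun x ↦ ?_, ?_⟩, ?_⟩
  · obtain ⟨p, rfl⟩ := Quotient.exists_rep x
    obtain ⟨c, rfl⟩ := hs p
    obtain ⟨ρ, hρ⟩ := h.exists_isOrbifoldRadius c (hfin _)
    obtain ⟨C, hC⟩ := h.exists_sliceChart_of_radius hρ (hfin _) hs
    exact ⟨C, ⟨c, hC⟩, ⟨0, hC.zero_mem⟩, hC.φ_apply _⟩
  · rintro C ⟨c, hC⟩ C' ⟨c', hC'⟩ x y hxy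
    exact h.sliceChart_compatible hs hC hC' x y hxy
  · rintro C ⟨c, hC⟩ x p hx
    exact h.sliceChart_lift hs hC hgN x p hx

end TransverseAction

end OrbifoldStructure

section FreeQuotient

variable {E : Type} [NormedAddCommGroup E] [NormedSpace ℝ E]
  {EA : Type*} [NormedAddCommGroup EA] [NormedSpace ℝ EA]
  {N : Type*} [TopologicalSpace N] [ChartedSpace E N] [IsManifold 𝓘(ℝ, E) ∞ N]
  {A : Type*} [TopologicalSpace A] [ChartedSpace EA A] [CommGroup A] [MulAction A N]
  {k : ℕ} {γ : ℝ × ℝ → A} [FiniteDimensional ℝ E]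
  {G : N → E →L[ℝ] E →L[ℝ] ℝ} {I : EndField E N} {ζ : Fin 2 → VField E N}

/-- The charts of the quotient are given by slices. -/
structure IsSliceAtlas [ChartedSpace (Euc k) (MulAction.orbitRel.Quotient A N)]
    (c : MulAction.orbitRel.Quotient A N → ActionSlice E N γ (Euc k)) : Prop where
  exists_chartAt : ∀ χ ∈ atlas (Euc k) (MulAction.orbitRel.Quotient A N), ∃ x, χ = chartAt (Euc k) x
  sub : ∀ x, ∀ y ∈ (chartAt (Euc k) x).target, y ∈ Metric.ball 0 (c x).r
  symm_apply : ∀ x, ∀ y ∈ (chartAt (Euc k) x).target,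
    (chartAt (Euc k) x).symm y = Quotient.mk (MulAction.orbitRel A N) ((c x).σ y)

namespace IsSliceAtlas

variable [ChartedSpace (Euc k) (MulAction.orbitRel.Quotient A N)]
  {c : MulAction.orbitRel.Quotient A N → ActionSlice E N γ (Euc k)} (hc : IsSliceAtlas c)
include hc

theorem chartAt_mk {x : MulAction.orbitRel.Quotient A N} {y : Euc k}
    (hy : y ∈ (chartAt (Euc k) x).target) :
    chartAt (Euc k) x (Quotient.mk (MulAction.orbitRel A N) ((c x).σ y)) = y := by
  rw [← hc.symm_apply x y hy]
  exact (chartAt (Euc k) x).right_inv hy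

theorem mk_σ {x z : MulAction.orbitRel.Quotient A N} (hz : z ∈ (chartAt (Euc k) x).source) :
    Quotient.mk (MulAction.orbitRel A N) ((c x).σ (chartAt (Euc k) x z)) = z := by
  rw [← hc.symm_apply x _ ((chartAt (Euc k) x).map_source hz)]
  exact (chartAt (Euc k) x).left_inv hz

end IsSliceAtlas

namespace TransverseAction

variable [ContMDiffSMul 𝓘(ℝ, EA) 𝓘(ℝ, E) ∞ A N] (h : TransverseAction EA G I ζ γ)
include h

theorem exists_sliceAtlas [FiniteDimensional ℝ EA] [LieGroup 𝓘(ℝ, EA) ∞ A] [ProperSMul A N]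
    (hs : ∀ p : N, ∃ c : ActionSlice E N γ (Euc k), c.σ 0 = p)
    (hfree : ∀ (a : A) (p : N), a • p = p → a = 1) :
    ∃ (_ : ChartedSpace (Euc k) (MulAction.orbitRel.Quotient A N))
      (c : MulAction.orbitRel.Quotient A N → ActionSlice E N γ (Euc k)), IsSliceAtlas c := by
  have hstab : ∀ p : N, ∀ a ∈ MulAction.stabilizer A p, a = 1 := fun p a ha ↦ hfree a p ha
  have hfin : ∀ p : N, Finite (MulAction.stabilizer A p) := fun p ↦ by
    have : Subsingleton (MulAction.stabilizer A p) :=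
      ⟨fun a b ↦ Subtype.ext ((hstab p a a.2).trans (hstab p b b.2).symm)⟩
    infer_instance
  have hchart : ∀ x : MulAction.orbitRel.Quotient A N, ∃ (c : ActionSlice E N γ (Euc k))
      (χ : OpenPartialHomeomorph (MulAction.orbitRel.Quotient A N) (Euc k)), x ∈ χ.source ∧
      (∀ y ∈ χ.target, y ∈ Metric.ball 0 c.r) ∧
      ∀ y ∈ χ.target, χ.symm y = Quotient.mk (MulAction.orbitRel A N) (c.σ y) := by
    intro x
    obtain ⟨p, rfl⟩ := Quotient.exists_rep x
    obtain ⟨c, rfl⟩ := hs p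
    obtain ⟨ρ, hρ⟩ := h.exists_isOrbifoldRadius c (hfin _)
    obtain ⟨C, hC⟩ := h.exists_sliceChart_of_radius hρ (hfin _) hs
    have hinj : Function.Injective C.φ := by
      intro y z hyz
      obtain ⟨f, hf, rfl⟩ := (C.fibres y z).1 hyz
      obtain ⟨a, ha, hfa⟩ := hC.group f hf
      refine Subtype.ext ?_
      rw [hfa, hstab _ a ha, h.lift_one_σ (hC.sub y)]
    have hemb : IsOpenEmbedding C.φ :=
      .of_continuous_injective_isOpenMap C.continuous hinj C.isOpenMap
    have hne : Nonempty C.U := ⟨⟨0, hC.zero_mem⟩⟩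
    set j := C.U.openPartialHomeomorphSubtypeCoe hne
    refine ⟨c, (hemb.toOpenPartialHomeomorph C.φ).symm.trans j, ?_, fun y hy ↦ ?_, fun y hy ↦ ?_⟩
    · have : C.φ ⟨0, hC.zero_mem⟩ = Quotient.mk (MulAction.orbitRel A N) (c.σ 0) := hC.φ_apply _
      simp [j, ← this]
    · have hyU : y ∈ C.U := by simpa [j] using hy
      exact hC.sub ⟨y, hyU⟩
    · have hyU : y ∈ C.U := by simpa [j] using hy
      have h1 : (j.symm y : Euc k) = y := j.right_inv (by simpa [j] using hyU)
      change C.φ (j.symm y) = _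
      rw [hC.φ_apply, h1]
  choose c χ hχ hsub hsymm using hchart
  let _ : ChartedSpace (Euc k) (MulAction.orbitRel.Quotient A N) :=
    { atlas := range χ, chartAt := χ, mem_chart_source := hχ, chart_mem_atlas := mem_range_self }
  exact ⟨_, c, ⟨by rintro _ ⟨x, rfl⟩; exact ⟨x, rfl⟩, hsub, hsymm⟩⟩

variable [ChartedSpace (Euc k) (MulAction.orbitRel.Quotient A N)]
  {c : MulAction.orbitRel.Quotient A N → ActionSlice E N γ (Euc k)} (hc : IsSliceAtlas c)
include hc

/-- In the charts given by slices, the projection is the projection to a slice. -/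
theorem exists_lift_chartAt (x : MulAction.orbitRel.Quotient A N) {q : N}
    (hq : Quotient.mk (MulAction.orbitRel A N) q ∈ (chartAt (Euc k) x).source) :
    ∃ a : A, a • q = (c x).σ (chartAt (Euc k) x (Quotient.mk _ q)) ∧ a • q ∈ (c x).e.source ∧
      (c x).lift a q = chartAt (Euc k) x (Quotient.mk _ q) ∧
      (fun q ↦ chartAt (Euc k) x (Quotient.mk (MulAction.orbitRel A N) q))
        =ᶠ[𝓝 q] (c x).lift a := by
  have ht := (chartAt (Euc k) x).map_source hq
  obtain ⟨a, ha⟩ := Quotient.exact (hc.mk_σ hq)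
  replace ha : a • q = (c x).σ (chartAt (Euc k) x (Quotient.mk _ q)) := ha
  have hm : a • q ∈ (c x).e.source := by
    rw [ha]
    exact h.σ_mem (c x) (hc.sub x _ ht)
  have hl : (c x).lift a q = chartAt (Euc k) x (Quotient.mk _ q) := by
    rw [ActionSlice.lift, ha, h.e_σ (c x) (hc.sub x _ ht)]
  refine ⟨a, ha, hm, hl, ?_⟩
  have hcont : ContinuousAt (fun q : N ↦ a • q) q :=
    (ContMDiffSMul.contMDiff_const_smul (I := 𝓘(ℝ, EA)) (I' := 𝓘(ℝ, E)) (n := ∞) a q).continuousAt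
  have h1 : ∀ᶠ q' in 𝓝 q, a • q' ∈ (c x).e.source :=
    hcont ((c x).e.open_source.mem_nhds hm)
  have h2 : ∀ᶠ q' in 𝓝 q, (c x).lift a q' ∈ (chartAt (Euc k) x).target :=
    (h.contMDiffAt_lift (c x) hm).continuousAt ((chartAt (Euc k) x).open_target.mem_nhds (by
      rwa [hl]))
  filter_upwards [h1, h2] with q' hq1 hq2
  rw [← mk_lift h hq1, hc.chartAt_mk hq2]

theorem isManifold_sliceAtlas : IsManifold 𝓘(ℝ, Euc k) ∞ (MulAction.orbitRel.Quotient A N) := by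
  refine isManifold_of_contDiffOn _ _ _ fun χ χ' hχ hχ' ↦ ?_
  obtain ⟨x, rfl⟩ := hc.exists_chartAt χ hχ
  obtain ⟨x', rfl⟩ := hc.exists_chartAt χ' hχ'
  rintro y ⟨hy, -⟩
  replace hy : y ∈ (chartAt (Euc k) x).target ∧
    (chartAt (Euc k) x).symm y ∈ (chartAt (Euc k) x').source := by simpa using hy
  rw [hc.symm_apply x y hy.1] at hy
  obtain ⟨a, -, ha, -, hae⟩ := h.exists_lift_chartAt hc x' hy.2
  have h1 := h.contMDiffAt_transition (c x) (c x') (hc.sub x y hy.1) ha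
  refine ContDiffAt.contDiffWithinAt ((contMDiffAt_iff_contDiffAt.1 h1).congr_of_eventuallyEq ?_)
  have h2 := (h.contMDiffAt_σ (c x) (hc.sub x y hy.1)).continuousAt.eventually hae
  filter_upwards [h2, (chartAt (Euc k) x).open_target.mem_nhds hy.1] with z hz hzt
  change chartAt (Euc k) x' ((chartAt (Euc k) x).symm z) = _
  rw [hc.symm_apply x z hzt]
  exact hz

end TransverseAction

end FreeQuotient

section FreeKahler

variable {E : Type} [NormedAddCommGroup E] [NormedSpace ℝ E]
  {EA : Type*} [NormedAddCommGroup EA] [NormedSpace ℝ EA]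
  {N : Type*} [TopologicalSpace N] [ChartedSpace E N] [IsManifold 𝓘(ℝ, E) ∞ N]
  {A : Type*} [TopologicalSpace A] [ChartedSpace EA A] [CommGroup A] [MulAction A N]
  {k : ℕ} {γ : ℝ × ℝ → A} [FiniteDimensional ℝ E]
  {G : N → E →L[ℝ] E →L[ℝ] ℝ} {I : EndField E N} {ζ : Fin 2 → VField E N}
  [ContMDiffSMul 𝓘(ℝ, EA) 𝓘(ℝ, E) ∞ A N]
  [ChartedSpace (Euc k) (MulAction.orbitRel.Quotient A N)]
  [IsManifold 𝓘(ℝ, Euc k) ∞ (MulAction.orbitRel.Quotient A N)]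
  {c : MulAction.orbitRel.Quotient A N → ActionSlice E N γ (Euc k)}

namespace TransverseAction

variable (h : TransverseAction EA G I ζ γ) (hc : IsSliceAtlas c)
include h hc

theorem contMDiff_mk :
    ContMDiff 𝓘(ℝ, E) 𝓘(ℝ, Euc k) ∞ (Quotient.mk (MulAction.orbitRel A N)) := by
  intro q
  rw [contMDiffAt_iff_target]
  obtain ⟨a, -, ha, -, hae⟩ := h.exists_lift_chartAt hc (Quotient.mk _ q)
    (mem_chart_source (Euc k) (Quotient.mk (MulAction.orbitRel A N) q))
  exact ⟨continuous_quotient_mk'.continuousAt,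
    (h.contMDiffAt_lift _ ha).congr_of_eventuallyEq hae⟩

/-- The differential of the projection in the chart at `x`. -/
theorem mD_chart_mk (x : MulAction.orbitRel.Quotient A N) {q : N}
    (hq : Quotient.mk (MulAction.orbitRel A N) q ∈ (chartAt (Euc k) x).source) :
    mD E (Euc k) (fun q ↦ chartAt (Euc k) x (Quotient.mk (MulAction.orbitRel A N) q)) q
      = mD (Euc k) (Euc k) (chartAt (Euc k) x) (Quotient.mk (MulAction.orbitRel A N) q)
        ∘L mD E (Euc k) (Quotient.mk (MulAction.orbitRel A N)) q :=
  mD_comp (g := chartAt (Euc k) x) (mdifferentiableAt_extChartAt (I := 𝓘(ℝ, Euc k)) hq)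
    ((h.contMDiff_mk hc q).mdifferentiableAt (by simp))

theorem mD_mk (q : N) : mD E (Euc k) (Quotient.mk (MulAction.orbitRel A N)) q
    = mD E (Euc k) (fun q' ↦ chartAt (Euc k) (Quotient.mk (MulAction.orbitRel A N) q)
      (Quotient.mk (MulAction.orbitRel A N) q')) q := by
  rw [h.mD_chart_mk hc _ (mem_chart_source _ _)]
  have h1 : mD (Euc k) (Euc k) (chartAt (Euc k) (Quotient.mk (MulAction.orbitRel A N) q))
      (Quotient.mk (MulAction.orbitRel A N) q) = .id ℝ (Euc k) := mfderiv_extChartAt_self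
  rw [h1]
  rfl

/-- The metric of the quotient, as a bilinear form. -/
def quotForm (c : MulAction.orbitRel.Quotient A N → ActionSlice E N γ (Euc k))
    (G : N → E →L[ℝ] E →L[ℝ] ℝ) (x : MulAction.orbitRel.Quotient A N) :
    Euc k →L[ℝ] Euc k →L[ℝ] ℝ := (c x).form G (chartAt (Euc k) x x)

/-- The complex structure of the quotient, as an endomorphism. -/
def quotCpx (c : MulAction.orbitRel.Quotient A N → ActionSlice E N γ (Euc k))
    (I : EndField E N) (x : MulAction.orbitRel.Quotient A N) :
    Euc k →L[ℝ] Euc k := (c x).cpx I (chartAt (Euc k) x x)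

variable (hs : ∀ p : N, ∃ c : ActionSlice E N γ (Euc k), c.σ 0 = p)
include hs

theorem isTransverseQuotient_chart_mk (x : MulAction.orbitRel.Quotient A N) {q : N}
    (hq : Quotient.mk (MulAction.orbitRel A N) q ∈ (chartAt (Euc k) x).source) :
    IsTransverseQuotient (G q) (endForm I q) (fun j ↦ vecForm (ζ j) q)
      (mD E (Euc k) (fun q ↦ chartAt (Euc k) x (Quotient.mk (MulAction.orbitRel A N) q)) q)
      ((c x).form G (chartAt (Euc k) x (Quotient.mk (MulAction.orbitRel A N) q)))
      ((c x).cpx I (chartAt (Euc k) x (Quotient.mk (MulAction.orbitRel A N) q))) := by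
  obtain ⟨a, -, ha, hl, hae⟩ := h.exists_lift_chartAt hc x hq
  rw [mD_congr hae, ← hl]
  exact h.isTransverseQuotient_lift hs (c x) ha

theorem isTransverseQuotient_mk (q : N) :
    IsTransverseQuotient (G q) (endForm I q) (fun j ↦ vecForm (ζ j) q)
      (mD E (Euc k) (Quotient.mk (MulAction.orbitRel A N)) q)
      (quotForm c G (Quotient.mk (MulAction.orbitRel A N) q))
      (quotCpx c I (Quotient.mk (MulAction.orbitRel A N) q)) := by
  rw [h.mD_mk hc]
  exact h.isTransverseQuotient_chart_mk hc hs _ (mem_chart_source _ _)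

/-- The Kähler structure of the quotient. -/
theorem exists_kahler_quotient :
    ∃ (K : RMetric (Euc k) (MulAction.orbitRel.Quotient A N))
      (J : EndField (Euc k) (MulAction.orbitRel.Quotient A N)), IsKahler K J ∧
      (∀ x, metricForm K x = quotForm c G x) ∧ ∀ x, endForm J x = quotCpx c I x := by
  have hsub : ∀ x : MulAction.orbitRel.Quotient A N, chartDom (Euc k) x ⊆ Metric.ball 0 (c x).r := fun x y hy ↦
    hc.sub x y (by simpa [chartDom] using hy)
  have hpar : ∀ (x : MulAction.orbitRel.Quotient A N) y,
      chartPar (Euc k) x y = (chartAt (Euc k) x).symm y := fun x y ↦ rfl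
  have key : ∀ x : MulAction.orbitRel.Quotient A N, ∀ y ∈ chartDom (Euc k) x,
      IsTransverseQuotient (G ((c x).σ y)) (endForm I ((c x).σ y))
        (fun j ↦ vecForm (ζ j) ((c x).σ y))
        (mD E (Euc k) (fun q ↦ chartAt (Euc k) x (Quotient.mk (MulAction.orbitRel A N) q))
          ((c x).σ y)) ((c x).form G y) ((c x).cpx I y) ∧
      IsTransverseQuotient (G ((c x).σ y)) (endForm I ((c x).σ y))
        (fun j ↦ vecForm (ζ j) ((c x).σ y))
        (mD E (Euc k) (Quotient.mk (MulAction.orbitRel A N)) ((c x).σ y))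
        (quotForm c G (chartPar (Euc k) x y)) (quotCpx c I (chartPar (Euc k) x y)) ∧
      ∀ u, parD (Euc k) (chartPar (Euc k) x) y
        (mD E (Euc k) (fun q ↦ chartAt (Euc k) x (Quotient.mk (MulAction.orbitRel A N) q))
          ((c x).σ y) u) = mD E (Euc k) (Quotient.mk (MulAction.orbitRel A N)) ((c x).σ y) u := by
    intro x y hy
    have hP := isParam_chart (Euc k) x
    have hyt : y ∈ (chartAt (Euc k) x).target := by simpa [chartDom] using hy
    have hcm := hc.chartAt_mk hyt
    have hms : Quotient.mk (MulAction.orbitRel A N) ((c x).σ y) ∈ (chartAt (Euc k) x).source := by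
      rw [← hc.symm_apply x y hyt]
      exact (chartAt (Euc k) x).map_target hyt
    have h1 := h.isTransverseQuotient_chart_mk hc hs x hms
    have h2 := h.isTransverseQuotient_mk hc hs ((c x).σ y)
    rw [hcm] at h1
    rw [← hc.symm_apply x y hyt, ← hpar] at h2
    refine ⟨h1, h2, fun u ↦ ?_⟩
    have hd : MDifferentiableAt 𝓘(ℝ, E) 𝓘(ℝ, Euc k)
        (fun q ↦ chartAt (Euc k) x (Quotient.mk (MulAction.orbitRel A N) q)) ((c x).σ y) :=
      MDifferentiableAt.comp (g := chartAt (Euc k) x) _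
        (mdifferentiableAt_extChartAt (I := 𝓘(ℝ, Euc k)) hms)
        ((h.contMDiff_mk hc _).mdifferentiableAt (by simp))
    have h3 := mD_comp (E'' := Euc k) (g := chartPar (Euc k) x)
      (f := fun q ↦ chartAt (Euc k) x (Quotient.mk (MulAction.orbitRel A N) q)) (q := (c x).σ y)
      (by rw [hcm]; exact hP.mdifferentiableAt hy) hd
    have h4 : (fun q ↦ chartPar (Euc k) x
        (chartAt (Euc k) x (Quotient.mk (MulAction.orbitRel A N) q))) =ᶠ[𝓝 ((c x).σ y)]
        Quotient.mk (MulAction.orbitRel A N) := by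
      have h5 : ∀ᶠ q in 𝓝 ((c x).σ y),
          Quotient.mk (MulAction.orbitRel A N) q ∈ (chartAt (Euc k) x).source :=
        (h.contMDiff_mk hc _).continuousAt ((chartAt (Euc k) x).open_source.mem_nhds hms)
      filter_upwards [h5] with q hq using (chartAt (Euc k) x).left_inv hq
    rw [mD_congr h4, hcm] at h3
    exact (DFunLike.congr_fun h3 u).symm
  refine exists_kahler (quotForm c G) (quotCpx c I) (fun x ↦ (c x).form G) (fun x ↦ (c x).cpx I)
    (fun x ↦ (h.kahler_slice (c x)).mono (isParam_chart _ x).isOpen (hsub x))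
    (fun x y hy ↦ ?_) (fun x y hy ↦ ?_)
  · obtain ⟨h1, h2, h3⟩ := key x y hy
    exact h1.isometric h2 h3
  · obtain ⟨h1, h2, h3⟩ := key x y hy
    exact fun u ↦ (h1.holomorphic h2 h3 u).symm

theorem isRiemannianSubmersion_mk {K : RMetric (Euc k) (MulAction.orbitRel.Quotient A N)}
    (hK : ∀ x, metricForm K x = quotForm c G x)
    {gN : Π p : N, TangentSpace 𝓘(ℝ, E) p → TangentSpace 𝓘(ℝ, E) p → ℝ}
    (hgN : ∀ (p : N) (u v : E), gN p u v = G p u v) :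
    IsRiemannianSubmersionOn gN K (Quotient.mk (MulAction.orbitRel A N)) univ := by
  have hT := h.isTransverseQuotient_mk hc hs
  refine ⟨(h.contMDiff_mk hc).contMDiffOn, fun q _ ↦ (hT q).surjective, fun q _ u v hu _ ↦ ?_⟩
  have key : ∀ u v : E, (∀ l : E, mD E (Euc k) (Quotient.mk (MulAction.orbitRel A N)) q l = 0 →
      G q u l = 0) → metricForm K (Quotient.mk (MulAction.orbitRel A N) q)
        (mD E (Euc k) (Quotient.mk (MulAction.orbitRel A N)) q u)
        (mD E (Euc k) (Quotient.mk (MulAction.orbitRel A N)) q v) = G q u v := by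
    intro u v hu
    rw [hK]
    exact (hT q).form_of_ortho (h.symm_form q) hu v
  exact (key u v fun l hl ↦ (hgN q u l).symm.trans (hu l hl)).trans (hgN q u v).symm

theorem isHolomorphic_mk {J : EndField (Euc k) (MulAction.orbitRel.Quotient A N)}
    (hJ : ∀ x, endForm J x = quotCpx c I x) :
    IsHolomorphicOn I J (Quotient.mk (MulAction.orbitRel A N)) univ := by
  refine ⟨(h.contMDiff_mk hc).contMDiffOn, fun q _ ↦ ?_⟩
  have key : ∀ u : E, mD E (Euc k) (Quotient.mk (MulAction.orbitRel A N)) q (endForm I q u)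
      = endForm J (Quotient.mk (MulAction.orbitRel A N) q)
        (mD E (Euc k) (Quotient.mk (MulAction.orbitRel A N)) q u) := by
    intro u
    rw [hJ]
    exact (h.isTransverseQuotient_mk hc hs q).map u
  exact key

omit hs [IsManifold 𝓘(ℝ, Euc k) ∞ (MulAction.orbitRel.Quotient A N)] in
theorem exists_eq_smul_σ (x : MulAction.orbitRel.Quotient A N) {q : N}
    (hq : Quotient.mk (MulAction.orbitRel A N) q ∈ (chartAt (Euc k) x).source) :
    ∃ a : A, q = a • (c x).σ (chartAt (Euc k) x (Quotient.mk (MulAction.orbitRel A N) q)) := by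
  obtain ⟨a, ha, -⟩ := h.exists_lift_chartAt hc x hq
  exact ⟨a⁻¹, by rw [← ha, inv_smul_smul]⟩

omit hs in
/-- The quotient is a principal bundle. -/
theorem isPrincipalBundle_mk [LieGroup 𝓘(ℝ, EA) ∞ A]
    (hfree : ∀ (a : A) (p : N), a • p = p → a = 1) :
    IsPrincipalBundle (E := E) (E' := Euc k) (EA := EA) A (Quotient.mk (MulAction.orbitRel A N)) where
  smooth := h.contMDiff_mk hc
  surjective := Quotient.mk_surjective
  locally_trivial b := by
    set χ := chartAt (Euc k) b
    set pr : N → MulAction.orbitRel.Quotient A N := Quotient.mk (MulAction.orbitRel A N)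
    have hpr := h.contMDiff_mk hc
    have hinj : ∀ (a a' : A) (p : N), a • p = a' • p → a = a' := fun a a' p hp ↦ by
      have := hfree (a'⁻¹ * a) p (by rw [mul_smul, hp, inv_smul_smul])
      exact (inv_mul_eq_one.1 this).symm
    have hex : ∀ q : N, ∃ a : A, pr q ∈ χ.source → q = a • (c b).σ (χ (pr q)) := by
      intro q
      by_cases hq : pr q ∈ χ.source
      · obtain ⟨a, ha⟩ := h.exists_eq_smul_σ hc b hq
        exact ⟨a, fun _ ↦ ha⟩
      · exact ⟨1, fun hq' ↦ absurd hq' hq⟩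
    choose α hα using hex
    have hsmul : ∀ (a : A) (q : N), pr (a • q) = pr q := fun a q ↦ Quotient.sound ⟨a, rfl⟩
    have hmkσ : ∀ x ∈ χ.source, pr ((c b).σ (χ x)) = x := fun x hx ↦ hc.mk_σ hx
    have hσ : ∀ x ∈ χ.source, ContMDiffAt 𝓘(ℝ, Euc k) 𝓘(ℝ, E) ∞ (fun x ↦ (c b).σ (χ x)) x :=
      fun x hx ↦ ContMDiffAt.comp (g := (c b).σ) x
        (h.contMDiffAt_σ (c b) (hc.sub b _ (χ.map_source hx)))
        (contMDiffAt_extChartAt' (I := 𝓘(ℝ, Euc k)) hx)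
    have hαs : ∀ q, pr q ∈ χ.source → ContMDiffAt 𝓘(ℝ, E) 𝓘(ℝ, EA) ∞ α q := by
      intro q hq
      obtain ⟨a, -, ha, -, hae⟩ := h.exists_lift_chartAt hc b hq
      have h1 : ContMDiffAt 𝓘(ℝ, E) 𝓘(ℝ, (ℝ × ℝ) × Euc k) ∞ (fun q ↦ (c b).e (a • q)) q :=
        ContMDiffAt.comp q ((c b).contMDiffAt_e ha)
          (ContMDiffSMul.contMDiff_const_smul (I := 𝓘(ℝ, EA)) (I' := 𝓘(ℝ, E)) (n := ∞) a q)
      have h2 : ContMDiffAt 𝓘(ℝ, E) 𝓘(ℝ, ℝ × ℝ) ∞ (fun q ↦ ((c b).e (a • q)).1) q :=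
        ContMDiffAt.comp q contDiff_fst.contMDiff.contMDiffAt h1
      have h3 : ContMDiffAt 𝓘(ℝ, E) 𝓘(ℝ, EA) ∞ (fun q ↦ a⁻¹ * γ ((c b).e (a • q)).1) q :=
        contMDiffAt_const.mul (ContMDiffAt.comp q (h.smooth _) h2)
      refine h3.congr_of_eventuallyEq ?_
      have h4 : ∀ᶠ q' in 𝓝 q, a • q' ∈ (c b).e.source :=
        (ContMDiffSMul.contMDiff_const_smul (I := 𝓘(ℝ, EA)) (I' := 𝓘(ℝ, E)) (n := ∞) a
          q).continuousAt ((c b).e.open_source.mem_nhds ha)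
      have h5 : ∀ᶠ q' in 𝓝 q, pr q' ∈ χ.source :=
        (hpr q).continuousAt (χ.open_source.mem_nhds hq)
      filter_upwards [h4, h5, hae] with q' hq1 hq2 hq3
      refine hinj _ _ ((c b).σ (χ (pr q'))) ?_
      rw [← hα q' hq2, mul_smul, eq_inv_smul_iff]
      have h6 := (c b).eq_smul hq1
      rw [show ((c b).e (a • q')).2 = χ (pr q') from hq3.symm] at h6
      exact h6.symm
    have hα' : ∀ x ∈ χ.source, ∀ a : A, α (a • (c b).σ (χ x)) = a := by
      intro x hx a
      have h1 : pr (a • (c b).σ (χ x)) = x := (hsmul _ _).trans (hmkσ x hx)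
      refine hinj _ _ ((c b).σ (χ x)) ?_
      have h2 := hα (a • (c b).σ (χ x)) (by rwa [h1])
      rw [h1] at h2
      exact h2.symm
    have hfs : ∀ q, pr q ∈ χ.source →
        ContMDiffAt 𝓘(ℝ, E) (𝓘(ℝ, Euc k).prod 𝓘(ℝ, EA)) ∞ (fun q ↦ (pr q, α q)) q :=
      fun q hq ↦ (hpr q).prodMk (hαs q hq)
    have hgs : ∀ z ∈ χ.source ×ˢ (univ : Set A),
        ContMDiffAt (𝓘(ℝ, Euc k).prod 𝓘(ℝ, EA)) 𝓘(ℝ, E) ∞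
          (fun z : MulAction.orbitRel.Quotient A N × A ↦ z.2 • (c b).σ (χ z.1)) z := fun z hz ↦
      ContMDiffAt.smul (I := 𝓘(ℝ, EA)) contMDiffAt_snd
        (ContMDiffAt.comp (I' := 𝓘(ℝ, Euc k)) (g := fun x ↦ (c b).σ (χ x)) (f := Prod.fst) z
          (hσ z.1 hz.1) contMDiffAt_fst)
    let Φ : OpenPartialHomeomorph N (MulAction.orbitRel.Quotient A N × A) :=
      { toFun := fun q ↦ (pr q, α q)
        invFun := fun z ↦ z.2 • (c b).σ (χ z.1)
        source := pr ⁻¹' χ.source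
        target := χ.source ×ˢ univ
        map_source' := fun q hq ↦ ⟨hq, trivial⟩
        map_target' := fun z hz ↦ by
          rw [mem_preimage, hsmul, hmkσ _ hz.1]
          exact hz.1
        left_inv' := fun q hq ↦ (hα q hq).symm
        right_inv' := fun z hz ↦ Prod.ext ((hsmul _ _).trans (hmkσ _ hz.1)) (hα' _ hz.1 _)
        open_source := χ.open_source.preimage hpr.continuous
        open_target := χ.open_source.prod isOpen_univ
        continuousOn_toFun := fun q hq ↦ (hfs q hq).continuousAt.continuousWithinAt
        continuousOn_invFun := fun z hz ↦ (hgs z hz).continuousAt.continuousWithinAt }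
    refine ⟨χ.source, χ.open_source, mem_chart_source (Euc k) b, Φ, rfl, rfl,
      fun q hq ↦ (hfs q hq).contMDiffWithinAt, fun z hz ↦ (hgs z hz).contMDiffWithinAt,
      fun q hq ↦ ⟨rfl, fun a ↦ Prod.ext (hsmul a q) ?_⟩⟩
    have h1 : pr q ∈ χ.source := hq
    change α (a • q) = a * α q
    conv_lhs => rw [hα q h1, smul_smul]
    exact hα' _ h1 _

end TransverseAction

end FreeKahler

section Corollary

/-- Factorisation of linear maps through an injective one. -/
theorem exists_clm_lift {F F' : Type*} [NormedAddCommGroup F] [NormedSpace ℝ F]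
    [NormedAddCommGroup F'] [NormedSpace ℝ F'] [FiniteDimensional ℝ F] {D T : F →L[ℝ] F'}
    (hD : Function.Injective D) (h : ∀ v, ∃ w, D w = T v) : ∃ S : F →L[ℝ] F, ∀ v, D (S v) = T v := by
  obtain ⟨L, hL⟩ := D.toLinearMap.exists_leftInverse_of_injective (LinearMap.ker_eq_bot.2 hD)
  refine ⟨(L ∘ₗ T.toLinearMap).toContinuousLinearMap, fun v ↦ ?_⟩
  obtain ⟨w, hw⟩ := h v
  have h1 : L (D w) = w := LinearMap.congr_fun hL w
  change D (L (T v)) = T v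
  rw [← hw, h1]

/-- The homomorphism `ℝ² → A` given by two one-parameter subgroups of an abelian group. -/
def plane {A : Type*} [Mul A] (η : Fin 2 → ℝ → A) (s : ℝ × ℝ) : A := η 0 s.1 * η 1 s.2

theorem plane_add {A : Type*} [CommGroup A] {η : Fin 2 → ℝ → A}
    (hη : ∀ i s t, η i (s + t) = η i s * η i t) (s t : ℝ × ℝ) :
    plane η (s + t) = plane η s * plane η t := by
  simp only [plane, Prod.fst_add, Prod.snd_add, hη, mul_mul_mul_comm]

theorem plane_surjective {A : Type*} [CommGroup A] {η : Fin 2 → ℝ → A}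
    (hη : ∀ i s t, η i (s + t) = η i s * η i t)
    (hgen : Subgroup.closure (⋃ i, Set.range (η i)) = ⊤) : Function.Surjective (plane η) := by
  let φ : Multiplicative (ℝ × ℝ) →* A :=
    MonoidHom.mk' (fun s ↦ plane η s.toAdd) fun s t ↦ plane_add hη _ _
  have h0 : ∀ i, η i 0 = 1 := fun i ↦ by simpa using hη i 0 0
  have h1 : (⊤ : Subgroup A) ≤ φ.range := by
    rw [← hgen, Subgroup.closure_le, iUnion_subset_iff]
    rintro i _ ⟨t, rfl⟩
    fin_cases i
    · exact ⟨Multiplicative.ofAdd (t, 0), by simp [φ, plane, h0]⟩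
    · exact ⟨Multiplicative.ofAdd (0, t), by simp [φ, plane, h0]⟩
  intro a
  obtain ⟨s, hs⟩ := h1 (Subgroup.mem_top a)
  exact ⟨s.toAdd, hs⟩

variable {n d : ℕ} {M : Type*} [TopologicalSpace M]
  [ChartedSpace (Euc (4 * n)) M] [IsManifold 𝓘(ℝ, Euc (4 * n)) ∞ M]
  {N : Type*} [TopologicalSpace N] [ChartedSpace (Euc d) N] [IsManifold 𝓘(ℝ, Euc d) ∞ N]
  {g : RMetric (Euc (4 * n)) M} {Q : SubspaceField (4 * n) M}
  {ξ : Fin 2 → VField (Euc (4 * n)) M} {ι : N → M} {f : N → ℝ}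
  {I : EndField (Euc d) N} {ζ : Fin 2 → VField (Euc d) N}

namespace IsMomentSubmanifold

variable [T2Space M] [SecondCountableTopology M] (h : IsMomentSubmanifold g Q ξ ι f I ζ)
include h

theorem isComplexStructure : IsComplexStructure I := by
  have hT := fun p ↦ h.transverseKahler (isParam_chart (Euc d) p)
  refine isComplexStructure_of_coord
    (fun p ↦ (hT p).smooth_I.contDiffAt ((hT p).isOpen.mem_nhds (mem_chartDom p)))
    (fun p u ↦ ?_) fun p u w ↦ (hT p).nijenhuis _ (mem_chartDom p) u w
  have hP := isParam_chart (Euc d) p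
  have hm := mem_chartDom (E := Euc d) p
  refine hP.parInv_injective hm ?_
  have h1 : ∀ v, parInv (Euc d) (chartPar (Euc d) p) (extChartAt 𝓘(ℝ, Euc d) p p) (endForm I p v)
      = coordEnd (chartPar (Euc d) p) I (extChartAt 𝓘(ℝ, Euc d) p p)
        (parInv (Euc d) (chartPar (Euc d) p) (extChartAt 𝓘(ℝ, Euc d) p p) v) := fun v ↦ by
    rw [← hP.parInv_endForm hm, chartPar_self]
  rw [h1, h1, (hT p).sq _ hm, map_neg]

variable {EA : Type*} [NormedAddCommGroup EA] [NormedSpace ℝ EA]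
  {A : Type*} [TopologicalSpace A] [ChartedSpace EA A] [CommGroup A]
  [LieGroup 𝓘(ℝ, EA) ∞ A] [MulAction A N] [ContMDiffSMul 𝓘(ℝ, EA) 𝓘(ℝ, Euc d) ∞ A N]

/-- The differential of the orbit maps of a one-parameter subgroup. -/
theorem mD_flow {η : ℝ → A} (hη : ContMDiff 𝓘(ℝ, ℝ) 𝓘(ℝ, EA) ∞ η) (i : Fin 2) (q : N)
    (hc : IsMIntegralCurve (I := 𝓘(ℝ, Euc (4 * n))) (fun t ↦ ι (η t • q)) (ξ i)) (t : ℝ) :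
    mD ℝ (Euc d) (fun t ↦ η t • q) t 1 = vecForm (ζ i) (η t • q) := by
  have h1 : ContMDiff 𝓘(ℝ, ℝ) 𝓘(ℝ, Euc d) ∞ (fun t ↦ η t • q) :=
    ContMDiff.smul (I := 𝓘(ℝ, EA)) hη contMDiff_const
  have h2 := mD_comp (E := ℝ) (E' := Euc d) (E'' := Euc (4 * n)) (g := ι) (f := fun t ↦ η t • q)
    (q := t) ((h.sub.1.contMDiff _).mdifferentiableAt (by simp))
    ((h1 t).mdifferentiableAt (by simp))
  have h3 : mD ℝ (Euc (4 * n)) (fun t ↦ ι (η t • q)) t 1 = vecForm (ξ i) (ι (η t • q)) := by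
    rw [mD, (hc t).mfderiv]
    exact one_smul ℝ _
  have h4 : Function.Injective (dForm d ι (η t • q)) :=
    IsImmersionAt.mfderiv_injective (h.sub.1.isImmersionAt _)
  refine h4 (Eq.trans ?_ (h3.trans (h.tangent i _).symm))
  rw [h2]
  rfl

/-- The action generated by the Killing fields. -/
theorem transverseAction {η : Fin 2 → ℝ → A} (hη : ∀ i, ContMDiff 𝓘(ℝ, ℝ) 𝓘(ℝ, EA) ∞ (η i))
    (hadd : ∀ i s t, η i (s + t) = η i s * η i t)
    (hgen : Subgroup.closure (⋃ i, Set.range (η i)) = ⊤)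
    (hc : ∀ i p, IsMIntegralCurve (I := 𝓘(ℝ, Euc (4 * n))) (fun t ↦ ι (η i t • p)) (ξ i)) :
    TransverseAction EA (indForm d g ι) I ζ (plane η) where
  smooth := ((hη 0).comp contDiff_fst.contMDiff).mul ((hη 1).comp contDiff_snd.contMDiff)
  map_add := plane_add hadd
  surjective := plane_surjective hadd hgen
  orbit q s u := by
    have h0 : ContMDiff 𝓘(ℝ, ℝ × ℝ) 𝓘(ℝ, Euc d) ∞ (fun s ↦ plane η s • q) :=
      ContMDiff.smul (I := 𝓘(ℝ, EA))
        (((hη 0).comp contDiff_fst.contMDiff).mul ((hη 1).comp contDiff_snd.contMDiff))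
        contMDiff_const
    have hd := (h0 s).mdifferentiableAt (by simp : (∞ : WithTop ℕ∞) ≠ 0)
    have e1 : HasFDerivAt (fun t : ℝ ↦ (t, s.2)) (.inl ℝ ℝ ℝ) s.1 := hasFDerivAt_prodMk_left _ _
    have e2 : HasFDerivAt (fun t : ℝ ↦ (s.1, t)) (.inr ℝ ℝ ℝ) s.2 := hasFDerivAt_prodMk_right _ _
    have h1 : mD (ℝ × ℝ) (Euc d) (fun s ↦ plane η s • q) s (1, 0)
        = vecForm (ζ 0) (plane η s • q) := by
      have h2 := mD_comp (E := ℝ) (E' := ℝ × ℝ) (E'' := Euc d) (g := fun s ↦ plane η s • q)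
        (f := fun t : ℝ ↦ (t, s.2)) (q := s.1) hd e1.differentiableAt.mdifferentiableAt
      rw [mD_fderiv, e1.fderiv] at h2
      have h3 := h.mD_flow (hη 0) 0 (η 1 s.2 • q) (hc 0 _) s.1
      simp only [← mul_smul] at h3
      exact (congrArg (fun L : ℝ →L[ℝ] Euc d ↦ L 1) h2).symm.trans h3
    have h1' : mD (ℝ × ℝ) (Euc d) (fun s ↦ plane η s • q) s (0, 1)
        = vecForm (ζ 1) (plane η s • q) := by
      have h2 := mD_comp (E := ℝ) (E' := ℝ × ℝ) (E'' := Euc d) (g := fun s ↦ plane η s • q)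
        (f := fun t : ℝ ↦ (s.1, t)) (q := s.2) hd e2.differentiableAt.mdifferentiableAt
      rw [mD_fderiv, e2.fderiv] at h2
      have h3 := h.mD_flow (hη 1) 1 (η 0 s.1 • q) (hc 1 _) s.2
      simp only [← mul_smul, mul_comm (η 1 _)] at h3
      exact (congrArg (fun L : ℝ →L[ℝ] Euc d ↦ L 1) h2).symm.trans h3
    rw [← h1, ← h1', ← _root_.map_smul, ← _root_.map_smul, ← _root_.map_add]
    simp
  transverse hψ := h.transverseKahler hψ

end IsMomentSubmanifold

end Corollary

theorem corollary2p2
    {n d : ℕ}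
    -- a quaternionic Kähler manifold of nonzero scalar curvature
    {M : Type*} [TopologicalSpace M] [T2Space M] [SecondCountableTopology M]
    [ChartedSpace (Euc (4 * n)) M] [IsManifold 𝓘(ℝ, Euc (4 * n)) ∞ M]
    (g : RMetric (Euc (4 * n)) M) (Q : SubspaceField (4 * n) M)
    (hQK : IsQuaternionicKahler g Q) (hscal : ∀ x, scalarCurvature g x ≠ 0)
    -- two Killing vector fields
    (ξ : Fin 2 → VField (Euc (4 * n)) M) (hξ : ∀ i, IsKilling g (ξ i))
    -- a submanifold
    {N : Type*} [TopologicalSpace N] [T2Space N] [SecondCountableTopology N]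
    [ChartedSpace (Euc d) N] [IsManifold 𝓘(ℝ, Euc d) ∞ N]
    (ι : N → M) (hι : IsSubmanifold (4 * n) d ι)
    -- assumption (i)
    (htangent : ∀ i p, ∃ w : TangentSpace 𝓘(ℝ, Euc d) p, dmap ι p w = ξ i (ι p))
    (hcomm : ∀ p, VectorField.mlieBracket 𝓘(ℝ, Euc (4 * n)) (ξ 0) (ξ 1) (ι p) = 0)
    (hnorm : ∀ p, g.inner (ι p) (ξ 0 (ι p)) (ξ 0 (ι p)) = g.inner (ι p) (ξ 1 (ι p)) (ξ 1 (ι p)))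
    (hne : ∀ i p, ξ i (ι p) ≠ 0)
    -- assumption (ii)
    (hPQ : ∀ p, momentMap g Q (ξ 0) (ι p) ∘L momentMap g Q (ξ 1) (ι p) ∈ Q (ι p))
    (hPN : ∀ p (w : TangentSpace 𝓘(ℝ, Euc d) p), ∃ w' : TangentSpace 𝓘(ℝ, Euc d) p,
      dmap ι p w' = momentMap g Q (ξ 0) (ι p) (momentMap g Q (ξ 1) (ι p) (dmap ι p w)))
    (f : N → ℝ) (hf : ContMDiff 𝓘(ℝ, Euc d) 𝓘(ℝ, ℝ) ∞ f) (hf0 : ∀ p, f p ≠ 0)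
    (hPξ : ∀ p, momentMap g Q (ξ 0) (ι p) (momentMap g Q (ξ 1) (ι p) (ξ 0 (ι p)))
      = f p • ξ 1 (ι p))
    -- a smooth proper action on `N` of a two-dimensional abelian Lie group generated by `ξ 0, ξ 1`
    {A : Type*} [TopologicalSpace A] [ChartedSpace (Euc 2) A] [CommGroup A]
    [LieGroup 𝓘(ℝ, Euc 2) ∞ A] [MulAction A N]
    [ContMDiffSMul 𝓘(ℝ, Euc 2) 𝓘(ℝ, Euc d) ∞ A N] [ProperSMul A N]
    (hgen : GenerateAction (A := A) (EA := Euc 2) ι ξ) :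
    -- `I = (1/f) P₁P₂` is a complex structure on `N`
    ∃ I : EndField (Euc d) N, IsComplexStructure I ∧
      (∀ p (w : TangentSpace 𝓘(ℝ, Euc d) p), dmap ι p (I p w)
        = (f p)⁻¹ • momentMap g Q (ξ 0) (ι p) (momentMap g Q (ξ 1) (ι p) (dmap ι p w))) ∧
      T2Space (MulAction.orbitRel.Quotient A N) ∧
      SecondCountableTopology (MulAction.orbitRel.Quotient A N) ∧
      -- free action: the quotient is a Kähler manifold
      ((∀ (a : A) (p : N), a • p = p → a = 1) →
        ∃ (_ : ChartedSpace (Euc (d - 2)) (MulAction.orbitRel.Quotient A N))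
          (_ : IsManifold 𝓘(ℝ, Euc (d - 2)) ∞ (MulAction.orbitRel.Quotient A N))
          (h : RMetric (Euc (d - 2)) (MulAction.orbitRel.Quotient A N))
          (J : EndField (Euc (d - 2)) (MulAction.orbitRel.Quotient A N)),
          IsKahler h J ∧
          IsPrincipalBundle (E := Euc d) (E' := Euc (d - 2)) (EA := Euc 2) A
            (Quotient.mk (MulAction.orbitRel A N)) ∧
          IsRiemannianSubmersionOn (inducedMetric (d := d) g ι) h
            (Quotient.mk (MulAction.orbitRel A N)) Set.univ ∧
          IsHolomorphicOn I J (Quotient.mk (MulAction.orbitRel A N)) Set.univ) ∧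
      -- finite stabilisers: the quotient is a Kähler orbifold, whose Kähler structure is induced
      -- from `N` in the sense that the projection locally lifts to each orbifold chart as a
      -- holomorphic Riemannian submersion
      ((∀ p : N, Finite (MulAction.stabilizer A p)) →
        ∃ O : KahlerOrbifoldStructure (MulAction.orbitRel.Quotient A N) (d - 2),
          ∀ c ∈ O.atlas, ∀ (x : c.U) (p : N), c.φ x = Quotient.mk (MulAction.orbitRel A N) p →
            ∃ (W : Set N) (s : N → c.U), IsOpen W ∧ p ∈ W ∧ s p = x ∧
              (∀ q ∈ W, c.φ (s q) = Quotient.mk (MulAction.orbitRel A N) q) ∧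
              IsRiemannianSubmersionOn (inducedMetric (d := d) g ι) c.h s W ∧
              IsHolomorphicOn I c.J s W) := by
  have hinj : ∀ p, Function.Injective (dForm d ι p) := fun p ↦
    IsImmersionAt.mfderiv_injective (hι.1.isImmersionAt p)
  have hI : ∀ p, ∃ S : Euc d →L[ℝ] Euc d, ∀ w, dForm d ι p (S w)
      = ((f p)⁻¹ • endForm (momentMap g Q (ξ 0)) (ι p) ∘L endForm (momentMap g Q (ξ 1)) (ι p)
        ∘L dForm d ι p) w := fun p ↦ exists_clm_lift (hinj p) fun w ↦ by
    obtain ⟨w', hw'⟩ := hPN p w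
    exact ⟨(f p)⁻¹ • w', (map_smul (dForm d ι p) _ _).trans (congrArg ((f p)⁻¹ • ·) hw')⟩
  choose I hI using hI
  choose ζ hζ using htangent
  have h : IsMomentSubmanifold g Q ξ ι f I ζ :=
    ⟨hQK, hscal, hξ, hι, hζ, hcomm, hnorm, hne, hPQ, hf, hf0, hPξ, hI⟩
  obtain ⟨η, hη, hadd, hcl, hcurve⟩ := hgen
  have ha := h.transverseAction hη hadd hcl hcurve
  have hs : ∀ p : N, ∃ c : ActionSlice (Euc d) N (plane η) (Euc (d - 2)), c.σ 0 = p := fun p ↦ by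
    refine ha.exists_slice ?_ p
    have h2 := (ha.hermitianLine p).linearIndependent.fintype_card_le_finrank
    simp only [Fintype.card_fin, finrank_euclideanSpace] at h2 ⊢
    omega
  have : ContinuousConstSMul A N := ⟨fun a ↦ (ContMDiffSMul.contMDiff_const_smul
    (I := 𝓘(ℝ, Euc 2)) (I' := 𝓘(ℝ, Euc d)) (n := ∞) a).continuous⟩
  have hg : ∀ (p : N) (u v : Euc d), inducedMetric (d := d) g ι p u v = indForm d g ι p u v :=
    fun p u v ↦ rfl
  refine ⟨I, h.isComplexStructure, hI, t2Space_quotient_mulAction_of_properSMul,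
    ContinuousConstSMul.secondCountableTopology, fun hfree ↦ ?_, ha.exists_orbifold hs hg⟩
  obtain ⟨_, c, hc⟩ := ha.exists_sliceAtlas hs hfree
  have := ha.isManifold_sliceAtlas hc
  obtain ⟨K, J, hKJ, hK, hJ⟩ := ha.exists_kahler_quotient hc hs
  exact ⟨inferInstance, this, K, J, hKJ, ha.isPrincipalBundle_mk hc hfree,
    ha.isRiemannianSubmersion_mk hc hs hK hg, ha.isHolomorphic_mk hc hs hJ⟩

end
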